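/- Let $l,T,\alpha,\varepsilon,\lambda>0$ and $\Omega_T=\{(x,t):0<x<l,\ 0<t\le T\}$. Consider the problem $$(\partial_{xx}-\lambda\partial_x)(\varepsilon u_t+u)-\partial_t(u_t+\alpha u)=F(x,t,u)\quad\text{in }\Omega_T,\tag{P}$$ $$u(x,0)=h_0(x),\quad u_t(x,0)=h_1(x)\quad(0\le x\le l),\qquad u(0,t)=u(l,t)=0\quad(0<t\le T).$$ *Assumptions.* $h_0,h_1$ are continuous on $[0,l]$ and continuously differentiable on $(0,l)$, $h_0''$ exists on $(0,l)$, and $h_0,h_1,h_0',h_1',h_0''$ are bounded on $(0,l)$; $h_0(0)=h_0(l)=0$. $F$ is continuous on $\Omega_T\times\mathbb R$; it is Lipschitz in $(x,t,u)$ on $K\times[-M,M]$ for every compact $K\subset\Omega_T$ and every $M$; it is bounded on $\Omega_T\times[-M,M]$ for every $M$; and there is a constant $C_F$ with $|F(x,t,u_1)-F(x,t,u_2)|\le C_F|u_1-u_2|$ for all $(x,t)\in\Omega_T$ and $u_1,u_2\in\mathbb R$. *Regular solutions.* Let $R$ be the rectangle $[0,l]\times[0,T]$ without those of the corners $(0,0),(l,0)$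 at which $h_1\neq0$ (so $R=[0,l]\times[0,T]$ if $h_1(0)=h_1(l)=0$). A regular solution of (P) is a continuous $u:[0,l]\times[0,T]\to\mathbb R$ such that $u_t$ exists and is continuous on $R$ and is bounded on $\Omega_T$; the derivatives $u_{tt}$, $\partial_x(\varepsilon u_t+u)$, $\partial_{xx}(\varepsilon u_t+u)$ exist and are continuous in $\Omega_T$; the equation holds in $\Omega_T$; $u(x,0)=h_0(x)$ for all $x\in[0,l]$; $u_t(x,0)=h_1(x)$ for all $x$ with $(x,0)\in R$; and $u(0,t)=u(l,t)=0$ for $0<t\le T$. (Derivatives in $t$ are one-sided at $t=0$ and $t=T$.) *Integral equation.* Put $\gamma_n=n\pi/l$, $b_n=\gamma_n^2+\lambda^2/4$, $g_n=\frac12(\alpha+\varepsilon b_n)$, $\omega_n=\sqrt{g_n^2-b_n}$, $G_n(t)=e^{-g_nt}\,\frac{\sinh(\omega_nt)}{\omega_n}$ (that is, $e^{-g_nt}\frac{\sin(|\omega_n|t)}{|\omega_n|}$ if $g_n^2<b_n$, and $te^{-g_nt}$ if $g_n^2=b_n$), and $$G(x,\xi,t)=\frac2l\,e^{\lambda(x-\xi)/2}\sum_{n=1}^\infty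 G_n(t)\sin(\gamma_n\xi)\sin(\gamma_nx).$$ Let $\mathcal B_T$ be the Banach space of bounded continuous functions on $\Omega_T$ with the sup norm, and for $v\in\mathcal B_T$, $(x,t)\in\Omega_T$, let $$\psi(v)(x,t)=\int_0^lh_1(\xi)G(x,\xi,t)\,d\xi+(\partial_t+\alpha+\varepsilon\lambda\partial_x-\varepsilon\partial_{xx})\int_0^lh_0(\xi)G(x,\xi,t)\,d\xi-\int_0^t\!\!\int_0^lG(x,\xi,t-\tau)F(\xi,\tau,v(\xi,\tau))\,d\xi\,d\tau.$$ **Theorem.** Problem (P) has a unique regular solution $u$. Moreover $\psi$ maps $\mathcal B_T$ into $\mathcal B_T$ and is a contraction for an equivalent norm $\sup_{\Omega_T}e^{-\kappa t}|v(x,t)|$ with some $\kappa\ge0$; $\psi$ has exactly one fixed point in $\mathcal B_T$, and this fixed point is the restriction of $u$ to $\Omega_T$. -/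

import Mathlib

namespace JosephsonStrip

/-- The set `Ω_T = {(x,t) : 0 < x < l, 0 < t ≤ T}`. -/
def Omega (l T : ℝ) : Set (ℝ × ℝ) := Set.Ioo 0 l ×ˢ Set.Ioc 0 T

/-- The closed rectangle `[0,l] × [0,T]`. -/
def ClosedRect (l T : ℝ) : Set (ℝ × ℝ) := Set.Icc 0 l ×ˢ Set.Icc 0 T

/-- The closed rectangle without those of the corners `(0,0)`, `(l,0)` at which the initial
velocity `h₁` does not vanish (there `u_t(x,0) = h₁(x)` contradicts the boundary condition). -/
def VelocityRect (l T : ℝ) (h₁ : ℝ → ℝ) : Set (ℝ × ℝ) :=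
  {p | p ∈ ClosedRect l T ∧ (p.2 = 0 → p.1 = 0 ∨ p.1 = l → h₁ p.1 = 0)}

/-- Hypotheses on the initial data `h₀`, `h₁` and on the source `F`. -/
structure DataAssumption (l T : ℝ) (h₀ h₁ : ℝ → ℝ) (F : ℝ → ℝ → ℝ → ℝ) : Prop where
  cont_h₀ : ContinuousOn h₀ (Set.Icc 0 l)
  cont_h₁ : ContinuousOn h₁ (Set.Icc 0 l)
  c1_h₀ : ContDiffOn ℝ 1 h₀ (Set.Ioo 0 l)
  c1_h₁ : ContDiffOn ℝ 1 h₁ (Set.Ioo 0 l)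
  /-- `h₀''` exists -/
  diff_h₀' : DifferentiableOn ℝ (deriv h₀) (Set.Ioo 0 l)
  bdd : ∃ B : ℝ, ∀ x ∈ Set.Ioo 0 l, |h₀ x| ≤ B ∧ |h₁ x| ≤ B ∧
    |deriv h₀ x| ≤ B ∧ |deriv (deriv h₀) x| ≤ B ∧ |deriv h₁ x| ≤ B
  /-- `F` is continuous on `D_T = Ω_T × ℝ` -/
  cont_F : ContinuousOn (fun q : (ℝ × ℝ) × ℝ => F q.1.1 q.1.2 q.2) (Omega l T ×ˢ Set.univ)
  /-- `F` is Lipschitz in `(x,t,u)` for `(x,t)` in compact subsets of `Ω_T` and bounded `u` -/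
  lip_F : ∀ K : Set (ℝ × ℝ), IsCompact K → K ⊆ Omega l T → ∀ M : ℝ,
    ∃ L : NNReal, LipschitzOnWith L (fun q : (ℝ × ℝ) × ℝ => F q.1.1 q.1.2 q.2)
      (K ×ˢ Set.Icc (-M) M)
  /-- `F` is bounded for bounded `u` -/
  bdd_F : ∀ M : ℝ, ∃ B : ℝ, ∀ x t : ℝ, (x, t) ∈ Omega l T → ∀ u : ℝ, |u| ≤ M → |F x t u| ≤ B
  /-- `F` is globally Lipschitz in `u` -/
  lip_u : ∃ C_F : ℝ, ∀ x t : ℝ, (x, t) ∈ Omega l T → ∀ u₁ u₂ : ℝ,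
    |F x t u₁ - F x t u₂| ≤ C_F * |u₁ - u₂|

/-- The partial derivative `∂_t u (x,t)`, one-sided at `t = 0` and at `t = T`. -/
noncomputable def dt (T : ℝ) (u : ℝ → ℝ → ℝ) : ℝ → ℝ → ℝ :=
  fun x t => derivWithin (fun s => u x s) (Set.Icc 0 T) t

/-- The partial derivative `∂_x u (x,t)`. -/
noncomputable def dx (u : ℝ → ℝ → ℝ) : ℝ → ℝ → ℝ :=
  fun x t => deriv (fun y => u y t) x

/-- The function `ε u_t + u`. -/
noncomputable def relaxed (T ε : ℝ) (u : ℝ → ℝ → ℝ) : ℝ → ℝ → ℝ :=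
  fun x t => ε * dt T u x t + u x t

/-- `u` is a regular solution of the Dirichlet problem
`(∂_xx - λ ∂_x)(ε u_t + u) - ∂_t (u_t + α u) = F(x,t,u)` in `Ω_T`,
`u(x,0) = h₀(x)`, `u_t(x,0) = h₁(x)`, `u(0,t) = u(l,t) = 0`. -/
structure IsRegularSolution (l T α ε lam : ℝ) (h₀ h₁ : ℝ → ℝ) (F : ℝ → ℝ → ℝ → ℝ)
    (u : ℝ → ℝ → ℝ) : Prop where
  cont : ContinuousOn (fun p : ℝ × ℝ => u p.1 p.2) (ClosedRect l T)
  /-- `u_t` exists, is bounded, and is continuous up to the boundary -/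
  diff_t : ∀ x t : ℝ, (x, t) ∈ VelocityRect l T h₁ →
    DifferentiableWithinAt ℝ (fun s => u x s) (Set.Icc 0 T) t
  cont_t : ContinuousOn (fun p : ℝ × ℝ => dt T u p.1 p.2) (VelocityRect l T h₁)
  bdd_t : ∃ B : ℝ, ∀ x t : ℝ, (x, t) ∈ Omega l T → |dt T u x t| ≤ B
  /-- `u_tt` exists and is continuous in `Ω_T` -/
  diff_tt : ∀ x t : ℝ, (x, t) ∈ Omega l T →
    DifferentiableWithinAt ℝ (fun s => dt T u x s) (Set.Icc 0 T) t
  cont_tt : ContinuousOn (fun p : ℝ × ℝ => dt T (dt T u) p.1 p.2) (Omega l T)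
  /-- `∂_x (ε u_t + u)` exists and is continuous in `Ω_T` -/
  diff_x : ∀ x t : ℝ, (x, t) ∈ Omega l T →
    DifferentiableAt ℝ (fun y => relaxed T ε u y t) x
  cont_x : ContinuousOn (fun p : ℝ × ℝ => dx (relaxed T ε u) p.1 p.2) (Omega l T)
  /-- `∂_xx (ε u_t + u)` exists and is continuous in `Ω_T` -/
  diff_xx : ∀ x t : ℝ, (x, t) ∈ Omega l T →
    DifferentiableAt ℝ (fun y => dx (relaxed T ε u) y t) x
  cont_xx : ContinuousOn (fun p : ℝ × ℝ => dx (dx (relaxed T ε u)) p.1 p.2) (Omega l T)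
  equation : ∀ x t : ℝ, (x, t) ∈ Omega l T →
    (dx (dx (relaxed T ε u)) x t - lam * dx (relaxed T ε u) x t)
      - (dt T (dt T u) x t + α * dt T u x t) = F x t (u x t)
  init_value : ∀ x ∈ Set.Icc 0 l, u x 0 = h₀ x
  init_velocity : ∀ x : ℝ, (x, 0) ∈ VelocityRect l T h₁ → dt T u x 0 = h₁ x
  boundary : ∀ t ∈ Set.Ioc 0 T, u 0 t = 0 ∧ u l t = 0

/-- `γ_n = n π / l` -/
noncomputable def freq (l : ℝ) (n : ℕ) : ℝ := n * Real.pi / l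

/-- `b_n = γ_n² + λ²/4` -/
noncomputable def bCoef (l lam : ℝ) (n : ℕ) : ℝ := freq l n ^ 2 + lam ^ 2 / 4

/-- `g_n = (α + ε b_n)/2` -/
noncomputable def gCoef (l α ε lam : ℝ) (n : ℕ) : ℝ := (α + ε * bCoef l lam n) / 2

/-- `G_n(t) = e^{-g_n t} sinh(ω_n t)/ω_n` with `ω_n = √(g_n² - b_n)`. When `ω_n` is imaginary,
`sinh(ω_n t)/ω_n` is `sin(|ω_n| t)/|ω_n|`; when `ω_n = 0`, it is `t`. -/
noncomputable def greenMode (l α ε lam : ℝ) (n : ℕ) (t : ℝ) : ℝ :=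
  let b := bCoef l lam n
  let g := gCoef l α ε lam n
  Real.exp (-g * t) *
    (if b < g ^ 2 then Real.sinh (√(g ^ 2 - b) * t) / √(g ^ 2 - b)
     else if g ^ 2 < b then Real.sin (√(b - g ^ 2) * t) / √(b - g ^ 2)
     else t)

/-- The Green function
`G(x,ξ,t) = (2/l) e^{λ(x-ξ)/2} ∑_{n ≥ 1} G_n(t) sin(γ_n ξ) sin(γ_n x)`. -/
noncomputable def green (l α ε lam x ξ t : ℝ) : ℝ :=
  2 / l * Real.exp (lam / 2 * (x - ξ)) *
    ∑' n : ℕ, greenMode l α ε lam (n + 1) t * Real.sin (freq l (n + 1) * ξ)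
      * Real.sin (freq l (n + 1) * x)

/-- The convolution `u_h(x,t) = ∫_0^l h(ξ) G(x,ξ,t) dξ`. -/
noncomputable def greenConv (l α ε lam : ℝ) (h : ℝ → ℝ) (x t : ℝ) : ℝ :=
  ∫ ξ in (0 : ℝ)..l, h ξ * green l α ε lam x ξ t

/-- The right-hand side of the integral equation:
`u_{h₁} + (∂_t + α + ελ∂_x - ε∂_xx) u_{h₀} - ∫_0^t ∫_0^l G(x,ξ,t-τ) F(ξ,τ,v(ξ,τ)) dξ dτ`. -/
noncomputable def integralMap (l α ε lam : ℝ) (h₀ h₁ : ℝ → ℝ) (F : ℝ → ℝ → ℝ → ℝ)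
    (v : ℝ → ℝ → ℝ) (x t : ℝ) : ℝ :=
  greenConv l α ε lam h₁ x t
    + (deriv (fun s => greenConv l α ε lam h₀ x s) t
        + α * greenConv l α ε lam h₀ x t
        + ε * lam * dx (greenConv l α ε lam h₀) x t
        - ε * dx (dx (greenConv l α ε lam h₀)) x t)
    - ∫ τ in (0 : ℝ)..t, ∫ ξ in (0 : ℝ)..l, green l α ε lam x ξ (t - τ) * F ξ τ (v ξ τ)

/-- The Banach space `B_T` of bounded continuous functions on `Ω_T` (sup norm). -/
abbrev BT (l T : ℝ) : Type := BoundedContinuousFunction (Omega l T) ℝ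

open Classical in
/-- A function on `Ω_T`, extended by zero to the plane. -/
noncomputable def extendZero {l T : ℝ} (v : BT l T) : ℝ → ℝ → ℝ :=
  fun x t => if hp : (x, t) ∈ Omega l T then v ⟨(x, t), hp⟩ else 0

/-- The norm `sup_{Ω_T} e^{-κ t} |v(x,t)|` on `B_T`; for `κ ≥ 0` it is equivalent to the sup
norm, with which it coincides for `κ = 0`. -/
noncomputable def weightedNorm {l T : ℝ} (κ : ℝ) (v : BT l T) : ℝ :=
  ⨆ p : Omega l T, Real.exp (-κ * p.1.2) * |v p|

end JosephsonStrip

open JosephsonStrip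

namespace JosephsonStrip

open MeasureTheory Set Filter Topology

/-! Writing u = e^{λx/2} û turns the equation into one that is diagonal in the sine basis: the n-th
coefficient y of û solves y'' + (α + ε b) y' + b y = -f_n, with b = γ_n² + λ²/4 and f_n the
coefficient of e^{-λx/2} F. Hence y is given by the modes G_n (`gm`), K_n = G_n' + (α + ε b) G_n
(`km`) and a Duhamel integral (`ym`). Everything rests on three bounds uniform in n
(`exists_gm_bounds`): b|G_n|, b|G_n' - e^{-εbt}| and |K_n| are bounded for t ≥ 0. In particular the
Green function is an absolutely convergent series, and the velocity modes differ from heat modes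
only by O(1/n²).

Fixed point. By `integralMap_eq` the integral map is e^{λx/2} times the sine series with
coefficients `ym`. Since ∑ |G_n| is bounded and F is globally Lipschitz in u, a large exponential
weight in time makes the map a contraction (`exists_weightedNorm_contraction`), and Banach's theorem
gives one fixed point.

Uniqueness. A regular solution gives no control of its x-derivatives near the lateral boundary, so
the equation is tested with weighted sines supported in [a, l - a]. After two integrations by parts
only boundary values of εu_t + u remain, and these vanish as a → 0 (`mode_identity`). The
coefficients of the solution thus satisfy the oscillator equation, an energy argument identifies
them with `ym` (`mode_eq_ym`), and completeness of the sines shows that the solution is a fixed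
point.

Existence. The fixed point has to be shown regular. Its velocity is an absolutely convergent series
plus the heat flow of k = e^{-λx/2} h₁. As k need not vanish at the endpoints, this heat flow is
split into a good series and two sawtooth flows, which are continuous up to t = 0 except at one
corner each; this is why exactly the corners with h₁ ≠ 0 are removed. The function Z =
e^{-λx/2}(εu_t + u) solves a heat equation Z_t = ε(Z_xx - λ²Z/4) + r, with r built from u_t and F
(`rhat`). Smoothing is used twice, each time gaining 15/8 powers of the frequency (`duhamel_gain`).
A bounded r gives coefficients of Z summable with weight 5/4, so Z is C¹ in x. Then u_t and F(x,t,u)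
are locally Lipschitz in x; the latter needs u Lipschitz in x, which comes from the bound on h₀''. A
cutoff ζ removes the boundary, the source of the equation for ζZ has coefficients of weight 1/4
(`exists_sum_sinCoef_locSrc_le`), and ζZ reaches weight 17/8 > 2, so Z is C² in x inside. Finally
u_t = e^{λx/2}(Z - û)/ε yields u_tt and the equation. -/

/-! ### Uniformly convergent series of functions -/

/-- The series `∑ a n` converges absolutely at each point of `s`, and uniformly on `s`. -/
def UnifSum {X : Type*} (a : ℕ → X → ℝ) (s : Set X) : Prop :=
  (∀ x ∈ s, Summable fun n => |a n x|) ∧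
    TendstoUniformlyOn (fun N x => ∑ n ∈ Finset.range N, a n x) (fun x => ∑' n, a n x) atTop s

lemma UnifSum.summable {X : Type*} {a : ℕ → X → ℝ} {s : Set X} (h : UnifSum a s) {x : X}
    (hx : x ∈ s) : Summable fun n => a n x :=
  (h.1 x hx).of_abs

lemma UnifSum.comp {X Y : Type*} {a : ℕ → X → ℝ} {s : Set X} (h : UnifSum a s) (g : Y → X)
    {t : Set Y} (hg : MapsTo g t s) : UnifSum (fun n y => a n (g y)) t :=
  ⟨fun y hy => h.1 (g y) (hg hy), (h.2.comp g).mono hg⟩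

lemma unifSum_of_bound {X : Type*} {a : ℕ → X → ℝ} {s : Set X} {u : ℕ → ℝ} (hu : Summable u)
    (h : ∀ n, ∀ x ∈ s, |a n x| ≤ u n) : UnifSum a s :=
  ⟨fun x hx => Summable.of_nonneg_of_le (fun _ => abs_nonneg _) (fun n => h n x hx) hu,
    tendstoUniformlyOn_tsum_nat hu h⟩

lemma summable_of_weight {c : ℕ → ℝ} {δ C : ℝ} (hδ : 0 ≤ δ)
    (h : ∀ N, ∑ n ∈ Finset.range N, ((n : ℝ) + 1) ^ δ * |c n| ≤ C) : Summable fun n => |c n| := by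
  refine summable_of_sum_range_le (c := C) (fun _ => abs_nonneg _) fun N => (le_trans ?_ (h N))
  refine Finset.sum_le_sum fun n _ => ?_
  have : (1 : ℝ) ≤ ((n : ℝ) + 1) ^ δ := Real.one_le_rpow (by linarith [n.cast_nonneg (α := ℝ)]) hδ
  nlinarith [abs_nonneg (c n)]

/-- The terms need no common summable majorant: a positive power of the index in the weight bounds
the tail after N by C (N+1)^{-δ}, uniformly in x. This serves for series that are controlled only in
a weighted ℓ¹ norm at each point. -/
lemma unifSum_of_weight {X : Type*} {a : ℕ → X → ℝ} {s : Set X} {δ C : ℝ} (hδ : 0 < δ)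
    (h : ∀ x ∈ s, ∀ N, ∑ n ∈ Finset.range N, ((n : ℝ) + 1) ^ δ * |a n x| ≤ C) :
    UnifSum a s := by
  have hs : ∀ x ∈ s, Summable fun n => |a n x| := fun x hx => summable_of_weight hδ.le (h x hx)
  refine ⟨hs, ?_⟩
  have key : ∀ x ∈ s, ∀ N : ℕ,
      |∑' n, a n x - ∑ n ∈ Finset.range N, a n x| ≤ C * ((N : ℝ) + 1) ^ (-δ) := by
    intro x hx N
    have h1 : Tendsto (fun M => ∑ n ∈ Finset.range M, a n x) atTop (𝓝 (∑' n, a n x)) :=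
      (hs x hx).of_abs.hasSum.tendsto_sum_nat
    refine le_of_tendsto ((h1.sub_const (∑ n ∈ Finset.range N, a n x)).abs) ?_
    filter_upwards [eventually_ge_atTop N] with M hM
    rw [← Finset.sum_Ico_eq_sub _ hM]
    refine (Finset.abs_sum_le_sum_abs _ _).trans ?_
    have hN : (0 : ℝ) < (N : ℝ) + 1 := by positivity
    have h2 : ∑ n ∈ Finset.Ico N M, |a n x| ≤
        ∑ n ∈ Finset.Ico N M, (((n : ℝ) + 1) ^ δ * |a n x|) * ((N : ℝ) + 1) ^ (-δ) := by
      refine Finset.sum_le_sum fun n hn => ?_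
      have hNn : (N : ℝ) ≤ n := by exact_mod_cast (Finset.mem_Ico.1 hn).1
      have h3 : ((N : ℝ) + 1) ^ δ ≤ ((n : ℝ) + 1) ^ δ :=
        Real.rpow_le_rpow hN.le (by linarith) hδ.le
      have h4 : ((N : ℝ) + 1) ^ δ * ((N : ℝ) + 1) ^ (-δ) = 1 := by
        rw [← Real.rpow_add hN]; simp
      have h5 : 0 ≤ ((N : ℝ) + 1) ^ (-δ) := by positivity
      calc |a n x| = (((N : ℝ) + 1) ^ δ * |a n x|) * ((N : ℝ) + 1) ^ (-δ) := by
            rw [mul_right_comm, h4, one_mul]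
        _ ≤ _ := by gcongr
    refine h2.trans ?_
    rw [← Finset.sum_mul]
    refine mul_le_mul_of_nonneg_right ?_ (by positivity)
    refine le_trans (Finset.sum_le_sum_of_subset_of_nonneg ?_ ?_) (h x hx M)
    · intro n hn
      exact Finset.mem_range.2 (Finset.mem_Ico.1 hn).2
    · intros; positivity
  have hlim : Tendsto (fun N : ℕ => C * ((N : ℝ) + 1) ^ (-δ)) atTop (𝓝 0) := by
    have := ((tendsto_rpow_neg_atTop hδ).comp
      (tendsto_atTop_add_const_right _ (1 : ℝ) tendsto_natCast_atTop_atTop)).const_mul C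
    simpa using! this
  rw [Metric.tendstoUniformlyOn_iff]
  intro ε hε
  filter_upwards [hlim.eventually (gt_mem_nhds hε)] with N hN x hx
  rw [Real.dist_eq]
  exact (key x hx N).trans_lt hN

lemma UnifSum.continuousOn {X : Type*} [TopologicalSpace X] {a : ℕ → X → ℝ} {s : Set X}
    (h : UnifSum a s) (hc : ∀ n, ContinuousOn (a n) s) : ContinuousOn (fun x => ∑' n, a n x) s :=
  h.2.continuousOn (Frequently.of_forall fun _ => continuousOn_finsetSum _ fun n _ => hc n)

lemma UnifSum.hasDerivAt {f f' : ℕ → ℝ → ℝ} {s : Set ℝ} (hs : IsOpen s) (h : UnifSum f' s)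
    (hf : ∀ n, ∀ x ∈ s, HasDerivAt (f n) (f' n x) x) (hsum : ∀ x ∈ s, Summable fun n => f n x)
    {x : ℝ} (hx : x ∈ s) : HasDerivAt (fun y => ∑' n, f n y) (∑' n, f' n x) x := by
  refine hasDerivAt_of_tendstoUniformlyOn (f := fun N y => ∑ n ∈ Finset.range N, f n y)
    hs h.2 ?_ ?_ hx
  · filter_upwards with N y hy
    exact HasDerivAt.fun_sum fun n _ => hf n y hy
  · intro y hy
    exact (hsum y hy).hasSum.tendsto_sum_nat

lemma summable_add_one_rpow {p : ℝ} (hp : p < -1) : Summable fun n : ℕ => ((n : ℝ) + 1) ^ p := by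
  have := (summable_nat_add_iff 1).2 (Real.summable_nat_rpow.2 hp)
  simpa using this

/-- Cauchy–Schwarz, since (n+1)^{2p} is summable for p < -1/2. The constant does not depend on the
sequence, so Bessel's inequality yields weighted ℓ¹ bounds that are uniform in time. -/
lemma weighted_sum_le_of_sq {p : ℝ} (hp : p < -1 / 2) :
    ∃ A : ℝ, 0 ≤ A ∧ ∀ (c : ℕ → ℝ) (B : ℝ), (∀ N, ∑ n ∈ Finset.range N, c n ^ 2 ≤ B) →
      ∀ N, ∑ n ∈ Finset.range N, ((n : ℝ) + 1) ^ p * |c n| ≤ A * √B := by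
  have hs : Summable fun n : ℕ => ((n : ℝ) + 1) ^ (2 * p) := summable_add_one_rpow (by linarith)
  refine ⟨√(∑' n : ℕ, ((n : ℝ) + 1) ^ (2 * p)), by positivity, fun c B h N => ?_⟩
  have h1 := Finset.sum_mul_sq_le_sq_mul_sq (Finset.range N) (fun n => ((n : ℝ) + 1) ^ p)
    (fun n => |c n|)
  have h2 : ∑ n ∈ Finset.range N, (((n : ℝ) + 1) ^ p) ^ 2 ≤ ∑' n : ℕ, ((n : ℝ) + 1) ^ (2 * p) := by
    refine le_trans (le_of_eq (Finset.sum_congr rfl fun n _ => ?_))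
      (hs.sum_le_tsum (Finset.range N) fun _ _ => by positivity)
    rw [← Real.rpow_natCast, ← Real.rpow_mul (by positivity)]
    congr 1; push_cast; ring
  have h3 : ∑ n ∈ Finset.range N, |c n| ^ 2 ≤ B := by simpa using h N
  have hB : 0 ≤ B := le_trans (Finset.sum_nonneg fun _ _ => sq_nonneg _) (h N)
  rw [← Real.sqrt_mul (tsum_nonneg fun _ => by positivity)]
  refine Real.le_sqrt_of_sq_le (h1.trans ?_)
  exact mul_le_mul h2 h3 (Finset.sum_nonneg fun _ _ => sq_nonneg _)
    (tsum_nonneg fun _ => by positivity)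

lemma weighted_sum_le_of_mul_sq {q : ℝ} (hq : q < 1 / 2) :
    ∃ A : ℝ, 0 ≤ A ∧ ∀ (c : ℕ → ℝ) (B : ℝ),
      (∀ N, ∑ n ∈ Finset.range N, (((n : ℝ) + 1) * c n) ^ 2 ≤ B) →
      ∀ N, ∑ n ∈ Finset.range N, ((n : ℝ) + 1) ^ q * |c n| ≤ A * √B := by
  obtain ⟨A, hA, h⟩ := weighted_sum_le_of_sq (p := q - 1) (by linarith)
  refine ⟨A, hA, fun c B hB N => le_trans (le_of_eq (Finset.sum_congr rfl fun n _ => ?_))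
    (h (fun n => ((n : ℝ) + 1) * c n) B hB N)⟩
  have hn : (0 : ℝ) < (n : ℝ) + 1 := by positivity
  rw [abs_mul, abs_of_pos hn, ← mul_assoc, Real.rpow_sub_one hn.ne']
  field_simp

/-! ### Bounded measurable functions on `(0, l)` -/

/-- `f` is measurable on `(0, l)` and bounded there by `M`. -/
def BddMeas (l M : ℝ) (f : ℝ → ℝ) : Prop :=
  AEStronglyMeasurable f (volume.restrict (Ioc 0 l)) ∧ ∀ x ∈ Ioo 0 l, |f x| ≤ M

lemma ae_mem_Ioo_of_restrict (l : ℝ) : ∀ᵐ x ∂volume.restrict (Ioc (0 : ℝ) l), x ∈ Ioo 0 l := by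
  rw [← restrict_Ioo_eq_restrict_Ioc]
  exact ae_restrict_mem measurableSet_Ioo

lemma ae_Ioc_of_Ioo {l : ℝ} {p : ℝ → Prop} (h : ∀ x ∈ Ioo 0 l, p x) :
    ∀ᵐ x ∂volume.restrict (Ioc (0 : ℝ) l), p x := by
  filter_upwards [ae_mem_Ioo_of_restrict l] with x hx using h x hx

lemma bddMeas_of_continuousOn {l M : ℝ} {f : ℝ → ℝ} (hc : ContinuousOn f (Ioo 0 l))
    (hb : ∀ x ∈ Ioo 0 l, |f x| ≤ M) : BddMeas l M f := by
  refine ⟨?_, hb⟩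
  rw [← restrict_Ioo_eq_restrict_Ioc]
  exact hc.aestronglyMeasurable measurableSet_Ioo

lemma BddMeas.integrableOn {l M : ℝ} {f : ℝ → ℝ} (h : BddMeas l M f) :
    IntegrableOn f (Ioc 0 l) := by
  refine Integrable.of_bound h.1 M ?_
  simpa only [Real.norm_eq_abs] using ae_Ioc_of_Ioo h.2

lemma BddMeas.intervalIntegrable {l M : ℝ} (hl : 0 < l) {f : ℝ → ℝ} (h : BddMeas l M f) :
    IntervalIntegrable f volume 0 l := by
  rw [intervalIntegrable_iff_integrableOn_Ioc_of_le hl.le]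
  exact h.integrableOn

lemma BddMeas.nonneg {l M : ℝ} (hl : 0 < l) {f : ℝ → ℝ} (h : BddMeas l M f) : 0 ≤ M :=
  (abs_nonneg _).trans (h.2 (l / 2) ⟨by linarith, by linarith⟩)

lemma BddMeas.mul {l M N : ℝ} (hl : 0 < l) {f g : ℝ → ℝ} (hf : BddMeas l M f)
    (hg : BddMeas l N g) : BddMeas l (M * N) (fun x => f x * g x) := by
  refine ⟨hf.1.mul hg.1, fun x hx => ?_⟩
  rw [abs_mul]
  exact mul_le_mul (hf.2 x hx) (hg.2 x hx) (abs_nonneg _) (hf.nonneg hl)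

lemma BddMeas.mul_continuous {l M N : ℝ} (hl : 0 < l) {f g : ℝ → ℝ} (hf : BddMeas l M f)
    (hg : Continuous g) (hN : ∀ x, |g x| ≤ N) : BddMeas l (M * N) (fun x => f x * g x) :=
  hf.mul hl (bddMeas_of_continuousOn hg.continuousOn fun x _ => hN x)

lemma intervalIntegral_congr_Ioo {l : ℝ} (hl : 0 < l) {f g : ℝ → ℝ}
    (h : ∀ x ∈ Ioo 0 l, f x = g x) : ∫ x in (0 : ℝ)..l, f x = ∫ x in (0 : ℝ)..l, g x := by
  rw [intervalIntegral.integral_of_le hl.le, intervalIntegral.integral_of_le hl.le]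
  exact integral_congr_ae (ae_Ioc_of_Ioo h)

lemma abs_intervalIntegral_le {l M : ℝ} (hl : 0 < l) {f : ℝ → ℝ}
    (h : ∀ x ∈ Ioo 0 l, |f x| ≤ M) : |∫ x in (0 : ℝ)..l, f x| ≤ M * l := by
  have := intervalIntegral.norm_integral_le_of_norm_le_const_ae (f := f) (a := 0) (b := l) (C := M)
    (by
      rw [uIoc_of_le hl.le]
      simpa only [Real.norm_eq_abs] using
        (ae_restrict_iff' measurableSet_Ioc).1 (ae_Ioc_of_Ioo h))
  simpa [abs_of_pos hl] using this

/-! ### Sine and cosine systems -/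

/-- The frequencies `π (n+1) / l`. -/
noncomputable def wave (l : ℝ) (n : ℕ) : ℝ := freq l (n + 1)

lemma wave_eq (l : ℝ) (n : ℕ) : wave l n = (n + 1) * (Real.pi / l) := by
  simp [wave, freq]; ring

lemma wave_pos {l : ℝ} (hl : 0 < l) (n : ℕ) : 0 < wave l n := by
  rw [wave_eq]; have := Real.pi_pos; positivity

lemma sin_wave_right {l : ℝ} (hl : 0 < l) (n : ℕ) : Real.sin (wave l n * l) = 0 := by
  rw [wave_eq, mul_assoc, div_mul_cancel₀ _ hl.ne']
  exact_mod_cast Real.sin_nat_mul_pi (n + 1)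

lemma integral_cos_int {l : ℝ} (hl : 0 < l) (j : ℤ) :
    ∫ x in (0 : ℝ)..l, Real.cos (j * (Real.pi / l) * x) = if j = 0 then l else 0 := by
  split_ifs with h
  · simp [h]
  · have hj : (j : ℝ) * (Real.pi / l) ≠ 0 := by
      have := Real.pi_pos
      have : (j : ℝ) ≠ 0 := by exact_mod_cast h
      positivity
    rw [intervalIntegral.integral_comp_mul_left (fun x => Real.cos x) hj, integral_cos]
    rw [mul_assoc, div_mul_cancel₀ _ hl.ne', Real.sin_int_mul_pi]
    simp

lemma integral_sin_wave_mul {l : ℝ} (hl : 0 < l) (n m : ℕ) :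
    ∫ x in (0 : ℝ)..l, Real.sin (wave l n * x) * Real.sin (wave l m * x) =
      if n = m then l / 2 else 0 := by
  have h : ∀ x, Real.sin (wave l n * x) * Real.sin (wave l m * x) =
      2⁻¹ * (Real.cos (((n - m : ℤ) : ℝ) * (Real.pi / l) * x)
        - Real.cos (((n + m + 2 : ℤ) : ℝ) * (Real.pi / l) * x)) := by
    intro x
    rw [wave_eq, wave_eq,
      show (((n - m : ℤ) : ℝ) * (Real.pi / l) * x) =
        (n + 1) * (Real.pi / l) * x - (m + 1) * (Real.pi / l) * x by push_cast; ring,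
      show (((n + m + 2 : ℤ) : ℝ) * (Real.pi / l) * x) =
        (n + 1) * (Real.pi / l) * x + (m + 1) * (Real.pi / l) * x by push_cast; ring,
      Real.cos_sub, Real.cos_add]
    ring
  simp_rw [h]
  rw [intervalIntegral.integral_const_mul, intervalIntegral.integral_sub
    (Continuous.intervalIntegrable (by fun_prop) _ _)
    (Continuous.intervalIntegrable (by fun_prop) _ _), integral_cos_int hl, integral_cos_int hl]
  have h2 : ¬ ((n : ℤ) + m + 2 = 0) := by omega
  rw [if_neg h2]
  by_cases hnm : n = m
  · simp [hnm]; ring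
  · have : ¬ ((n : ℤ) - m = 0) := by omega
    simp [hnm, this]

lemma integral_cos_wave_mul {l : ℝ} (hl : 0 < l) (n m : ℕ) :
    ∫ x in (0 : ℝ)..l, Real.cos (wave l n * x) * Real.cos (wave l m * x) =
      if n = m then l / 2 else 0 := by
  have h : ∀ x, Real.cos (wave l n * x) * Real.cos (wave l m * x) =
      2⁻¹ * (Real.cos (((n - m : ℤ) : ℝ) * (Real.pi / l) * x)
        + Real.cos (((n + m + 2 : ℤ) : ℝ) * (Real.pi / l) * x)) := by
    intro x
    rw [wave_eq, wave_eq,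
      show (((n - m : ℤ) : ℝ) * (Real.pi / l) * x) =
        (n + 1) * (Real.pi / l) * x - (m + 1) * (Real.pi / l) * x by push_cast; ring,
      show (((n + m + 2 : ℤ) : ℝ) * (Real.pi / l) * x) =
        (n + 1) * (Real.pi / l) * x + (m + 1) * (Real.pi / l) * x by push_cast; ring,
      Real.cos_sub, Real.cos_add]
    ring
  simp_rw [h]
  rw [intervalIntegral.integral_const_mul, intervalIntegral.integral_add
    (Continuous.intervalIntegrable (by fun_prop) _ _)
    (Continuous.intervalIntegrable (by fun_prop) _ _), integral_cos_int hl, integral_cos_int hl]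
  have h2 : ¬ ((n : ℤ) + m + 2 = 0) := by omega
  rw [if_neg h2]
  by_cases hnm : n = m
  · simp [hnm]; ring
  · have : ¬ ((n : ℤ) - m = 0) := by omega
    simp [hnm, this]

/-- Bessel's inequality for a bounded function. -/
lemma bessel_of_orthogonal {l M : ℝ} (hl : 0 < l) {f : ℝ → ℝ} (hf : BddMeas l M f)
    {φ : ℕ → ℝ → ℝ} (hφ : ∀ n, Continuous (φ n)) (hb : ∀ n x, |φ n x| ≤ 1)
    (ho : ∀ n m, ∫ x in (0 : ℝ)..l, φ n x * φ m x = if n = m then l / 2 else 0) (N : ℕ) :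
    ∑ n ∈ Finset.range N, (∫ x in (0 : ℝ)..l, f x * φ n x) ^ 2 ≤ l ^ 2 * M ^ 2 / 2 := by
  set c : ℕ → ℝ := fun n => ∫ x in (0 : ℝ)..l, f x * φ n x with hc
  have hff : IntervalIntegrable (fun x => f x * f x) volume 0 l :=
    (hf.mul hl hf).intervalIntegrable hl
  have hfφ : ∀ n, IntervalIntegrable (fun x => f x * φ n x) volume 0 l := fun n =>
    (hf.mul_continuous hl (hφ n) (hb n)).intervalIntegrable hl
  have hφφ : ∀ n m, IntervalIntegrable (fun x => φ n x * φ m x) volume 0 l := fun n m =>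
    ((hφ n).mul (hφ m)).intervalIntegrable _ _
  -- The subtracted sum is the orthogonal projection of f onto the first N functions; 2/l is the
  -- inverse of their squared norm.
  have h0 : 0 ≤ ∫ x in (0 : ℝ)..l, (f x - ∑ n ∈ Finset.range N, 2 / l * c n * φ n x) ^ 2 :=
    intervalIntegral.integral_nonneg hl.le fun _ _ => sq_nonneg _
  have hexp : ∀ x, (f x - ∑ n ∈ Finset.range N, 2 / l * c n * φ n x) ^ 2 =
      f x * f x - ∑ n ∈ Finset.range N, (2 * (2 / l * c n)) * (f x * φ n x)
        + ∑ n ∈ Finset.range N, ∑ m ∈ Finset.range N,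
          (2 / l * c n * (2 / l * c m)) * (φ n x * φ m x) := by
    intro x
    rw [sub_sq, sq (∑ n ∈ Finset.range N, 2 / l * c n * φ n x), Finset.sum_mul_sum, Finset.mul_sum,
      sq (f x)]
    congr 1
    · congr 1
      exact Finset.sum_congr rfl fun _ _ => by ring
    · exact Finset.sum_congr rfl fun _ _ => Finset.sum_congr rfl fun _ _ => by ring
  simp_rw [hexp] at h0
  have i1 : IntervalIntegrable (fun x => ∑ n ∈ Finset.range N, (2 * (2 / l * c n)) * (f x * φ n x))
      volume 0 l := by
    have := IntervalIntegrable.sum (Finset.range N) (f := fun n x =>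
      (2 * (2 / l * c n)) * (f x * φ n x)) fun n _ => (hfφ n).const_mul _
    simpa only [Finset.sum_fn] using this
  have i2 : ∀ n, IntervalIntegrable (fun x => ∑ m ∈ Finset.range N,
      (2 / l * c n * (2 / l * c m)) * (φ n x * φ m x)) volume 0 l := by
    intro n
    exact (continuous_finsetSum _ fun m _ =>
      continuous_const.mul ((hφ n).mul (hφ m))).intervalIntegrable _ _
  have i3 : IntervalIntegrable (fun x => ∑ n ∈ Finset.range N, ∑ m ∈ Finset.range N,
      (2 / l * c n * (2 / l * c m)) * (φ n x * φ m x)) volume 0 l :=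
    (continuous_finsetSum _ fun n _ => continuous_finsetSum _ fun m _ =>
      continuous_const.mul ((hφ n).mul (hφ m))).intervalIntegrable _ _
  rw [intervalIntegral.integral_add (hff.sub i1) i3, intervalIntegral.integral_sub hff i1,
    intervalIntegral.integral_finsetSum (fun n _ => (hfφ n).const_mul _),
    intervalIntegral.integral_finsetSum (fun n _ => i2 n)] at h0
  simp_rw [intervalIntegral.integral_finsetSum (fun m _ => (hφφ _ m).const_mul _),
    intervalIntegral.integral_const_mul, ho] at h0
  have h1 : ∑ n ∈ Finset.range N, ∑ m ∈ Finset.range N,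
      2 / l * c n * (2 / l * c m) * (if n = m then l / 2 else 0) =
      ∑ n ∈ Finset.range N, 2 / l * c n ^ 2 := by
    refine Finset.sum_congr rfl fun n hn => ?_
    simp only [mul_ite, mul_zero]
    rw [Finset.sum_ite_eq, if_pos hn]
    field_simp
  rw [h1] at h0
  have h2 : ∑ n ∈ Finset.range N, 2 * (2 / l * c n) * ∫ x in (0 : ℝ)..l, f x * φ n x =
      2 * ∑ n ∈ Finset.range N, 2 / l * c n ^ 2 := by
    rw [Finset.mul_sum]
    exact Finset.sum_congr rfl fun n _ => by rw [← show c n = _ from rfl]; ring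
  rw [h2] at h0
  have h3 : ∫ x in (0 : ℝ)..l, f x * f x ≤ M * M * l :=
    (le_abs_self _).trans (abs_intervalIntegral_le hl (hf.mul hl hf).2)
  have h4 : 2 / l * ∑ n ∈ Finset.range N, c n ^ 2 ≤ M * M * l := by
    rw [Finset.mul_sum]; linarith
  have h5 : ∑ n ∈ Finset.range N, c n ^ 2 = l / 2 * (2 / l * ∑ n ∈ Finset.range N, c n ^ 2) := by
    field_simp
  rw [h5]
  have : l / 2 * (2 / l * ∑ n ∈ Finset.range N, c n ^ 2) ≤ l / 2 * (M * M * l) :=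
    mul_le_mul_of_nonneg_left h4 (by positivity)
  linarith [this, show l / 2 * (M * M * l) = l ^ 2 * M ^ 2 / 2 by ring]

/-- The sine coefficient `∫_0^l f(x) sin(γ_n x) dx`. -/
noncomputable def sinCoef (l : ℝ) (f : ℝ → ℝ) (n : ℕ) : ℝ :=
  ∫ x in (0 : ℝ)..l, f x * Real.sin (wave l n * x)

lemma abs_sinCoef_le {l M : ℝ} (hl : 0 < l) {f : ℝ → ℝ} (h : ∀ x ∈ Ioo 0 l, |f x| ≤ M) (n : ℕ) :
    |sinCoef l f n| ≤ M * l := by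
  refine abs_intervalIntegral_le hl fun x hx => ?_
  rw [abs_mul]
  nlinarith [h x hx, abs_nonneg (f x), Real.abs_sin_le_one (wave l n * x)]

lemma sum_sinCoef_sq_le {l M : ℝ} (hl : 0 < l) {f : ℝ → ℝ} (hf : BddMeas l M f) (N : ℕ) :
    ∑ n ∈ Finset.range N, sinCoef l f n ^ 2 ≤ l ^ 2 * M ^ 2 / 2 :=
  bessel_of_orthogonal hl hf (fun _ => by fun_prop) (fun _ _ => Real.abs_sin_le_one _)
    (integral_sin_wave_mul hl) N

lemma BddMeas.mul_sin {l M : ℝ} (hl : 0 < l) {f : ℝ → ℝ} (hf : BddMeas l M f) (k : ℝ) :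
    IntervalIntegrable (fun x => f x * Real.sin (k * x)) volume 0 l :=
  (hf.mul_continuous hl (by fun_prop) (fun _ => Real.abs_sin_le_one _)).intervalIntegrable hl

lemma sinCoef_congr {l : ℝ} (hl : 0 < l) {f g : ℝ → ℝ} (h : ∀ x ∈ Ioo 0 l, f x = g x) (n : ℕ) :
    sinCoef l f n = sinCoef l g n :=
  intervalIntegral_congr_Ioo hl fun x hx => by rw [h x hx]

lemma sinCoef_add {l M N : ℝ} (hl : 0 < l) {f g : ℝ → ℝ} (hf : BddMeas l M f)
    (hg : BddMeas l N g) (n : ℕ) :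
    sinCoef l (fun x => f x + g x) n = sinCoef l f n + sinCoef l g n := by
  simp only [sinCoef, add_mul]
  exact intervalIntegral.integral_add (hf.mul_sin hl _) (hg.mul_sin hl _)

lemma sinCoef_sub {l M N : ℝ} (hl : 0 < l) {f g : ℝ → ℝ} (hf : BddMeas l M f)
    (hg : BddMeas l N g) (n : ℕ) :
    sinCoef l (fun x => f x - g x) n = sinCoef l f n - sinCoef l g n := by
  simp only [sinCoef, sub_mul]
  exact intervalIntegral.integral_sub (hf.mul_sin hl _) (hg.mul_sin hl _)

lemma sinCoef_const_mul (l c : ℝ) (f : ℝ → ℝ) (n : ℕ) :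
    sinCoef l (fun x => c * f x) n = c * sinCoef l f n := by
  simp only [sinCoef, mul_assoc]
  exact intervalIntegral.integral_const_mul _ _

/-- Integration of a bounded function against an absolutely convergent series. -/
lemma hasSum_integral_mul_series {l M : ℝ} (hl : 0 < l) {r : ℝ → ℝ} (hr : BddMeas l M r)
    {c : ℕ → ℝ} (hc : Summable fun n => |c n|) {ψ : ℕ → ℝ → ℝ} (hψ : ∀ n, Continuous (ψ n))
    (hb : ∀ n x, |ψ n x| ≤ 1) :
    HasSum (fun n => c n * ∫ x in (0 : ℝ)..l, r x * ψ n x)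
      (∫ x in (0 : ℝ)..l, r x * ∑' n, c n * ψ n x) := by
  have hs : ∀ x, Summable fun n => c n * ψ n x := fun x =>
    Summable.of_norm_bounded hc fun n => by
      rw [Real.norm_eq_abs, abs_mul]
      nlinarith [hb n x, abs_nonneg (c n)]
  have := intervalIntegral.hasSum_integral_of_dominated_convergence (μ := volume) (a := 0) (b := l)
    (F := fun n x => c n * (r x * ψ n x)) (f := fun x => r x * ∑' n, c n * ψ n x)
    (fun n _ => M * |c n|) (fun n => ?_) (fun n => ?_) ?_ ?_ ?_
  · simpa only [intervalIntegral.integral_const_mul] using this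
  · rw [uIoc_of_le hl.le]
    exact ((hr.mul_continuous hl (hψ n) (hb n)).1).const_mul _
  · rw [uIoc_of_le hl.le]
    refine (ae_restrict_iff' measurableSet_Ioc).1 (ae_Ioc_of_Ioo fun x hx => ?_)
    rw [Real.norm_eq_abs, abs_mul, abs_mul, mul_comm M]
    refine mul_le_mul_of_nonneg_left ?_ (abs_nonneg _)
    nlinarith [hr.2 x hx, hb n x, abs_nonneg (r x)]
  · exact Eventually.of_forall fun x _ => hc.mul_left M
  · simp
  · refine Eventually.of_forall fun x _ => ?_
    have := (hs x).hasSum.mul_left (r x)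
    refine this.congr_fun fun n => ?_
    ring

lemma tsum_sin_bddMeas {l : ℝ} {c : ℕ → ℝ} (hc : Summable fun n => |c n|) :
    BddMeas l (∑' n, |c n|) (fun x => ∑' n, c n * Real.sin (wave l n * x)) := by
  have hb : ∀ n x, |c n * Real.sin (wave l n * x)| ≤ |c n| := fun n x => by
    rw [abs_mul]; nlinarith [Real.abs_sin_le_one (wave l n * x), abs_nonneg (c n)]
  refine bddMeas_of_continuousOn ?_ fun x _ => ?_
  · exact ((unifSum_of_bound (s := univ) hc fun n x _ => hb n x).continuousOn
      fun n => by fun_prop).mono (subset_univ _)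
  · rw [← Real.norm_eq_abs]
    exact tsum_of_norm_bounded hc.hasSum fun n => by rw [Real.norm_eq_abs]; exact hb n x

lemma sinCoef_tsum {l : ℝ} (hl : 0 < l) {c : ℕ → ℝ} (hc : Summable fun n => |c n|) (n : ℕ) :
    sinCoef l (fun x => ∑' m, c m * Real.sin (wave l m * x)) n = l / 2 * c n := by
  have h := hasSum_integral_mul_series hl (r := fun x => Real.sin (wave l n * x)) (M := 1)
    (bddMeas_of_continuousOn (by fun_prop) fun x _ => Real.abs_sin_le_one _) hc
    (ψ := fun m x => Real.sin (wave l m * x)) (fun _ => by fun_prop)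
    (fun _ _ => Real.abs_sin_le_one _)
  simp_rw [integral_sin_wave_mul hl] at h
  have h2 := h.unique (hasSum_single n fun m hm => by simp [hm.symm])
  rw [if_pos rfl] at h2
  rw [sinCoef, mul_comm (l / 2), ← h2]
  exact intervalIntegral.integral_congr fun x _ => mul_comm _ _

/-! ### Completeness of the sine system -/

/-- A factor cos(πx/l) only shifts the frequency of a sine by one in both directions, and frequency
0 gives zero, so induction on the power applies. The case k = 1 makes g sin(πx/l) orthogonal to
every polynomial in cos(πx/l). -/
lemma integral_mul_sin_mul_cos_pow_eq_zero {l M : ℝ} (hl : 0 < l) {g : ℝ → ℝ}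
    (hg : BddMeas l M g) (h0 : ∀ n, sinCoef l g n = 0) (n : ℕ) :
    ∀ k : ℕ, ∫ x in (0 : ℝ)..l, g x *
      (Real.sin (k * (Real.pi / l) * x) * Real.cos (Real.pi / l * x) ^ n) = 0 := by
  induction n with
  | zero =>
    intro k
    rcases k with _ | k
    · simp
    · have := h0 k
      rw [sinCoef, wave_eq] at this
      simpa using this
  | succ n ih =>
    intro k
    rcases k with _ | k
    · simp
    · have h : ∀ x, g x * (Real.sin ((k + 1 : ℕ) * (Real.pi / l) * x) *
          Real.cos (Real.pi / l * x) ^ (n + 1)) =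
          2⁻¹ * (g x * (Real.sin ((k + 2 : ℕ) * (Real.pi / l) * x) * Real.cos (Real.pi / l * x) ^ n)
            + g x * (Real.sin (k * (Real.pi / l) * x) * Real.cos (Real.pi / l * x) ^ n)) := by
        intro x
        rw [show ((k + 2 : ℕ) : ℝ) * (Real.pi / l) * x =
            (k + 1 : ℕ) * (Real.pi / l) * x + Real.pi / l * x by push_cast; ring,
          show (k : ℝ) * (Real.pi / l) * x =
            (k + 1 : ℕ) * (Real.pi / l) * x - Real.pi / l * x by push_cast; ring,
          Real.sin_add, Real.sin_sub]
        ring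
      have hi : ∀ j : ℕ, IntervalIntegrable (fun x => g x * (Real.sin (j * (Real.pi / l) * x) *
          Real.cos (Real.pi / l * x) ^ n)) volume 0 l := fun j =>
        (hg.mul_continuous hl (N := 1) (by fun_prop) fun x => by
          rw [abs_mul, abs_pow]
          exact mul_le_one₀ (Real.abs_sin_le_one _) (by positivity)
            (pow_le_one₀ (abs_nonneg _) (Real.abs_cos_le_one _))).intervalIntegrable hl
      simp_rw [h]
      rw [intervalIntegral.integral_const_mul, intervalIntegral.integral_add (hi _) (hi _),
        ih (k + 2), ih k]
      simp

/-- A bounded continuous function on `(0, l)` with vanishing sine coefficients is zero. -/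
lemma eq_zero_of_sinCoef_eq_zero {l M : ℝ} (hl : 0 < l) {g : ℝ → ℝ}
    (hc : ContinuousOn g (Ioo 0 l)) (hM : ∀ x ∈ Ioo 0 l, |g x| ≤ M)
    (h0 : ∀ n, sinCoef l g n = 0) {x : ℝ} (hx : x ∈ Ioo 0 l) : g x = 0 := by
  have hg : BddMeas l M g := bddMeas_of_continuousOn hc hM
  have hpi := Real.pi_pos
  -- A bounded g may have no limits at the endpoints; the factor sin(πx/l) forces h to be continuous
  -- on the closed interval with value 0 there.
  set h : ℝ → ℝ := fun x => g x * Real.sin (Real.pi / l * x) with hh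
  have hl0 : h 0 = 0 := by simp [hh]
  have hll : h l = 0 := by simp [hh, div_mul_cancel₀ _ hl.ne']
  have hbd : ∀ x ∈ Icc 0 l, |h x| ≤ M * |Real.sin (Real.pi / l * x)| := by
    intro x hx
    rcases eq_or_lt_of_le hx.1 with h1 | h1
    · rw [← h1, hl0]; simp
    rcases eq_or_lt_of_le hx.2 with h2 | h2
    · rw [h2, hll]; simp [div_mul_cancel₀ _ hl.ne']
    rw [hh, abs_mul]
    exact mul_le_mul_of_nonneg_right (hM x ⟨h1, h2⟩) (abs_nonneg _)
  have hend : ∀ y, h y = 0 → Real.sin (Real.pi / l * y) = 0 →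
      ContinuousWithinAt h (Icc 0 l) y := by
    intro y hy hy'
    rw [ContinuousWithinAt, hy]
    refine squeeze_zero_norm' (a := fun x => M * |Real.sin (Real.pi / l * x)|) ?_ ?_
    · filter_upwards [self_mem_nhdsWithin] with x hx using hbd x hx
    · have : Continuous fun x => M * |Real.sin (Real.pi / l * x)| := by fun_prop
      have h2 := (this.tendsto y).mono_left (nhdsWithin_le_nhds (s := Icc 0 l))
      simpa [hy'] using h2
  have hcont : ContinuousOn h (Icc 0 l) := by
    intro y hy
    rcases eq_or_lt_of_le hy.1 with h1 | h1
    · exact hend y (h1 ▸ hl0) (by simp [← h1])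
    rcases eq_or_lt_of_le hy.2 with h2 | h2
    · exact hend y (h2 ▸ hll) (by simp [h2, div_mul_cancel₀ _ hl.ne'])
    have : ContinuousAt g y := hc.continuousAt (Ioo_mem_nhds h1 h2)
    exact (this.mul (by fun_prop)).continuousWithinAt
  have hpoly : ∀ p : Polynomial ℝ, ∫ x in (0 : ℝ)..l, h x * p.eval (Real.cos (Real.pi / l * x))
      = 0 := by
    intro p
    have hi : ∀ q : Polynomial ℝ, IntervalIntegrable
        (fun x => h x * q.eval (Real.cos (Real.pi / l * x))) volume 0 l := fun q => by
      refine ContinuousOn.intervalIntegrable ?_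
      rw [uIcc_of_le hl.le]
      exact hcont.mul (by fun_prop)
    induction p using Polynomial.induction_on' with
    | add p q hp hq =>
      simp only [Polynomial.eval_add, mul_add]
      rw [intervalIntegral.integral_add (hi p) (hi q), hp, hq, add_zero]
    | monomial n a =>
      have := integral_mul_sin_mul_cos_pow_eq_zero hl hg h0 n 1
      have h3 : ∀ x, h x * (Polynomial.monomial n a).eval (Real.cos (Real.pi / l * x)) =
          a * (g x * (Real.sin ((1 : ℕ) * (Real.pi / l) * x) *
            Real.cos (Real.pi / l * x) ^ n)) := by
        intro x
        simp only [hh, Polynomial.eval_monomial, Nat.cast_one, one_mul]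
        ring
      simp_rw [h3]
      rw [intervalIntegral.integral_const_mul, this, mul_zero]
  -- The substitution y = cos(πx/l) turns h into a continuous function on [-1, 1], so by Weierstrass
  -- h is a uniform limit of polynomials in cos(πx/l). Being orthogonal to all of these, h has zero
  -- L² norm.
  have hGc : ContinuousOn (fun y => h (l / Real.pi * Real.arccos y)) (Icc (-1) 1) := by
    refine hcont.comp (by fun_prop) fun y _ => ⟨?_, ?_⟩
    · have := Real.arccos_nonneg y; positivity
    · have := Real.arccos_le_pi y
      calc l / Real.pi * Real.arccos y ≤ l / Real.pi * Real.pi := by gcongr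
        _ = l := by field_simp
  have hM0 : 0 ≤ M := hg.nonneg hl
  have hhM : ∀ x ∈ Icc 0 l, |h x| ≤ M := fun x hx => (hbd x hx).trans (by
    nlinarith [Real.abs_sin_le_one (Real.pi / l * x), abs_nonneg (Real.sin (Real.pi / l * x))])
  have hle : ∀ ε > 0, ∫ x in (0 : ℝ)..l, h x * h x ≤ M * ε * l := by
    intro ε hε
    obtain ⟨p, hp⟩ := exists_polynomial_near_of_continuousOn (-1) 1 _ hGc ε hε
    have hsplit : ∫ x in (0 : ℝ)..l, h x * h x =
        ∫ x in (0 : ℝ)..l, h x * (h x - p.eval (Real.cos (Real.pi / l * x))) := by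
      have : ∀ x, h x * (h x - p.eval (Real.cos (Real.pi / l * x))) =
          h x * h x - h x * p.eval (Real.cos (Real.pi / l * x)) := fun x => by ring
      simp_rw [this]
      rw [intervalIntegral.integral_sub, hpoly p, sub_zero]
      · refine ContinuousOn.intervalIntegrable ?_
        rw [uIcc_of_le hl.le]
        exact hcont.mul hcont
      · refine ContinuousOn.intervalIntegrable ?_
        rw [uIcc_of_le hl.le]
        exact hcont.mul (by fun_prop)
    rw [hsplit]
    refine (le_abs_self _).trans (abs_intervalIntegral_le hl fun x hx => ?_)
    rw [abs_mul]
    have h1 : Real.arccos (Real.cos (Real.pi / l * x)) = Real.pi / l * x := by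
      refine Real.arccos_cos ?_ ?_
      · have := hx.1; positivity
      · calc Real.pi / l * x ≤ Real.pi / l * l := by have := hx.2.le; gcongr
          _ = Real.pi := by field_simp
    have h2 := hp (Real.cos (Real.pi / l * x)) ⟨Real.neg_one_le_cos _, Real.cos_le_one _⟩
    have h3 : l / Real.pi * (Real.pi / l * x) = x := by field_simp
    rw [h1, h3, abs_sub_comm] at h2
    exact mul_le_mul (hhM x ⟨hx.1.le, hx.2.le⟩) h2.le (abs_nonneg _) hM0
  have hle0 : ∫ x in (0 : ℝ)..l, h x * h x ≤ 0 := by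
    refine le_of_forall_pos_le_add fun η hη => ?_
    rw [zero_add]
    refine (hle (η / (M * l + 1)) (by positivity)).trans ?_
    rw [mul_div_assoc', div_mul_eq_mul_div, div_le_iff₀ (by positivity)]
    nlinarith
  by_contra hne
  have hpos : 0 < ∫ x in (0 : ℝ)..l, h x * h x := by
    refine intervalIntegral.integral_pos hl (hcont.mul hcont) (fun _ _ => mul_self_nonneg _)
      ⟨x, Ioo_subset_Icc_self hx, mul_self_pos.2 (mul_ne_zero hne (ne_of_gt ?_))⟩
    refine Real.sin_pos_of_pos_of_lt_pi (by have := hx.1; positivity) ?_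
    calc Real.pi / l * x < Real.pi / l * l := by have := hx.2; gcongr
      _ = Real.pi := by field_simp
  linarith

/-- Expansion in a sine series with summable coefficients. -/
lemma eq_sine_series {l : ℝ} (hl : 0 < l) {f : ℝ → ℝ} (hf : ContinuousOn f (Icc 0 l))
    (hs : Summable fun n => |sinCoef l f n|) {x : ℝ} (hx : x ∈ Ioo 0 l) :
    f x = 2 / l * ∑' n, sinCoef l f n * Real.sin (wave l n * x) := by
  obtain ⟨M, hM⟩ := isCompact_Icc.exists_bound_of_continuousOn hf
  have hfm : BddMeas l M f := bddMeas_of_continuousOn (hf.mono Ioo_subset_Icc_self)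
    fun x hx => hM x (Ioo_subset_Icc_self hx)
  have hb : ∀ n x, |sinCoef l f n * Real.sin (wave l n * x)| ≤ |sinCoef l f n| := fun n x => by
    rw [abs_mul]; nlinarith [Real.abs_sin_le_one (wave l n * x), abs_nonneg (sinCoef l f n)]
  have hsm := tsum_sin_bddMeas (l := l) hs
  have hsc : Continuous fun x => ∑' n, sinCoef l f n * Real.sin (wave l n * x) := by
    rw [← continuousOn_univ]
    exact (unifSum_of_bound hs fun n x _ => hb n x).continuousOn fun n => by fun_prop
  have hsm2 : BddMeas l (2 / l * ∑' n, |sinCoef l f n|)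
      (fun x => 2 / l * ∑' n, sinCoef l f n * Real.sin (wave l n * x)) :=
    ⟨hsm.1.const_mul _, fun x hx => by
      rw [abs_mul, abs_of_pos (by positivity)]
      exact mul_le_mul_of_nonneg_left (hsm.2 x hx) (by positivity)⟩
  have := eq_zero_of_sinCoef_eq_zero hl
    (g := fun x => f x - 2 / l * ∑' n, sinCoef l f n * Real.sin (wave l n * x))
    (M := M + 2 / l * ∑' n, |sinCoef l f n|)
    ((hf.mono Ioo_subset_Icc_self).sub (continuous_const.mul hsc).continuousOn)
    (fun x hx => (abs_sub _ _).trans (add_le_add (hfm.2 x hx) (hsm2.2 x hx)))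
    (fun n => by
      rw [sinCoef_sub hl hfm hsm2, sinCoef_const_mul, sinCoef_tsum hl hs]
      field_simp; ring) hx
  linarith

lemma eq_sine_series_of_boundary {l : ℝ} (hl : 0 < l) {f : ℝ → ℝ} (hf : ContinuousOn f (Icc 0 l))
    (hs : Summable fun n => |sinCoef l f n|) (h0 : f 0 = 0) (h1 : f l = 0) {x : ℝ}
    (hx : x ∈ Icc 0 l) :
    f x = 2 / l * ∑' n, sinCoef l f n * Real.sin (wave l n * x) := by
  rcases eq_or_lt_of_le hx.1 with h | h
  · simp [← h, h0]
  rcases eq_or_lt_of_le hx.2 with h' | h'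
  · rw [h', h1]; simp [sin_wave_right hl]
  exact eq_sine_series hl hf hs ⟨h, h'⟩

/-! ### Sine coefficients of Lipschitz functions -/

/-- Integration by parts is available because a Lipschitz function is absolutely continuous; the
boundary values of f remove the boundary terms. -/
lemma wave_mul_sinCoef {l : ℝ} (hl : 0 < l) {f : ℝ → ℝ} {K : NNReal}
    (hf : LipschitzOnWith K f (Icc 0 l)) (h0 : f 0 = 0) (h1 : f l = 0) (n : ℕ) :
    wave l n * sinCoef l f n = ∫ x in (0 : ℝ)..l, deriv f x * Real.cos (wave l n * x) := by
  have hac : AbsolutelyContinuousOnInterval f 0 l := by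
    refine LipschitzOnWith.absolutelyContinuousOnInterval (K := K) ?_
    rwa [uIcc_of_le hl.le]
  have hcos : AbsolutelyContinuousOnInterval (fun x => Real.cos (wave l n * x)) 0 l :=
    ContDiffOn.absolutelyContinuousOnInterval (by fun_prop)
  have hder : ∀ x, deriv (fun x => Real.cos (wave l n * x)) x =
      -(wave l n * Real.sin (wave l n * x)) := fun x => by
    have h : HasDerivAt (fun x => Real.cos (wave l n * x))
        (-Real.sin (wave l n * x) * (wave l n * 1)) x :=
      (Real.hasDerivAt_cos _).comp x ((hasDerivAt_id x).const_mul _)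
    rw [h.deriv]; ring
  have := hac.integral_mul_deriv_eq_deriv_mul hcos
  simp_rw [hder, h0, h1] at this
  have h2 : ∫ x in (0 : ℝ)..l, f x * -(wave l n * Real.sin (wave l n * x)) =
      -(wave l n * sinCoef l f n) := by
    rw [sinCoef, ← intervalIntegral.integral_const_mul, ← intervalIntegral.integral_neg]
    exact intervalIntegral.integral_congr fun x _ => by ring
  rw [h2] at this
  linarith

lemma bddMeas_deriv {l : ℝ} {f : ℝ → ℝ} {K : NNReal} (hf : LipschitzOnWith K f (Icc 0 l)) :
    BddMeas l K (deriv f) := by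
  refine ⟨(measurable_deriv f).aestronglyMeasurable, fun x hx => ?_⟩
  exact norm_deriv_le_of_lipschitzOn (Icc_mem_nhds hx.1 hx.2) hf

/-- Up to a constant, (n+1) times the sine coefficient of f is the cosine coefficient of f', which
is square-summable by Bessel. The constant A depends only on l and q, so the bound is uniform over
families with a common Lipschitz constant. -/
lemma weighted_sinCoef_le_of_lipschitz {l : ℝ} (hl : 0 < l) {q : ℝ} (hq : q < 1 / 2) :
    ∃ A : ℝ, 0 ≤ A ∧ ∀ (f : ℝ → ℝ) (K : NNReal), LipschitzOnWith K f (Icc 0 l) → f 0 = 0 →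
      f l = 0 → ∀ N, ∑ n ∈ Finset.range N, ((n : ℝ) + 1) ^ q * |sinCoef l f n| ≤ A * K := by
  obtain ⟨A, hA, h⟩ := weighted_sum_le_of_mul_sq hq
  have hpi := Real.pi_pos
  refine ⟨A * √((l / Real.pi) ^ 2 * (l ^ 2 / 2)), by positivity, fun f K hf h0 h1 N => ?_⟩
  have hB := h (sinCoef l f) ((l / Real.pi) ^ 2 * (l ^ 2 * K ^ 2 / 2)) (fun N => ?_) N
  · refine hB.trans (le_of_eq ?_)
    rw [show (l / Real.pi) ^ 2 * (l ^ 2 * (K : ℝ) ^ 2 / 2) =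
      (l / Real.pi) ^ 2 * (l ^ 2 / 2) * (K : ℝ) ^ 2 by ring, Real.sqrt_mul (by positivity),
      Real.sqrt_sq K.coe_nonneg]
    ring
  · have hbs := bessel_of_orthogonal hl (bddMeas_deriv hf)
      (φ := fun n x => Real.cos (wave l n * x)) (fun _ => by fun_prop)
      (fun _ _ => Real.abs_cos_le_one _) (integral_cos_wave_mul hl) N
    simp_rw [← wave_mul_sinCoef hl hf h0 h1] at hbs
    refine le_trans (le_of_eq ?_) (mul_le_mul_of_nonneg_left hbs (by positivity))
    rw [Finset.mul_sum]
    refine Finset.sum_congr rfl fun n _ => ?_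
    rw [wave_eq]
    field_simp

lemma lipschitzOnWith_Icc_of_hasDerivAt {a b : ℝ} {f f' : ℝ → ℝ} {K : NNReal}
    (hf : ContinuousOn f (Icc a b)) (hd : ∀ x ∈ Ioo a b, HasDerivAt f (f' x) x)
    (hK : ∀ x ∈ Ioo a b, |f' x| ≤ K) : LipschitzOnWith K f (Icc a b) := by
  have key : ∀ x ∈ Icc a b, ∀ y ∈ Icc a b, x < y → |f y - f x| ≤ K * (y - x) := by
    intro x hx y hy hxy
    obtain ⟨c, hc, hcd⟩ := exists_hasDerivAt_eq_slope f f' hxy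
      (hf.mono (Icc_subset_Icc hx.1 hy.2)) fun z hz =>
        hd z ⟨hx.1.trans_lt hz.1, hz.2.trans_le hy.2⟩
    have h1 := hK c ⟨hx.1.trans_lt hc.1, hc.2.trans_le hy.2⟩
    have h2 : 0 < y - x := sub_pos.2 hxy
    rwa [hcd, abs_div, abs_of_pos h2, div_le_iff₀ h2] at h1
  refine LipschitzOnWith.of_dist_le_mul fun x hx y hy => ?_
  rw [Real.dist_eq, Real.dist_eq]
  rcases lt_trichotomy x y with h | h | h
  · rw [abs_sub_comm, abs_sub_comm x y, abs_of_pos (sub_pos.2 h)]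
    exact key x hx y hy h
  · simp [h]
  · rw [abs_of_pos (sub_pos.2 h)]
    exact key y hy x hx h

/-! ### Linear first order equations and convolutions -/

/-- The function e^{ks}(D(s) - Q/k) is nonincreasing for s ≥ 0; the lower bound is the same fact for
-D. -/
lemma abs_le_of_linear_ode {k Q : ℝ} (hk : 0 < k) {D q : ℝ → ℝ}
    (hD : ∀ t, HasDerivAt D (-k * D t + q t) t) (hq : ∀ t, 0 ≤ t → |q t| ≤ Q) {t : ℝ}
    (ht : 0 ≤ t) : |D t| ≤ |D 0| + Q / k := by
  have key : ∀ (D q : ℝ → ℝ), (∀ t, HasDerivAt D (-k * D t + q t) t) →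
      (∀ t, 0 ≤ t → |q t| ≤ Q) → D t ≤ |D 0| + Q / k := by
    intro D q hD hq
    have hQ : 0 ≤ Q := (abs_nonneg _).trans (hq 0 le_rfl)
    have hder : ∀ s, HasDerivAt (fun s => Real.exp (k * s) * (D s - Q / k))
        (Real.exp (k * s) * (q s - Q)) s := by
      intro s
      have h1 : HasDerivAt (fun s => Real.exp (k * s)) (Real.exp (k * s) * (k * 1)) s :=
        ((hasDerivAt_id s).const_mul k).exp
      convert! h1.mul ((hD s).sub_const (Q / k)) using 1
      field_simp; ring
    have hanti : AntitoneOn (fun s => Real.exp (k * s) * (D s - Q / k)) (Ici 0) := by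
      refine antitoneOn_of_deriv_nonpos (convex_Ici 0)
        (fun s _ => (hder s).continuousAt.continuousWithinAt)
        (fun s _ => (hder s).differentiableAt.differentiableWithinAt) fun s hs => ?_
      rw [interior_Ici] at hs
      rw [(hder s).deriv]
      have := (abs_le.1 (hq s (le_of_lt hs))).2
      exact mul_nonpos_of_nonneg_of_nonpos (Real.exp_pos _).le (by linarith)
    have h := hanti (mem_Ici.2 le_rfl) (mem_Ici.2 ht) ht
    simp only [mul_zero, Real.exp_zero, one_mul] at h
    by_contra hcon
    push Not at hcon
    have h1 : 1 ≤ Real.exp (k * t) := Real.one_le_exp (by positivity)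
    have h2 : 0 ≤ D t - Q / k := by linarith [abs_nonneg (D 0)]
    have h3 : 0 ≤ Q / k := by positivity
    nlinarith [le_abs_self (D 0)]
  refine abs_le.2 ⟨?_, key D q hD hq⟩
  have := key (fun t => -D t) (fun t => -q t) (fun t => by
    convert! (hD t).neg using 1; ring) (fun t ht => by rw [abs_neg]; exact hq t ht)
  simp only [abs_neg] at this
  linarith

/-- Variation of constants. -/
lemma variation_of_constants {k t₀ t : ℝ} (ht : t₀ ≤ t) {a ρ : ℝ → ℝ}
    (hc : ContinuousOn a (Icc t₀ t)) (hd : ∀ s ∈ Ioo t₀ t, HasDerivAt a (-k * a s + ρ s) s)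
    (hρ : IntervalIntegrable ρ volume t₀ t) :
    a t = Real.exp (-k * (t - t₀)) * a t₀ + ∫ τ in t₀..t, Real.exp (-k * (t - τ)) * ρ τ := by
  have h := intervalIntegral.integral_eq_sub_of_hasDerivAt_of_le ht
    (f := fun τ => Real.exp (-k * (t - τ)) * a τ) (f' := fun τ => Real.exp (-k * (t - τ)) * ρ τ)
    (ContinuousOn.mul (by fun_prop) hc) (fun s hs => by
      have h1 : HasDerivAt (fun τ => Real.exp (-k * (t - τ))) (Real.exp (-k * (t - s)) *
          (-k * (-1))) s := (((hasDerivAt_id s).const_sub t).const_mul (-k)).exp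
      convert! h1.mul (hd s hs) using 1
      ring)
    (hρ.continuousOn_mul (by fun_prop))
  rw [h]
  simp

lemma intervalIntegrable_of_continuousOn_Ioi {B : ℝ} {f : ℝ → ℝ} (hf : ContinuousOn f (Ioi 0))
    (hB : ∀ t, 0 < t → |f t| ≤ B) {s t : ℝ} (hs : 0 ≤ s) (ht : 0 ≤ t) :
    IntervalIntegrable f volume s t := by
  have key : ∀ t, 0 ≤ t → IntervalIntegrable f volume 0 t := by
    intro t ht
    rcases eq_or_lt_of_le ht with h | h
    · rw [← h]
    · exact (bddMeas_of_continuousOn (hf.mono fun x hx => hx.1)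
        fun x hx => hB x hx.1).intervalIntegrable h
  exact (key s hs).symm.trans (key t ht)

lemma abs_convolution_le {A B : ℝ} {G f : ℝ → ℝ} (hG : ∀ t, 0 ≤ t → |G t| ≤ A)
    (hB : ∀ t, 0 < t → |f t| ≤ B) {t : ℝ} (ht : 0 ≤ t) :
    |∫ τ in (0 : ℝ)..t, G (t - τ) * f τ| ≤ A * B * t := by
  have h := intervalIntegral.norm_integral_le_of_norm_le_const (a := 0) (b := t) (C := A * B)
    (f := fun τ => G (t - τ) * f τ) fun τ hτ => by
      rw [uIoc_of_le ht] at hτ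
      rw [Real.norm_eq_abs, abs_mul]
      exact mul_le_mul (hG _ (by linarith [hτ.2])) (hB _ hτ.1) (abs_nonneg _)
        ((abs_nonneg _).trans (hG 0 le_rfl))
  rwa [Real.norm_eq_abs, sub_zero, abs_of_nonneg ht] at h

/-- Leibniz' rule for a convolution. -/
lemma hasDerivAt_convolution {B : ℝ} {G G' f : ℝ → ℝ} (hG : ∀ t, HasDerivAt G (G' t) t)
    (hG' : Continuous G') (hf : ContinuousOn f (Ioi 0)) (hB : ∀ t, 0 < t → |f t| ≤ B)
    {t₀ : ℝ} (ht₀ : 0 < t₀) :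
    HasDerivAt (fun t => ∫ τ in (0 : ℝ)..t, G (t - τ) * f τ)
      (G 0 * f t₀ + ∫ τ in (0 : ℝ)..t₀, G' (t₀ - τ) * f τ) t₀ := by
  have hGc : Continuous G := continuous_iff_continuousAt.2 fun t => (hG t).continuousAt
  have hint : ∀ s t u, 0 ≤ s → 0 ≤ t →
      IntervalIntegrable (fun τ => G (u - τ) * f τ) volume s t := fun s t u hs ht =>
    (intervalIntegrable_of_continuousOn_Ioi hf hB hs ht).continuousOn_mul (by fun_prop)
  have hfm : AEStronglyMeasurable f (volume.restrict (uIoc 0 t₀)) :=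
    (intervalIntegrable_of_continuousOn_Ioi hf hB le_rfl ht₀.le).def'.aestronglyMeasurable
  -- The integral over [0, t] is split at t₀. The part with the fixed endpoint is differentiated
  -- under the integral sign; the part over [t₀, t] contributes G(0) f(t₀) by continuity of the
  -- integrand at the diagonal point.
  have h1 : HasDerivAt (fun t => ∫ τ in (0 : ℝ)..t₀, G (t - τ) * f τ)
      (∫ τ in (0 : ℝ)..t₀, G' (t₀ - τ) * f τ) t₀ := by
    obtain ⟨C, hC⟩ := (isCompact_Icc (a := -1) (b := t₀ + 1)).exists_bound_of_continuousOn
      hG'.continuousOn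
    refine (intervalIntegral.hasDerivAt_integral_of_dominated_loc_of_deriv_le
      (F := fun t τ => G (t - τ) * f τ) (F' := fun t τ => G' (t - τ) * f τ)
      (bound := fun _ => C * B) (s := Icc (t₀ - 1) (t₀ + 1))
      (Icc_mem_nhds (by linarith) (by linarith)) ?_ (hint _ _ _ le_rfl ht₀.le) ?_ ?_ (by simp)
      ?_).2
    · exact Eventually.of_forall fun t =>
        (Continuous.aestronglyMeasurable (by fun_prop)).mul hfm
    · exact (Continuous.aestronglyMeasurable (by fun_prop)).mul hfm
    · refine Eventually.of_forall fun τ hτ t ht => ?_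
      rw [uIoc_of_le ht₀.le] at hτ
      rw [norm_mul]
      have h2 := hC (t - τ) ⟨by linarith [hτ.2, ht.1], by linarith [hτ.1, ht.2]⟩
      exact mul_le_mul h2 (hB τ hτ.1) (abs_nonneg _) ((norm_nonneg _).trans h2)
    · refine Eventually.of_forall fun τ _ t _ => ?_
      have h2 : HasDerivAt (fun t => G (t - τ)) (G' (t - τ) * 1) t :=
        (hG (t - τ)).comp t ((hasDerivAt_id t).sub_const τ)
      simpa using h2.mul_const (f τ)
  have h2 : HasDerivAt (fun t => ∫ τ in t₀..t, G (t - τ) * f τ) (G 0 * f t₀) t₀ := by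
    rw [hasDerivAt_iff_isLittleO, Asymptotics.isLittleO_iff]
    intro c hc
    have hca : ContinuousAt (fun p : ℝ × ℝ => G (p.1 - p.2) * f p.2) (t₀, t₀) := by
      have hfa : ContinuousAt f t₀ := hf.continuousAt (Ioi_mem_nhds ht₀)
      have : ContinuousAt (fun p : ℝ × ℝ => f p.2) (t₀, t₀) :=
        ContinuousAt.comp (f := Prod.snd) (x := (t₀, t₀)) hfa continuousAt_snd
      exact ContinuousAt.mul (by fun_prop) this
    obtain ⟨δ, hδ, hball⟩ := Metric.continuousAt_iff.1 hca c hc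
    filter_upwards [Metric.ball_mem_nhds t₀ (lt_min hδ ht₀)] with t ht
    rw [Metric.mem_ball, Real.dist_eq, lt_min_iff] at ht
    have ht0 : 0 ≤ t := by linarith [(abs_lt.1 ht.2).1]
    have h3 : ∫ τ in t₀..t, G (t - τ) * f τ - G 0 * f t₀ =
        (∫ τ in t₀..t, G (t - τ) * f τ) - (t - t₀) * (G 0 * f t₀) := by
      rw [intervalIntegral.integral_sub (hint _ _ _ ht₀.le ht0) (by simp),
        intervalIntegral.integral_const, smul_eq_mul]
    rw [intervalIntegral.integral_same, sub_zero, smul_eq_mul, ← h3]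
    refine intervalIntegral.norm_integral_le_of_norm_le_const fun τ hτ => ?_
    have h4 : |τ - t₀| ≤ |t - t₀| := by
      rcases le_total t₀ t with h | h
      · rw [uIoc_of_le h] at hτ
        rw [abs_of_nonneg (by linarith [hτ.1]), abs_of_nonneg (by linarith)]
        linarith [hτ.2]
      · rw [uIoc_of_ge h] at hτ
        rw [abs_of_nonpos (by linarith [hτ.2]), abs_of_nonpos (by linarith)]
        linarith [hτ.1]
    have h5 := hball (x := (t, τ)) (by
      rw [Prod.dist_eq, Real.dist_eq, Real.dist_eq]
      exact max_lt ht.1 (h4.trans_lt ht.1))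
    rw [Real.dist_eq] at h5
    simpa using h5.le
  have h3 := (h1.fun_add h2).congr_deriv (add_comm _ _)
  refine h3.congr_of_eventuallyEq ?_
  filter_upwards [Ioi_mem_nhds ht₀] with t ht
  exact (intervalIntegral.integral_add_adjacent_intervals (hint _ _ _ le_rfl ht₀.le)
    (hint _ _ _ ht₀.le (le_of_lt ht))).symm

/-! ### The modes of the Green function -/

/-- All three branches solve s'' = d s with s(0) = 0 and s'(0) = 1. Afterwards only this
characterization is used, so the overdamped, critical and oscillatory regimes need no separate
treatment. -/
lemma exists_sinh_like (d : ℝ) :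
    ∃ s' : ℝ → ℝ,
      (∀ t, HasDerivAt (fun t => if 0 < d then Real.sinh (√d * t) / √d
        else if d < 0 then Real.sin (√(-d) * t) / √(-d) else t) (s' t) t) ∧
      (∀ t, HasDerivAt s' (d * (if 0 < d then Real.sinh (√d * t) / √d
        else if d < 0 then Real.sin (√(-d) * t) / √(-d) else t)) t) ∧ s' 0 = 1 := by
  rcases lt_trichotomy d 0 with h | h | h
  · have h' : ¬ 0 < d := by linarith
    have hs : √(-d) ≠ 0 := (Real.sqrt_pos.2 (by linarith)).ne'
    simp only [h, h', if_true, if_false]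
    refine ⟨fun t => Real.cos (√(-d) * t), fun t => ?_, fun t => ?_, by simp⟩
    · have h1 : HasDerivAt (fun t => Real.sin (√(-d) * t)) (Real.cos (√(-d) * t) * (√(-d) * 1)) t :=
        ((hasDerivAt_id t).const_mul _).sin
      convert! h1.div_const (√(-d)) using 1
      field_simp
    · have h1 : HasDerivAt (fun t => Real.cos (√(-d) * t))
          (-Real.sin (√(-d) * t) * (√(-d) * 1)) t := ((hasDerivAt_id t).const_mul _).cos
      convert! h1 using 1
      have : √(-d) * √(-d) = -d := Real.mul_self_sqrt (by linarith)
      field_simp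
      linear_combination Real.sin (√(-d) * t) * this
  · subst h
    simp only [lt_irrefl, if_false, zero_mul]
    exact ⟨fun _ => 1, fun t => hasDerivAt_id' t, fun t => hasDerivAt_const _ _, rfl⟩
  · have hs : √d ≠ 0 := (Real.sqrt_pos.2 h).ne'
    simp only [h, if_true]
    refine ⟨fun t => Real.cosh (√d * t), fun t => ?_, fun t => ?_, by simp⟩
    · have h1 : HasDerivAt (fun t => Real.sinh (√d * t)) (Real.cosh (√d * t) * (√d * 1)) t :=
        ((hasDerivAt_id t).const_mul _).sinh
      convert! h1.div_const (√d) using 1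
      field_simp
    · have h1 : HasDerivAt (fun t => Real.cosh (√d * t)) (Real.sinh (√d * t) * (√d * 1)) t :=
        ((hasDerivAt_id t).const_mul _).cosh
      convert! h1 using 1
      have : √d * √d = d := Real.mul_self_sqrt h.le
      field_simp
      linear_combination (-Real.sinh (√d * t)) * this

section Modes

variable (l α ε lam : ℝ)

/-- The coefficient `b_{n+1}`. -/
noncomputable def bC (n : ℕ) : ℝ := bCoef l lam (n + 1)

/-- The Green mode `G_{n+1}`. -/
noncomputable def gm (n : ℕ) : ℝ → ℝ := greenMode l α ε lam (n + 1)

/-- The derivative of the Green mode `G_{n+1}`. -/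
noncomputable def gm' (n : ℕ) : ℝ → ℝ := deriv (gm l α ε lam n)

/-- The mode `G_{n+1}' + 2 g_{n+1} G_{n+1}` of the initial value. -/
noncomputable def km (n : ℕ) (t : ℝ) : ℝ :=
  gm' l α ε lam n t + (α + ε * bC l lam n) * gm l α ε lam n t

lemma bC_eq (n : ℕ) : bC l lam n = wave l n ^ 2 + lam ^ 2 / 4 := rfl

/-- As 2g = α + εb, the factor e^{-gt} turns s'' = (g² - b)s into the damped oscillator equation
with initial value 0 and initial velocity 1. -/
lemma exists_gm_deriv (n : ℕ) : ∃ G' : ℝ → ℝ, (∀ t, HasDerivAt (gm l α ε lam n) (G' t) t) ∧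
    (∀ t, HasDerivAt G' (-(α + ε * bC l lam n) * G' t - bC l lam n * gm l α ε lam n t) t) ∧
    G' 0 = 1 := by
  set b := bC l lam n with hb
  set g := gCoef l α ε lam (n + 1) with hg
  have hgb : α + ε * b = 2 * g := by rw [hg, gCoef, hb, bC]; ring
  obtain ⟨s', h1, h2, h3⟩ := exists_sinh_like (g ^ 2 - b)
  set s : ℝ → ℝ := fun t => if 0 < g ^ 2 - b then Real.sinh (√(g ^ 2 - b) * t) / √(g ^ 2 - b)
        else if g ^ 2 - b < 0 then Real.sin (√(-(g ^ 2 - b)) * t) / √(-(g ^ 2 - b)) else t with hs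
  have hG : ∀ t, gm l α ε lam n t = Real.exp (-g * t) * s t := by
    intro t
    simp only [gm, greenMode, hs, sub_pos, sub_neg, neg_sub]
    rfl
  have hs0 : s 0 = 0 := by simp [hs]
  have he : ∀ t, HasDerivAt (fun t => Real.exp (-g * t)) (Real.exp (-g * t) * (-g * 1)) t :=
    fun t => ((hasDerivAt_id t).const_mul _).exp
  refine ⟨fun t => Real.exp (-g * t) * (s' t - g * s t), fun t => ?_, fun t => ?_, ?_⟩
  · rw [show gm l α ε lam n = fun t => Real.exp (-g * t) * s t from funext hG]
    convert! (he t).mul (h1 t) using 1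
    ring
  · convert! (he t).mul ((h2 t).fun_sub ((h1 t).const_mul g)) using 1
    rw [hG, hgb]
    change _ = _ + Real.exp (-g * t) * ((g ^ 2 - b) * s t - _)
    ring
  · simp [hs0, h3]

lemma hasDerivAt_gm (n : ℕ) (t : ℝ) : HasDerivAt (gm l α ε lam n) (gm' l α ε lam n t) t := by
  obtain ⟨G', h, -⟩ := exists_gm_deriv l α ε lam n
  rw [gm', (h t).deriv]; exact h t

lemma hasDerivAt_gm' (n : ℕ) (t : ℝ) : HasDerivAt (gm' l α ε lam n)
    (-(α + ε * bC l lam n) * gm' l α ε lam n t - bC l lam n * gm l α ε lam n t) t := by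
  obtain ⟨G', h, h2, -⟩ := exists_gm_deriv l α ε lam n
  rw [show gm' l α ε lam n = G' from funext fun t => (h t).deriv]
  exact h2 t

lemma gm_zero (n : ℕ) : gm l α ε lam n 0 = 0 := by
  simp [gm, greenMode]

lemma gm'_zero (n : ℕ) : gm' l α ε lam n 0 = 1 := by
  obtain ⟨G', h, -, h3⟩ := exists_gm_deriv l α ε lam n
  rw [gm', (h 0).deriv, h3]

lemma continuous_gm (n : ℕ) : Continuous (gm l α ε lam n) :=
  continuous_iff_continuousAt.2 fun t => (hasDerivAt_gm l α ε lam n t).continuousAt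

lemma continuous_gm' (n : ℕ) : Continuous (gm' l α ε lam n) :=
  continuous_iff_continuousAt.2 fun t => (hasDerivAt_gm' l α ε lam n t).continuousAt

lemma hasDerivAt_km (n : ℕ) (t : ℝ) :
    HasDerivAt (km l α ε lam n) (-bC l lam n * gm l α ε lam n t) t := by
  convert! (hasDerivAt_gm' l α ε lam n t).add
    ((hasDerivAt_gm l α ε lam n t).const_mul (α + ε * bC l lam n)) using 1
  ring

lemma continuous_km (n : ℕ) : Continuous (km l α ε lam n) :=
  continuous_iff_continuousAt.2 fun t => (hasDerivAt_km l α ε lam n t).continuousAt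

lemma km_zero (n : ℕ) : km l α ε lam n 0 = 1 := by
  simp [km, gm_zero, gm'_zero]

lemma bC_pos (hlam : 0 < lam) (n : ℕ) : 0 < bC l lam n := by
  rw [bC_eq]; positivity

lemma le_bC (n : ℕ) : (Real.pi / l) ^ 2 * ((n : ℝ) + 1) ^ 2 ≤ bC l lam n := by
  rw [bC_eq, wave_eq]
  nlinarith [sq_nonneg lam]

/-- The energy has derivative -2(α + εb)G'² ≤ 0 and starts from 1. This gives first bounds uniform
in n, which the decay estimates then refine. -/
lemma gm_energy (hα : 0 < α) (hε : 0 < ε) (hlam : 0 < lam) (n : ℕ) {t : ℝ} (ht : 0 ≤ t) :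
    gm' l α ε lam n t ^ 2 + bC l lam n * gm l α ε lam n t ^ 2 ≤ 1 := by
  have hder : ∀ s, HasDerivAt
      (fun s => gm' l α ε lam n s ^ 2 + bC l lam n * gm l α ε lam n s ^ 2)
      (-(2 * (α + ε * bC l lam n) * gm' l α ε lam n s ^ 2)) s := by
    intro s
    convert! ((hasDerivAt_gm' l α ε lam n s).pow 2).add
      (((hasDerivAt_gm l α ε lam n s).pow 2).const_mul (bC l lam n)) using 1
    push_cast; ring
  have hb := bC_pos l lam hlam n
  have hanti : Antitone fun s => gm' l α ε lam n s ^ 2 + bC l lam n * gm l α ε lam n s ^ 2 := by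
    refine antitone_of_deriv_nonpos (fun s => (hder s).differentiableAt) fun s => ?_
    rw [(hder s).deriv, neg_nonpos]
    positivity
  have := hanti ht
  simpa [gm_zero, gm'_zero] using this

lemma abs_gm'_le_one (hα : 0 < α) (hε : 0 < ε) (hlam : 0 < lam) (n : ℕ) {t : ℝ} (ht : 0 ≤ t) :
    |gm' l α ε lam n t| ≤ 1 := by
  rw [← sq_le_one_iff_abs_le_one]
  nlinarith [gm_energy l α ε lam hα hε hlam n ht, bC_pos l lam hlam n,
    sq_nonneg (gm l α ε lam n t), mul_nonneg (bC_pos l lam hlam n).le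
      (sq_nonneg (gm l α ε lam n t))]

lemma abs_gm_le (hα : 0 < α) (hε : 0 < ε) (hlam : 0 < lam) (n : ℕ) {t : ℝ} (ht : 0 ≤ t) :
    |gm l α ε lam n t| ≤ 2 / lam := by
  refine abs_le_of_sq_le_sq ?_ (by positivity)
  have h1 := gm_energy l α ε lam hα hε hlam n ht
  have h2 : lam ^ 2 / 4 * gm l α ε lam n t ^ 2 ≤ 1 := by
    have : lam ^ 2 / 4 ≤ bC l lam n := by rw [bC_eq]; nlinarith [sq_nonneg (wave l n)]
    nlinarith [mul_le_mul_of_nonneg_right this (sq_nonneg (gm l α ε lam n t)),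
      sq_nonneg (gm' l α ε lam n t)]
  rw [div_pow, le_div_iff₀ (by positivity)]
  linarith

/-- Uniform bounds for the Green modes. -/
lemma exists_gm_bounds (hα : 0 < α) (hε : 0 < ε) (hlam : 0 < lam) :
    ∃ C : ℝ, 0 < C ∧ ∀ n : ℕ, ∀ t, 0 ≤ t →
      bC l lam n * |gm l α ε lam n t| ≤ C ∧
      bC l lam n * |gm' l α ε lam n t - Real.exp (-(ε * bC l lam n) * t)| ≤ C ∧
      |km l α ε lam n t| ≤ C := by
  set c := 1 / ε - α with hc
  set Z := ε + 2 / lam with hZ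
  have hZ0 : 0 < Z := by positivity
  set C₀ := |c| * (Z + 2 / lam) with hC₀
  have hC₀0 : 0 ≤ C₀ := by positivity
  set C₁ := 1 / ε + ε * (C₀ / ε ^ 2 + Z / ε ^ 3) + Z / ε ^ 2 with hC₁
  have hC₁0 : 0 ≤ C₁ := by positivity
  set C₂ := (C₀ / ε + C₁) / ε with hC₂
  have hC₂0 : 0 ≤ C₂ := by positivity
  refine ⟨C₁ + C₂ + (1 + α * (2 / lam) + ε * C₁), by positivity, fun n t ht => ?_⟩
  set b := bC l lam n with hb
  have hb0 : 0 < b := bC_pos l lam hlam n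
  set G := gm l α ε lam n
  set G' := gm' l α ε lam n
  have hG1 : ∀ t, HasDerivAt G (G' t) t := hasDerivAt_gm l α ε lam n
  have hG2 : ∀ t, HasDerivAt G' (-(α + ε * b) * G' t - b * G t) t := hasDerivAt_gm' l α ε lam n
  have hGb : ∀ t, 0 ≤ t → |G t| ≤ 2 / lam := fun t ht => abs_gm_le l α ε lam hα hε hlam n ht
  have hG'b : ∀ t, 0 ≤ t → |G' t| ≤ 1 := fun t ht => abs_gm'_le_one l α ε lam hα hε hlam n ht
  have hζb : ∀ t, 0 ≤ t → |ε * G' t + G t| ≤ Z := fun t ht => by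
    refine (abs_add_le _ _).trans ?_
    rw [abs_mul, abs_of_pos hε]
    nlinarith [hGb t ht, hG'b t ht]
  -- The combination εG' + G isolates the fast direction: it obeys a first order equation with rate
  -- εb, and the remainder c(εG') has already been bounded uniformly in n.
  have hζ : ∀ t, HasDerivAt (fun t => ε * G' t + G t)
      (-(ε * b) * (ε * G' t + G t) + c * (ε * G' t)) t := fun t => by
    convert! ((hG2 t).const_mul ε).add (hG1 t) using 1
    rw [hc]; field_simp; ring
  have hq : ∀ t, 0 ≤ t → |c * (ε * G' t)| ≤ C₀ := fun t ht => by
    rw [abs_mul, hC₀]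
    refine mul_le_mul_of_nonneg_left ?_ (abs_nonneg _)
    have := hζb t ht
    have h2 := hGb t ht
    calc |ε * G' t| = |(ε * G' t + G t) - G t| := by ring_nf
      _ ≤ _ := (abs_sub _ _).trans (add_le_add this h2)
  have he : ∀ t, HasDerivAt (fun t => Real.exp (-(ε * b) * t))
      (Real.exp (-(ε * b) * t) * (-(ε * b) * 1)) t :=
    fun t => ((hasDerivAt_id t).const_mul _).exp
  -- Both εG' + G and εe^{-εbt} start from ε, so their difference starts from 0 and stays below
  -- C₀/(εb).
  have hD := abs_le_of_linear_ode (k := ε * b) (Q := C₀) (by positivity)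
    (D := fun t => ε * G' t + G t - ε * Real.exp (-(ε * b) * t)) (q := fun t => c * (ε * G' t))
    (fun t => by
      convert! (hζ t).sub ((he t).const_mul ε) using 1
      ring) hq ht
  have hG0 : G 0 = 0 := gm_zero l α ε lam n
  have hG'0 : G' 0 = 1 := gm'_zero l α ε lam n
  simp only [hG0, hG'0, mul_zero, Real.exp_zero, mul_one, add_zero, sub_self, abs_zero,
    zero_add] at hD
  -- In the derivative of G + β(εG' + G) this β cancels the term (εG' + G)/ε of G' against the fast
  -- decay. What remains decays at the slow rate 1/ε with a forcing of size 1/b, whence b|G| ≤ C₁.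
  set β := 1 / (ε ^ 2 * b) with hβ
  have hE := abs_le_of_linear_ode (k := 1 / ε) (Q := (C₀ / ε ^ 2 + Z / ε ^ 3) / b) (by positivity)
    (D := fun t => G t + β * (ε * G' t + G t))
    (q := fun t => β * (ε * G' t + G t) / ε + β * (c * (ε * G' t)))
    (fun t => by
      convert! (hG1 t).add ((hζ t).const_mul β) using 1
      rw [hβ]; field_simp; ring)
    (fun t ht => by
      refine (abs_add_le _ _).trans ?_
      rw [abs_div, abs_mul β, abs_mul β, abs_of_pos hε, abs_of_pos (show 0 < β by positivity)]
      calc β * |ε * G' t + G t| / ε + β * |c * (ε * G' t)| ≤ β * Z / ε + β * C₀ := by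
            gcongr
            · exact hζb t ht
            · exact hq t ht
        _ = _ := by rw [hβ]; field_simp; ring) ht
  simp only [hG0, hG'0, mul_one, add_zero, zero_add] at hE
  have hGC : b * |G t| ≤ C₁ := by
    have h1 : |G t| ≤ |G t + β * (ε * G' t + G t)| + β * Z := by
      calc |G t| = |(G t + β * (ε * G' t + G t)) - β * (ε * G' t + G t)| := by ring_nf
        _ ≤ |G t + β * (ε * G' t + G t)| + |β * (ε * G' t + G t)| := abs_sub _ _
        _ ≤ _ := by
          rw [abs_mul β, abs_of_pos (show 0 < β by positivity)]
          gcongr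
          exact hζb t ht
    rw [abs_of_pos (show 0 < β * ε by positivity)] at hE
    calc b * |G t| ≤ b * ((β * ε + (C₀ / ε ^ 2 + Z / ε ^ 3) / b / (1 / ε)) + β * Z) := by
          gcongr; linarith
      _ = C₁ := by rw [hβ, hC₁]; field_simp
  refine ⟨by nlinarith [mul_nonneg hε.le hC₁0, show 0 ≤ α * (2 / lam) by positivity], ?_, ?_⟩
  · have h1 : G' t - Real.exp (-(ε * b) * t) =
        ((ε * G' t + G t - ε * Real.exp (-(ε * b) * t)) - G t) / ε := by field_simp; ring
    have h2 : b * |G' t - Real.exp (-(ε * b) * t)| ≤ C₂ := by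
      rw [h1, abs_div, abs_of_pos hε]
      calc b * (|ε * G' t + G t - ε * Real.exp (-(ε * b) * t) - G t| / ε)
          ≤ b * ((C₀ / (ε * b) + |G t|) / ε) := by
            gcongr
            exact (abs_sub _ _).trans (by gcongr)
        _ = (C₀ / ε + b * |G t|) / ε := by field_simp
        _ ≤ _ := by rw [hC₂]; gcongr
    nlinarith [mul_nonneg hε.le hC₁0, show 0 ≤ α * (2 / lam) by positivity]
  · have h1 : |km l α ε lam n t| ≤ 1 + α * (2 / lam) + ε * C₁ := by
      have : km l α ε lam n t = G' t + α * G t + ε * (b * G t) := by rw [km]; ring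
      rw [this]
      refine (abs_add_le _ _).trans (add_le_add ((abs_add_le _ _).trans (add_le_add
        (hG'b t ht) ?_)) ?_)
      · rw [abs_mul, abs_of_pos hα]; gcongr; exact hGb t ht
      · rw [abs_mul, abs_mul, abs_of_pos hε, abs_of_pos hb0]; gcongr
    linarith

end Modes

/-! ### Elementary bounds -/

lemma summable_one_div_add_one_sq : Summable fun n : ℕ => 1 / ((n : ℝ) + 1) ^ 2 := by
  have := (summable_nat_add_iff 1).2 (Real.summable_one_div_nat_pow.2 one_lt_two)
  simpa using this

lemma exp_neg_le_one_div {y : ℝ} (hy : 0 < y) : Real.exp (-y) ≤ 1 / y := by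
  rw [Real.exp_neg, ← one_div]
  exact one_div_le_one_div_of_le hy (by linarith [Real.add_one_le_exp y])

lemma exp_neg_le_rpow {θ y : ℝ} (hθ : 0 ≤ θ) (hθ1 : θ ≤ 1) (hy : 0 < y) :
    Real.exp (-y) ≤ y ^ (-θ) := by
  rw [Real.exp_neg, Real.rpow_neg hy.le]
  refine inv_anti₀ (by positivity) ?_
  rcases le_total y 1 with h | h
  · exact (Real.rpow_le_one hy.le h hθ).trans (Real.one_le_exp hy.le)
  · calc y ^ θ ≤ y ^ (1 : ℝ) := Real.rpow_le_rpow_of_exponent_le h hθ1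
      _ = y := Real.rpow_one y
      _ ≤ Real.exp y := by linarith [Real.add_one_le_exp y]

lemma exp_bC_le {l ε lam : ℝ} (hl : 0 < l) (hε : 0 < ε) {δ : ℝ} (hδ : 0 < δ) (n : ℕ) {t : ℝ}
    (ht : δ ≤ t) : Real.exp (-(ε * bC l lam n) * t) ≤
      1 / (ε * (Real.pi / l) ^ 2 * δ) * (1 / ((n : ℝ) + 1) ^ 2) := by
  have hpi := Real.pi_pos
  have h1 := le_bC l lam n
  have hb : 0 ≤ bC l lam n := le_trans (by positivity) h1
  have h2 : ε * (Real.pi / l) ^ 2 * δ * ((n : ℝ) + 1) ^ 2 ≤ ε * bC l lam n * t := by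
    calc ε * (Real.pi / l) ^ 2 * δ * ((n : ℝ) + 1) ^ 2
        = ε * ((Real.pi / l) ^ 2 * ((n : ℝ) + 1) ^ 2) * δ := by ring
      _ ≤ ε * bC l lam n * t := by gcongr
  rw [neg_mul]
  calc Real.exp (-(ε * bC l lam n * t)) ≤
        Real.exp (-(ε * (Real.pi / l) ^ 2 * δ * ((n : ℝ) + 1) ^ 2)) :=
        Real.exp_le_exp.2 (neg_le_neg h2)
    _ ≤ 1 / (ε * (Real.pi / l) ^ 2 * δ * ((n : ℝ) + 1) ^ 2) := exp_neg_le_one_div (by positivity)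
    _ = _ := by field_simp

lemma continuousOn_of_local {X : Type*} [TopologicalSpace X] {f : X → ℝ} {s : Set X}
    (h : ∀ x ∈ s, ∃ t : Set X, ContinuousOn f t ∧ x ∈ t ∧ t ∈ 𝓝[s] x) : ContinuousOn f s := by
  intro x hx
  obtain ⟨t, ht, hxt, hn⟩ := h x hx
  exact (ht x hxt).mono_of_mem_nhdsWithin hn

/-! ### The heat flow of the sawtooth function -/

/-- Abel summation. The induction is run with the boundary term a_M ∑ d_k subtracted, because then
the bound (a_0 - a_M)B telescopes. -/
lemma abs_sum_mul_le_of_antitone {a d : ℕ → ℝ} {B : ℝ} (ha : Antitone a) (h0 : ∀ n, 0 ≤ a n)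
    (hB : ∀ m, |∑ k ∈ Finset.range m, d k| ≤ B) (M : ℕ) :
    |∑ k ∈ Finset.range M, a k * d k| ≤ a 0 * B := by
  have key : |∑ k ∈ Finset.range M, a k * d k - a M * ∑ k ∈ Finset.range M, d k| ≤
      (a 0 - a M) * B := by
    induction M with
    | zero => simp
    | succ M ih =>
      have h1 : ∑ k ∈ Finset.range (M + 1), a k * d k -
          a (M + 1) * ∑ k ∈ Finset.range (M + 1), d k =
          (∑ k ∈ Finset.range M, a k * d k - a M * ∑ k ∈ Finset.range M, d k) +
          (a M - a (M + 1)) * ∑ k ∈ Finset.range (M + 1), d k := by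
        rw [Finset.sum_range_succ, Finset.sum_range_succ]; ring
      have h2 : 0 ≤ a M - a (M + 1) := sub_nonneg.2 (ha (Nat.le_succ M))
      rw [h1]
      refine (abs_add_le _ _).trans ?_
      rw [abs_mul, abs_of_nonneg h2]
      nlinarith [mul_le_mul_of_nonneg_left (hB (M + 1)) h2]
  have h1 : |a M * ∑ k ∈ Finset.range M, d k| ≤ a M * B := by
    rw [abs_mul, abs_of_nonneg (h0 M)]
    exact mul_le_mul_of_nonneg_left (hB M) (h0 M)
  calc |∑ k ∈ Finset.range M, a k * d k|
      = |(∑ k ∈ Finset.range M, a k * d k - a M * ∑ k ∈ Finset.range M, d k) +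
          a M * ∑ k ∈ Finset.range M, d k| := by ring_nf
    _ ≤ (a 0 - a M) * B + a M * B := (abs_add_le _ _).trans (add_le_add key h1)
    _ = a 0 * B := by ring

/-- Multiplied by 2 sin(θ/2) the sum telescopes to a difference of two cosines, and sin(θ/2) ≥ x/l
by Jordan's inequality. The bound does not depend on the starting index N. -/
lemma abs_sum_sin_le {l x : ℝ} (hl : 0 < l) (hx : 0 < x) (hxl : x ≤ l) (N m : ℕ) :
    |∑ k ∈ Finset.range m, Real.sin (wave l (N + k) * x)| ≤ l / x := by
  have hpi := Real.pi_pos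
  set θ := Real.pi / l * x with hθ
  have hθ0 : 0 < θ := by positivity
  have hθ1 : θ ≤ Real.pi := by
    calc θ ≤ Real.pi / l * l := by rw [hθ]; gcongr
      _ = Real.pi := by field_simp
  have hs : x / l ≤ Real.sin (θ / 2) := by
    have := Real.mul_le_sin (x := θ / 2) (by linarith) (by linarith)
    refine le_trans (le_of_eq ?_) this
    rw [hθ]; field_simp
  have hs0 : 0 < Real.sin (θ / 2) := lt_of_lt_of_le (by positivity) hs
  have htel : 2 * Real.sin (θ / 2) * ∑ k ∈ Finset.range m, Real.sin (wave l (N + k) * x) =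
      Real.cos ((N + 1 / 2) * θ) - Real.cos ((N + m + 1 / 2) * θ) := by
    induction m with
    | zero => simp
    | succ m ih =>
      rw [Finset.sum_range_succ, mul_add, ih]
      have h1 : wave l (N + m) * x = (N + m + 1) * θ := by
        rw [wave_eq, hθ]; push_cast; ring
      rw [h1]
      have h2 : Real.cos ((N + m + 1 / 2) * θ) = Real.cos ((N + m + 1) * θ - θ / 2) := by ring_nf
      have h3 : Real.cos ((N + (m + 1 : ℕ) + 1 / 2) * θ) = Real.cos ((N + m + 1) * θ + θ / 2) := by
        push_cast; ring_nf
      rw [h2, h3, Real.cos_sub, Real.cos_add]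
      ring
  have h2 : 2 * Real.sin (θ / 2) * |∑ k ∈ Finset.range m, Real.sin (wave l (N + k) * x)| ≤ 2 := by
    rw [← abs_of_pos (show 0 < 2 * Real.sin (θ / 2) by positivity), ← abs_mul, htel]
    refine (abs_sub _ _).trans ?_
    linarith [Real.abs_cos_le_one ((N + 1 / 2) * θ), Real.abs_cos_le_one ((N + m + 1 / 2) * θ)]
  rw [le_div_iff₀ hx]
  have h3 := mul_le_mul_of_nonneg_right hs
    (abs_nonneg (∑ k ∈ Finset.range m, Real.sin (wave l (N + k) * x)))
  have h4 : x / l * |∑ k ∈ Finset.range m, Real.sin (wave l (N + k) * x)| ≤ 1 := by linarith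
  rw [div_mul_eq_mul_div, div_le_one hl] at h4
  linarith

section Saw

variable (l ε lam : ℝ)

/-- The coefficients of the heat flow of the sawtooth function. -/
noncomputable def sawCoef (n : ℕ) (t : ℝ) : ℝ := Real.exp (-(ε * bC l lam n) * t) / (n + 1)

/-- The partial sums of the heat flow of the sawtooth function. -/
noncomputable def sawPart (N : ℕ) (x t : ℝ) : ℝ :=
  ∑ n ∈ Finset.range N, sawCoef l ε lam n t * Real.sin (wave l n * x)

/-- The heat flow of the sawtooth function `π/2 (1 - x/l)`. -/
noncomputable def saw (x t : ℝ) : ℝ := limUnder atTop fun N => sawPart l ε lam N x t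

variable {l ε lam}

lemma sawCoef_antitone (hl : 0 < l) (hε : 0 < ε) {t : ℝ} (ht : 0 ≤ t) :
    Antitone fun n => sawCoef l ε lam n t := by
  refine antitone_nat_of_succ_le fun n => ?_
  have hpi := Real.pi_pos
  have hb : bC l lam n ≤ bC l lam (n + 1) := by
    rw [bC_eq, bC_eq, wave_eq, wave_eq]; push_cast; gcongr; linarith
  simp only [sawCoef]
  refine div_le_div₀ (Real.exp_pos _).le (Real.exp_le_exp.2 ?_) (by positivity)
    (by push_cast; linarith)
  have := mul_le_mul_of_nonneg_right (mul_le_mul_of_nonneg_left hb hε.le) ht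
  linarith

lemma sawCoef_nonneg (n : ℕ) (t : ℝ) : 0 ≤ sawCoef l ε lam n t := by
  unfold sawCoef; positivity

lemma sawCoef_le (hε : 0 < ε) (hlam : 0 < lam) (n : ℕ) {t : ℝ} (ht : 0 ≤ t) :
    sawCoef l ε lam n t ≤ 1 / (n + 1) := by
  unfold sawCoef
  gcongr
  rw [Real.exp_le_one_iff]
  have := bC_pos l lam hlam n
  have : 0 ≤ ε * bC l lam n * t := by positivity
  linarith

lemma abs_sawPart_sub_le (hl : 0 < l) (hε : 0 < ε) (hlam : 0 < lam) {x t : ℝ} (hx : 0 < x)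
    (hxl : x ≤ l) (ht : 0 ≤ t) {N M : ℕ} (hNM : N ≤ M) :
    |sawPart l ε lam M x t - sawPart l ε lam N x t| ≤ l / x / (N + 1) := by
  obtain ⟨m, rfl⟩ := Nat.exists_eq_add_of_le hNM
  have h1 : sawPart l ε lam (N + m) x t - sawPart l ε lam N x t =
      ∑ k ∈ Finset.range m, sawCoef l ε lam (N + k) t * Real.sin (wave l (N + k) * x) := by
    rw [sawPart, sawPart, Finset.sum_range_add]; ring
  rw [h1]
  have h2 := abs_sum_mul_le_of_antitone (a := fun k => sawCoef l ε lam (N + k) t)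
    (d := fun k => Real.sin (wave l (N + k) * x))
    (fun i j hij => sawCoef_antitone hl hε ht (Nat.add_le_add_left hij N))
    (fun n => sawCoef_nonneg _ _) (abs_sum_sin_le hl hx hxl N) m
  refine h2.trans ?_
  rw [div_eq_mul_one_div (l / x), mul_comm]
  have := sawCoef_le (l := l) hε hlam N ht
  have h3 : 0 ≤ l / x := by positivity
  exact mul_le_mul_of_nonneg_left (by simpa using this) h3

/-- For indices up to l/x each term is at most πx/l because |sin(γx)| ≤ γx; beyond l/x Abel
summation bounds the rest by 1. The resulting bound is uniform even at the jump of the sawtooth,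
where convergence is not uniform. -/
lemma abs_sawPart_le (hl : 0 < l) (hε : 0 < ε) (hlam : 0 < lam) {x t : ℝ} (hx : x ∈ Icc 0 l)
    (ht : 0 ≤ t) (N : ℕ) : |sawPart l ε lam N x t| ≤ 2 * Real.pi + 1 := by
  have hpi := Real.pi_pos
  rcases eq_or_lt_of_le hx.1 with h | hx0
  · simp only [sawPart, ← h, mul_zero, Real.sin_zero, Finset.sum_const_zero, abs_zero]
    positivity
  have small : ∀ N : ℕ, (N : ℝ) ≤ l / x + 1 → |sawPart l ε lam N x t| ≤ 2 * Real.pi := by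
    intro N hN
    refine (Finset.abs_sum_le_sum_abs _ _).trans ?_
    have h1 : ∀ n ∈ Finset.range N,
        |sawCoef l ε lam n t * Real.sin (wave l n * x)| ≤ Real.pi / l * x := by
      intro n _
      have hw := wave_pos hl n
      rw [abs_mul, abs_of_nonneg (sawCoef_nonneg _ _)]
      have h2 : |Real.sin (wave l n * x)| ≤ wave l n * x := by
        have := Real.abs_sin_le_abs (x := wave l n * x)
        rwa [abs_of_pos (show 0 < wave l n * x by positivity)] at this
      calc sawCoef l ε lam n t * |Real.sin (wave l n * x)| ≤ 1 / (n + 1) * (wave l n * x) :=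
            mul_le_mul (sawCoef_le hε hlam n ht) h2 (abs_nonneg _) (by positivity)
        _ = Real.pi / l * x := by rw [wave_eq]; field_simp
    refine (Finset.sum_le_card_nsmul _ _ _ h1).trans ?_
    rw [Finset.card_range, nsmul_eq_mul]
    have hxl : x / l ≤ 1 := by rw [div_le_one hl]; exact hx.2
    calc (N : ℝ) * (Real.pi / l * x) ≤ (l / x + 1) * (Real.pi / l * x) := by gcongr
      _ = Real.pi + Real.pi * (x / l) := by field_simp
      _ ≤ 2 * Real.pi := by nlinarith
  rcases le_or_gt N ⌊l / x⌋₊ with h | h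
  · have h1 : (N : ℝ) ≤ l / x + 1 := by
      have : (N : ℝ) ≤ ⌊l / x⌋₊ := by exact_mod_cast h
      have := Nat.floor_le (show 0 ≤ l / x by positivity)
      linarith
    linarith [small N h1]
  · set m := ⌊l / x⌋₊ with hm
    have h1 : |sawPart l ε lam m x t| ≤ 2 * Real.pi :=
      small m (by have := Nat.floor_le (show 0 ≤ l / x by positivity); linarith)
    have h2 := abs_sawPart_sub_le hl hε hlam hx0 hx.2 ht h.le
    have h3 : l / x / (m + 1) ≤ 1 := by
      rw [div_le_one (by positivity)]
      exact (Nat.lt_floor_add_one (l / x)).le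
    calc |sawPart l ε lam N x t|
        = |(sawPart l ε lam N x t - sawPart l ε lam m x t) + sawPart l ε lam m x t| := by ring_nf
      _ ≤ _ := (abs_add_le _ _).trans (by linarith)

/-- At t = 0 the series need not converge absolutely, which is why `saw` is the limit of the partial
sums in their natural order and not an unordered sum. -/
lemma tendsto_sawPart (hl : 0 < l) (hε : 0 < ε) (hlam : 0 < lam) {x t : ℝ} (hx : x ∈ Icc 0 l)
    (ht : 0 ≤ t) : Tendsto (fun N => sawPart l ε lam N x t) atTop (𝓝 (saw l ε lam x t)) := by
  rcases eq_or_lt_of_le hx.1 with h | hx0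
  · have : (fun N => sawPart l ε lam N x t) = fun _ => (0 : ℝ) := by
      funext N; simp [sawPart, ← h]
    exact tendsto_nhds_limUnder ⟨0, by rw [this]; exact tendsto_const_nhds⟩
  · refine tendsto_nhds_limUnder (cauchySeq_tendsto_of_complete ?_)
    refine cauchySeq_of_le_tendsto_0' (fun N : ℕ => l / x / (N + 1)) (fun n m hnm => ?_) ?_
    · rw [dist_comm, Real.dist_eq]
      exact abs_sawPart_sub_le hl hε hlam hx0 hx.2 ht hnm
    · have := (tendsto_one_div_add_atTop_nhds_zero_nat (𝕜 := ℝ)).const_mul (l / x)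
      simpa [div_eq_mul_inv] using this

lemma abs_saw_le (hl : 0 < l) (hε : 0 < ε) (hlam : 0 < lam) {x t : ℝ} (hx : x ∈ Icc 0 l)
    (ht : 0 ≤ t) : |saw l ε lam x t| ≤ 2 * Real.pi + 1 :=
  le_of_tendsto (tendsto_sawPart hl hε hlam hx ht).abs
    (Eventually.of_forall fun N => abs_sawPart_le hl hε hlam hx ht N)

lemma abs_saw_sub_le (hl : 0 < l) (hε : 0 < ε) (hlam : 0 < lam) {x t : ℝ} (hx : 0 < x)
    (hxl : x ≤ l) (ht : 0 ≤ t) (N : ℕ) :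
    |saw l ε lam x t - sawPart l ε lam N x t| ≤ l / x / (N + 1) := by
  refine le_of_tendsto ((tendsto_sawPart hl hε hlam ⟨hx.le, hxl⟩ ht).sub_const _).abs ?_
  filter_upwards [eventually_ge_atTop N] with M hM
  exact abs_sawPart_sub_le hl hε hlam hx hxl ht hM

lemma saw_zero_left (t : ℝ) : saw l ε lam 0 t = 0 := by
  have : (fun N => sawPart l ε lam N 0 t) = fun _ => (0 : ℝ) := by
    funext N; simp [sawPart]
  rw [saw, this]
  exact tendsto_const_nhds.limUnder_eq

lemma saw_right (hl : 0 < l) (t : ℝ) : saw l ε lam l t = 0 := by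
  have : (fun N => sawPart l ε lam N l t) = fun _ => (0 : ℝ) := by
    funext N; simp [sawPart, sin_wave_right hl]
  rw [saw, this]
  exact tendsto_const_nhds.limUnder_eq

lemma unifSum_saw (hl : 0 < l) (hε : 0 < ε) {δ : ℝ} (hδ : 0 < δ) :
    UnifSum (fun n (p : ℝ × ℝ) => sawCoef l ε lam n p.2 * Real.sin (wave l n * p.1))
      {p | δ ≤ p.2} := by
  refine unifSum_of_bound
    (summable_one_div_add_one_sq.mul_left (1 / (ε * (Real.pi / l) ^ 2 * δ))) fun n p hp => ?_
  have h1 : sawCoef l ε lam n p.2 ≤ Real.exp (-(ε * bC l lam n) * p.2) :=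
    div_le_self (Real.exp_pos _).le (by linarith [n.cast_nonneg (α := ℝ)])
  rw [abs_mul, abs_of_nonneg (sawCoef_nonneg _ _)]
  calc sawCoef l ε lam n p.2 * |Real.sin (wave l n * p.1)|
      ≤ sawCoef l ε lam n p.2 * 1 :=
        mul_le_mul_of_nonneg_left (Real.abs_sin_le_one _) (sawCoef_nonneg _ _)
    _ ≤ _ := by rw [mul_one]; exact h1.trans (exp_bC_le hl hε hδ n hp)

lemma saw_eq_tsum (hl : 0 < l) (hε : 0 < ε) {x t : ℝ} (ht : 0 < t) :
    saw l ε lam x t = ∑' n, sawCoef l ε lam n t * Real.sin (wave l n * x) := by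
  have h := (unifSum_saw (lam := lam) hl hε ht).summable (x := (x, t)) (le_refl t)
  exact h.hasSum.tendsto_sum_nat.limUnder_eq

lemma continuous_sawCoef (n : ℕ) : Continuous (sawCoef l ε lam n) := by
  unfold sawCoef; fun_prop

/-- Near a point with t = 0 and x > 0 the Abel bound l/(x(N+1)) gives uniform convergence; near a
point with t > 0 the exponential factors do. Only the corner (0,0), where the initial sawtooth
jumps, escapes both arguments. -/
lemma continuousOn_saw (hl : 0 < l) (hε : 0 < ε) (hlam : 0 < lam) :
    ContinuousOn (fun p : ℝ × ℝ => saw l ε lam p.1 p.2)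
      {p | p.1 ∈ Icc 0 l ∧ 0 ≤ p.2 ∧ (p.1 = 0 → 0 < p.2)} := by
  refine continuousOn_of_local fun p hp => ?_
  rcases eq_or_lt_of_le hp.2.1 with h | h
  · have hp1 : 0 < p.1 := by
      rcases eq_or_lt_of_le hp.1.1 with h' | h'
      · exact absurd (hp.2.2 h'.symm) (by rw [← h]; exact lt_irrefl _)
      · exact h'
    refine ⟨{q | p.1 / 2 ≤ q.1 ∧ q.1 ≤ l ∧ 0 ≤ q.2}, ?_, ⟨by linarith, hp.1.2, hp.2.1⟩, ?_⟩
    · refine TendstoUniformlyOn.continuousOn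
        (F := fun N (q : ℝ × ℝ) => sawPart l ε lam N q.1 q.2) (p := atTop) ?_
        (Frequently.of_forall fun N => ?_)
      · rw [Metric.tendstoUniformlyOn_iff]
        intro η hη
        have hlim : Tendsto (fun N : ℕ => l / (p.1 / 2) / ((N : ℝ) + 1)) atTop (𝓝 0) := by
          have := (tendsto_one_div_add_atTop_nhds_zero_nat (𝕜 := ℝ)).const_mul (l / (p.1 / 2))
          simpa [div_eq_mul_inv] using this
        filter_upwards [hlim.eventually (gt_mem_nhds hη)] with N hN q hq
        have hq1 : 0 < q.1 := lt_of_lt_of_le (by linarith) hq.1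
        refine lt_of_le_of_lt (abs_saw_sub_le hl hε hlam hq1 hq.2.1 hq.2.2 N) (lt_of_le_of_lt ?_ hN)
        have := hq.1
        gcongr
      · unfold sawPart
        exact (continuous_finsetSum _ fun n _ =>
          ((continuous_sawCoef n).comp continuous_snd).mul (by fun_prop)).continuousOn
    · have : {q : ℝ × ℝ | p.1 / 2 < q.1} ∈ 𝓝 p :=
        (isOpen_lt continuous_const continuous_fst).mem_nhds (by simp; linarith)
      filter_upwards [mem_nhdsWithin_of_mem_nhds this, self_mem_nhdsWithin] with q hq1 hq2
      exact ⟨le_of_lt hq1, hq2.1.2, hq2.2.1⟩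
  · refine ⟨{q | p.2 / 2 ≤ q.2}, ?_, by simp; linarith, ?_⟩
    · have h2 := (unifSum_saw (lam := lam) hl hε (half_pos h)).continuousOn fun n =>
        (((continuous_sawCoef n).comp continuous_snd).mul (by fun_prop)).continuousOn
      refine h2.congr fun q hq => saw_eq_tsum hl hε (lt_of_lt_of_le (half_pos h) hq)
    · have : {q : ℝ × ℝ | p.2 / 2 < q.2} ∈ 𝓝 p :=
        (isOpen_lt continuous_const continuous_snd).mem_nhds (by simp; linarith)
      filter_upwards [mem_nhdsWithin_of_mem_nhds this] with q hq1
      exact le_of_lt hq1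

lemma sinCoef_one_sub (hl : 0 < l) (n : ℕ) :
    sinCoef l (fun x => 1 - x / l) n = l / Real.pi / (n + 1) := by
  have hw := wave_pos hl n
  have hpi := Real.pi_pos
  have hder : ∀ x, HasDerivAt (fun x => -((1 - x / l) * Real.cos (wave l n * x) / wave l n)
      - Real.sin (wave l n * x) / (l * wave l n ^ 2))
      ((1 - x / l) * Real.sin (wave l n * x)) x := by
    intro x
    have h1 : HasDerivAt (fun x => 1 - x / l) (-(1 / l)) x :=
      ((hasDerivAt_id x).div_const l).const_sub 1
    have h2 : HasDerivAt (fun x => Real.cos (wave l n * x))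
        (-Real.sin (wave l n * x) * (wave l n * 1)) x := ((hasDerivAt_id x).const_mul _).cos
    have h3 : HasDerivAt (fun x => Real.sin (wave l n * x))
        (Real.cos (wave l n * x) * (wave l n * 1)) x := ((hasDerivAt_id x).const_mul _).sin
    convert! ((h1.mul h2).div_const (wave l n)).neg.sub (h3.div_const (l * wave l n ^ 2)) using 1
    field_simp; ring
  rw [sinCoef, intervalIntegral.integral_eq_sub_of_hasDerivAt (fun x _ => hder x)
    (Continuous.intervalIntegrable (by fun_prop) _ _), sin_wave_right hl, div_self hl.ne', wave_eq]
  simp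
  field_simp

lemma sinCoef_reflect (hl : 0 < l) (f : ℝ → ℝ) (n : ℕ) :
    sinCoef l (fun x => f (l - x)) n = (-1) ^ n * sinCoef l f n := by
  have h1 : ∀ x, f (l - x) * Real.sin (wave l n * x) =
      (fun y => (-1) ^ n * (f y * Real.sin (wave l n * y))) (l - x) := by
    intro x
    have : wave l n * (l - x) = (n + 1 : ℕ) * Real.pi - wave l n * x := by
      rw [wave_eq]; push_cast; field_simp
    simp only [this, Real.sin_nat_mul_pi_sub]
    rw [pow_succ]
    have h : ((-1 : ℝ) ^ n) * (-1) ^ n = 1 := by rw [← mul_pow]; simp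
    linear_combination (-(f (l - x) * Real.sin (wave l n * x))) * h
  simp only [sinCoef]
  simp_rw [h1]
  rw [intervalIntegral.integral_comp_sub_left (fun y => (-1) ^ n * (f y * Real.sin (wave l n * y))),
    intervalIntegral.integral_const_mul]
  simp

/-- The partial sums are uniformly bounded and converge pointwise, so their sine coefficients
converge to those of the limit. These agree with the coefficients of the affine function, and
completeness identifies the two. -/
lemma saw_initial (hl : 0 < l) (hε : 0 < ε) (hlam : 0 < lam) {x : ℝ} (hx : x ∈ Ioo 0 l) :
    saw l ε lam x 0 = Real.pi / 2 * (1 - x / l) := by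
  have hpi := Real.pi_pos
  have hc : ContinuousOn (fun x => saw l ε lam x 0) (Ioo 0 l) :=
    (continuousOn_saw hl hε hlam).comp (f := fun x => (x, (0 : ℝ))) (by fun_prop)
      fun x hx => ⟨⟨hx.1.le, hx.2.le⟩, le_rfl, fun h => absurd h hx.1.ne'⟩
  have hsb : ∀ x ∈ Ioo 0 l, |saw l ε lam x 0| ≤ 2 * Real.pi + 1 := fun x hx =>
    abs_saw_le hl hε hlam ⟨hx.1.le, hx.2.le⟩ le_rfl
  have hm1 : BddMeas l (2 * Real.pi + 1) fun x => saw l ε lam x 0 :=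
    bddMeas_of_continuousOn hc hsb
  have hlin : ∀ x ∈ Ioo 0 l, |Real.pi / 2 * (1 - x / l)| ≤ Real.pi / 2 := by
    intro x hx
    have h1 : 0 < x / l := div_pos hx.1 hl
    have h2 : x / l < 1 := (div_lt_one hl).2 hx.2
    rw [abs_of_nonneg (by have : 0 < 1 - x / l := by linarith
                          positivity)]
    nlinarith
  have hm2 : BddMeas l (Real.pi / 2) fun x => Real.pi / 2 * (1 - x / l) :=
    bddMeas_of_continuousOn (by fun_prop) hlin
  have hcoef : ∀ n, sinCoef l (fun x => saw l ε lam x 0) n = l / 2 / (n + 1) := by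
    intro n
    have hlim : Tendsto (fun N => sinCoef l (fun x => sawPart l ε lam N x 0) n) atTop
        (𝓝 (sinCoef l (fun x => saw l ε lam x 0) n)) := by
      refine intervalIntegral.tendsto_integral_filter_of_dominated_convergence
        (fun _ => 2 * Real.pi + 1) (Eventually.of_forall fun N => ?_)
        (Eventually.of_forall fun N => ?_) (by simp) ?_
      · unfold sawPart
        exact Continuous.aestronglyMeasurable (by fun_prop)
      · rw [uIoc_of_le hl.le]
        refine (ae_restrict_iff' measurableSet_Ioc).1 (ae_Ioc_of_Ioo fun x hx => ?_)
        rw [Real.norm_eq_abs, abs_mul]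
        have h1 := abs_sawPart_le hl hε hlam ⟨hx.1.le, hx.2.le⟩ le_rfl (t := 0) N
        nlinarith [Real.abs_sin_le_one (wave l n * x), abs_nonneg (sawPart l ε lam N x 0)]
      · rw [uIoc_of_le hl.le]
        refine Eventually.of_forall fun x hx => ?_
        exact (tendsto_sawPart hl hε hlam ⟨hx.1.le, hx.2⟩ le_rfl).mul_const _
    refine tendsto_nhds_unique hlim (tendsto_const_nhds.congr' ?_)
    filter_upwards [eventually_gt_atTop n] with N hN
    have h2 : ∀ x, sawPart l ε lam N x 0 * Real.sin (wave l n * x) =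
        ∑ m ∈ Finset.range N, 1 / ((m : ℝ) + 1) *
          (Real.sin (wave l m * x) * Real.sin (wave l n * x)) := by
      intro x
      rw [sawPart, Finset.sum_mul]
      exact Finset.sum_congr rfl fun m _ => by simp [sawCoef]; ring
    rw [sinCoef]
    simp_rw [h2]
    rw [intervalIntegral.integral_finsetSum fun m _ =>
      Continuous.intervalIntegrable (by fun_prop) _ _]
    simp_rw [intervalIntegral.integral_const_mul, integral_sin_wave_mul hl]
    simp only [mul_ite, mul_zero]
    rw [Finset.sum_ite_eq' , if_pos (Finset.mem_range.2 hN)]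
    field_simp
  have := eq_zero_of_sinCoef_eq_zero hl
    (g := fun x => saw l ε lam x 0 - Real.pi / 2 * (1 - x / l)) (hc.sub (by fun_prop))
    (fun x hx => (abs_sub _ _).trans (add_le_add (hsb x hx) (hlin x hx)))
    (fun n => by
      rw [sinCoef_sub hl hm1 hm2, hcoef, sinCoef_const_mul, sinCoef_one_sub hl]
      field_simp; ring) hx
  linarith

end Saw

/-! ### Sources and modes of the solution -/

/-- `f` is continuous on `(0, l) × (0, ∞)` and bounded there by `M`. -/
structure IsSource (l M : ℝ) (f : ℝ → ℝ → ℝ) : Prop where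
  cont : ContinuousOn (fun p : ℝ × ℝ => f p.1 p.2) (Ioo 0 l ×ˢ Ioi 0)
  bdd : ∀ x ∈ Ioo 0 l, ∀ t, 0 < t → |f x t| ≤ M

/-- The weight `e^{-λx/2}`. -/
noncomputable def wt (lam x : ℝ) : ℝ := Real.exp (-(lam / 2) * x)

lemma continuous_wt (lam : ℝ) : Continuous (wt lam) := by unfold wt; fun_prop

lemma wt_pos (lam x : ℝ) : 0 < wt lam x := Real.exp_pos _

lemma abs_wt_le {lam x : ℝ} (hlam : 0 < lam) (hx : 0 ≤ x) : |wt lam x| ≤ 1 := by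
  rw [abs_of_pos (wt_pos _ _), wt, Real.exp_le_one_iff]
  have : 0 ≤ lam / 2 * x := by positivity
  linarith

lemma exp_mul_wt (lam x : ℝ) : Real.exp (lam / 2 * x) * wt lam x = 1 := by
  rw [wt, ← Real.exp_add, neg_mul, add_neg_cancel, Real.exp_zero]

lemma BddMeas.wt_mul {l M lam : ℝ} (hlam : 0 < lam) {f : ℝ → ℝ} (hf : BddMeas l M f) :
    BddMeas l M (fun x => wt lam x * f x) := by
  refine ⟨(continuous_wt lam).aestronglyMeasurable.mul hf.1, fun x hx => ?_⟩
  rw [abs_mul]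
  have := abs_wt_le hlam hx.1.le
  nlinarith [hf.2 x hx, abs_nonneg (f x), abs_nonneg (wt lam x)]

/-- The sine coefficients of `e^{-λx/2} f(x,t)`. -/
noncomputable def srcCoef (l lam : ℝ) (f : ℝ → ℝ → ℝ) (n : ℕ) (t : ℝ) : ℝ :=
  sinCoef l (fun x => wt lam x * f x t) n

lemma continuousOn_integral_of_bddMeas {l M : ℝ} (hl : 0 < l) {r : ℝ → ℝ → ℝ} {s : Set ℝ}
    (hm : ∀ t ∈ s, BddMeas l M (fun x => r x t)) (hc : ∀ x ∈ Ioo 0 l, ContinuousOn (r x) s) :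
    ContinuousOn (fun t => ∫ x in (0 : ℝ)..l, r x t) s := by
  intro t₀ ht₀
  refine intervalIntegral.continuousWithinAt_of_dominated_interval (bound := fun _ => M)
    ?_ ?_ (by simp) ?_
  · filter_upwards [self_mem_nhdsWithin] with t ht
    rw [uIoc_of_le hl.le]
    exact (hm t ht).1
  · filter_upwards [self_mem_nhdsWithin] with t ht
    rw [uIoc_of_le hl.le]
    exact (ae_restrict_iff' measurableSet_Ioc).1 (ae_Ioc_of_Ioo (hm t ht).2)
  · rw [uIoc_of_le hl.le]
    exact (ae_restrict_iff' measurableSet_Ioc).1 (ae_Ioc_of_Ioo fun x hx => hc x hx t₀ ht₀)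

lemma continuousOn_integral_mul {l M N : ℝ} (hl : 0 < l) {r : ℝ → ℝ → ℝ} {s : Set ℝ}
    (hr : ContinuousOn (fun p : ℝ × ℝ => r p.1 p.2) (Ioo 0 l ×ˢ s))
    (hb : ∀ x ∈ Ioo 0 l, ∀ t ∈ s, |r x t| ≤ M) {φ : ℝ → ℝ} (hφ : ContinuousOn φ (Ioo 0 l))
    (hN : ∀ x ∈ Ioo 0 l, |φ x| ≤ N) :
    ContinuousOn (fun t => ∫ x in (0 : ℝ)..l, r x t * φ x) s :=
  continuousOn_integral_of_bddMeas hl (M := M * N)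
    (fun t ht => (bddMeas_of_continuousOn (hr.comp (f := fun x => (x, t)) (by fun_prop)
      fun _ hx => ⟨hx, ht⟩) fun x hx => hb x hx t ht).mul hl (bddMeas_of_continuousOn hφ hN))
    fun x hx => (hr.comp (f := fun t => (x, t)) (by fun_prop) fun _ ht => ⟨hx, ht⟩).mul
      continuousOn_const

lemma IsSource.bddMeas {l M : ℝ} {f : ℝ → ℝ → ℝ} (hf : IsSource l M f) {t : ℝ} (ht : 0 < t) :
    BddMeas l M (fun x => f x t) :=
  bddMeas_of_continuousOn (hf.cont.comp (f := fun x => (x, t)) (by fun_prop)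
    fun x hx => ⟨hx, ht⟩) fun x hx => hf.bdd x hx t ht

lemma IsSource.abs_srcCoef_le {l M lam : ℝ} (hl : 0 < l) (hlam : 0 < lam) {f : ℝ → ℝ → ℝ}
    (hf : IsSource l M f) (n : ℕ) {t : ℝ} (ht : 0 < t) : |srcCoef l lam f n t| ≤ M * l :=
  abs_sinCoef_le hl ((hf.bddMeas ht).wt_mul hlam).2 n

lemma IsSource.continuousOn_srcCoef {l M lam : ℝ} (hl : 0 < l) (hlam : 0 < lam) {f : ℝ → ℝ → ℝ}
    (hf : IsSource l M f) (n : ℕ) : ContinuousOn (srcCoef l lam f n) (Ioi 0) := by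
  have := continuousOn_integral_mul hl (r := fun x t => wt lam x * f x t) (s := Ioi 0) (M := M)
    (N := 1) (((continuous_wt lam).comp continuous_fst).continuousOn.mul hf.cont)
    (fun x hx t ht => ((hf.bddMeas ht).wt_mul hlam).2 x hx)
    (φ := fun x => Real.sin (wave l n * x)) (by fun_prop) (fun x _ => Real.abs_sin_le_one _)
  exact this

section Sol

variable (l α ε lam : ℝ) (a d : ℕ → ℝ) (f : ℝ → ℝ → ℝ)

/-- The modes of the solution with initial values `a`, initial velocities `d` and source `f`. -/
noncomputable def ym (n : ℕ) (t : ℝ) : ℝ :=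
  km l α ε lam n t * a n + gm l α ε lam n t * d n -
    ∫ τ in (0 : ℝ)..t, gm l α ε lam n (t - τ) * srcCoef l lam f n τ

/-- The time derivatives of the modes. -/
noncomputable def ym' (n : ℕ) (t : ℝ) : ℝ :=
  -bC l lam n * gm l α ε lam n t * a n + gm' l α ε lam n t * d n -
    ∫ τ in (0 : ℝ)..t, gm' l α ε lam n (t - τ) * srcCoef l lam f n τ

variable {l α ε lam a d f}

lemma hasDerivAt_ym (hl : 0 < l) (hlam : 0 < lam) {M : ℝ} (hf : IsSource l M f) (n : ℕ) {t : ℝ}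
    (ht : 0 < t) : HasDerivAt (ym l α ε lam a d f n) (ym' l α ε lam a d f n t) t := by
  have h1 := hasDerivAt_convolution (hasDerivAt_gm l α ε lam n) (continuous_gm' l α ε lam n)
    (hf.continuousOn_srcCoef hl hlam n) (fun t ht => hf.abs_srcCoef_le hl hlam n ht) ht
  rw [gm_zero, zero_mul, zero_add] at h1
  exact (((hasDerivAt_km l α ε lam n t).mul_const (a n)).add
    ((hasDerivAt_gm l α ε lam n t).mul_const (d n))).sub h1

lemma hasDerivAt_ym' (hl : 0 < l) (hlam : 0 < lam) {M : ℝ} (hf : IsSource l M f) (n : ℕ) {t : ℝ}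
    (ht : 0 < t) : HasDerivAt (ym' l α ε lam a d f n)
      (-(α + ε * bC l lam n) * ym' l α ε lam a d f n t - bC l lam n * ym l α ε lam a d f n t
        - srcCoef l lam f n t) t := by
  have hc := hf.continuousOn_srcCoef hl hlam n
  have hb : ∀ t, 0 < t → |srcCoef l lam f n t| ≤ M * l :=
    fun t ht => hf.abs_srcCoef_le hl hlam n ht
  have h1 := hasDerivAt_convolution (hasDerivAt_gm' l α ε lam n)
    (by
      have := continuous_gm l α ε lam n
      have := continuous_gm' l α ε lam n
      fun_prop) hc hb ht
  have hi := intervalIntegrable_of_continuousOn_Ioi hc hb le_rfl ht.le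
  have hi1 : IntervalIntegrable (fun τ => gm l α ε lam n (t - τ) * srcCoef l lam f n τ)
      volume 0 t := hi.continuousOn_mul
    ((continuous_gm l α ε lam n).comp (by fun_prop)).continuousOn
  have hi2 : IntervalIntegrable (fun τ => gm' l α ε lam n (t - τ) * srcCoef l lam f n τ)
      volume 0 t := hi.continuousOn_mul
    ((continuous_gm' l α ε lam n).comp (by fun_prop)).continuousOn
  have h2 : ∫ τ in (0 : ℝ)..t, (-(α + ε * bC l lam n) * gm' l α ε lam n (t - τ) -
      bC l lam n * gm l α ε lam n (t - τ)) * srcCoef l lam f n τ =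
      -(α + ε * bC l lam n) * (∫ τ in (0 : ℝ)..t, gm' l α ε lam n (t - τ) * srcCoef l lam f n τ) -
      bC l lam n * ∫ τ in (0 : ℝ)..t, gm l α ε lam n (t - τ) * srcCoef l lam f n τ := by
    rw [← intervalIntegral.integral_const_mul, ← intervalIntegral.integral_const_mul,
      ← intervalIntegral.integral_sub (hi2.const_mul _) (hi1.const_mul _)]
    exact intervalIntegral.integral_congr fun τ _ => by ring
  rw [h2, gm'_zero] at h1
  have h3 : HasDerivAt (fun t => -bC l lam n * gm l α ε lam n t * a n)
      (-bC l lam n * gm' l α ε lam n t * a n) t :=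
    ((hasDerivAt_gm l α ε lam n t).const_mul _).mul_const _
  refine ((h3.add ((hasDerivAt_gm' l α ε lam n t).mul_const (d n))).sub h1).congr_deriv ?_
  rw [ym, ym', km]
  ring

/-- Uniform bounds for the Green modes in terms of `n`. -/
lemma exists_mode_bounds (hl : 0 < l) (hα : 0 < α) (hε : 0 < ε) (hlam : 0 < lam) :
    ∃ C : ℝ, 0 < C ∧ ∀ n : ℕ, ∀ t, 0 ≤ t →
      |gm l α ε lam n t| ≤ C * (1 / ((n : ℝ) + 1) ^ 2) ∧
      |gm' l α ε lam n t - Real.exp (-(ε * bC l lam n) * t)| ≤ C * (1 / ((n : ℝ) + 1) ^ 2) ∧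
      |km l α ε lam n t| ≤ C ∧ bC l lam n * |gm l α ε lam n t| ≤ C ∧
      wave l n * |gm l α ε lam n t| ≤ C := by
  obtain ⟨C, hC, h⟩ := exists_gm_bounds l α ε lam hα hε hlam
  have hpi := Real.pi_pos
  have key : ∀ (n : ℕ) (z : ℝ), 0 ≤ z → bC l lam n * z ≤ C →
      z ≤ C * (l / Real.pi) ^ 2 * (1 / ((n : ℝ) + 1) ^ 2) := by
    intro n z hz h1
    have h2 : (Real.pi / l) ^ 2 * ((n : ℝ) + 1) ^ 2 * z ≤ C :=
      (mul_le_mul_of_nonneg_right (le_bC l lam n) hz).trans h1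
    calc z = (Real.pi / l) ^ 2 * ((n : ℝ) + 1) ^ 2 * z * (l / Real.pi) ^ 2 *
          (1 / ((n : ℝ) + 1) ^ 2) := by field_simp
      _ ≤ _ := by gcongr
  refine ⟨C + C * (l / Real.pi) ^ 2 + C * (l / Real.pi), by positivity, fun n t ht => ?_⟩
  obtain ⟨h1, h2, h3⟩ := h n t ht
  have hn : (0 : ℝ) < 1 / ((n : ℝ) + 1) ^ 2 := by positivity
  have e1 : 0 < C * (l / Real.pi) ^ 2 := by positivity
  have e2 : 0 < C * (l / Real.pi) := by positivity
  refine ⟨(key n _ (abs_nonneg _) h1).trans (by gcongr; linarith),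
    (key n _ (abs_nonneg _) h2).trans (by gcongr; linarith), by linarith, by linarith, ?_⟩
  have hw := wave_pos hl n
  have h4 : wave l n ≤ l / Real.pi * bC l lam n := by
    have h5 : Real.pi / l ≤ wave l n := by
      rw [wave_eq]
      have : 0 < Real.pi / l := by positivity
      nlinarith [n.cast_nonneg (α := ℝ)]
    calc wave l n = l / Real.pi * (Real.pi / l * wave l n) := by field_simp
      _ ≤ l / Real.pi * (wave l n * wave l n) := by gcongr
      _ ≤ l / Real.pi * bC l lam n := by
        gcongr; rw [bC_eq]; nlinarith [sq_nonneg lam]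
  calc wave l n * |gm l α ε lam n t| ≤ l / Real.pi * bC l lam n * |gm l α ε lam n t| := by gcongr
    _ = l / Real.pi * (bC l lam n * |gm l α ε lam n t|) := by ring
    _ ≤ l / Real.pi * C := by gcongr
    _ ≤ _ := by nlinarith

lemma continuousOn_ym (hl : 0 < l) (hα : 0 < α) (hε : 0 < ε) (hlam : 0 < lam) {M : ℝ}
    (hf : IsSource l M f) (n : ℕ) : ContinuousOn (ym l α ε lam a d f n) (Ici 0) := by
  intro t ht
  rcases eq_or_lt_of_le (mem_Ici.1 ht) with h | h
  · subst h
    refine ContinuousWithinAt.sub ((((continuous_km l α ε lam n).mul_const _).add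
      ((continuous_gm l α ε lam n).mul_const _)).continuousWithinAt) ?_
    rw [ContinuousWithinAt, intervalIntegral.integral_same]
    refine squeeze_zero_norm' (a := fun t => 2 / lam * (M * l) * t) ?_ ?_
    · filter_upwards [self_mem_nhdsWithin] with t ht
      exact abs_convolution_le (fun t ht => abs_gm_le l α ε lam hα hε hlam n ht)
        (fun t ht => hf.abs_srcCoef_le hl hlam n ht) ht
    · have : Continuous fun t : ℝ => 2 / lam * (M * l) * t := by fun_prop
      simpa using! (this.tendsto 0).mono_left (nhdsWithin_le_nhds (s := Ici 0))
  · exact (hasDerivAt_ym hl hlam hf n h).continuousAt.continuousWithinAt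

lemma continuousOn_ym' (hl : 0 < l) (hα : 0 < α) (hε : 0 < ε) (hlam : 0 < lam) {M : ℝ}
    (hf : IsSource l M f) (n : ℕ) : ContinuousOn (ym' l α ε lam a d f n) (Ici 0) := by
  intro t ht
  rcases eq_or_lt_of_le (mem_Ici.1 ht) with h | h
  · subst h
    refine ContinuousWithinAt.sub (((((continuous_gm l α ε lam n).const_mul _).mul_const _).add
      ((continuous_gm' l α ε lam n).mul_const _)).continuousWithinAt) ?_
    rw [ContinuousWithinAt, intervalIntegral.integral_same]
    refine squeeze_zero_norm' (a := fun t => 1 * (M * l) * t) ?_ ?_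
    · filter_upwards [self_mem_nhdsWithin] with t ht
      exact abs_convolution_le (fun t ht => abs_gm'_le_one l α ε lam hα hε hlam n ht)
        (fun t ht => hf.abs_srcCoef_le hl hlam n ht) ht
    · have : Continuous fun t : ℝ => 1 * (M * l) * t := by fun_prop
      simpa using! (this.tendsto 0).mono_left (nhdsWithin_le_nhds (s := Ici 0))
  · exact (hasDerivAt_ym' hl hlam hf n h).continuousAt.continuousWithinAt

lemma ym_zero (n : ℕ) : ym l α ε lam a d f n 0 = a n := by simp [ym, km_zero, gm_zero]

lemma ym'_zero (n : ℕ) : ym' l α ε lam a d f n 0 = d n := by simp [ym', gm_zero, gm'_zero]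

/-- The modes are dominated by a summable sequence. -/
lemma exists_ym_bound (hl : 0 < l) (hα : 0 < α) (hε : 0 < ε) (hlam : 0 < lam) {M D : ℝ}
    (hf : IsSource l M f) (hM : 0 ≤ M) (ha : Summable fun n => |a n|) (hd : ∀ n, |d n| ≤ D)
    (T : ℝ) : ∃ u : ℕ → ℝ, Summable u ∧ ∀ n, ∀ t ∈ Icc 0 T, |ym l α ε lam a d f n t| ≤ u n := by
  obtain ⟨C, hC, h⟩ := exists_mode_bounds hl hα hε hlam
  refine ⟨fun n => C * |a n| + C * (D + M * l * T) * (1 / ((n : ℝ) + 1) ^ 2),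
    (ha.mul_left C).add (summable_one_div_add_one_sq.mul_left _), fun n t ht => ?_⟩
  have hconv := abs_convolution_le (fun t ht => (h n t ht).1)
    (fun t ht => hf.abs_srcCoef_le hl hlam n ht) ht.1
  have h1 : |km l α ε lam n t * a n| ≤ C * |a n| := by
    rw [abs_mul]; gcongr; exact (h n t ht.1).2.2.1
  have h2 : |gm l α ε lam n t * d n| ≤ C * (1 / ((n : ℝ) + 1) ^ 2) * D := by
    rw [abs_mul]
    exact mul_le_mul (h n t ht.1).1 (hd n) (abs_nonneg _) (by positivity)
  have h3 : C * (1 / ((n : ℝ) + 1) ^ 2) * (M * l) * t ≤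
      C * (1 / ((n : ℝ) + 1) ^ 2) * (M * l) * T := by have := ht.2; gcongr
  calc |ym l α ε lam a d f n t| ≤ C * |a n| + C * (1 / ((n : ℝ) + 1) ^ 2) * D +
        C * (1 / ((n : ℝ) + 1) ^ 2) * (M * l) * T :=
        (abs_sub _ _).trans (add_le_add ((abs_add_le _ _).trans (add_le_add h1 h2))
          (hconv.trans h3))
    _ = _ := by ring

variable (l α ε lam a d f) in
/-- The function `e^{-λx/2} u(x,t)`. -/
noncomputable def Uhat (x t : ℝ) : ℝ := 2 / l * ∑' n, ym l α ε lam a d f n t * Real.sin (wave l n * x)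

lemma unifSum_ym (hl : 0 < l) (hα : 0 < α) (hε : 0 < ε) (hlam : 0 < lam) {M D : ℝ}
    (hf : IsSource l M f) (hM : 0 ≤ M) (ha : Summable fun n => |a n|) (hd : ∀ n, |d n| ≤ D)
    (T : ℝ) : UnifSum (fun n (p : ℝ × ℝ) => ym l α ε lam a d f n p.2 * Real.sin (wave l n * p.1))
      (univ ×ˢ Icc 0 T) := by
  obtain ⟨u, hu, h⟩ := exists_ym_bound hl hα hε hlam hf hM ha hd T
  refine unifSum_of_bound hu fun n p hp => ?_
  rw [abs_mul]
  nlinarith [h n p.2 hp.2, abs_nonneg (ym l α ε lam a d f n p.2),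
    Real.abs_sin_le_one (wave l n * p.1)]

lemma continuousOn_Uhat (hl : 0 < l) (hα : 0 < α) (hε : 0 < ε) (hlam : 0 < lam) {M D : ℝ}
    (hf : IsSource l M f) (hM : 0 ≤ M) (ha : Summable fun n => |a n|) (hd : ∀ n, |d n| ≤ D)
    (T : ℝ) : ContinuousOn (fun p : ℝ × ℝ => Uhat l α ε lam a d f p.1 p.2) (univ ×ˢ Icc 0 T) := by
  refine ((unifSum_ym hl hα hε hlam hf hM ha hd T).continuousOn fun n => ?_).const_mul _
  refine ContinuousOn.mul ?_ (by fun_prop)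
  exact (continuousOn_ym hl hα hε hlam hf n).comp (by fun_prop) fun p hp => hp.2.1

lemma abs_Uhat_le (hl : 0 < l) (hα : 0 < α) (hε : 0 < ε) (hlam : 0 < lam) {M D : ℝ}
    (hf : IsSource l M f) (hM : 0 ≤ M) (ha : Summable fun n => |a n|) (hd : ∀ n, |d n| ≤ D)
    (T : ℝ) : ∃ B, ∀ x, ∀ t ∈ Icc 0 T, |Uhat l α ε lam a d f x t| ≤ B := by
  obtain ⟨u, hu, h⟩ := exists_ym_bound hl hα hε hlam hf hM ha hd T
  refine ⟨2 / l * ∑' n, u n, fun x t ht => ?_⟩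
  rw [Uhat, abs_mul, abs_of_pos (show 0 < 2 / l by positivity)]
  refine mul_le_mul_of_nonneg_left ?_ (by positivity)
  rw [← Real.norm_eq_abs]
  refine tsum_of_norm_bounded hu.hasSum fun n => ?_
  rw [Real.norm_eq_abs, abs_mul]
  nlinarith [h n t ht, abs_nonneg (ym l α ε lam a d f n t), Real.abs_sin_le_one (wave l n * x)]

/-! ### The integral map as a series -/

lemma green_eq (x ξ t : ℝ) : green l α ε lam x ξ t = 2 / l * Real.exp (lam / 2 * x) *
    (wt lam ξ * ∑' n, gm l α ε lam n t * Real.sin (wave l n * x) * Real.sin (wave l n * ξ)) := by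
  have h1 : Real.exp (lam / 2 * (x - ξ)) = Real.exp (lam / 2 * x) * wt lam ξ := by
    rw [wt, ← Real.exp_add]; ring_nf
  have h2 : ∀ n : ℕ, greenMode l α ε lam (n + 1) t * Real.sin (freq l (n + 1) * ξ)
      * Real.sin (freq l (n + 1) * x) =
      gm l α ε lam n t * Real.sin (wave l n * x) * Real.sin (wave l n * ξ) := fun n => by
    simp only [gm, wave]; ring
  rw [green, h1]
  simp_rw [← h2]
  ring

lemma integral_mul_green (hl : 0 < l) (hα : 0 < α) (hε : 0 < ε) (hlam : 0 < lam) {M : ℝ}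
    {h : ℝ → ℝ} (hh : BddMeas l M h) (x : ℝ) {t : ℝ} (ht : 0 ≤ t) :
    ∫ ξ in (0 : ℝ)..l, h ξ * green l α ε lam x ξ t = 2 / l * Real.exp (lam / 2 * x) *
      ∑' n, gm l α ε lam n t * sinCoef l (fun ξ => wt lam ξ * h ξ) n * Real.sin (wave l n * x) := by
  obtain ⟨C, hC, hb⟩ := exists_mode_bounds hl hα hε hlam
  have hs : Summable fun n => |gm l α ε lam n t * Real.sin (wave l n * x)| := by
    refine Summable.of_nonneg_of_le (fun _ => abs_nonneg _) (fun n => ?_)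
      (summable_one_div_add_one_sq.mul_left C)
    rw [abs_mul]
    nlinarith [(hb n t ht).1, abs_nonneg (gm l α ε lam n t), Real.abs_sin_le_one (wave l n * x)]
  have h1 := hasSum_integral_mul_series hl (hh.wt_mul hlam) hs
    (ψ := fun n ξ => Real.sin (wave l n * ξ)) (fun _ => by fun_prop)
    (fun _ _ => Real.abs_sin_le_one _)
  have h2 : ∫ ξ in (0 : ℝ)..l, h ξ * green l α ε lam x ξ t = 2 / l * Real.exp (lam / 2 * x) *
      ∫ ξ in (0 : ℝ)..l, wt lam ξ * h ξ *
        ∑' n, gm l α ε lam n t * Real.sin (wave l n * x) * Real.sin (wave l n * ξ) := by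
    rw [← intervalIntegral.integral_const_mul]
    refine intervalIntegral.integral_congr fun ξ _ => ?_
    simp only [green_eq]
    ring
  rw [h2, ← h1.tsum_eq]
  congr 1
  refine tsum_congr fun n => ?_
  rw [sinCoef]
  ring

/-- The part of the integral map that depends on the initial value. -/
lemma greenConv_operator (hl : 0 < l) (hα : 0 < α) (hε : 0 < ε) (hlam : 0 < lam) {M : ℝ}
    {h : ℝ → ℝ} (hh : BddMeas l M h)
    (hs : Summable fun n => |sinCoef l (fun ξ => wt lam ξ * h ξ) n|) (x : ℝ) {t : ℝ} (ht : 0 < t) :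
    deriv (fun s => greenConv l α ε lam h x s) t + α * greenConv l α ε lam h x t
      + ε * lam * dx (greenConv l α ε lam h) x t - ε * dx (dx (greenConv l α ε lam h)) x t =
    2 / l * Real.exp (lam / 2 * x) * ∑' n, km l α ε lam n t *
      sinCoef l (fun ξ => wt lam ξ * h ξ) n * Real.sin (wave l n * x) := by
  obtain ⟨C, hC, hb⟩ := exists_mode_bounds hl hα hε hlam
  set c : ℕ → ℝ := sinCoef l (fun ξ => wt lam ξ * h ξ) with hc
  have hgc : ∀ x s, 0 ≤ s → greenConv l α ε lam h x s = 2 / l * Real.exp (lam / 2 * x) *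
      ∑' n, gm l α ε lam n s * c n * Real.sin (wave l n * x) := fun x s hs =>
    integral_mul_green hl hα hε hlam hh x hs
  have hle : ∀ (A B s D : ℝ), |A| ≤ D → |s| ≤ 1 → |A * B * s| ≤ D * |B| := by
    intro A B s D h1 h2
    rw [abs_mul, abs_mul]
    calc |A| * |B| * |s| ≤ D * |B| * 1 :=
          mul_le_mul (mul_le_mul_of_nonneg_right h1 (abs_nonneg _)) h2 (abs_nonneg _)
            (mul_nonneg ((abs_nonneg _).trans h1) (abs_nonneg _))
      _ = _ := mul_one _
  have hsq : ∀ n : ℕ, C * (1 / ((n : ℝ) + 1) ^ 2) ≤ C := fun n => by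
    rw [mul_one_div]
    exact div_le_self hC.le (one_le_pow₀ (by linarith [n.cast_nonneg (α := ℝ)]))
  have hu0 : ∀ s, 0 ≤ s → UnifSum (fun n x => gm l α ε lam n s * c n * Real.sin (wave l n * x))
      univ := fun s hs0 => unifSum_of_bound (hs.mul_left C) fun n x _ =>
    hle _ _ _ _ ((hb n s hs0).1.trans (hsq n)) (Real.abs_sin_le_one _)
  have hu1 : UnifSum (fun n x => gm l α ε lam n t * c n * (wave l n * Real.cos (wave l n * x)))
      univ := unifSum_of_bound (hs.mul_left C) fun n x _ => by
    have h1 : gm l α ε lam n t * c n * (wave l n * Real.cos (wave l n * x)) =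
      (wave l n * gm l α ε lam n t) * c n * Real.cos (wave l n * x) := by ring
    rw [h1]
    refine hle _ _ _ _ ?_ (Real.abs_cos_le_one _)
    rw [abs_mul, abs_of_pos (wave_pos hl n)]
    exact (hb n t ht.le).2.2.2.2
  -- Since γ²|G_n| ≤ b|G_n| ≤ C, two termwise x-derivatives are paid for by the Green mode alone;
  -- summability of the coefficients of the weighted datum suffices.
  have hu2 : UnifSum (fun n x => -(gm l α ε lam n t * c n *
      (wave l n ^ 2 * Real.sin (wave l n * x)))) univ :=
    unifSum_of_bound (hs.mul_left C) fun n x _ => by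
    have h1 : gm l α ε lam n t * c n * (wave l n ^ 2 * Real.sin (wave l n * x)) =
      (wave l n ^ 2 * gm l α ε lam n t) * c n * Real.sin (wave l n * x) := by ring
    rw [abs_neg, h1]
    refine hle _ _ _ _ ?_ (Real.abs_sin_le_one _)
    rw [abs_mul, abs_of_nonneg (sq_nonneg _)]
    refine le_trans (mul_le_mul_of_nonneg_right ?_ (abs_nonneg _)) (hb n t ht.le).2.2.2.1
    rw [bC_eq]; nlinarith [sq_nonneg lam]
  have hut : UnifSum (fun n s => gm' l α ε lam n s * c n * Real.sin (wave l n * x)) (Ioi 0) :=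
    unifSum_of_bound (hs.mul_left 1) fun n s hs0 =>
      hle _ _ _ _ (abs_gm'_le_one l α ε lam hα hε hlam n (le_of_lt hs0)) (Real.abs_sin_le_one _)
  set P := fun x => ∑' n, gm l α ε lam n t * c n * Real.sin (wave l n * x) with hP
  set P1 := fun x => ∑' n, gm l α ε lam n t * c n * (wave l n * Real.cos (wave l n * x)) with hP1
  set P2 := fun x => ∑' n, -(gm l α ε lam n t * c n *
      (wave l n ^ 2 * Real.sin (wave l n * x))) with hP2
  have dP : ∀ x, HasDerivAt P (P1 x) x := fun x => hu1.hasDerivAt isOpen_univ (fun n y _ => by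
    have h1 : HasDerivAt (fun y => Real.sin (wave l n * y))
      (Real.cos (wave l n * y) * (wave l n * 1)) y := ((hasDerivAt_id y).const_mul _).sin
    convert! h1.const_mul (gm l α ε lam n t * c n) using 1
    ring) (fun y _ => (hu0 t ht.le).summable (mem_univ y)) (mem_univ x)
  have dP1 : ∀ x, HasDerivAt P1 (P2 x) x := fun x => hu2.hasDerivAt isOpen_univ (fun n y _ => by
    have h1 : HasDerivAt (fun y => Real.cos (wave l n * y))
      (-Real.sin (wave l n * y) * (wave l n * 1)) y := ((hasDerivAt_id y).const_mul _).cos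
    convert! (h1.const_mul (wave l n)).const_mul (gm l α ε lam n t * c n) using 1
    ring) (fun y _ => hu1.summable (mem_univ y)) (mem_univ x)
  have dE : ∀ x, HasDerivAt (fun x => 2 / l * Real.exp (lam / 2 * x))
      (2 / l * (Real.exp (lam / 2 * x) * (lam / 2 * 1))) x := fun x =>
    (((hasDerivAt_id x).const_mul _).exp).const_mul _
  have e1 : ∀ x, dx (greenConv l α ε lam h) x t =
      2 / l * Real.exp (lam / 2 * x) * (lam / 2 * P x + P1 x) := fun x => by
    have h1 : (fun y => greenConv l α ε lam h y t) =
        fun y => 2 / l * Real.exp (lam / 2 * y) * P y := funext fun y => hgc y t ht.le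
    rw [dx, h1, ((dE x).fun_mul (dP x)).deriv]
    ring
  have e2 : dx (dx (greenConv l α ε lam h)) x t =
      2 / l * Real.exp (lam / 2 * x) * (lam ^ 2 / 4 * P x + lam * P1 x + P2 x) := by
    have h1 : (fun y => dx (greenConv l α ε lam h) y t) =
        fun y => 2 / l * Real.exp (lam / 2 * y) * (lam / 2 * P y + P1 y) := funext e1
    rw [dx, h1, ((dE x).fun_mul (((dP x).const_mul (lam / 2)).fun_add (dP1 x))).deriv]
    ring
  have e3 : deriv (fun s => greenConv l α ε lam h x s) t = 2 / l * Real.exp (lam / 2 * x) *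
      ∑' n, gm' l α ε lam n t * c n * Real.sin (wave l n * x) := by
    have h1 := (hut.hasDerivAt isOpen_Ioi
      (f := fun n s => gm l α ε lam n s * c n * Real.sin (wave l n * x))
      (fun n s _ => ((hasDerivAt_gm l α ε lam n s).mul_const _).mul_const _)
      (fun s hs0 => (hu0 s (le_of_lt hs0)).summable (mem_univ x)) ht).const_mul
      (2 / l * Real.exp (lam / 2 * x))
    refine (h1.congr_of_eventuallyEq ?_).deriv
    filter_upwards [Ioi_mem_nhds ht] with s hs0 using hgc x s (le_of_lt hs0)
  rw [e1, e2, e3, hgc x t ht.le]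
  -- On e^{λx/2} sin(γx) the first order terms cancel and α + ελ∂_x - ε∂_xx acts as multiplication
  -- by α + εb; together with ∂_t this turns G_n into K_n.
  have hsum : ∑' n, km l α ε lam n t * c n * Real.sin (wave l n * x) =
      (∑' n, gm' l α ε lam n t * c n * Real.sin (wave l n * x)) + (α + ε * (lam ^ 2 / 4)) * P x
        - ε * P2 x := by
    simp only [hP, hP2]
    rw [← tsum_mul_left, ← tsum_mul_left, ← Summable.tsum_add (hut.summable ht)
      (((hu0 t ht.le).summable (mem_univ x)).mul_left _), ← Summable.tsum_sub
      ((hut.summable ht).add (((hu0 t ht.le).summable (mem_univ x)).mul_left _))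
      ((hu2.summable (mem_univ x)).mul_left _)]
    refine tsum_congr fun n => ?_
    rw [km, bC_eq]; ring
  rw [hsum]
  ring

lemma hasSum_integral_convolution (hl : 0 < l) (hα : 0 < α) (hε : 0 < ε) (hlam : 0 < lam) {M : ℝ}
    (hf : IsSource l M f) (x : ℝ) {t : ℝ} (ht : 0 < t) :
    HasSum (fun n => (∫ τ in (0 : ℝ)..t, gm l α ε lam n (t - τ) * srcCoef l lam f n τ) *
        Real.sin (wave l n * x))
      (∫ τ in (0 : ℝ)..t, ∑' n, gm l α ε lam n (t - τ) * srcCoef l lam f n τ *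
        Real.sin (wave l n * x)) := by
  obtain ⟨C, hC, hb⟩ := exists_mode_bounds hl hα hε hlam
  have hbound : ∀ n, ∀ τ ∈ Ioc 0 t, |gm l α ε lam n (t - τ) * srcCoef l lam f n τ *
      Real.sin (wave l n * x)| ≤ C * (M * l) * (1 / ((n : ℝ) + 1) ^ 2) := by
    intro n τ hτ
    have h1 := (hb n (t - τ) (by linarith [hτ.2])).1
    have h2 := hf.abs_srcCoef_le hl hlam n hτ.1
    rw [abs_mul, abs_mul]
    calc |gm l α ε lam n (t - τ)| * |srcCoef l lam f n τ| * |Real.sin (wave l n * x)|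
        ≤ (C * (1 / ((n : ℝ) + 1) ^ 2)) * (M * l) * 1 :=
          mul_le_mul (mul_le_mul h1 h2 (abs_nonneg _) (by positivity)) (Real.abs_sin_le_one _)
            (abs_nonneg _) (mul_nonneg (by positivity) ((abs_nonneg _).trans h2))
      _ = _ := by ring
  have := intervalIntegral.hasSum_integral_of_dominated_convergence (μ := volume) (a := 0) (b := t)
    (F := fun n τ => gm l α ε lam n (t - τ) * srcCoef l lam f n τ * Real.sin (wave l n * x))
    (f := fun τ => ∑' n, gm l α ε lam n (t - τ) * srcCoef l lam f n τ * Real.sin (wave l n * x))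
    (fun n _ => C * (M * l) * (1 / ((n : ℝ) + 1) ^ 2)) (fun n => ?_) (fun n => ?_) ?_ ?_ ?_
  · simpa only [intervalIntegral.integral_mul_const] using this
  · rw [uIoc_of_le ht.le]
    refine ContinuousOn.aestronglyMeasurable ?_ measurableSet_Ioc
    exact ((((continuous_gm l α ε lam n).comp (continuous_const.sub continuous_id)).continuousOn).mul
      ((hf.continuousOn_srcCoef hl hlam n).mono fun τ hτ => hτ.1)).mul continuousOn_const
  · rw [uIoc_of_le ht.le]
    exact Eventually.of_forall fun τ hτ => hbound n τ hτ
  · exact Eventually.of_forall fun τ _ => summable_one_div_add_one_sq.mul_left _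
  · simp
  · rw [uIoc_of_le ht.le]
    refine Eventually.of_forall fun τ hτ => Summable.hasSum ?_
    exact Summable.of_norm_bounded (summable_one_div_add_one_sq.mul_left (C * (M * l)))
      fun n => hbound n τ hτ

/-- The three parts of the integral map are sine series whose n-th coefficients add up to `ym`. The
source f has to agree with F(x,t,v) only for times up to T, so any convenient extension to later
times may be used. -/
lemma integralMap_eq (hl : 0 < l) (hα : 0 < α) (hε : 0 < ε) (hlam : 0 < lam) {M M₀ M₁ T : ℝ}
    {h₀ h₁ : ℝ → ℝ} {F : ℝ → ℝ → ℝ → ℝ} {v : ℝ → ℝ → ℝ} (hf : IsSource l M f)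
    (hh₀ : BddMeas l M₀ h₀) (hh₁ : BddMeas l M₁ h₁)
    (hs : Summable fun n => |sinCoef l (fun ξ => wt lam ξ * h₀ ξ) n|)
    (hv : ∀ x ∈ Ioo 0 l, ∀ t ∈ Ioc 0 T, F x t (v x t) = f x t) (x : ℝ) {t : ℝ}
    (ht : t ∈ Ioc 0 T) :
    integralMap l α ε lam h₀ h₁ F v x t = Real.exp (lam / 2 * x) *
      Uhat l α ε lam (sinCoef l fun ξ => wt lam ξ * h₀ ξ) (sinCoef l fun ξ => wt lam ξ * h₁ ξ)
        f x t := by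
  obtain ⟨C, hC, hb⟩ := exists_mode_bounds hl hα hε hlam
  have hinner : ∀ τ ∈ Ioc 0 t, ∫ ξ in (0 : ℝ)..l, green l α ε lam x ξ (t - τ) * F ξ τ (v ξ τ) =
      2 / l * Real.exp (lam / 2 * x) * ∑' n, gm l α ε lam n (t - τ) * srcCoef l lam f n τ *
        Real.sin (wave l n * x) := by
    intro τ hτ
    rw [← show _ = 2 / l * Real.exp (lam / 2 * x) * ∑' n, gm l α ε lam n (t - τ) *
      srcCoef l lam f n τ * Real.sin (wave l n * x) from
      integral_mul_green hl hα hε hlam (hf.bddMeas hτ.1) x (show 0 ≤ t - τ by linarith [hτ.2])]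
    refine intervalIntegral_congr_Ioo hl fun ξ hξ => ?_
    rw [hv ξ hξ τ ⟨hτ.1, hτ.2.trans ht.2⟩, mul_comm]
  have hdouble : ∫ τ in (0 : ℝ)..t, ∫ ξ in (0 : ℝ)..l, green l α ε lam x ξ (t - τ) * F ξ τ (v ξ τ) =
      2 / l * Real.exp (lam / 2 * x) * ∑' n, (∫ τ in (0 : ℝ)..t, gm l α ε lam n (t - τ) *
        srcCoef l lam f n τ) * Real.sin (wave l n * x) := by
    rw [(hasSum_integral_convolution hl hα hε hlam hf x ht.1).tsum_eq,
      ← intervalIntegral.integral_const_mul]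
    refine intervalIntegral_congr_Ioo ht.1 fun τ hτ => hinner τ ⟨hτ.1, hτ.2.le⟩
  have s1 : Summable fun n => gm l α ε lam n t * sinCoef l (fun ξ => wt lam ξ * h₁ ξ) n *
      Real.sin (wave l n * x) := by
    refine Summable.of_norm_bounded (summable_one_div_add_one_sq.mul_left (C * (M₁ * l)))
      fun n => ?_
    rw [Real.norm_eq_abs, abs_mul, abs_mul]
    have h2 := abs_sinCoef_le hl (hh₁.wt_mul hlam).2 n
    calc _ ≤ (C * (1 / ((n : ℝ) + 1) ^ 2)) * (M₁ * l) * 1 :=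
          mul_le_mul (mul_le_mul (hb n t ht.1.le).1 h2 (abs_nonneg _) (by positivity))
            (Real.abs_sin_le_one _)
            (abs_nonneg _) (mul_nonneg (by positivity) ((abs_nonneg _).trans h2))
      _ = _ := by ring
  have s2 : Summable fun n => km l α ε lam n t * sinCoef l (fun ξ => wt lam ξ * h₀ ξ) n *
      Real.sin (wave l n * x) := by
    refine Summable.of_norm_bounded (hs.mul_left C) fun n => ?_
    rw [Real.norm_eq_abs, abs_mul, abs_mul]
    calc _ ≤ C * |sinCoef l (fun ξ => wt lam ξ * h₀ ξ) n| * 1 :=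
          mul_le_mul (mul_le_mul_of_nonneg_right (hb n t ht.1.le).2.2.1 (abs_nonneg _))
            (Real.abs_sin_le_one _)
            (abs_nonneg _) (by positivity)
      _ = _ := by ring
  have s3 := (hasSum_integral_convolution hl hα hε hlam hf x ht.1).summable
  rw [integralMap, greenConv_operator hl hα hε hlam hh₀ hs x ht.1, hdouble,
    show greenConv l α ε lam h₁ x t = _ from integral_mul_green hl hα hε hlam hh₁ x ht.1.le, Uhat]
  have hsum : ∑' n, ym l α ε lam (sinCoef l fun ξ => wt lam ξ * h₀ ξ)
      (sinCoef l fun ξ => wt lam ξ * h₁ ξ) f n t * Real.sin (wave l n * x) =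
      (∑' n, gm l α ε lam n t * sinCoef l (fun ξ => wt lam ξ * h₁ ξ) n * Real.sin (wave l n * x))
      + (∑' n, km l α ε lam n t * sinCoef l (fun ξ => wt lam ξ * h₀ ξ) n * Real.sin (wave l n * x))
      - ∑' n, (∫ τ in (0 : ℝ)..t, gm l α ε lam n (t - τ) * srcCoef l lam f n τ) *
        Real.sin (wave l n * x) := by
    rw [← s1.tsum_add s2, ← (s1.add s2).tsum_sub s3]
    refine tsum_congr fun n => ?_
    rw [ym]; ring
  rw [hsum]
  ring

end Sol

/-! ### Consequences of the assumptions on the data -/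

section Data

variable {l T α ε lam : ℝ} {h₀ h₁ : ℝ → ℝ} {F : ℝ → ℝ → ℝ → ℝ}

/-- The source `F(x,t,v(x,t))`, frozen in time after `T`. -/
def srcOf (T : ℝ) (F : ℝ → ℝ → ℝ → ℝ) (v : ℝ → ℝ → ℝ) (x t : ℝ) : ℝ := F x (min t T) (v x (min t T))

lemma srcOf_of_le {v : ℝ → ℝ → ℝ} {x t : ℝ} (ht : t ≤ T) : srcOf T F v x t = F x t (v x t) := by
  simp [srcOf, min_eq_left ht]

lemma isSource_srcOf (hT : 0 < T) (hdata : DataAssumption l T h₀ h₁ F) {v : ℝ → ℝ → ℝ} {M B : ℝ}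
    (hc : ContinuousOn (fun p : ℝ × ℝ => v p.1 p.2) (Omega l T))
    (hM : ∀ x t, (x, t) ∈ Omega l T → |v x t| ≤ M)
    (hB : ∀ x t : ℝ, (x, t) ∈ Omega l T → ∀ u : ℝ, |u| ≤ M → |F x t u| ≤ B) :
    IsSource l B (srcOf T F v) := by
  have hmap : MapsTo (fun p : ℝ × ℝ => (p.1, min p.2 T)) (Ioo 0 l ×ˢ Ioi 0) (Omega l T) :=
    fun p hp => ⟨hp.1, lt_min hp.2 hT, min_le_right _ _⟩
  refine ⟨?_, fun x hx t ht => ?_⟩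
  · have h1 : ContinuousOn (fun p : ℝ × ℝ => (p.1, min p.2 T)) (Ioo 0 l ×ˢ Ioi 0) := by fun_prop
    exact hdata.cont_F.comp (h1.prodMk (hc.comp h1 hmap)) fun p hp => ⟨hmap hp, mem_univ _⟩
  · have hm := hmap (show (x, t) ∈ Ioo 0 l ×ˢ Ioi 0 from ⟨hx, ht⟩)
    exact hB _ _ hm _ (hM _ _ hm)

lemma lipschitz_of_bdd_deriv {h : ℝ → ℝ} (hl : 0 < l) (hc : ContinuousOn h (Icc 0 l))
    (hd : ContDiffOn ℝ 1 h (Ioo 0 l)) {B : ℝ} (hB : ∀ x ∈ Ioo 0 l, |deriv h x| ≤ B) :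
    LipschitzOnWith B.toNNReal h (Icc 0 l) := by
  refine lipschitzOnWith_Icc_of_hasDerivAt hc (f' := deriv h) (fun x hx => ?_) fun x hx => ?_
  · exact ((hd.differentiableOn one_ne_zero x hx).differentiableAt
      (Ioo_mem_nhds hx.1 hx.2)).hasDerivAt
  · rw [Real.coe_toNNReal _ ((abs_nonneg _).trans (hB (l / 2) ⟨by linarith, by linarith⟩))]
    exact hB x hx

lemma exists_lipschitz_mul {f g : ℝ → ℝ} {s : Set ℝ} {K L : NNReal} {A B : ℝ}
    (hf : LipschitzOnWith K f s) (hg : LipschitzOnWith L g s) (hA : ∀ x ∈ s, |f x| ≤ A)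
    (hB : ∀ x ∈ s, |g x| ≤ B) :
    LipschitzOnWith (A * L + B * K).toNNReal (fun x => f x * g x) s := by
  refine LipschitzOnWith.of_dist_le_mul fun x hx y hy => ?_
  have h1 := hf.dist_le_mul x hx y hy
  have h2 := hg.dist_le_mul x hx y hy
  rw [Real.dist_eq, Real.dist_eq] at h1 h2
  rw [Real.dist_eq, Real.dist_eq]
  have hd : 0 ≤ |x - y| := abs_nonneg _
  calc |f x * g x - f y * g y| = |f x * (g x - g y) + (f x - f y) * g y| := by ring_nf
    _ ≤ |f x| * |g x - g y| + |f x - f y| * |g y| := by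
      refine (abs_add_le _ _).trans ?_
      rw [abs_mul, abs_mul]
    _ ≤ A * (L * |x - y|) + (K * |x - y|) * B := by
      have := (abs_nonneg _).trans (hA x hx)
      exact add_le_add (mul_le_mul (hA x hx) h2 (abs_nonneg _) this)
        (mul_le_mul h1 (hB y hy) (abs_nonneg _) (by positivity))
    _ = (A * L + B * K) * |x - y| := by ring
    _ ≤ _ := by gcongr; exact Real.le_coe_toNNReal _

lemma lipschitz_wt (hlam : 0 < lam) : LipschitzOnWith (lam / 2).toNNReal (wt lam) (Icc 0 l) := by
  have hd : ∀ x, HasDerivAt (wt lam) (wt lam x * (-(lam / 2) * 1)) x := fun x =>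
    ((hasDerivAt_id x).const_mul _).exp
  refine lipschitzOnWith_Icc_of_hasDerivAt (continuous_wt lam).continuousOn (fun x _ => hd x)
    fun x hx => ?_
  rw [Real.coe_toNNReal _ (by positivity), abs_mul, mul_one, abs_neg,
    abs_of_pos (show 0 < lam / 2 by positivity)]
  have := abs_wt_le hlam hx.1.le
  nlinarith

lemma exists_lipschitz_wt_mul (hlam : 0 < lam) {h : ℝ → ℝ} {K : NNReal}
    (hh : LipschitzOnWith K h (Icc 0 l)) :
    ∃ K' : NNReal, LipschitzOnWith K' (fun x => wt lam x * h x) (Icc 0 l) := by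
  obtain ⟨B, hB⟩ := isCompact_Icc.exists_bound_of_continuousOn hh.continuousOn
  exact ⟨_, exists_lipschitz_mul (lipschitz_wt hlam) hh (fun x hx => abs_wt_le hlam hx.1) hB⟩

lemma summable_sinCoef_of_lipschitz (hl : 0 < l) {h : ℝ → ℝ} {K : NNReal}
    (hh : LipschitzOnWith K h (Icc 0 l)) (h0 : h 0 = 0) (h1 : h l = 0) :
    Summable fun n => |sinCoef l h n| := by
  obtain ⟨A, -, hA⟩ := weighted_sinCoef_le_of_lipschitz hl (q := 0) (by norm_num)
  exact summable_of_weight le_rfl (hA h K hh h0 h1)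

lemma DataAssumption.exists_lipschitz_h₀ (hl : 0 < l) (hdata : DataAssumption l T h₀ h₁ F) :
    ∃ K : NNReal, LipschitzOnWith K h₀ (Icc 0 l) := by
  obtain ⟨B, hB⟩ := hdata.bdd
  exact ⟨_, lipschitz_of_bdd_deriv hl hdata.cont_h₀ hdata.c1_h₀ fun x hx => (hB x hx).2.2.1⟩

lemma DataAssumption.exists_lipschitz_h₁ (hl : 0 < l) (hdata : DataAssumption l T h₀ h₁ F) :
    ∃ K : NNReal, LipschitzOnWith K h₁ (Icc 0 l) := by
  obtain ⟨B, hB⟩ := hdata.bdd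
  exact ⟨_, lipschitz_of_bdd_deriv hl hdata.cont_h₁ hdata.c1_h₁ fun x hx => (hB x hx).2.2.2.2⟩

lemma DataAssumption.exists_bddMeas (hdata : DataAssumption l T h₀ h₁ F) :
    ∃ B, BddMeas l B h₀ ∧ BddMeas l B h₁ := by
  obtain ⟨B, hB⟩ := hdata.bdd
  exact ⟨B, bddMeas_of_continuousOn (hdata.cont_h₀.mono Ioo_subset_Icc_self)
      fun x hx => (hB x hx).1,
    bddMeas_of_continuousOn (hdata.cont_h₁.mono Ioo_subset_Icc_self) fun x hx => (hB x hx).2.1⟩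

lemma DataAssumption.summable_coef (hl : 0 < l) (hlam : 0 < lam)
    (hdata : DataAssumption l T h₀ h₁ F) (h0 : h₀ 0 = 0) (hl0 : h₀ l = 0) :
    Summable fun n => |sinCoef l (fun ξ => wt lam ξ * h₀ ξ) n| := by
  obtain ⟨K, hK⟩ := hdata.exists_lipschitz_h₀ hl
  obtain ⟨K', hK'⟩ := exists_lipschitz_wt_mul hlam hK
  exact summable_sinCoef_of_lipschitz hl hK' (by simp [h0]) (by simp [hl0])

/-! ### The integral map as a contraction -/

lemma extendZero_of_mem (v : BT l T) {x t : ℝ} (h : (x, t) ∈ Omega l T) :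
    extendZero v x t = v ⟨(x, t), h⟩ := by
  simp [extendZero, h]

lemma continuousOn_extendZero (v : BT l T) :
    ContinuousOn (fun p : ℝ × ℝ => extendZero v p.1 p.2) (Omega l T) := by
  rw [continuousOn_iff_continuous_domRestrict]
  have : (Omega l T).domRestrict (fun p : ℝ × ℝ => extendZero v p.1 p.2) = v := by
    funext p
    exact extendZero_of_mem v p.2
  rw [this]
  exact v.continuous

lemma abs_extendZero_le (v : BT l T) {x t : ℝ} (h : (x, t) ∈ Omega l T) :
    |extendZero v x t| ≤ ‖v‖ := by
  rw [extendZero_of_mem v h]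
  exact v.norm_coe_le_norm _

lemma nonempty_Omega (hl : 0 < l) (hT : 0 < T) : Nonempty (Omega l T) :=
  ⟨⟨(l / 2, T), ⟨⟨by simpa using hl, by simpa using hl⟩, hT, le_rfl⟩⟩⟩

lemma DataAssumption.exists_isSource (hT : 0 < T) (hl : 0 < l)
    (hdata : DataAssumption l T h₀ h₁ F) {v : ℝ → ℝ → ℝ} {M : ℝ}
    (hc : ContinuousOn (fun p : ℝ × ℝ => v p.1 p.2) (Omega l T))
    (hM : ∀ x t, (x, t) ∈ Omega l T → |v x t| ≤ M) :
    ∃ B, 0 ≤ B ∧ IsSource l B (srcOf T F v) := by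
  obtain ⟨B, hB⟩ := hdata.bdd_F M
  have h := isSource_srcOf hT hdata hc hM hB
  exact ⟨B, (h.bddMeas zero_lt_one).nonneg hl, h⟩

variable (α ε lam) in
lemma exists_integralMap_operator (hl : 0 < l) (hT : 0 < T) (hα : 0 < α) (hε : 0 < ε)
    (hlam : 0 < lam) (hdata : DataAssumption l T h₀ h₁ F) (h0 : h₀ 0 = 0) (hl0 : h₀ l = 0) :
    ∃ Ψ : BT l T → BT l T, ∀ (v : BT l T) (p : Omega l T),
      Ψ v p = integralMap l α ε lam h₀ h₁ F (extendZero v) p.1.1 p.1.2 := by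
  have key : ∀ v : BT l T, ∃ w : BT l T, ∀ p : Omega l T,
      w p = integralMap l α ε lam h₀ h₁ F (extendZero v) p.1.1 p.1.2 := by
    intro v
    obtain ⟨B₀, hB₀, hB₁⟩ := hdata.exists_bddMeas
    obtain ⟨B, hB, hf⟩ := hdata.exists_isSource hT hl (continuousOn_extendZero v)
      fun x t h => abs_extendZero_le v h
    have hs := hdata.summable_coef hl hlam h0 hl0
    have hd := abs_sinCoef_le hl (hB₁.wt_mul hlam).2
    have heq : ∀ p : Omega l T, integralMap l α ε lam h₀ h₁ F (extendZero v) p.1.1 p.1.2 = _ :=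
      fun p => integralMap_eq hl hα hε hlam hf hB₀ hB₁ hs (T := T) (v := extendZero v) (F := F)
        (fun x _ t ht => (srcOf_of_le ht.2).symm) p.1.1 p.2.2
    obtain ⟨C, hC⟩ := abs_Uhat_le hl hα hε hlam hf hB hs hd T
    have hcont := continuousOn_Uhat hl hα hε hlam hf hB hs hd T
    refine ⟨BoundedContinuousFunction.ofNormedAddCommGroup
      (fun p : Omega l T => integralMap l α ε lam h₀ h₁ F (extendZero v) p.1.1 p.1.2) ?_
      (Real.exp (lam / 2 * l) * C) ?_, fun p => rfl⟩
    · simp_rw [heq]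
      refine Continuous.mul (by fun_prop) ?_
      exact hcont.comp_continuous (f := fun p : Omega l T => p.1) continuous_subtype_val
        fun p => ⟨mem_univ _, p.2.2.1.le, p.2.2.2⟩
    · intro p
      rw [heq, Real.norm_eq_abs, abs_mul, abs_of_pos (Real.exp_pos _)]
      have h1 : Real.exp (lam / 2 * p.1.1) ≤ Real.exp (lam / 2 * l) := by
        have := p.2.1.2.le
        gcongr
      exact mul_le_mul h1 (hC _ _ ⟨p.2.2.1.le, p.2.2.2⟩) (abs_nonneg _) (Real.exp_pos _).le
  choose Ψ hΨ using key
  exact ⟨Ψ, hΨ⟩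

/-- Multiplication by `e^{κt}`. -/
noncomputable def mulExp (κ : ℝ) (v : BT l T) : BT l T :=
  BoundedContinuousFunction.ofNormedAddCommGroup (fun p : Omega l T => Real.exp (κ * p.1.2) * v p)
    (by fun_prop) (Real.exp (|κ| * T) * ‖v‖) (fun p => by
      rw [norm_mul, Real.norm_eq_abs, abs_of_pos (Real.exp_pos _)]
      refine mul_le_mul (Real.exp_le_exp.2 ?_) (v.norm_coe_le_norm _) (norm_nonneg _)
        (Real.exp_pos _).le
      calc κ * p.1.2 ≤ |κ| * p.1.2 := by
            have := p.2.2.1.le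
            gcongr; exact le_abs_self κ
        _ ≤ |κ| * T := by have := p.2.2.2; gcongr)

lemma mulExp_apply (κ : ℝ) (v : BT l T) (p : Omega l T) :
    mulExp κ v p = Real.exp (κ * p.1.2) * v p := rfl

/-- Multiplication by e^{-κt} carries the weighted norm to the sup norm, so the contraction
principle can be applied in the given complete space. -/
lemma weightedNorm_eq (hl : 0 < l) (hT : 0 < T) (κ : ℝ) (v : BT l T) :
    weightedNorm κ v = ‖mulExp (-κ) v‖ := by
  have := nonempty_Omega hl hT
  rw [BoundedContinuousFunction.norm_eq_iSup_norm, weightedNorm]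
  congr 1
  funext p
  rw [mulExp_apply, norm_mul, Real.norm_eq_abs, Real.norm_eq_abs, abs_of_pos (Real.exp_pos _)]

lemma mulExp_mulExp (κ : ℝ) (v : BT l T) : mulExp (-κ) (mulExp κ v) = v := by
  ext p
  rw [mulExp_apply, mulExp_apply, ← mul_assoc, ← Real.exp_add]
  simp

lemma mulExp_mulExp' (κ : ℝ) (v : BT l T) : mulExp κ (mulExp (-κ) v) = v := by
  simpa using mulExp_mulExp (-κ) v

lemma mulExp_sub (κ : ℝ) (v w : BT l T) : mulExp κ (v - w) = mulExp κ v - mulExp κ w := by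
  ext p
  simp [mulExp_apply, mul_sub]

lemma abs_le_weightedNorm (hl : 0 < l) (hT : 0 < T) (κ : ℝ) (v : BT l T) (p : Omega l T) :
    |v p| ≤ Real.exp (κ * p.1.2) * weightedNorm κ v := by
  have h1 := (mulExp (-κ) v).norm_coe_le_norm p
  rw [← weightedNorm_eq hl hT, mulExp_apply, norm_mul, Real.norm_eq_abs, Real.norm_eq_abs,
    abs_of_pos (Real.exp_pos _)] at h1
  calc |v p| = Real.exp (κ * p.1.2) * (Real.exp (-κ * p.1.2) * |v p|) := by
        rw [← mul_assoc, ← Real.exp_add]; simp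
    _ ≤ _ := by gcongr

lemma integral_exp_mul_le {κ t : ℝ} (hκ : 0 < κ) :
    ∫ τ in (0 : ℝ)..t, Real.exp (κ * τ) ≤ Real.exp (κ * t) / κ := by
  have hd : ∀ τ, HasDerivAt (fun τ => Real.exp (κ * τ) / κ) (Real.exp (κ * τ)) τ := fun τ => by
    have h : HasDerivAt (fun τ => Real.exp (κ * τ)) (Real.exp (κ * τ) * (κ * 1)) τ :=
      ((hasDerivAt_id τ).const_mul κ).exp
    convert! h.div_const κ using 1
    field_simp
  rw [intervalIntegral.integral_eq_sub_of_hasDerivAt (fun τ _ => hd τ)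
    (Continuous.intervalIntegrable (by fun_prop) _ _)]
  have : 0 < Real.exp (κ * 0) / κ := by positivity
  linarith

/-- The source difference at time τ is at most |C_F| e^{κτ} times the weighted distance, and ∫_0^t
e^{κτ} dτ ≤ e^{κt}/κ. Since |G_n| ≤ C/(n+1)², summation over n leaves a factor A/κ with A
independent of κ; κ = 2A + 1 makes it at most 1/2. -/
lemma exists_weightedNorm_contraction (hl : 0 < l) (hT : 0 < T) (hα : 0 < α) (hε : 0 < ε)
    (hlam : 0 < lam) (hdata : DataAssumption l T h₀ h₁ F) (h0 : h₀ 0 = 0) (hl0 : h₀ l = 0)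
    {Ψ : BT l T → BT l T} (hΨ : ∀ (v : BT l T) (p : Omega l T),
      Ψ v p = integralMap l α ε lam h₀ h₁ F (extendZero v) p.1.1 p.1.2) :
    ∃ κ : ℝ, 0 ≤ κ ∧ ∀ v w : BT l T,
      weightedNorm κ (Ψ v - Ψ w) ≤ 1 / 2 * weightedNorm κ (v - w) := by
  obtain ⟨C, hC, hb⟩ := exists_mode_bounds hl hα hε hlam
  obtain ⟨C_F, hCF⟩ := hdata.lip_u
  obtain ⟨B₀, hB₀, hB₁⟩ := hdata.exists_bddMeas
  have hs := hdata.summable_coef hl hlam h0 hl0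
  have hd := abs_sinCoef_le hl (hB₁.wt_mul hlam).2
  set S := ∑' n : ℕ, 1 / ((n : ℝ) + 1) ^ 2 with hS
  have hS0 : 0 ≤ S := tsum_nonneg fun _ => by positivity
  set A := Real.exp (lam / 2 * l) * (2 / l * (C * (|C_F| * l) * S)) with hA
  have hA0 : 0 ≤ A := by positivity
  refine ⟨2 * A + 1, by positivity, fun v w => ?_⟩
  set κ := 2 * A + 1 with hκ
  have hκ0 : 0 < κ := by positivity
  set K := weightedNorm κ (v - w) with hK
  have hK0 : 0 ≤ K := by rw [hK, weightedNorm_eq hl hT]; exact norm_nonneg _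
  have hsrc : ∀ v : BT l T, ∃ B, 0 ≤ B ∧ IsSource l B (srcOf T F (extendZero v)) := fun v =>
    hdata.exists_isSource hT hl (continuousOn_extendZero v) fun x t h => abs_extendZero_le v h
  have heq : ∀ (v : BT l T) (p : Omega l T), Ψ v p = Real.exp (lam / 2 * p.1.1) *
      Uhat l α ε lam (sinCoef l fun ξ => wt lam ξ * h₀ ξ) (sinCoef l fun ξ => wt lam ξ * h₁ ξ)
        (srcOf T F (extendZero v)) p.1.1 p.1.2 := fun v p => by
    obtain ⟨B, -, hf⟩ := hsrc v
    rw [hΨ]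
    exact integralMap_eq hl hα hε hlam hf hB₀ hB₁ hs (T := T)
      (fun x _ t ht => (srcOf_of_le ht.2).symm) p.1.1 p.2.2
  obtain ⟨Bv, hBv, hfv⟩ := hsrc v
  obtain ⟨Bw, hBw, hfw⟩ := hsrc w
  have hdiff : ∀ n, ∀ τ ∈ Ioc 0 T, |srcCoef l lam (srcOf T F (extendZero v)) n τ -
      srcCoef l lam (srcOf T F (extendZero w)) n τ| ≤ |C_F| * l * K * Real.exp (κ * τ) := by
    intro n τ hτ
    rw [srcCoef, srcCoef, ← sinCoef_sub hl ((hfv.bddMeas hτ.1).wt_mul hlam)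
      ((hfw.bddMeas hτ.1).wt_mul hlam)]
    refine (abs_sinCoef_le hl (M := |C_F| * (Real.exp (κ * τ) * K)) (fun x hx => ?_) n).trans
      (le_of_eq (by ring))
    have hmem : (x, τ) ∈ Omega l T := ⟨hx, hτ⟩
    rw [← mul_sub, abs_mul, srcOf_of_le hτ.2, srcOf_of_le hτ.2]
    have h1 := hCF x τ hmem (extendZero v x τ) (extendZero w x τ)
    have h2 : |extendZero v x τ - extendZero w x τ| ≤ Real.exp (κ * τ) * K := by
      rw [extendZero_of_mem v hmem, extendZero_of_mem w hmem]
      exact abs_le_weightedNorm hl hT κ (v - w) ⟨(x, τ), hmem⟩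
    calc |wt lam x| * |F x τ (extendZero v x τ) - F x τ (extendZero w x τ)|
        ≤ 1 * (|C_F| * (Real.exp (κ * τ) * K)) := by
          refine mul_le_mul (abs_wt_le hlam hx.1.le) (h1.trans ?_) (abs_nonneg _) zero_le_one
          exact mul_le_mul (le_abs_self _) h2 (abs_nonneg _) (abs_nonneg _)
      _ = _ := one_mul _
  have hmode : ∀ n, ∀ t ∈ Ioc 0 T, |(∫ τ in (0 : ℝ)..t, gm l α ε lam n (t - τ) *
      srcCoef l lam (srcOf T F (extendZero w)) n τ) - ∫ τ in (0 : ℝ)..t, gm l α ε lam n (t - τ) *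
      srcCoef l lam (srcOf T F (extendZero v)) n τ| ≤
      C * (|C_F| * l * K * (Real.exp (κ * t) / κ)) * (1 / ((n : ℝ) + 1) ^ 2) := by
    intro n t ht
    have hi : ∀ {B : ℝ} {f : ℝ → ℝ → ℝ}, IsSource l B f → IntervalIntegrable (fun τ =>
        gm l α ε lam n (t - τ) * srcCoef l lam f n τ) volume 0 t := fun hf =>
      (intervalIntegrable_of_continuousOn_Ioi (hf.continuousOn_srcCoef hl hlam n)
        (fun t ht => hf.abs_srcCoef_le hl hlam n ht) le_rfl ht.1.le).continuousOn_mul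
        ((continuous_gm l α ε lam n).comp (by fun_prop)).continuousOn
    rw [← intervalIntegral.integral_sub (hi hfw) (hi hfv), ← Real.norm_eq_abs]
    have h1 : ∀ τ ∈ Ioc 0 t, ‖gm l α ε lam n (t - τ) *
        srcCoef l lam (srcOf T F (extendZero w)) n τ - gm l α ε lam n (t - τ) *
        srcCoef l lam (srcOf T F (extendZero v)) n τ‖ ≤
        C * (1 / ((n : ℝ) + 1) ^ 2) * (|C_F| * l * K) * Real.exp (κ * τ) := by
      intro τ hτ
      rw [← mul_sub, norm_mul, Real.norm_eq_abs, Real.norm_eq_abs, abs_sub_comm (srcCoef _ _ _ _ _)]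
      refine (mul_le_mul (hb n (t - τ) (by linarith [hτ.2])).1
        (hdiff n τ ⟨hτ.1, hτ.2.trans ht.2⟩) (abs_nonneg _) (by positivity)).trans
        (le_of_eq (by ring))
    refine (intervalIntegral.norm_integral_le_of_norm_le ht.1.le
      (Eventually.of_forall h1) (Continuous.intervalIntegrable (by fun_prop) _ _)).trans ?_
    rw [intervalIntegral.integral_const_mul]
    calc _ ≤ C * (1 / ((n : ℝ) + 1) ^ 2) * (|C_F| * l * K) * (Real.exp (κ * t) / κ) := by
          gcongr; exact integral_exp_mul_le hκ0
      _ = _ := by ring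
  rw [weightedNorm_eq hl hT, BoundedContinuousFunction.norm_le (by positivity)]
  intro p
  set x := p.1.1
  set t := p.1.2
  have ht : t ∈ Ioc 0 T := p.2.2
  rw [mulExp_apply, BoundedContinuousFunction.sub_apply, heq v p, heq w p, ← mul_sub]
  have hU : |Uhat l α ε lam (sinCoef l fun ξ => wt lam ξ * h₀ ξ)
      (sinCoef l fun ξ => wt lam ξ * h₁ ξ) (srcOf T F (extendZero v)) x t -
      Uhat l α ε lam (sinCoef l fun ξ => wt lam ξ * h₀ ξ)
      (sinCoef l fun ξ => wt lam ξ * h₁ ξ) (srcOf T F (extendZero w)) x t| ≤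
      2 / l * (C * (|C_F| * l * K * (Real.exp (κ * t) / κ)) * S) := by
    have htm : (x, t) ∈ (univ : Set ℝ) ×ˢ Icc 0 T := ⟨mem_univ _, ht.1.le, ht.2⟩
    have s1 := (unifSum_ym hl hα hε hlam hfv hBv hs hd T).summable htm
    have s2 := (unifSum_ym hl hα hε hlam hfw hBw hs hd T).summable htm
    rw [Uhat, Uhat, ← mul_sub, ← s1.tsum_sub s2, abs_mul, abs_of_pos (show 0 < 2 / l by positivity)]
    refine mul_le_mul_of_nonneg_left ?_ (by positivity)
    rw [hS, ← Real.norm_eq_abs]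
    refine tsum_of_norm_bounded (summable_one_div_add_one_sq.hasSum.mul_left _) fun n => ?_
    rw [← sub_mul, norm_mul, Real.norm_eq_abs, Real.norm_eq_abs]
    have h1 := hmode n t ht
    refine (mul_le_mul (le_trans (le_of_eq ?_) h1) (Real.abs_sin_le_one _) (abs_nonneg _)
      ((abs_nonneg _).trans h1)).trans (le_of_eq (mul_one _))
    rw [ym, ym]; congr 1; ring
  have hx : Real.exp (lam / 2 * x) ≤ Real.exp (lam / 2 * l) := by
    have : x ≤ l := p.2.1.2.le
    gcongr
  rw [norm_mul, norm_mul, Real.norm_eq_abs, Real.norm_eq_abs, Real.norm_eq_abs,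
    abs_of_pos (Real.exp_pos _), abs_of_pos (Real.exp_pos _)]
  calc Real.exp (-κ * t) * (Real.exp (lam / 2 * x) * _)
      ≤ Real.exp (-κ * t) * (Real.exp (lam / 2 * l) *
        (2 / l * (C * (|C_F| * l * K * (Real.exp (κ * t) / κ)) * S))) := by gcongr
    _ = (Real.exp (-κ * t) * Real.exp (κ * t)) * (A / κ * K) := by rw [hA]; ring
    _ = A / κ * K := by rw [← Real.exp_add]; simp
    _ ≤ 1 / 2 * K := by
      refine mul_le_mul_of_nonneg_right ?_ hK0
      rw [div_le_div_iff₀ hκ0 two_pos]; linarith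

/-- A contraction for a weighted norm has exactly one fixed point. -/
lemma exists_fixedPoint (hl : 0 < l) (hT : 0 < T) {Ψ : BT l T → BT l T} {κ : ℝ}
    (h : ∀ v w : BT l T, weightedNorm κ (Ψ v - Ψ w) ≤ 1 / 2 * weightedNorm κ (v - w)) :
    ∃ U : BT l T, Ψ U = U ∧ ∀ V : BT l T, Ψ V = V → V = U := by
  set Φ : BT l T → BT l T := fun v => mulExp (-κ) (Ψ (mulExp κ v)) with hΦ
  have hcon : ContractingWith (1 / 2) Φ := by
    refine ⟨by rw [← NNReal.coe_lt_coe]; norm_num, LipschitzWith.of_dist_le_mul fun v w => ?_⟩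
    rw [dist_eq_norm, dist_eq_norm, hΦ, ← mulExp_sub, ← weightedNorm_eq hl hT]
    refine (h _ _).trans (le_of_eq ?_)
    rw [weightedNorm_eq hl hT, ← mulExp_sub, mulExp_mulExp]
    norm_num
  have hfix : Φ hcon.fixedPoint = hcon.fixedPoint := hcon.fixedPoint_isFixedPt
  refine ⟨mulExp κ hcon.fixedPoint, ?_, fun V hV => ?_⟩
  · have h1 := congrArg (mulExp κ) hfix
    simpa only [hΦ, mulExp_mulExp'] using h1
  · have h1 : Φ (mulExp (-κ) V) = mulExp (-κ) V := by simp only [hΦ, mulExp_mulExp', hV]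
    have h2 : mulExp (-κ) V = hcon.fixedPoint := hcon.fixedPoint_unique h1
    rw [← h2, mulExp_mulExp']

end Data

/-! ### Test functions vanishing near the boundary -/

section Test

variable {l lam : ℝ} {n : ℕ}

/-- The weighted sine wave on `[a, l - a]`, extended by zero. -/
noncomputable def testFn (l lam : ℝ) (n : ℕ) (a x : ℝ) : ℝ :=
  -- The truncation freezes the argument of the sine at 0 on the left of a and at (n+1)π on the
  -- right of l - a, so the zero extension is continuous.
  wt lam x * Real.sin ((n + 1) * Real.pi / (l - 2 * a) * max 0 (min (x - a) (l - 2 * a)))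

lemma continuous_testFn (a : ℝ) : Continuous (testFn l lam n a) := by
  have := continuous_wt lam
  unfold testFn
  fun_prop

lemma abs_testFn_le (hlam : 0 < lam) (a : ℝ) {x : ℝ} (hx : 0 ≤ x) : |testFn l lam n a x| ≤ 1 := by
  rw [testFn, abs_mul]
  exact mul_le_one₀ (abs_wt_le hlam hx) (abs_nonneg _) (Real.abs_sin_le_one _)

lemma testFn_eq {a x : ℝ} (hx : x ∈ Icc a (l - a)) : testFn l lam n a x =
    wt lam x * Real.sin ((n + 1) * Real.pi / (l - 2 * a) * (x - a)) := by
  rw [testFn, min_eq_left (by linarith [hx.2]), max_eq_right (by linarith [hx.1])]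

lemma testFn_eq_zero_of_le {a x : ℝ} (hx : x ≤ a) : testFn l lam n a x = 0 := by
  have : max 0 (min (x - a) (l - 2 * a)) = 0 :=
    max_eq_left ((min_le_left _ _).trans (by linarith))
  simp [testFn, this]

lemma testFn_eq_zero_of_ge {a x : ℝ} (ha : 2 * a < l) (hx : l - a ≤ x) :
    testFn l lam n a x = 0 := by
  have h : max 0 (min (x - a) (l - 2 * a)) = l - 2 * a := by
    rw [min_eq_right (by linarith), max_eq_right (by linarith)]
  rw [testFn, h, div_mul_cancel₀ _ (by linarith : l - 2 * a ≠ 0)]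
  have := Real.sin_nat_mul_pi (n + 1)
  push_cast at this
  rw [this, mul_zero]

lemma tendsto_testFn (hl : 0 < l) {x : ℝ} (hx : x ∈ Ioo 0 l) :
    Tendsto (fun a => testFn l lam n a x) (𝓝[>] 0) (𝓝 (wt lam x * Real.sin (wave l n * x))) := by
  have h : ContinuousAt (fun a => testFn l lam n a x) 0 := by
    unfold testFn
    refine continuousAt_const.mul (Real.continuous_sin.continuousAt.comp ?_)
    refine ContinuousAt.mul (ContinuousAt.div continuousAt_const (by fun_prop) ?_) (by fun_prop)
    simpa using hl.ne'
  have h0 : testFn l lam n 0 x = wt lam x * Real.sin (wave l n * x) := by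
    rw [testFn_eq (by simpa using Ioo_subset_Icc_self hx), wave_eq]
    simp [mul_div_assoc]
  rw [← h0]
  exact h.mono_left nhdsWithin_le_nhds

lemma tendsto_integral_testFn (hl : 0 < l) (hlam : 0 < lam) {M : ℝ} {g : ℝ → ℝ}
    (hg : BddMeas l M g) :
    Tendsto (fun a => ∫ x in (0 : ℝ)..l, g x * testFn l lam n a x) (𝓝[>] 0)
      (𝓝 (sinCoef l (fun x => wt lam x * g x) n)) := by
  refine intervalIntegral.tendsto_integral_filter_of_dominated_convergence (fun _ => M) ?_ ?_
    (by simp) ?_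
  · refine Eventually.of_forall fun a => ?_
    rw [uIoc_of_le hl.le]
    exact hg.1.mul (continuous_testFn a).aestronglyMeasurable
  · refine Eventually.of_forall fun a => ?_
    rw [uIoc_of_le hl.le]
    refine (ae_restrict_iff' measurableSet_Ioc).1 (ae_Ioc_of_Ioo fun x hx => ?_)
    rw [Real.norm_eq_abs, abs_mul]
    have := hg.2 x hx
    nlinarith [abs_testFn_le (l := l) (n := n) hlam a hx.1.le, abs_nonneg (g x)]
  · rw [uIoc_of_le hl.le]
    refine (ae_restrict_iff' measurableSet_Ioc).1 (ae_Ioc_of_Ioo fun x hx => ?_)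
    convert! (tendsto_testFn (lam := lam) (n := n) hl hx).const_mul (g x) using 2
    ring

lemma integral_mul_testFn (hl : 0 < l) {a : ℝ} (ha : 0 < a) (ha2 : 2 * a < l) {M : ℝ}
    {g : ℝ → ℝ} (hg : BddMeas l M g) (hlam : 0 < lam) :
    ∫ x in (0 : ℝ)..l, g x * testFn l lam n a x =
      ∫ x in a..(l - a), g x * testFn l lam n a x := by
  have hi : IntervalIntegrable (fun x => g x * testFn l lam n a x) volume 0 l :=
    (hg.mul hl (bddMeas_of_continuousOn (continuous_testFn a).continuousOn
      fun x hx => abs_testFn_le hlam a hx.1.le)).intervalIntegrable hl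
  have hsub : ∀ {c d : ℝ}, 0 ≤ c → c ≤ d → d ≤ l →
      IntervalIntegrable (fun x => g x * testFn l lam n a x) volume c d := fun h0 h1 h2 =>
    hi.mono_set (by rw [uIcc_of_le h1, uIcc_of_le hl.le]; exact Icc_subset_Icc h0 h2)
  have z1 : ∫ x in (0 : ℝ)..a, g x * testFn l lam n a x = 0 := by
    rw [intervalIntegral.integral_congr (g := fun _ => (0 : ℝ)), intervalIntegral.integral_zero]
    intro x hx
    rw [uIcc_of_le ha.le] at hx
    simp [testFn_eq_zero_of_le hx.2]
  have z2 : ∫ x in (l - a)..l, g x * testFn l lam n a x = 0 := by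
    rw [intervalIntegral.integral_congr (g := fun _ => (0 : ℝ)), intervalIntegral.integral_zero]
    intro x hx
    rw [uIcc_of_le (by linarith)] at hx
    simp [testFn_eq_zero_of_ge ha2 hx.1]
  rw [← intervalIntegral.integral_add_adjacent_intervals (hsub le_rfl ha.le (by linarith))
    (hsub ha.le (by linarith) le_rfl), z1, zero_add,
    ← intervalIntegral.integral_add_adjacent_intervals (b := l - a)
    (hsub ha.le (by linarith) (by linarith)) (hsub (by linarith) (by linarith) le_rfl), z2, add_zero]

/-- Integration by parts of the spatial operator against a test function. -/
lemma integral_operator_testFn {a : ℝ} (ha2 : 2 * a < l) {z z' z'' : ℝ → ℝ}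
    (hz : ∀ x ∈ Icc a (l - a), HasDerivAt z (z' x) x)
    (hz' : ∀ x ∈ Icc a (l - a), HasDerivAt z' (z'' x) x) (hc : ContinuousOn z'' (Icc a (l - a))) :
    ∫ x in a..(l - a), (z'' x - lam * z' x) * testFn l lam n a x =
      -(((n + 1) * Real.pi / (l - 2 * a)) ^ 2 + lam ^ 2 / 4) *
        (∫ x in a..(l - a), z x * testFn l lam n a x)
      + ((n + 1) * Real.pi / (l - 2 * a)) * (wt lam a * z a - (-1) ^ (n + 1) * wt lam (l - a) *
        z (l - a)) := by
  set k := (n + 1) * Real.pi / (l - 2 * a) with hk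
  have hle : a ≤ l - a := by linarith
  have hwt : ∀ x, HasDerivAt (wt lam) (-(lam / 2) * wt lam x) x := fun x => by
    convert! ((hasDerivAt_id x).const_mul (-(lam / 2))).exp using 1
    simp [wt]; ring
  have hs : ∀ x, HasDerivAt (fun x => Real.sin (k * (x - a))) (k * Real.cos (k * (x - a))) x :=
    fun x => by
      convert! (((hasDerivAt_id x).sub_const a).const_mul k).sin using 1
      simp; ring
  have hco : ∀ x, HasDerivAt (fun x => Real.cos (k * (x - a))) (-k * Real.sin (k * (x - a))) x :=
    fun x => by
      convert! (((hasDerivAt_id x).sub_const a).const_mul k).cos using 1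
      simp; ring
  have hzc : ContinuousOn z (Icc a (l - a)) := fun x hx => (hz x hx).continuousAt.continuousWithinAt
  have hzc' : ContinuousOn z' (Icc a (l - a)) :=
    fun x hx => (hz' x hx).continuousAt.continuousWithinAt
  -- Lagrange's identity: the weighted sine is an eigenfunction of the adjoint ∂_xx + λ∂_x with
  -- eigenvalue -(k² + λ²/4). At a and l - a the sine vanishes, so of the boundary terms only those
  -- with z and the cosine survive, and none with z'.
  have hft := intervalIntegral.integral_eq_sub_of_hasDerivAt (a := a) (b := l - a)
    (f := fun x => wt lam x * (z' x * Real.sin (k * (x - a)) - lam / 2 * z x * Real.sin (k * (x - a))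
      - k * z x * Real.cos (k * (x - a))))
    (f' := fun x => (z'' x - lam * z' x) * testFn l lam n a x +
      (k ^ 2 + lam ^ 2 / 4) * (z x * testFn l lam n a x)) (fun x hx => by
      rw [uIcc_of_le hle] at hx
      rw [testFn_eq hx]
      refine ((hwt x).mul ((((hz' x hx).mul (hs x)).sub
        (((hz x hx).const_mul (lam / 2)).mul (hs x))).sub
        (((hz x hx).const_mul k).mul (hco x)))).congr_deriv ?_
      rw [← hk]
      simp
      ring) (by
      refine ContinuousOn.intervalIntegrable ?_
      rw [uIcc_of_le hle]
      have := (continuous_testFn (l := l) (lam := lam) (n := n) a).continuousOn (s := Icc a (l - a))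
      fun_prop)
  have i1 : IntervalIntegrable (fun x => (z'' x - lam * z' x) * testFn l lam n a x) volume a (l - a) := by
    refine ContinuousOn.intervalIntegrable ?_
    rw [uIcc_of_le hle]
    have := (continuous_testFn (l := l) (lam := lam) (n := n) a).continuousOn (s := Icc a (l - a))
    fun_prop
  have i2 : IntervalIntegrable (fun x => z x * testFn l lam n a x) volume a (l - a) := by
    refine ContinuousOn.intervalIntegrable ?_
    rw [uIcc_of_le hle]
    have := (continuous_testFn (l := l) (lam := lam) (n := n) a).continuousOn (s := Icc a (l - a))
    fun_prop
  rw [intervalIntegral.integral_add i1 (i2.const_mul _), intervalIntegral.integral_const_mul] at hft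
  have e1 : k * (l - a - a) = ((n + 1 : ℕ) : ℝ) * Real.pi := by
    rw [hk]; push_cast
    have : l - 2 * a ≠ 0 := by linarith
    field_simp
    ring
  simp only [e1, Real.sin_nat_mul_pi, Real.cos_nat_mul_pi, sub_self, mul_zero, Real.sin_zero,
    Real.cos_zero, mul_one] at hft
  linear_combination hft

end Test

/-! ### Modes of a regular solution -/

section Regular

variable {l T α ε lam : ℝ} {h₀ h₁ : ℝ → ℝ} {F : ℝ → ℝ → ℝ → ℝ} {w : ℝ → ℝ → ℝ}

lemma mem_VelocityRect_of_pos {x t : ℝ} (hx : x ∈ Icc 0 l) (ht : t ∈ Ioc 0 T) :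
    (x, t) ∈ VelocityRect l T h₁ :=
  ⟨⟨hx, ht.1.le, ht.2⟩, fun h => absurd h ht.1.ne'⟩

lemma mem_VelocityRect_of_interior {x t : ℝ} (hx : x ∈ Ioo 0 l) (ht : t ∈ Icc 0 T) :
    (x, t) ∈ VelocityRect l T h₁ :=
  ⟨⟨Ioo_subset_Icc_self hx, ht⟩, fun _ h => (h.elim hx.1.ne' hx.2.ne).elim⟩

namespace IsRegularSolution

variable (hw : IsRegularSolution l T α ε lam h₀ h₁ F w)
include hw

lemma hasDerivWithinAt_t {x t : ℝ} (h : (x, t) ∈ VelocityRect l T h₁) :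
    HasDerivWithinAt (fun s => w x s) (dt T w x t) (Icc 0 T) t := (hw.diff_t x t h).hasDerivWithinAt

lemma hasDerivAt_t {x t : ℝ} (hx : x ∈ Ioo 0 l) (ht : t ∈ Ioo 0 T) :
    HasDerivAt (fun s => w x s) (dt T w x t) t :=
  (hw.hasDerivWithinAt_t (mem_VelocityRect_of_interior hx (Ioo_subset_Icc_self ht))).hasDerivAt
    (Icc_mem_nhds ht.1 ht.2)

lemma hasDerivAt_tt {x t : ℝ} (hx : x ∈ Ioo 0 l) (ht : t ∈ Ioo 0 T) :
    HasDerivAt (fun s => dt T w x s) (dt T (dt T w) x t) t :=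
  ((hw.diff_tt x t ⟨hx, ht.1, ht.2.le⟩).hasDerivWithinAt).hasDerivAt (Icc_mem_nhds ht.1 ht.2)

lemma exists_bound (hdata : DataAssumption l T h₀ h₁ F) :
    ∃ B, ∀ x ∈ Ioo 0 l, ∀ t ∈ Icc 0 T, |w x t| ≤ B ∧ |dt T w x t| ≤ B := by
  obtain ⟨A, hA⟩ := (isCompact_Icc.prod isCompact_Icc : IsCompact (ClosedRect l T)).exists_bound_of_continuousOn hw.cont
  obtain ⟨B, hB⟩ := hw.bdd_t
  obtain ⟨C, hC⟩ := hdata.bdd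
  refine ⟨max A (max B C), fun x hx t ht => ⟨?_, ?_⟩⟩
  · exact (hA (x, t) ⟨Ioo_subset_Icc_self hx, ht⟩).trans (le_max_left _ _)
  · rcases eq_or_lt_of_le ht.1 with h | h
    · subst h
      rw [hw.init_velocity x (mem_VelocityRect_of_interior hx ht)]
      exact (hC x hx).2.1.trans ((le_max_right _ _).trans (le_max_right _ _))
    · exact (hB x t ⟨hx, h, ht.2⟩).trans ((le_max_left _ _).trans (le_max_right _ _))

lemma continuousOn_relaxed :
    ContinuousOn (fun p : ℝ × ℝ => relaxed T ε w p.1 p.2) (Icc 0 l ×ˢ Ioc 0 T) := by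
  have h1 := hw.cont_t.mono fun (p : ℝ × ℝ) (hp : p ∈ Icc 0 l ×ˢ Ioc 0 T) =>
    mem_VelocityRect_of_pos (h₁ := h₁) hp.1 hp.2
  have h2 := hw.cont.mono fun (p : ℝ × ℝ) (hp : p ∈ Icc 0 l ×ˢ Ioc 0 T) =>
    (⟨hp.1, hp.2.1.le, hp.2.2⟩ : p ∈ ClosedRect l T)
  exact (continuousOn_const.mul h1).add h2

lemma relaxed_boundary {t : ℝ} (ht : t ∈ Ioc 0 T) :
    relaxed T ε w 0 t = 0 ∧ relaxed T ε w l t = 0 := by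
  have key : ∀ x, (∀ s ∈ Ioc 0 T, w x s = 0) → relaxed T ε w x t = 0 := by
    intro x hx
    have h1 : dt T w x t = 0 := by
      have h2 : (fun s => w x s) =ᶠ[𝓝[Icc 0 T] t] fun _ => 0 := by
        filter_upwards [self_mem_nhdsWithin, mem_nhdsWithin_of_mem_nhds (Ioi_mem_nhds ht.1)]
          with s hs hs' using hx s ⟨hs', hs.2⟩
      rw [dt, h2.derivWithin_eq (hx t ht)]
      simp
    rw [relaxed, h1, hx t ht]; simp
  exact ⟨key 0 fun s hs => (hw.boundary s hs).1, key l fun s hs => (hw.boundary s hs).2⟩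

/-- The equation tested on `[a, l - a]`. -/
lemma test_identity (hl : 0 < l) (hlam : 0 < lam) (hdata : DataAssumption l T h₀ h₁ F) (n : ℕ)
    {a : ℝ} (ha : 0 < a) (ha2 : 2 * a < l) {s t : ℝ} (hs : 0 < s) (hst : s ≤ t) (ht : t ≤ T) :
    (∫ x in (0 : ℝ)..l, (dt T w x t + α * w x t) * testFn l lam n a x)
      - (∫ x in (0 : ℝ)..l, (dt T w x s + α * w x s) * testFn l lam n a x) =
    ∫ τ in s..t, (-(((n + 1) * Real.pi / (l - 2 * a)) ^ 2 + lam ^ 2 / 4) *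
        (∫ x in (0 : ℝ)..l, relaxed T ε w x τ * testFn l lam n a x)
      - (∫ x in (0 : ℝ)..l, srcOf T F w x τ * testFn l lam n a x)
      + ((n + 1) * Real.pi / (l - 2 * a)) * (wt lam a * relaxed T ε w a τ -
        (-1) ^ (n + 1) * wt lam (l - a) * relaxed T ε w (l - a) τ)) := by
  obtain ⟨B, hB⟩ := hw.exists_bound hdata
  obtain ⟨C, hC, hf⟩ := hdata.exists_isSource (v := w) (M := B) (hs.trans_le (hst.trans ht)) hl
    (hw.cont.mono fun p hp => ⟨Ioo_subset_Icc_self hp.1, hp.2.1.le, hp.2.2⟩)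
    fun x t h => (hB x h.1 t ⟨h.2.1.le, h.2.2⟩).1
  have hle : a ≤ l - a := by linarith
  have hIoo : ∀ {x}, x ∈ Icc a (l - a) → x ∈ Ioo 0 l := fun hx =>
    ⟨ha.trans_le hx.1, by linarith [hx.2]⟩
  have hφ := continuous_testFn (l := l) (lam := lam) (n := n) a
  have hcv : ContinuousOn (fun p : ℝ × ℝ => dt T w p.1 p.2) (Ioo 0 l ×ˢ Icc 0 T) :=
    hw.cont_t.mono fun p hp => mem_VelocityRect_of_interior hp.1 hp.2
  have hcw : ContinuousOn (fun p : ℝ × ℝ => w p.1 p.2) (Ioo 0 l ×ˢ Icc 0 T) :=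
    hw.cont.mono fun p hp => ⟨Ioo_subset_Icc_self hp.1, hp.2⟩
  have hslice : ∀ {g : ℝ → ℝ → ℝ} {S : Set ℝ}, ContinuousOn (fun p : ℝ × ℝ => g p.1 p.2)
      (Ioo 0 l ×ˢ S) → ∀ τ ∈ S, ContinuousOn (fun x => g x τ) (Ioo 0 l) := fun hg τ hτ =>
    hg.comp (f := fun x => (x, τ)) (by fun_prop) fun x hx => ⟨hx, hτ⟩
  have hslice' : ∀ {g : ℝ → ℝ → ℝ} {S : Set ℝ}, ContinuousOn (fun p : ℝ × ℝ => g p.1 p.2)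
      (Ioo 0 l ×ˢ S) → ∀ x ∈ Ioo 0 l, ContinuousOn (fun τ => g x τ) S := fun hg x hx =>
    hg.comp (f := fun τ => (x, τ)) (by fun_prop) fun τ hτ => ⟨hx, hτ⟩
  have hQm : ∀ τ ∈ Icc 0 T, BddMeas l (B + |α| * B) (fun x => dt T w x τ + α * w x τ) :=
    fun τ hτ => bddMeas_of_continuousOn
      ((hslice hcv τ hτ).add ((hslice hcw τ hτ).const_smul α)) fun x hx => by
      refine (abs_add_le _ _).trans (add_le_add (hB x hx τ hτ).2 ?_)
      rw [abs_mul]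
      exact mul_le_mul_of_nonneg_left (hB x hx τ hτ).1 (abs_nonneg _)
  have hzm : ∀ τ ∈ Ioc 0 T, BddMeas l (|ε| * B + B) (fun x => relaxed T ε w x τ) := fun τ hτ =>
    bddMeas_of_continuousOn (hslice (hw.continuousOn_relaxed.mono
      (prod_mono_left Ioo_subset_Icc_self)) τ hτ) fun x hx => by
      have hτ' := Ioc_subset_Icc_self hτ
      refine (abs_add_le _ _).trans (add_le_add ?_ (hB x hx τ hτ').1)
      rw [abs_mul]
      exact mul_le_mul_of_nonneg_left (hB x hx τ hτ').2 (abs_nonneg _)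
  set G : ℝ → ℝ → ℝ := fun x τ => dt T (dt T w) x τ + α * dt T w x τ with hG
  have hGc : ContinuousOn (fun p : ℝ × ℝ => G p.1 p.2) (Ioo 0 l ×ˢ Ioc 0 T) :=
    ContinuousOn.add hw.cont_tt
      (continuousOn_const.mul (hcv.mono (prod_mono_right Ioc_subset_Icc_self)))
  have hinner : ∀ τ ∈ Ioc 0 T, ∫ x in a..(l - a), G x τ * testFn l lam n a x =
      -(((n + 1) * Real.pi / (l - 2 * a)) ^ 2 + lam ^ 2 / 4) *
        (∫ x in (0 : ℝ)..l, relaxed T ε w x τ * testFn l lam n a x)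
      - (∫ x in (0 : ℝ)..l, srcOf T F w x τ * testFn l lam n a x)
      + ((n + 1) * Real.pi / (l - 2 * a)) * (wt lam a * relaxed T ε w a τ -
        (-1) ^ (n + 1) * wt lam (l - a) * relaxed T ε w (l - a) τ) := by
    intro τ hτ
    have h1 := integral_operator_testFn (lam := lam) (n := n) ha2
      (z := fun x => relaxed T ε w x τ) (z' := fun x => dx (relaxed T ε w) x τ)
      (z'' := fun x => dx (dx (relaxed T ε w)) x τ)
      (fun x hx => (hw.diff_x x τ ⟨hIoo hx, hτ⟩).hasDerivAt)
      (fun x hx => (hw.diff_xx x τ ⟨hIoo hx, hτ⟩).hasDerivAt)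
      ((hslice hw.cont_xx τ hτ).mono fun x hx => hIoo hx)
    rw [integral_mul_testFn hl ha ha2 (hzm τ hτ) hlam,
      integral_mul_testFn hl ha ha2 (hf.bddMeas hτ.1) hlam]
    have hi : ∀ {g : ℝ → ℝ}, ContinuousOn g (Ioo 0 l) →
        IntervalIntegrable (fun x => g x * testFn l lam n a x) volume a (l - a) := fun hg => by
      refine ContinuousOn.intervalIntegrable ?_
      rw [uIcc_of_le hle]
      exact (hg.mono fun x hx => hIoo hx).mul hφ.continuousOn
    have h2 : ∫ x in a..(l - a), G x τ * testFn l lam n a x =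
        (∫ x in a..(l - a), (dx (dx (relaxed T ε w)) x τ - lam * dx (relaxed T ε w) x τ) *
          testFn l lam n a x) - ∫ x in a..(l - a), srcOf T F w x τ * testFn l lam n a x := by
      rw [← intervalIntegral.integral_sub]
      · refine intervalIntegral.integral_congr fun x hx => ?_
        rw [uIcc_of_le hle] at hx
        simp only [hG]
        rw [srcOf_of_le hτ.2, ← hw.equation x τ ⟨hIoo hx, hτ⟩]
        ring
      · exact hi ((hslice hw.cont_xx τ hτ).sub
          (continuousOn_const.mul (hslice hw.cont_x τ hτ)))
      · exact hi (hf.cont.comp (f := fun x => (x, τ)) (by fun_prop) fun x hx => ⟨hx, hτ.1⟩)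
    rw [h2, h1]
    ring
  have hst' : ∀ {τ}, τ ∈ Icc s t → τ ∈ Ioc 0 T := fun hτ =>
    ⟨hs.trans_le hτ.1, hτ.2.trans ht⟩
  have hR : ∫ τ in s..t, ∫ x in a..(l - a), G x τ * testFn l lam n a x = _ :=
    intervalIntegral.integral_congr fun τ hτ => hinner τ (hst' (by rwa [uIcc_of_le hst] at hτ))
  rw [← hR]
  have hsT : s ∈ Icc 0 T := ⟨hs.le, hst.trans ht⟩
  have htT : t ∈ Icc 0 T := ⟨hs.le.trans hst, ht⟩
  rw [integral_mul_testFn hl ha ha2 (hQm t htT) hlam, integral_mul_testFn hl ha ha2 (hQm s hsT) hlam]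
  -- The rectangle [s, t] × [a, l - a] is compact in Ω_T. With s = 0 or a = 0 nothing would be known
  -- about the integrability of u_tt.
  have hint : IntegrableOn (Function.uncurry fun τ x => G x τ * testFn l lam n a x)
      (uIoc s t ×ˢ uIoc a (l - a)) := by
    refine IntegrableOn.mono_set (t := Icc s t ×ˢ Icc a (l - a))
      (ContinuousOn.integrableOn_compact (isCompact_Icc.prod isCompact_Icc) ?_) ?_
    · have h3 : ContinuousOn (fun p : ℝ × ℝ => G p.2 p.1) (Icc s t ×ˢ Icc a (l - a)) :=
        hGc.comp (f := fun p : ℝ × ℝ => (p.2, p.1)) (by fun_prop)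
          fun p hp => ⟨hIoo hp.2, hst' hp.1⟩
      exact h3.mul (hφ.comp continuous_snd).continuousOn
    · rw [uIoc_of_le hst, uIoc_of_le hle]
      exact prod_mono Ioc_subset_Icc_self Ioc_subset_Icc_self
  rw [intervalIntegral_intervalIntegral_swap hint, ← intervalIntegral.integral_sub]
  · refine intervalIntegral.integral_congr fun x hx => ?_
    rw [uIcc_of_le hle] at hx
    have hx' := hIoo hx
    rw [intervalIntegral.integral_mul_const, intervalIntegral.integral_eq_sub_of_hasDerivAt_of_le hst
      (f := fun τ => dt T w x τ + α * w x τ) (f' := fun τ => G x τ)]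
    · ring
    · exact ((hslice' hcv x hx').add (continuousOn_const.mul (hslice' hcw x hx'))).mono
        (Icc_subset_Icc hs.le ht)
    · intro τ hτ
      have hτ' : τ ∈ Ioo 0 T := ⟨hs.trans hτ.1, hτ.2.trans_le ht⟩
      exact (hw.hasDerivAt_tt hx' hτ').add ((hw.hasDerivAt_t hx' hτ').const_mul α)
    · refine ContinuousOn.intervalIntegrable ?_
      rw [uIcc_of_le hst]
      exact (hslice' hGc x hx').mono fun τ hτ => hst' hτ
  all_goals
    refine ContinuousOn.intervalIntegrable ?_
    rw [uIcc_of_le hle]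
    refine ContinuousOn.mul ?_ hφ.continuousOn
    refine ContinuousOn.mono ?_ fun x hx => hIoo hx
  · exact (hslice hcv t htT).add (continuousOn_const.mul (hslice hcw t htT))
  · exact (hslice hcv s hsT).add (continuousOn_const.mul (hslice hcw s hsT))

end IsRegularSolution

end Regular

/-! ### The mode identity on the whole interval, as the test interval grows to (0, l) -/

section Regular

variable {l T α ε lam : ℝ} {h₀ h₁ : ℝ → ℝ} {F : ℝ → ℝ → ℝ → ℝ} {w : ℝ → ℝ → ℝ}

lemma srcCoef_add_smul (hl : 0 < l) (hlam : 0 < lam) {M N : ℝ} {f g : ℝ → ℝ → ℝ} {t : ℝ}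
    (hf : BddMeas l M fun x => f x t) (hg : BddMeas l N fun x => g x t) (c d : ℝ) (n : ℕ) :
    srcCoef l lam (fun x t => c * f x t + d * g x t) n t =
      c * srcCoef l lam f n t + d * srcCoef l lam g n t := by
  have h1 := (hf.wt_mul hlam).mul_sin hl (wave l n)
  have h2 := (hg.wt_mul hlam).mul_sin hl (wave l n)
  rw [srcCoef, srcCoef, srcCoef, sinCoef, sinCoef, sinCoef, ← intervalIntegral.integral_const_mul,
    ← intervalIntegral.integral_const_mul,
    ← intervalIntegral.integral_add (h1.const_mul _) (h2.const_mul _)]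
  exact intervalIntegral.integral_congr fun x _ => by ring

namespace IsRegularSolution

variable (hw : IsRegularSolution l T α ε lam h₀ h₁ F w)
include hw

lemma continuousOn_velocity_interior :
    ContinuousOn (fun p : ℝ × ℝ => dt T w p.1 p.2) (Ioo 0 l ×ˢ Icc 0 T) :=
  hw.cont_t.mono fun _ hp => mem_VelocityRect_of_interior hp.1 hp.2

lemma continuousOn_interior :
    ContinuousOn (fun p : ℝ × ℝ => w p.1 p.2) (Ioo 0 l ×ˢ Icc 0 T) :=
  hw.cont.mono fun _ hp => ⟨Ioo_subset_Icc_self hp.1, hp.2⟩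

lemma bddMeas_of_bound {B : ℝ}
    (hB : ∀ x ∈ Ioo 0 l, ∀ t ∈ Icc 0 T, |w x t| ≤ B ∧ |dt T w x t| ≤ B) {t : ℝ}
    (ht : t ∈ Icc 0 T) : BddMeas l B (fun x => w x t) ∧ BddMeas l B (fun x => dt T w x t) :=
  ⟨bddMeas_of_continuousOn (hw.continuousOn_interior.comp (f := fun x => (x, t)) (by fun_prop)
      fun _ hx => ⟨hx, ht⟩) fun x hx => (hB x hx t ht).1,
    bddMeas_of_continuousOn (hw.continuousOn_velocity_interior.comp (f := fun x => (x, t))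
      (by fun_prop) fun _ hx => ⟨hx, ht⟩) fun x hx => (hB x hx t ht).2⟩

/-- Obtained by letting a → 0 in `test_identity`. The boundary terms contain only the values of εu_t
+ u at a and l - a, which are bounded and tend to the zero boundary values for each positive time;
no information on x-derivatives near the lateral boundary is used. -/
lemma mode_identity (hl : 0 < l) (hlam : 0 < lam) (hdata : DataAssumption l T h₀ h₁ F) (n : ℕ)
    {s t : ℝ} (hs : 0 < s) (hst : s ≤ t) (ht : t ≤ T) :
    (srcCoef l lam (dt T w) n t + α * srcCoef l lam w n t) -
      (srcCoef l lam (dt T w) n s + α * srcCoef l lam w n s) =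
    ∫ τ in s..t, (-bC l lam n * (ε * srcCoef l lam (dt T w) n τ + srcCoef l lam w n τ)
      - srcCoef l lam (srcOf T F w) n τ) := by
  obtain ⟨B, hB⟩ := hw.exists_bound hdata
  obtain ⟨C, hC, hf⟩ := hdata.exists_isSource (v := w) (M := B) (hs.trans_le (hst.trans ht)) hl
    (hw.cont.mono fun p hp => ⟨Ioo_subset_Icc_self hp.1, hp.2.1.le, hp.2.2⟩)
    fun x t h => (hB x h.1 t ⟨h.2.1.le, h.2.2⟩).1
  have hQ : ∀ τ ∈ Icc 0 T, BddMeas l (B + |α| * B) (fun x => dt T w x τ + α * w x τ) ∧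
      srcCoef l lam (fun x τ => dt T w x τ + α * w x τ) n τ =
        srcCoef l lam (dt T w) n τ + α * srcCoef l lam w n τ := by
    intro τ hτ
    have hb := hw.bddMeas_of_bound hB hτ
    refine ⟨⟨hb.2.1.add (hb.1.1.const_mul α), fun x hx => ?_⟩, ?_⟩
    · refine (abs_add_le _ _).trans (add_le_add (hB x hx τ hτ).2 ?_)
      rw [abs_mul]
      exact mul_le_mul_of_nonneg_left (hB x hx τ hτ).1 (abs_nonneg _)
    · simpa using! srcCoef_add_smul hl hlam hb.2 hb.1 1 α n
  have hz : ∀ τ ∈ Ioc 0 T, BddMeas l (|ε| * B + B) (fun x => relaxed T ε w x τ) ∧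
      srcCoef l lam (relaxed T ε w) n τ =
        ε * srcCoef l lam (dt T w) n τ + srcCoef l lam w n τ := by
    intro τ hτ
    have hτ' := Ioc_subset_Icc_self hτ
    have hb := hw.bddMeas_of_bound hB hτ'
    refine ⟨⟨(hb.2.1.const_mul ε).add hb.1.1, fun x hx => ?_⟩, ?_⟩
    · refine (abs_add_le _ _).trans (add_le_add ?_ (hB x hx τ hτ').1)
      rw [abs_mul]
      exact mul_le_mul_of_nonneg_left (hB x hx τ hτ').2 (abs_nonneg _)
    · simpa using! srcCoef_add_smul hl hlam hb.2 hb.1 ε 1 n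
  have hst' : ∀ {τ}, τ ∈ Icc s t → τ ∈ Ioc 0 T := fun hτ => ⟨hs.trans_le hτ.1, hτ.2.trans ht⟩
  have hB0 : 0 ≤ |ε| * B + B := (hz t ⟨hs.trans_le hst, ht⟩).1.nonneg hl
  have hzb : ∀ x ∈ Ioo 0 l, ∀ τ ∈ Ioc 0 T, |relaxed T ε w x τ| ≤ |ε| * B + B :=
    fun x hx τ hτ => (hz τ hτ).1.2 x hx
  have hquart : ∀ᶠ a in 𝓝[>] (0 : ℝ), a ∈ Ioo 0 (l / 4) := Ioo_mem_nhdsGT (by positivity)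
  -- For a < l/4 the test interval has length at least l/2, so K bounds all wave numbers that occur.
  set K := (n + 1) * Real.pi / (l / 2) with hK
  have hk : ∀ a ∈ Ioo 0 (l / 4), 0 ≤ (n + 1) * Real.pi / (l - 2 * a) ∧
      (n + 1) * Real.pi / (l - 2 * a) ≤ K := by
    intro a ha
    have hpi := Real.pi_pos
    have h1 : l / 2 ≤ l - 2 * a := by linarith [ha.2]
    have h2 : 0 < l / 2 := by positivity
    exact ⟨div_nonneg (by positivity) (by linarith), by rw [hK]; gcongr⟩
  have hkt : Tendsto (fun a : ℝ => (n + 1) * Real.pi / (l - 2 * a)) (𝓝[>] 0) (𝓝 (wave l n)) := by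
    have : ContinuousAt (fun a : ℝ => (n + 1) * Real.pi / (l - 2 * a)) 0 :=
      ContinuousAt.div continuousAt_const (by fun_prop) (by simpa using hl.ne')
    have h2 := this.mono_left (nhdsWithin_le_nhds (s := Ioi 0))
    simpa [wave_eq, mul_div_assoc] using h2
  have hint : ∀ {M : ℝ} {g : ℝ → ℝ}, BddMeas l M g → ∀ a,
      |∫ x in (0 : ℝ)..l, g x * testFn l lam n a x| ≤ M * l := by
    intro M g hg a
    refine abs_intervalIntegral_le hl fun x hx => ?_
    rw [abs_mul]
    have := hg.2 x hx
    nlinarith [abs_testFn_le (l := l) (n := n) hlam a hx.1.le, abs_nonneg (g x)]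
  have hL := ((tendsto_integral_testFn (n := n) hl hlam (hQ t ⟨hs.le.trans hst, ht⟩).1).sub
    (tendsto_integral_testFn (n := n) hl hlam (hQ s ⟨hs.le, hst.trans ht⟩).1))
  have hR : Tendsto (fun a => ∫ τ in s..t,
      (-(((n + 1) * Real.pi / (l - 2 * a)) ^ 2 + lam ^ 2 / 4) *
        (∫ x in (0 : ℝ)..l, relaxed T ε w x τ * testFn l lam n a x)
      - (∫ x in (0 : ℝ)..l, srcOf T F w x τ * testFn l lam n a x)
      + ((n + 1) * Real.pi / (l - 2 * a)) * (wt lam a * relaxed T ε w a τ -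
        (-1) ^ (n + 1) * wt lam (l - a) * relaxed T ε w (l - a) τ))) (𝓝[>] 0)
      (𝓝 (∫ τ in s..t, (-(wave l n ^ 2 + lam ^ 2 / 4) * srcCoef l lam (relaxed T ε w) n τ
        - srcCoef l lam (srcOf T F w) n τ + wave l n * (wt lam 0 * 0 -
          (-1) ^ (n + 1) * wt lam (l - 0) * 0)))) := by
    refine intervalIntegral.tendsto_integral_filter_of_dominated_convergence
      (fun _ => (K ^ 2 + lam ^ 2 / 4) * ((|ε| * B + B) * l) + C * l +
        K * ((|ε| * B + B) + (|ε| * B + B))) ?_ ?_ (by simp) ?_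
    · filter_upwards [hquart] with a ha
      rw [uIoc_of_le hst]
      have haI : a ∈ Icc 0 l := ⟨ha.1.le, by linarith [ha.2]⟩
      have haI' : l - a ∈ Icc 0 l := ⟨by linarith [ha.2], by linarith [ha.1]⟩
      refine ContinuousOn.aestronglyMeasurable ?_ measurableSet_Ioc
      have hsub : Ioc s t ⊆ Ioc 0 T := fun τ hτ => hst' (Ioc_subset_Icc_self hτ)
      have hφ := continuous_testFn (l := l) (lam := lam) (n := n) a
      have c1 := (continuousOn_integral_mul hl (hw.continuousOn_relaxed.mono
        (prod_mono_left Ioo_subset_Icc_self)) hzb hφ.continuousOn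
        fun x hx => abs_testFn_le hlam a hx.1.le).mono hsub
      have c2 := (continuousOn_integral_mul hl hf.cont hf.bdd hφ.continuousOn
        fun x hx => abs_testFn_le hlam a hx.1.le).mono (fun τ hτ => (hsub hτ).1 : Ioc s t ⊆ Ioi 0)
      have c3 : ∀ x ∈ Icc 0 l, ContinuousOn (fun τ => relaxed T ε w x τ) (Ioc s t) := fun x hx =>
        hw.continuousOn_relaxed.comp (f := fun τ => (x, τ)) (by fun_prop)
          fun τ hτ => ⟨hx, hsub hτ⟩
      exact ((c1.const_mul _).sub c2).add ((((c3 a haI).const_mul _).sub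
        ((c3 _ haI').const_mul _)).const_mul _)
    · filter_upwards [hquart] with a ha
      refine Eventually.of_forall fun τ hτ => ?_
      rw [uIoc_of_le hst] at hτ
      have hτ' := hst' (Ioc_subset_Icc_self hτ)
      have ha1 : a ∈ Ioo 0 l := ⟨ha.1, by linarith [ha.2]⟩
      have ha2 : l - a ∈ Ioo 0 l := ⟨by linarith [ha.2], by linarith [ha.1]⟩
      have b1 := hint (hz τ hτ').1 a
      have b2 := hint (hf.bddMeas hτ'.1) a
      have b3 := hzb a ha1 τ hτ'
      have b4 := hzb _ ha2 τ hτ'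
      obtain ⟨k1, k2⟩ := hk a ha
      rw [Real.norm_eq_abs]
      refine (abs_add_le _ _).trans (add_le_add ((abs_sub _ _).trans (add_le_add ?_ b2)) ?_)
      · rw [abs_mul, abs_neg, abs_of_nonneg (by positivity)]
        gcongr
      · rw [abs_mul, abs_of_nonneg k1]
        refine mul_le_mul k2 ((abs_sub _ _).trans (add_le_add ?_ ?_)) (abs_nonneg _) (k1.trans k2)
        · rw [abs_mul]
          nlinarith [abs_wt_le hlam ha1.1.le, abs_nonneg (relaxed T ε w a τ)]
        · rw [abs_mul, abs_mul, abs_pow, abs_neg, abs_one, one_pow, one_mul]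
          nlinarith [abs_wt_le hlam ha2.1.le, abs_nonneg (relaxed T ε w (l - a) τ)]
    · refine Eventually.of_forall fun τ hτ => ?_
      rw [uIoc_of_le hst] at hτ
      have hτ' := hst' (Ioc_subset_Icc_self hτ)
      have hwt := continuous_wt lam
      have hcz : ∀ g : ℝ → ℝ, Continuous g → g 0 ∈ Icc 0 l → (∀ a ∈ Ioo 0 (l / 4), g a ∈ Icc 0 l) →
          relaxed T ε w (g 0) τ = 0 →
          Tendsto (fun a => relaxed T ε w (g a) τ) (𝓝[>] 0) (𝓝 0) := by
        intro g hg h0 hmem hz0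
        have h1 : Tendsto (fun p : ℝ × ℝ => relaxed T ε w p.1 p.2)
          (𝓝[Icc 0 l ×ˢ Ioc 0 T] (g 0, τ)) (𝓝 (relaxed T ε w (g 0) τ)) :=
          hw.continuousOn_relaxed (g 0, τ) ⟨h0, hτ'⟩
        rw [hz0] at h1
        refine h1.comp (f := fun a => (g a, τ)) (tendsto_nhdsWithin_iff.2 ⟨?_, ?_⟩)
        · exact ((hg.prodMk continuous_const).tendsto 0).mono_left nhdsWithin_le_nhds
        · filter_upwards [hquart] with a ha using ⟨hmem a ha, hτ'⟩
      have z1 := hcz (fun a => a) continuous_id ⟨le_rfl, hl.le⟩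
        (fun a ha => ⟨ha.1.le, by linarith [ha.2]⟩) (hw.relaxed_boundary hτ').1
      have z2 := hcz (fun a => l - a) (by fun_prop) ⟨by simpa using hl.le, by simp⟩
        (fun a ha => ⟨by linarith [ha.2], by linarith [ha.1]⟩)
        (by simpa using (hw.relaxed_boundary hτ').2)
      have w1 : Tendsto (wt lam) (𝓝[>] 0) (𝓝 (wt lam 0)) :=
        (hwt.tendsto 0).mono_left nhdsWithin_le_nhds
      have w2 : Tendsto (fun a => wt lam (l - a)) (𝓝[>] 0) (𝓝 (wt lam (l - 0))) :=
        ((hwt.comp (continuous_const.sub continuous_id)).tendsto 0).mono_left nhdsWithin_le_nhds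
      exact (((((hkt.pow 2).add_const _).neg).mul
        (tendsto_integral_testFn hl hlam (hz τ hτ').1)).sub
        (tendsto_integral_testFn hl hlam (hf.bddMeas hτ'.1))).add
        (hkt.mul ((w1.mul z1).sub ((w2.const_mul _).mul z2)))
  have heq := tendsto_nhds_unique (hL.congr' (by
    filter_upwards [hquart] with a ha
    exact hw.test_identity hl hlam hdata n ha.1 (by linarith [ha.2]) hs hst ht)) hR
  have e1 := (hQ t ⟨hs.le.trans hst, ht⟩).2
  have e2 := (hQ s ⟨hs.le, hst.trans ht⟩).2
  rw [srcCoef] at e1 e2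
  rw [e1, e2] at heq
  rw [heq]
  refine intervalIntegral.integral_congr fun τ hτ => ?_
  rw [uIcc_of_le hst] at hτ
  rw [(hz τ (hst' hτ)).2, bC_eq]
  ring

end IsRegularSolution

end Regular

/-! ### The oscillator equations for the modes of a regular solution -/

section Regular

variable {l T α ε lam : ℝ} {h₀ h₁ : ℝ → ℝ} {F : ℝ → ℝ → ℝ → ℝ} {w : ℝ → ℝ → ℝ}

lemma continuousOn_srcCoef_of_continuousOn {B : ℝ} (hl : 0 < l) (hlam : 0 < lam)
    {f : ℝ → ℝ → ℝ} {s : Set ℝ} (hf : ContinuousOn (fun p : ℝ × ℝ => f p.1 p.2) (Ioo 0 l ×ˢ s))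
    (hB : ∀ x ∈ Ioo 0 l, ∀ t ∈ s, |f x t| ≤ B) (n : ℕ) : ContinuousOn (srcCoef l lam f n) s := by
  have := continuousOn_integral_mul hl (N := 1) hf hB
    (φ := fun x => wt lam x * Real.sin (wave l n * x))
    (by have := continuous_wt lam; fun_prop) (fun x hx => by
      rw [abs_mul]
      exact mul_le_one₀ (abs_wt_le hlam hx.1.le) (abs_nonneg _) (Real.abs_sin_le_one _))
  refine this.congr fun t _ => ?_
  exact intervalIntegral.integral_congr fun x _ => by ring

lemma hasDerivAt_srcCoef {B : ℝ} (hl : 0 < l) (hlam : 0 < lam) {f f' : ℝ → ℝ → ℝ} {s : Set ℝ}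
    (hs : IsOpen s) (hf : ContinuousOn (fun p : ℝ × ℝ => f p.1 p.2) (Ioo 0 l ×ˢ s))
    (hf' : ContinuousOn (fun p : ℝ × ℝ => f' p.1 p.2) (Ioo 0 l ×ˢ s))
    (hB : ∀ x ∈ Ioo 0 l, ∀ t ∈ s, |f x t| ≤ B ∧ |f' x t| ≤ B)
    (hd : ∀ x ∈ Ioo 0 l, ∀ t ∈ s, HasDerivAt (f x) (f' x t) t) (n : ℕ) {t : ℝ} (ht : t ∈ s) :
    HasDerivAt (srcCoef l lam f n) (srcCoef l lam f' n t) t := by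
  have hslice : ∀ {g : ℝ → ℝ → ℝ}, ContinuousOn (fun p : ℝ × ℝ => g p.1 p.2) (Ioo 0 l ×ˢ s) →
      (∀ x ∈ Ioo 0 l, ∀ t ∈ s, |g x t| ≤ B) → ∀ τ ∈ s, BddMeas l B (fun x => wt lam x * g x τ) :=
    fun hg hb τ hτ => (bddMeas_of_continuousOn (hg.comp (f := fun x => (x, τ)) (by fun_prop)
      fun x hx => ⟨hx, hτ⟩) fun x hx => hb x hx τ hτ).wt_mul hlam
  have b0 := hslice hf fun x hx t ht => (hB x hx t ht).1
  have b1 := hslice hf' fun x hx t ht => (hB x hx t ht).2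
  have hsin : ∀ {g : ℝ → ℝ}, BddMeas l B g → AEStronglyMeasurable
      (fun x => g x * Real.sin (wave l n * x)) (volume.restrict (Ioc 0 l)) := fun hg =>
    hg.1.mul (by fun_prop)
  refine (intervalIntegral.hasDerivAt_integral_of_dominated_loc_of_deriv_le
    (F := fun t x => wt lam x * f x t * Real.sin (wave l n * x))
    (F' := fun t x => wt lam x * f' x t * Real.sin (wave l n * x)) (bound := fun _ => B)
    (hs.mem_nhds ht) ?_ ((b0 t ht).mul_sin hl _) ?_ ?_ (by simp) ?_).2
  · filter_upwards [hs.mem_nhds ht] with τ hτ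
    rw [uIoc_of_le hl.le]
    exact hsin (b0 τ hτ)
  · rw [uIoc_of_le hl.le]
    exact hsin (b1 t ht)
  · rw [uIoc_of_le hl.le]
    refine (ae_restrict_iff' measurableSet_Ioc).1 (ae_Ioc_of_Ioo fun x hx τ hτ => ?_)
    rw [Real.norm_eq_abs, abs_mul]
    have := (b1 τ hτ).2 x hx
    nlinarith [Real.abs_sin_le_one (wave l n * x), abs_nonneg (wt lam x * f' x τ)]
  · rw [uIoc_of_le hl.le]
    refine (ae_restrict_iff' measurableSet_Ioc).1 (ae_Ioc_of_Ioo fun x hx τ hτ => ?_)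
    exact ((hd x hx τ hτ).const_mul _).mul_const _

namespace IsRegularSolution

variable (hw : IsRegularSolution l T α ε lam h₀ h₁ F w)
include hw

lemma exists_isSource (hT : 0 < T) (hl : 0 < l) (hdata : DataAssumption l T h₀ h₁ F) :
    ∃ C, 0 ≤ C ∧ IsSource l C (srcOf T F w) := by
  obtain ⟨B, hB⟩ := hw.exists_bound hdata
  exact hdata.exists_isSource (v := w) (M := B) hT hl
    (hw.cont.mono fun p hp => ⟨Ioo_subset_Icc_self hp.1, hp.2.1.le, hp.2.2⟩)
    fun x t h => (hB x h.1 t ⟨h.2.1.le, h.2.2⟩).1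

/-- Differentiation of the velocity coefficient under the integral is not available, as u_tt may be
unbounded near the lateral boundary. Instead `mode_identity` exhibits q + αp, with p and q the modes
of w and w_t, as a primitive of a continuous function, and αp is subtracted. -/
lemma hasDerivAt_velocity_mode (hl : 0 < l) (hlam : 0 < lam)
    (hdata : DataAssumption l T h₀ h₁ F) (n : ℕ) {t : ℝ} (ht : t ∈ Ioo 0 T) :
    HasDerivAt (srcCoef l lam (dt T w) n) (-(α + ε * bC l lam n) * srcCoef l lam (dt T w) n t -
      bC l lam n * srcCoef l lam w n t - srcCoef l lam (srcOf T F w) n t) t := by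
  obtain ⟨B, hB⟩ := hw.exists_bound hdata
  obtain ⟨C, hC, hf⟩ := hw.exists_isSource (ht.1.trans ht.2) hl hdata
  have hsub : Ioo 0 T ⊆ Icc 0 T := Ioo_subset_Icc_self
  have hp : HasDerivAt (srcCoef l lam w n) (srcCoef l lam (dt T w) n t) t :=
    hasDerivAt_srcCoef hl hlam isOpen_Ioo
      (hw.continuousOn_interior.mono (prod_mono_right hsub))
      (hw.continuousOn_velocity_interior.mono (prod_mono_right hsub))
      (fun x hx t ht => hB x hx t (hsub ht)) (fun x hx t ht => hw.hasDerivAt_t hx ht) n ht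
  have cp := (continuousOn_srcCoef_of_continuousOn (lam := lam) hl hlam hw.continuousOn_interior
    (fun x hx t ht => (hB x hx t ht).1) n).mono hsub
  have cq := (continuousOn_srcCoef_of_continuousOn (lam := lam) hl hlam
    hw.continuousOn_velocity_interior (fun x hx t ht => (hB x hx t ht).2) n).mono hsub
  have cf := (hf.continuousOn_srcCoef hl hlam n).mono (fun t ht => ht.1 : Ioo 0 T ⊆ Ioi 0)
  set R : ℝ → ℝ := fun τ => -bC l lam n * (ε * srcCoef l lam (dt T w) n τ + srcCoef l lam w n τ)
      - srcCoef l lam (srcOf T F w) n τ with hR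
  have cR : ContinuousOn R (Ioo 0 T) :=
    (continuousOn_const.mul ((continuousOn_const.mul cq).add cp)).sub cf
  have hs0 : 0 < t / 2 := by linarith [ht.1]
  have hst : t / 2 < t := by linarith [ht.1]
  have hint : HasDerivAt (fun τ => ∫ r in t / 2..τ, R r) (R t) t := by
    refine intervalIntegral.integral_hasDerivAt_right ?_
      (cR.stronglyMeasurableAtFilter isOpen_Ioo t ht) (cR.continuousAt (isOpen_Ioo.mem_nhds ht))
    refine (cR.mono ?_).intervalIntegrable
    rw [uIcc_of_le hst.le]
    exact fun r hr => ⟨hs0.trans_le hr.1, hr.2.trans_lt ht.2⟩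
  have hQ : HasDerivAt (fun τ => srcCoef l lam (dt T w) n τ + α * srcCoef l lam w n τ) (R t) t := by
    refine (hint.const_add (srcCoef l lam (dt T w) n (t / 2) + α * srcCoef l lam w n (t / 2))).congr_of_eventuallyEq ?_
    filter_upwards [Ioo_mem_nhds hst ht.2] with τ hτ
    have := hw.mode_identity hl hlam hdata n hs0 hτ.1.le hτ.2.le
    linarith
  have h3 := hQ.sub (hp.const_mul α)
  refine (h3.congr_of_eventuallyEq (Eventually.of_forall fun τ => ?_)).congr_deriv ?_
  · simp
  · rw [hR]; ring

/-- The modes of a regular solution. -/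
lemma mode_eq_ym (hT : 0 < T) (hl : 0 < l) (hα : 0 < α) (hε : 0 < ε) (hlam : 0 < lam)
    (hdata : DataAssumption l T h₀ h₁ F) (n : ℕ) {t : ℝ} (ht : t ∈ Icc 0 T) :
    srcCoef l lam w n t = ym l α ε lam (sinCoef l fun ξ => wt lam ξ * h₀ ξ)
      (sinCoef l fun ξ => wt lam ξ * h₁ ξ) (srcOf T F w) n t := by
  obtain ⟨B, hB⟩ := hw.exists_bound hdata
  obtain ⟨C, hC, hf⟩ := hw.exists_isSource hT hl hdata
  set a := sinCoef l fun ξ => wt lam ξ * h₀ ξ with ha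
  set d := sinCoef l fun ξ => wt lam ξ * h₁ ξ with hd
  set f := srcOf T F w
  have hsub : Ioo 0 T ⊆ Icc 0 T := Ioo_subset_Icc_self
  have cp := continuousOn_srcCoef_of_continuousOn (lam := lam) hl hlam hw.continuousOn_interior
    (fun x hx t ht => (hB x hx t ht).1) n
  have cq := continuousOn_srcCoef_of_continuousOn (lam := lam) hl hlam
    hw.continuousOn_velocity_interior (fun x hx t ht => (hB x hx t ht).2) n
  have hp : ∀ t ∈ Ioo 0 T, HasDerivAt (srcCoef l lam w n) (srcCoef l lam (dt T w) n t) t :=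
    fun t ht => hasDerivAt_srcCoef hl hlam isOpen_Ioo
      (hw.continuousOn_interior.mono (prod_mono_right hsub))
      (hw.continuousOn_velocity_interior.mono (prod_mono_right hsub))
      (fun x hx t ht => hB x hx t (hsub ht)) (fun x hx t ht => hw.hasDerivAt_t hx ht) n ht
  set e : ℝ → ℝ := fun t => srcCoef l lam w n t - ym l α ε lam a d f n t with he
  set e' : ℝ → ℝ := fun t => srcCoef l lam (dt T w) n t - ym' l α ε lam a d f n t with he'
  set b := bC l lam n with hb
  have hb0 : 0 < b := bC_pos l lam hlam n
  -- The error e solves the homogeneous oscillator equation, so its energy is nonincreasing; it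
  -- vanishes at t = 0.
  have hE : ∀ t ∈ Ioo 0 T, HasDerivAt (fun t => e' t ^ 2 + b * e t ^ 2)
      (-2 * (α + ε * b) * e' t ^ 2) t := by
    intro t ht
    have h1 : HasDerivAt e (e' t) t := (hp t ht).sub (hasDerivAt_ym hl hlam hf n ht.1)
    have h2 := (hw.hasDerivAt_velocity_mode hl hlam hdata n ht).sub
      (hasDerivAt_ym' (α := α) (ε := ε) (a := a) (d := d) hl hlam hf n ht.1)
    refine ((h2.pow 2).add ((h1.pow 2).const_mul b)).congr_deriv ?_
    simp only [he, he', Pi.sub_apply, ← hb, Nat.cast_ofNat]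
    ring
  have hc : ContinuousOn (fun t => e' t ^ 2 + b * e t ^ 2) (Icc 0 T) := by
    have h1 : ContinuousOn e (Icc 0 T) := cp.sub
      ((continuousOn_ym hl hα hε hlam hf n).mono fun t ht => ht.1)
    have h2 : ContinuousOn e' (Icc 0 T) := cq.sub
      ((continuousOn_ym' hl hα hε hlam hf n).mono fun t ht => ht.1)
    fun_prop
  have hanti : AntitoneOn (fun t => e' t ^ 2 + b * e t ^ 2) (Icc 0 T) := by
    refine antitoneOn_of_deriv_nonpos (convex_Icc _ _) hc ?_ ?_
    · rw [interior_Icc]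
      exact fun t ht => (hE t ht).differentiableAt.differentiableWithinAt
    · rw [interior_Icc]
      intro t ht
      rw [(hE t ht).deriv]
      have : 0 ≤ (α + ε * b) * e' t ^ 2 := by positivity
      linarith
  have h0T : (0 : ℝ) ∈ Icc 0 T := ⟨le_rfl, hT.le⟩
  have e0 : e 0 = 0 := by
    simp only [he]
    rw [ym_zero, ha, srcCoef, sub_eq_zero]
    exact sinCoef_congr hl (fun x hx => by rw [hw.init_value x (Ioo_subset_Icc_self hx)]) n
  have e0' : e' 0 = 0 := by
    simp only [he']
    rw [ym'_zero, hd, srcCoef, sub_eq_zero]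
    exact sinCoef_congr hl (fun x hx => by
      rw [hw.init_velocity x (mem_VelocityRect_of_interior hx h0T)]) n
  have h1 : e' t ^ 2 + b * e t ^ 2 ≤ 0 := by
    have := hanti h0T ht ht.1
    simpa [e0, e0'] using this
  have h2 : e t ^ 2 = 0 := by
    have := sq_nonneg (e' t)
    have := sq_nonneg (e t)
    nlinarith
  exact sub_eq_zero.1 (pow_eq_zero_iff two_ne_zero |>.1 h2)

lemma eq_Uhat (hT : 0 < T) (hl : 0 < l) (hα : 0 < α) (hε : 0 < ε) (hlam : 0 < lam)
    (hdata : DataAssumption l T h₀ h₁ F) (h0 : h₀ 0 = 0) (hl0 : h₀ l = 0) {x t : ℝ}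
    (hx : x ∈ Ioo 0 l) (ht : t ∈ Icc 0 T) :
    w x t = Real.exp (lam / 2 * x) * Uhat l α ε lam (sinCoef l fun ξ => wt lam ξ * h₀ ξ)
      (sinCoef l fun ξ => wt lam ξ * h₁ ξ) (srcOf T F w) x t := by
  obtain ⟨B₀, hB₀, hB₁⟩ := hdata.exists_bddMeas
  obtain ⟨C, hC, hf⟩ := hw.exists_isSource hT hl hdata
  obtain ⟨u, hu, hub⟩ := exists_ym_bound hl hα hε hlam hf hC (hdata.summable_coef hl hlam h0 hl0)
    (abs_sinCoef_le hl (hB₁.wt_mul hlam).2) T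
  have hm := fun n => hw.mode_eq_ym hT hl hα hε hlam hdata n ht
  have hcont : ContinuousOn (fun ξ => wt lam ξ * w ξ t) (Icc 0 l) :=
    (continuous_wt lam).continuousOn.mul (hw.cont.comp (f := fun x => (x, t)) (by fun_prop)
      fun x hx => ⟨hx, ht⟩)
  have h1 := eq_sine_series hl hcont (Summable.of_nonneg_of_le (fun _ => abs_nonneg _)
    (fun n => (le_of_eq (congrArg abs (hm n))).trans (hub n t ht)) hu) hx
  have h2 : ∀ n, sinCoef l (fun ξ => wt lam ξ * w ξ t) n = _ := hm
  simp_rw [h2] at h1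
  rw [Uhat, ← h1, ← mul_assoc, exp_mul_wt, one_mul]

/-- A regular solution satisfies the integral equation. -/
lemma eq_integralMap (hT : 0 < T) (hl : 0 < l) (hα : 0 < α) (hε : 0 < ε) (hlam : 0 < lam)
    (hdata : DataAssumption l T h₀ h₁ F) (h0 : h₀ 0 = 0) (hl0 : h₀ l = 0) {v : ℝ → ℝ → ℝ}
    (hv : ∀ x t, (x, t) ∈ Omega l T → v x t = w x t) {x t : ℝ} (hx : (x, t) ∈ Omega l T) :
    w x t = integralMap l α ε lam h₀ h₁ F v x t := by
  obtain ⟨B₀, hB₀, hB₁⟩ := hdata.exists_bddMeas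
  obtain ⟨C, hC, hf⟩ := hw.exists_isSource hT hl hdata
  rw [integralMap_eq hl hα hε hlam hf hB₀ hB₁ (hdata.summable_coef hl hlam h0 hl0) (T := T)
    (fun x hx t ht => by rw [srcOf_of_le ht.2, hv x t ⟨hx, ht⟩]) x hx.2]
  exact hw.eq_Uhat hT hl hα hε hlam hdata h0 hl0 hx.1 ⟨hx.2.1.le, hx.2.2⟩

end IsRegularSolution

end Regular

/-! ### The heat flow of Lipschitz data that need not vanish at the boundary -/

section Heat

variable {l ε lam : ℝ} {k : ℝ → ℝ}

lemma sin_wave_reflect (hl : 0 < l) (n : ℕ) (x : ℝ) :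
    Real.sin (wave l n * (l - x)) = (-1) ^ n * Real.sin (wave l n * x) := by
  have : wave l n * (l - x) = (n + 1 : ℕ) * Real.pi - wave l n * x := by
    rw [wave_eq]; push_cast; field_simp
  rw [this, Real.sin_nat_mul_pi_sub, pow_succ]
  ring

/-- The deviation from the affine interpolation of the boundary values. -/
noncomputable def boundaryRem (l : ℝ) (k : ℝ → ℝ) (x : ℝ) : ℝ :=
  k x - (k 0 * (1 - x / l) + k l * (1 - (l - x) / l))

lemma exists_lipschitz_boundaryRem {K : NNReal} (hl : 0 < l) (hk : LipschitzOnWith K k (Icc 0 l)) :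
    ∃ K' : NNReal, LipschitzOnWith K' (boundaryRem l k) (Icc 0 l) := by
  have h1 : LipschitzOnWith (|(k l - k 0) / l|).toNNReal
      (fun x => k 0 * (1 - x / l) + k l * (1 - (l - x) / l)) (Icc 0 l) := by
    refine LipschitzOnWith.of_dist_le_mul fun x _ y _ => ?_
    rw [Real.dist_eq, Real.dist_eq, Real.coe_toNNReal _ (abs_nonneg _), ← abs_mul]
    refine le_of_eq (congrArg abs ?_)
    field_simp
    ring
  exact ⟨_, hk.sub h1⟩

lemma boundaryRem_zero (hl : 0 < l) : boundaryRem l k 0 = 0 := by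
  simp [boundaryRem, hl.ne']

lemma boundaryRem_right (hl : 0 < l) : boundaryRem l k l = 0 := by
  simp [boundaryRem, hl.ne']

lemma bddMeas_of_lipschitz {K : NNReal} (hk : LipschitzOnWith K k (Icc 0 l)) :
    ∃ B, BddMeas l B k := by
  obtain ⟨B, hB⟩ := isCompact_Icc.exists_bound_of_continuousOn hk.continuousOn
  exact ⟨B, bddMeas_of_continuousOn (hk.continuousOn.mono Ioo_subset_Icc_self)
    fun x hx => hB x (Ioo_subset_Icc_self hx)⟩

lemma sinCoef_eq_boundaryRem {K : NNReal} (hl : 0 < l) (hk : LipschitzOnWith K k (Icc 0 l))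
    (n : ℕ) : sinCoef l k n = sinCoef l (boundaryRem l k) n + k 0 * (l / Real.pi / (n + 1)) +
      k l * ((-1) ^ n * (l / Real.pi / (n + 1))) := by
  obtain ⟨K', hK'⟩ := exists_lipschitz_boundaryRem hl hk
  obtain ⟨B, hB⟩ := bddMeas_of_lipschitz hK'
  have b1 : BddMeas l |k 0| (fun x => k 0 * (1 - x / l)) := by
    refine bddMeas_of_continuousOn (by fun_prop) fun x hx => ?_
    rw [abs_mul]
    refine mul_le_of_le_one_right (abs_nonneg _) ?_
    have h1 : 0 < x / l := div_pos hx.1 hl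
    have h2 : x / l < 1 := (div_lt_one hl).2 hx.2
    rw [abs_le]; constructor <;> linarith
  have b2 : BddMeas l |k l| (fun x => k l * (1 - (l - x) / l)) := by
    refine bddMeas_of_continuousOn (by fun_prop) fun x hx => ?_
    rw [abs_mul]
    refine mul_le_of_le_one_right (abs_nonneg _) ?_
    have h1 : 0 < (l - x) / l := div_pos (by linarith [hx.2]) hl
    have h2 : (l - x) / l < 1 := (div_lt_one hl).2 (by linarith [hx.1])
    rw [abs_le]; constructor <;> linarith
  have b3 : BddMeas l (B + |k 0|) (fun x => boundaryRem l k x + k 0 * (1 - x / l)) :=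
    ⟨hB.1.add b1.1, fun x hx => (abs_add_le _ _).trans (add_le_add (hB.2 x hx) (b1.2 x hx))⟩
  have h1 := sinCoef_add hl b3 b2 n
  rw [sinCoef_add hl hB b1, sinCoef_const_mul, sinCoef_const_mul, sinCoef_one_sub hl,
    sinCoef_reflect hl (fun x => 1 - x / l), sinCoef_one_sub hl] at h1
  rw [← h1]
  refine sinCoef_congr hl (fun x _ => ?_) n
  rw [boundaryRem]; ring

variable (l ε lam k) in
/-- The solution of `v_t = ε (v_xx - λ²/4 v)` with initial value `k` and zero boundary values. -/
noncomputable def heat (x t : ℝ) : ℝ :=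
  2 / l * (∑' n, Real.exp (-(ε * bC l lam n) * t) * sinCoef l (boundaryRem l k) n *
    Real.sin (wave l n * x)) + (k 0 * (2 / Real.pi * saw l ε lam x t) +
      k l * (2 / Real.pi * saw l ε lam (l - x) t))

lemma exp_bC_le_one (hε : 0 < ε) (hlam : 0 < lam) (n : ℕ) {t : ℝ} (ht : 0 ≤ t) :
    Real.exp (-(ε * bC l lam n) * t) ≤ 1 := by
  rw [Real.exp_le_one_iff]
  have := bC_pos l lam hlam n
  have : 0 ≤ ε * bC l lam n * t := by positivity
  linarith

lemma unifSum_heatRem {K : NNReal} (hl : 0 < l) (hε : 0 < ε) (hlam : 0 < lam)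
    (hk : LipschitzOnWith K k (Icc 0 l)) :
    UnifSum (fun n (p : ℝ × ℝ) => Real.exp (-(ε * bC l lam n) * p.2) *
      sinCoef l (boundaryRem l k) n * Real.sin (wave l n * p.1)) {p | 0 ≤ p.2} := by
  obtain ⟨K', hK'⟩ := exists_lipschitz_boundaryRem hl hk
  refine unifSum_of_bound (summable_sinCoef_of_lipschitz hl hK' (boundaryRem_zero hl)
    (boundaryRem_right hl)) fun n p hp => ?_
  have h1 := exp_bC_le_one (l := l) hε hlam n (show 0 ≤ p.2 from hp)
  rw [abs_mul, abs_mul, abs_of_pos (Real.exp_pos _)]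
  calc _ ≤ 1 * |sinCoef l (boundaryRem l k) n| * 1 := by
        gcongr; exact Real.abs_sin_le_one _
    _ = _ := by ring

/-- For t > 0 the exponential factors let the three pieces recombine into the single sine series of
k. At t = 0 that series need not converge absolutely when k does not vanish at the endpoints, and
only the split form remains usable there. -/
lemma heat_eq_tsum {K : NNReal} (hl : 0 < l) (hε : 0 < ε) (hlam : 0 < lam)
    (hk : LipschitzOnWith K k (Icc 0 l)) (x : ℝ) {t : ℝ} (ht : 0 < t) :
    heat l ε lam k x t = 2 / l * ∑' n, Real.exp (-(ε * bC l lam n) * t) * sinCoef l k n *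
      Real.sin (wave l n * x) := by
  have s0 := (unifSum_heatRem hl hε hlam hk).summable (x := (x, t)) ht.le
  have s1 := (unifSum_saw (lam := lam) hl hε ht).summable (x := (x, t)) (le_refl t)
  have s2 := (unifSum_saw (lam := lam) hl hε ht).summable (x := (l - x, t)) (le_refl t)
  have hpi := Real.pi_pos
  have h : ∑' n, Real.exp (-(ε * bC l lam n) * t) * sinCoef l k n * Real.sin (wave l n * x) =
      (∑' n, Real.exp (-(ε * bC l lam n) * t) * sinCoef l (boundaryRem l k) n *
        Real.sin (wave l n * x)) + (k 0 * (l / Real.pi)) * (∑' n, sawCoef l ε lam n t *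
        Real.sin (wave l n * x)) + (k l * (l / Real.pi)) * (∑' n, sawCoef l ε lam n t *
        Real.sin (wave l n * (l - x))) := by
    rw [← tsum_mul_left, ← tsum_mul_left, ← s0.tsum_add (s1.mul_left _),
      ← (s0.add (s1.mul_left _)).tsum_add (s2.mul_left _)]
    refine tsum_congr fun n => ?_
    rw [sinCoef_eq_boundaryRem hl hk, sin_wave_reflect hl]
    simp only [sawCoef]
    ring
  rw [← saw_eq_tsum hl hε ht, ← saw_eq_tsum hl hε ht] at h
  rw [h, heat]
  generalize (∑' n, Real.exp (-(ε * bC l lam n) * t) * sinCoef l (boundaryRem l k) n *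
    Real.sin (wave l n * x)) = S
  field_simp
  ring

lemma heat_zero_left (hl : 0 < l) (t : ℝ) : heat l ε lam k 0 t = 0 := by
  simp [heat, saw_zero_left, saw_right hl]

lemma heat_right (hl : 0 < l) (t : ℝ) : heat l ε lam k l t = 0 := by
  simp [heat, saw_zero_left, saw_right hl, sin_wave_right hl]

lemma heat_initial {K : NNReal} (hl : 0 < l) (hε : 0 < ε) (hlam : 0 < lam)
    (hk : LipschitzOnWith K k (Icc 0 l)) {x : ℝ} (hx : x ∈ Ioo 0 l) : heat l ε lam k x 0 = k x := by
  obtain ⟨K', hK'⟩ := exists_lipschitz_boundaryRem hl hk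
  have h1 := eq_sine_series hl hK'.continuousOn (summable_sinCoef_of_lipschitz hl hK'
    (boundaryRem_zero hl) (boundaryRem_right hl)) hx
  have hpi := Real.pi_pos
  simp only [heat, mul_zero, Real.exp_zero, one_mul]
  rw [← h1, saw_initial hl hε hlam hx, saw_initial hl hε hlam (x := l - x)
    ⟨by linarith [hx.2], by linarith [hx.1]⟩, boundaryRem]
  field_simp
  ring

/-- Each sawtooth flow is multiplied by the boundary value of k at its own bad corner. A corner
therefore has to be excluded only if k is nonzero there, which is the condition defining
`VelocityRect`. -/
lemma continuousOn_heat {K : NNReal} (hl : 0 < l) (hε : 0 < ε) (hlam : 0 < lam)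
    (hk : LipschitzOnWith K k (Icc 0 l)) : ContinuousOn (fun p : ℝ × ℝ => heat l ε lam k p.1 p.2)
      {p | p.1 ∈ Icc 0 l ∧ 0 ≤ p.2 ∧ (p.2 = 0 → (p.1 = 0 → k 0 = 0) ∧ (p.1 = l → k l = 0))} := by
  have hpos : ∀ {c : ℝ} {p : ℝ × ℝ}, c ≠ 0 → 0 ≤ p.2 → (p.2 = 0 → c = 0) → 0 < p.2 :=
    fun hc h0 h => h0.lt_of_ne fun h' => hc (h h'.symm)
  refine ContinuousOn.add ?_ (ContinuousOn.add ?_ ?_)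
  · refine (((unifSum_heatRem hl hε hlam hk).continuousOn fun n => ?_).const_mul _).mono
      fun p hp => hp.2.1
    fun_prop
  · rcases eq_or_ne (k 0) 0 with h | h
    · simp only [h, zero_mul]; exact continuousOn_const
    · refine ContinuousOn.const_mul (ContinuousOn.const_mul
        ((continuousOn_saw hl hε hlam).mono fun p hp => ?_) _) _
      exact ⟨hp.1, hp.2.1, fun h0 => hpos h hp.2.1 fun h' => (hp.2.2 h').1 h0⟩
  · rcases eq_or_ne (k l) 0 with h | h
    · simp only [h, zero_mul]; exact continuousOn_const
    · refine ContinuousOn.const_mul (ContinuousOn.const_mul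
        ((continuousOn_saw hl hε hlam).comp (f := fun p : ℝ × ℝ => (l - p.1, p.2)) (by fun_prop)
          fun p hp => ?_) _) _
      exact ⟨⟨by linarith [hp.1.2], by linarith [hp.1.1]⟩, hp.2.1,
        fun h0 => hpos h hp.2.1 fun h' => (hp.2.2 h').2 (by simp only at h0; linarith)⟩

lemma exists_heat_bound {K : NNReal} (hl : 0 < l) (hε : 0 < ε) (hlam : 0 < lam)
    (hk : LipschitzOnWith K k (Icc 0 l)) :
    ∃ B, ∀ x ∈ Icc 0 l, ∀ t, 0 ≤ t → |heat l ε lam k x t| ≤ B := by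
  obtain ⟨K', hK'⟩ := exists_lipschitz_boundaryRem hl hk
  have hs := summable_sinCoef_of_lipschitz hl hK' (boundaryRem_zero hl) (boundaryRem_right hl)
  have hpi := Real.pi_pos
  refine ⟨2 / l * (∑' n, |sinCoef l (boundaryRem l k) n|) +
    (|k 0| * (2 / Real.pi * (2 * Real.pi + 1)) + |k l| * (2 / Real.pi * (2 * Real.pi + 1))),
    fun x hx t ht => ?_⟩
  have h1 := abs_saw_le hl hε hlam hx ht
  have h2 := abs_saw_le hl hε hlam (x := l - x) ⟨by linarith [hx.2], by linarith [hx.1]⟩ ht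
  refine (abs_add_le _ _).trans (add_le_add ?_ ((abs_add_le _ _).trans (add_le_add ?_ ?_)))
  · rw [abs_mul, abs_of_pos (show 0 < 2 / l by positivity)]
    refine mul_le_mul_of_nonneg_left ?_ (by positivity)
    rw [← Real.norm_eq_abs]
    refine tsum_of_norm_bounded hs.hasSum fun n => ?_
    have h1 := exp_bC_le_one (l := l) hε hlam n ht
    rw [Real.norm_eq_abs, abs_mul, abs_mul, abs_of_pos (Real.exp_pos _)]
    calc _ ≤ 1 * |sinCoef l (boundaryRem l k) n| * 1 := by
          gcongr; exact Real.abs_sin_le_one _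
      _ = _ := by ring
  · rw [abs_mul, abs_mul, abs_of_pos (show 0 < 2 / Real.pi by positivity)]
    gcongr
  · rw [abs_mul, abs_mul, abs_of_pos (show 0 < 2 / Real.pi by positivity)]
    gcongr

end Heat

/-! ### The velocity -/

/-- The exponential part of the kernel integrates to at most 1/k, the remainder to at most At. With
k = εb and A of order 1/n² the Duhamel term of the velocity gains O(1/n²), whereas |G'| ≤ 1 alone
would give no decay. -/
lemma abs_convolution_exp_le {k A B : ℝ} (hk : 0 < k) (hB0 : 0 ≤ B) {G f : ℝ → ℝ}
    (hG : ∀ t, 0 ≤ t → |G t - Real.exp (-k * t)| ≤ A) (hB : ∀ t, 0 < t → |f t| ≤ B) {t : ℝ}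
    (ht : 0 ≤ t) : |∫ τ in (0 : ℝ)..t, G (t - τ) * f τ| ≤ B * (1 / k + A * t) := by
  have h1 : ∀ τ ∈ Ioc 0 t, ‖G (t - τ) * f τ‖ ≤
      B * (Real.exp (-k * t) * Real.exp (k * τ) + A) := by
    intro τ hτ
    have h2 := hG (t - τ) (by linarith [hτ.2])
    have h3 : Real.exp (-k * (t - τ)) = Real.exp (-k * t) * Real.exp (k * τ) := by
      rw [← Real.exp_add]; ring_nf
    have h4 : |G (t - τ)| ≤ Real.exp (-k * t) * Real.exp (k * τ) + A := by
      rw [← h3]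
      have := abs_add_le (G (t - τ) - Real.exp (-k * (t - τ))) (Real.exp (-k * (t - τ)))
      rw [sub_add_cancel, abs_of_pos (Real.exp_pos (-k * (t - τ)))] at this
      linarith
    rw [norm_mul, Real.norm_eq_abs, Real.norm_eq_abs, mul_comm]
    exact mul_le_mul (hB τ hτ.1) h4 (abs_nonneg _) hB0
  rw [← Real.norm_eq_abs]
  refine (intervalIntegral.norm_integral_le_of_norm_le ht
    (Eventually.of_forall h1) (Continuous.intervalIntegrable (by fun_prop) _ _)).trans ?_
  rw [intervalIntegral.integral_const_mul, intervalIntegral.integral_add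
    (Continuous.intervalIntegrable (by fun_prop) _ _)
    (Continuous.intervalIntegrable (by fun_prop) _ _), intervalIntegral.integral_const_mul,
    intervalIntegral.integral_const, smul_eq_mul, sub_zero]
  have h5 := integral_exp_mul_le (t := t) hk
  have h6 : Real.exp (-k * t) * (Real.exp (k * t) / k) = 1 / k := by
    rw [← mul_div_assoc, ← Real.exp_add]; simp
  rw [← h6, mul_comm t A]
  gcongr

section Velocity

variable (l α ε lam : ℝ) (a : ℕ → ℝ) (k : ℝ → ℝ) (f : ℝ → ℝ → ℝ)

/-- The velocity modes without the heat flow of the initial velocity. -/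
noncomputable def rm (n : ℕ) (t : ℝ) : ℝ :=
  ym' l α ε lam a (sinCoef l k) f n t - Real.exp (-(ε * bC l lam n) * t) * sinCoef l k n

/-- The function `e^{-λx/2} u_t(x,t)`. -/
noncomputable def Vhat (x t : ℝ) : ℝ :=
  2 / l * (∑' n, rm l α ε lam a k f n t * Real.sin (wave l n * x)) + heat l ε lam k x t

variable {l α ε lam a k f}

/-- After the heat flow of the initial velocity is removed, every remaining term is dominated down
to t = 0: b|G_n| ≤ C meets the summable a_n, G_n' - e^{-εbt} is O(1/n²), and the convolution is
O(1/n²) by `abs_convolution_exp_le`. -/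
lemma exists_rm_bound (hl : 0 < l) (hα : 0 < α) (hε : 0 < ε) (hlam : 0 < lam) {M D : ℝ}
    (hf : IsSource l M f) (hM : 0 ≤ M) (ha : Summable fun n => |a n|)
    (hd : ∀ n, |sinCoef l k n| ≤ D) (T : ℝ) :
    ∃ u : ℕ → ℝ, Summable u ∧ ∀ n, ∀ t ∈ Icc 0 T, |rm l α ε lam a k f n t| ≤ u n := by
  obtain ⟨C, hC, h⟩ := exists_mode_bounds hl hα hε hlam
  have hpi := Real.pi_pos
  set A := 1 / (ε * (Real.pi / l) ^ 2) with hA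
  refine ⟨fun n => C * |a n| + (C * D + M * l * (A + C * T)) * (1 / ((n : ℝ) + 1) ^ 2),
    (ha.mul_left C).add (summable_one_div_add_one_sq.mul_left _), fun n t ht => ?_⟩
  have hb := bC_pos l lam hlam n
  have hconv := abs_convolution_exp_le (k := ε * bC l lam n) (by positivity)
    (A := C * (1 / ((n : ℝ) + 1) ^ 2))
    (mul_nonneg hM hl.le) (fun t ht => (h n t ht).2.1)
    (fun t ht => hf.abs_srcCoef_le hl hlam n ht) ht.1
  have h1 : |-bC l lam n * gm l α ε lam n t * a n| ≤ C * |a n| := by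
    rw [abs_mul, abs_mul, abs_neg, abs_of_pos hb]
    gcongr; exact (h n t ht.1).2.2.2.1
  have h2 : |(gm' l α ε lam n t - Real.exp (-(ε * bC l lam n) * t)) * sinCoef l k n| ≤
      C * (1 / ((n : ℝ) + 1) ^ 2) * D := by
    rw [abs_mul]
    exact mul_le_mul (h n t ht.1).2.1 (hd n) (abs_nonneg _) (by positivity)
  have h3 : 1 / (ε * bC l lam n) ≤ A * (1 / ((n : ℝ) + 1) ^ 2) := by
    rw [hA, one_div_mul_one_div, mul_assoc]
    refine one_div_le_one_div_of_le (by positivity) ?_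
    gcongr
    exact le_bC l lam n
  have h4 : C * (1 / ((n : ℝ) + 1) ^ 2) * t ≤ C * (1 / ((n : ℝ) + 1) ^ 2) * T := by
    have := ht.2; gcongr
  have h5 : rm l α ε lam a k f n t = -bC l lam n * gm l α ε lam n t * a n +
      (gm' l α ε lam n t - Real.exp (-(ε * bC l lam n) * t)) * sinCoef l k n -
      ∫ τ in (0 : ℝ)..t, gm' l α ε lam n (t - τ) * srcCoef l lam f n τ := by
    rw [rm, ym']; ring
  rw [h5]
  calc _ ≤ C * |a n| + C * (1 / ((n : ℝ) + 1) ^ 2) * D +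
        M * l * (A * (1 / ((n : ℝ) + 1) ^ 2) + C * (1 / ((n : ℝ) + 1) ^ 2) * T) :=
        (abs_sub _ _).trans (add_le_add ((abs_add_le _ _).trans (add_le_add h1 h2))
          (hconv.trans (by gcongr)))
    _ = _ := by ring

lemma unifSum_rm (hl : 0 < l) (hα : 0 < α) (hε : 0 < ε) (hlam : 0 < lam) {M D : ℝ}
    (hf : IsSource l M f) (hM : 0 ≤ M) (ha : Summable fun n => |a n|)
    (hd : ∀ n, |sinCoef l k n| ≤ D) (T : ℝ) :
    UnifSum (fun n (p : ℝ × ℝ) => rm l α ε lam a k f n p.2 * Real.sin (wave l n * p.1))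
      (univ ×ˢ Icc 0 T) := by
  obtain ⟨u, hu, h⟩ := exists_rm_bound hl hα hε hlam hf hM ha hd T
  refine unifSum_of_bound hu fun n p hp => ?_
  rw [abs_mul]
  nlinarith [h n p.2 hp.2, abs_nonneg (rm l α ε lam a k f n p.2),
    Real.abs_sin_le_one (wave l n * p.1)]

lemma continuousOn_rm (hl : 0 < l) (hα : 0 < α) (hε : 0 < ε) (hlam : 0 < lam) {M : ℝ}
    (hf : IsSource l M f) (n : ℕ) : ContinuousOn (rm l α ε lam a k f n) (Ici 0) :=
  (continuousOn_ym' hl hα hε hlam hf n).sub (by fun_prop)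

lemma continuousOn_Vhat {K : NNReal} (hl : 0 < l) (hα : 0 < α) (hε : 0 < ε) (hlam : 0 < lam)
    {M D : ℝ} (hf : IsSource l M f) (hM : 0 ≤ M) (ha : Summable fun n => |a n|)
    (hd : ∀ n, |sinCoef l k n| ≤ D) (hk : LipschitzOnWith K k (Icc 0 l)) (T : ℝ) :
    ContinuousOn (fun p : ℝ × ℝ => Vhat l α ε lam a k f p.1 p.2)
      {p | p.1 ∈ Icc 0 l ∧ p.2 ∈ Icc 0 T ∧
        (p.2 = 0 → (p.1 = 0 → k 0 = 0) ∧ (p.1 = l → k l = 0))} := by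
  refine ContinuousOn.add (ContinuousOn.const_mul ?_ _) ?_
  · refine ((unifSum_rm hl hα hε hlam hf hM ha hd T).continuousOn fun n => ?_).mono
      fun p hp => ⟨mem_univ _, hp.2.1⟩
    exact ((continuousOn_rm hl hα hε hlam hf n).comp (by fun_prop) fun p hp => hp.2.1).mul
      (by fun_prop)
  · exact (continuousOn_heat hl hε hlam hk).mono fun p hp => ⟨hp.1, hp.2.1.1, hp.2.2⟩

lemma exists_Vhat_bound {K : NNReal} (hl : 0 < l) (hα : 0 < α) (hε : 0 < ε) (hlam : 0 < lam)
    {M D : ℝ} (hf : IsSource l M f) (hM : 0 ≤ M) (ha : Summable fun n => |a n|)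
    (hd : ∀ n, |sinCoef l k n| ≤ D) (hk : LipschitzOnWith K k (Icc 0 l)) (T : ℝ) :
    ∃ B, ∀ x ∈ Icc 0 l, ∀ t ∈ Icc 0 T, |Vhat l α ε lam a k f x t| ≤ B := by
  obtain ⟨u, hu, h⟩ := exists_rm_bound hl hα hε hlam hf hM ha hd T
  obtain ⟨B, hB⟩ := exists_heat_bound hl hε hlam hk
  refine ⟨2 / l * (∑' n, u n) + B, fun x hx t ht =>
    (abs_add_le _ _).trans (add_le_add ?_ (hB x hx t ht.1))⟩
  rw [abs_mul, abs_of_pos (show 0 < 2 / l by positivity)]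
  refine mul_le_mul_of_nonneg_left ?_ (by positivity)
  rw [← Real.norm_eq_abs]
  refine tsum_of_norm_bounded hu.hasSum fun n => ?_
  rw [Real.norm_eq_abs, abs_mul]
  nlinarith [h n t ht, abs_nonneg (rm l α ε lam a k f n t), Real.abs_sin_le_one (wave l n * x)]

lemma Vhat_zero_left (hl : 0 < l) (t : ℝ) : Vhat l α ε lam a k f 0 t = 0 := by
  simp [Vhat, heat_zero_left hl]

lemma Vhat_right (hl : 0 < l) (t : ℝ) : Vhat l α ε lam a k f l t = 0 := by
  simp [Vhat, heat_right hl, sin_wave_right hl]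

lemma Vhat_initial {K : NNReal} (hl : 0 < l) (hε : 0 < ε) (hlam : 0 < lam)
    (hk : LipschitzOnWith K k (Icc 0 l)) {x : ℝ} (hx : x ∈ Icc 0 l)
    (h0 : x = 0 → k 0 = 0) (h1 : x = l → k l = 0) : Vhat l α ε lam a k f x 0 = k x := by
  rcases eq_or_lt_of_le hx.1 with h | h
  · rw [← h, Vhat_zero_left hl, h0 h.symm]
  rcases eq_or_lt_of_le hx.2 with h' | h'
  · rw [h', Vhat_right hl, h1 h']
  · rw [Vhat, heat_initial hl hε hlam hk ⟨h, h'⟩]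
    simp [rm, ym'_zero]

lemma exists_ym'_bound (hl : 0 < l) (hα : 0 < α) (hε : 0 < ε) (hlam : 0 < lam) {M D : ℝ}
    (hf : IsSource l M f) (hM : 0 ≤ M) (ha : Summable fun n => |a n|)
    (hd : ∀ n, |sinCoef l k n| ≤ D) {δ : ℝ} (hδ : 0 < δ) (T : ℝ) :
    ∃ u : ℕ → ℝ, Summable u ∧
      ∀ n, ∀ t ∈ Icc δ T, |ym' l α ε lam a (sinCoef l k) f n t| ≤ u n := by
  obtain ⟨u, hu, h⟩ := exists_rm_bound hl hα hε hlam hf hM ha hd T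
  refine ⟨_, hu.add (summable_one_div_add_one_sq.mul_left
    (1 / (ε * (Real.pi / l) ^ 2 * δ) * D)), fun n t ht => ?_⟩
  have h1 : |Real.exp (-(ε * bC l lam n) * t) * sinCoef l k n| ≤
      1 / (ε * (Real.pi / l) ^ 2 * δ) * (1 / ((n : ℝ) + 1) ^ 2) * D := by
    have hpi := Real.pi_pos
    rw [abs_mul, abs_of_pos (Real.exp_pos _)]
    exact mul_le_mul (exp_bC_le hl hε hδ n ht.1) (hd n) (abs_nonneg _) (by positivity)
  have h3 := abs_add_le (rm l α ε lam a k f n t)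
    (Real.exp (-(ε * bC l lam n) * t) * sinCoef l k n)
  rw [rm, sub_add_cancel, ← rm] at h3
  have := h n t ⟨hδ.le.trans ht.1, ht.2⟩
  linarith

lemma unifSum_ym' (hl : 0 < l) (hα : 0 < α) (hε : 0 < ε) (hlam : 0 < lam) {M D : ℝ}
    (hf : IsSource l M f) (hM : 0 ≤ M) (ha : Summable fun n => |a n|)
    (hd : ∀ n, |sinCoef l k n| ≤ D) {δ : ℝ} (hδ : 0 < δ) (T : ℝ) :
    UnifSum (fun n (p : ℝ × ℝ) => ym' l α ε lam a (sinCoef l k) f n p.2 *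
      Real.sin (wave l n * p.1)) (univ ×ˢ Icc δ T) := by
  obtain ⟨u, hu, h⟩ := exists_ym'_bound hl hα hε hlam hf hM ha hd hδ T
  refine unifSum_of_bound hu fun n p hp => ?_
  rw [abs_mul]
  nlinarith [h n p.2 hp.2, abs_nonneg (ym' l α ε lam a (sinCoef l k) f n p.2),
    Real.abs_sin_le_one (wave l n * p.1)]

lemma Vhat_eq_tsum {K : NNReal} (hl : 0 < l) (hα : 0 < α) (hε : 0 < ε) (hlam : 0 < lam)
    {M D : ℝ} (hf : IsSource l M f) (hM : 0 ≤ M) (ha : Summable fun n => |a n|)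
    (hd : ∀ n, |sinCoef l k n| ≤ D) (hk : LipschitzOnWith K k (Icc 0 l)) (x : ℝ) {t : ℝ}
    (ht : 0 < t) : Vhat l α ε lam a k f x t =
      2 / l * ∑' n, ym' l α ε lam a (sinCoef l k) f n t * Real.sin (wave l n * x) := by
  have s1 := (unifSum_rm hl hα hε hlam hf hM ha hd t).summable (x := (x, t))
    ⟨mem_univ _, ht.le, le_rfl⟩
  have s2 := (unifSum_ym' hl hα hε hlam hf hM ha hd ht t).summable (x := (x, t))
    ⟨mem_univ _, le_rfl, le_rfl⟩
  have s3 := s2.sub s1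
  rw [Vhat, heat_eq_tsum hl hε hlam hk x ht, ← mul_add]
  congr 1
  rw [← s1.tsum_add (s3.congr fun n => ?_)]
  · exact tsum_congr fun n => by rw [rm]; ring
  · simp only [rm]; ring

lemma hasDerivAt_Uhat {K : NNReal} (hl : 0 < l) (hα : 0 < α) (hε : 0 < ε) (hlam : 0 < lam)
    {M D : ℝ} (hf : IsSource l M f) (hM : 0 ≤ M) (ha : Summable fun n => |a n|)
    (hd : ∀ n, |sinCoef l k n| ≤ D) (hk : LipschitzOnWith K k (Icc 0 l)) (x : ℝ) {t : ℝ}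
    (ht : 0 < t) : HasDerivAt (fun s => Uhat l α ε lam a (sinCoef l k) f x s)
      (Vhat l α ε lam a k f x t) t := by
  rw [Vhat_eq_tsum hl hα hε hlam hf hM ha hd hk x ht]
  have hmem : t ∈ Ioo (t / 2) (t + 1) := ⟨by linarith, by linarith⟩
  refine (UnifSum.hasDerivAt isOpen_Ioo ((unifSum_ym' hl hα hε hlam hf hM ha hd
    (δ := t / 2) (by linarith) (t + 1)).comp (fun s => (x, s)) fun s hs =>
      ⟨mem_univ _, hs.1.le, hs.2.le⟩) (fun n s hs => ?_) (fun s hs => ?_) hmem).const_mul _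
  · exact (hasDerivAt_ym hl hlam hf n ((by linarith : 0 < t / 2).trans hs.1)).mul_const _
  · exact (unifSum_ym hl hα hε hlam hf hM ha hd (t + 1)).summable (x := (x, s))
      ⟨mem_univ _, ((by linarith : 0 < t / 2).trans hs.1).le, hs.2.le⟩

/-- The uniform majorants for the velocity series are available only on t ≥ δ > 0. At t = 0 the
one-sided derivative is obtained from continuity of the function and the limit of its derivative as
t → 0⁺, that is, from continuity of `Vhat` up to the initial line. -/
lemma hasDerivWithinAt_Uhat {K : NNReal} (hl : 0 < l) (hα : 0 < α) (hε : 0 < ε) (hlam : 0 < lam)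
    {M D : ℝ} (hf : IsSource l M f) (hM : 0 ≤ M) (ha : Summable fun n => |a n|)
    (hd : ∀ n, |sinCoef l k n| ≤ D) (hk : LipschitzOnWith K k (Icc 0 l)) {T x t : ℝ} (hT : 0 < T)
    (hx : x ∈ Icc 0 l) (ht : 0 ≤ t) (h0 : t = 0 → (x = 0 → k 0 = 0) ∧ (x = l → k l = 0)) :
    HasDerivWithinAt (fun s => Uhat l α ε lam a (sinCoef l k) f x s)
      (Vhat l α ε lam a k f x t) (Icc 0 T) t := by
  rcases eq_or_lt_of_le ht with h | h
  · subst h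
    have hU : ContinuousOn (fun s => Uhat l α ε lam a (sinCoef l k) f x s) (Icc 0 T) :=
      (continuousOn_Uhat hl hα hε hlam hf hM ha hd T).comp (f := fun s => (x, s)) (by fun_prop)
        fun s hs => ⟨mem_univ _, hs⟩
    have hV : ContinuousOn (fun s => Vhat l α ε lam a k f x s) (Icc 0 T) :=
      (continuousOn_Vhat hl hα hε hlam hf hM ha hd hk T).comp (f := fun s => (x, s))
        (by fun_prop) fun s hs => ⟨hx, hs, fun _ => h0 rfl⟩
    have h0T : (0 : ℝ) ∈ Icc 0 T := ⟨le_rfl, hT.le⟩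
    have hder : ∀ s ∈ Ioo 0 T, HasDerivAt (fun s => Uhat l α ε lam a (sinCoef l k) f x s)
        (Vhat l α ε lam a k f x s) s := fun s hs =>
      hasDerivAt_Uhat hl hα hε hlam hf hM ha hd hk x hs.1
    refine (hasDerivWithinAt_Ici_of_tendsto_deriv (s := Ioo 0 T)
      (fun s hs => (hder s hs).differentiableAt.differentiableWithinAt)
      ((hU 0 h0T).mono Ioo_subset_Icc_self) (Ioo_mem_nhdsGT hT) ?_).mono Icc_subset_Ici_self
    have h1 : Tendsto (fun s => Vhat l α ε lam a k f x s) (𝓝[>] 0)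
        (𝓝 (Vhat l α ε lam a k f x 0)) :=
      ((hV 0 h0T).mono Ioo_subset_Icc_self).tendsto.mono_left
        (nhdsWithin_le_of_mem (Ioo_mem_nhdsGT hT))
    refine h1.congr' ?_
    filter_upwards [Ioo_mem_nhdsGT hT] with s hs using (hder s hs).deriv.symm
  · exact (hasDerivAt_Uhat hl hα hε hlam hf hM ha hd hk x h).hasDerivWithinAt

end Velocity

/-! ### Lipschitz continuity in space -/

/-- Here the sine vanishes at both ends, so g itself needs no boundary condition. -/
lemma wave_mul_integral_cos {l : ℝ} (hl : 0 < l) {g : ℝ → ℝ} {K : NNReal}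
    (hg : LipschitzOnWith K g (Icc 0 l)) (n : ℕ) :
    wave l n * (∫ x in (0 : ℝ)..l, g x * Real.cos (wave l n * x)) = -sinCoef l (deriv g) n := by
  have hac : AbsolutelyContinuousOnInterval g 0 l := by
    refine LipschitzOnWith.absolutelyContinuousOnInterval (K := K) ?_
    rwa [uIcc_of_le hl.le]
  have hsin : AbsolutelyContinuousOnInterval (fun x => Real.sin (wave l n * x)) 0 l :=
    ContDiffOn.absolutelyContinuousOnInterval (by fun_prop)
  have hder : ∀ x, deriv (fun x => Real.sin (wave l n * x)) x =
      wave l n * Real.cos (wave l n * x) := fun x => by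
    have h : HasDerivAt (fun x => Real.sin (wave l n * x))
        (Real.cos (wave l n * x) * (wave l n * 1)) x :=
      (Real.hasDerivAt_sin _).comp x ((hasDerivAt_id x).const_mul _)
    rw [h.deriv]; ring
  have := hac.integral_mul_deriv_eq_deriv_mul hsin
  simp_rw [hder, sin_wave_right hl, mul_zero, Real.sin_zero, mul_zero] at this
  have h2 : ∫ x in (0 : ℝ)..l, g x * (wave l n * Real.cos (wave l n * x)) =
      wave l n * ∫ x in (0 : ℝ)..l, g x * Real.cos (wave l n * x) := by
    rw [← intervalIntegral.integral_const_mul]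
    exact intervalIntegral.integral_congr fun x _ => by ring
  rw [h2] at this
  rw [this, sinCoef]
  ring

/-- Two integrations by parts make (n+1)² times the coefficient a multiple of a sine coefficient of
the bounded function g', hence square-summable; Cauchy–Schwarz with weight -1 gives the claim. The
function g is a Lipschitz extension of h' to the closed interval. -/
lemma summable_mul_sinCoef {l : ℝ} (hl : 0 < l) {h g : ℝ → ℝ} {K L : NNReal}
    (hh : LipschitzOnWith K h (Icc 0 l)) (h0 : h 0 = 0) (h1 : h l = 0)
    (hg : LipschitzOnWith L g (Icc 0 l)) (hd : ∀ x ∈ Ioo 0 l, deriv h x = g x) :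
    Summable fun n : ℕ => ((n : ℝ) + 1) * |sinCoef l h n| := by
  obtain ⟨A, hA, hw⟩ := weighted_sum_le_of_sq (p := -1) (by norm_num)
  have hpi := Real.pi_pos
  have key : ∀ n : ℕ, ((n : ℝ) + 1) ^ 2 * sinCoef l h n =
      -((l / Real.pi) ^ 2 * sinCoef l (deriv g) n) := by
    intro n
    have e1 := wave_mul_sinCoef hl hh h0 h1 n
    rw [intervalIntegral_congr_Ioo hl (g := fun x => g x * Real.cos (wave l n * x))
      fun x hx => by rw [hd x hx]] at e1
    have e2 := wave_mul_integral_cos hl hg n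
    rw [← e1, wave_eq] at e2
    have e3 : sinCoef l (deriv g) n = -(((n : ℝ) + 1) * (Real.pi / l) *
      (((n : ℝ) + 1) * (Real.pi / l) * sinCoef l h n)) := by rw [e2, neg_neg]
    rw [e3]
    field_simp
  have hb := hw (fun n => ((n : ℝ) + 1) ^ 2 * sinCoef l h n)
    ((l / Real.pi) ^ 4 * (l ^ 2 * L ^ 2 / 2)) fun N => by
      have := sum_sinCoef_sq_le hl (bddMeas_deriv hg) N
      refine le_trans (le_of_eq ?_) (mul_le_mul_of_nonneg_left this (by positivity))
      rw [Finset.mul_sum]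
      exact Finset.sum_congr rfl fun n _ => by rw [key]; ring
  refine summable_of_sum_range_le (fun n => by positivity) fun N => (le_of_eq ?_).trans (hb N)
  refine Finset.sum_congr rfl fun n _ => ?_
  have hn : (0 : ℝ) < (n : ℝ) + 1 := by positivity
  rw [abs_mul, abs_of_pos (show (0 : ℝ) < ((n : ℝ) + 1) ^ 2 by positivity), Real.rpow_neg_one]
  field_simp

lemma sum_abs_integral_le {s t : ℝ} (hst : s ≤ t) {φ : ℕ → ℝ → ℝ} {g : ℝ → ℝ} (N : ℕ)
    (hφ : ∀ n, IntervalIntegrable (φ n) volume s t) (hg : IntervalIntegrable g volume s t)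
    (hb : ∀ τ ∈ Ioo s t, ∑ n ∈ Finset.range N, |φ n τ| ≤ g τ) :
    ∑ n ∈ Finset.range N, |∫ τ in s..t, φ n τ| ≤ ∫ τ in s..t, g τ := by
  calc ∑ n ∈ Finset.range N, |∫ τ in s..t, φ n τ|
      ≤ ∑ n ∈ Finset.range N, ∫ τ in s..t, |φ n τ| :=
        Finset.sum_le_sum fun n _ => intervalIntegral.abs_integral_le_integral_abs hst
    _ = ∫ τ in s..t, ∑ n ∈ Finset.range N, |φ n τ| :=
        (intervalIntegral.integral_finsetSum fun n _ => (hφ n).abs).symm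
    _ ≤ ∫ τ in s..t, g τ := by
        refine intervalIntegral.integral_mono_on_of_le_Ioo hst ?_ hg hb
        convert! IntervalIntegrable.sum (Finset.range N) (f := fun n τ => |φ n τ|)
          fun n _ => (hφ n).abs using 1
        ext τ; simp

/-! ### Decay of the coefficients of the weighted initial value -/

section

variable {l T α ε lam : ℝ} {h₀ h₁ : ℝ → ℝ} {F : ℝ → ℝ → ℝ → ℝ}

/-- This is where the bound on h₀'' enters: it makes the derivative of e^{-λx/2} h₀ Lipschitz on the
open interval, and this derivative then extends to a Lipschitz function on the line. Without it the
solution would not be known to be Lipschitz in x. -/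
lemma DataAssumption.summable_mul_coef (hl : 0 < l) (hlam : 0 < lam)
    (hdata : DataAssumption l T h₀ h₁ F) (h0 : h₀ 0 = 0) (hl0 : h₀ l = 0) :
    Summable fun n : ℕ => ((n : ℝ) + 1) * |sinCoef l (fun ξ => wt lam ξ * h₀ ξ) n| := by
  obtain ⟨K, hK⟩ := hdata.exists_lipschitz_h₀ hl
  obtain ⟨K', hK'⟩ := exists_lipschitz_wt_mul hlam hK
  obtain ⟨B, hB⟩ := hdata.bdd
  have hB0 : 0 ≤ B := (abs_nonneg _).trans (hB (l / 2) ⟨by linarith, by linarith⟩).1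
  have hwt : ∀ x, HasDerivAt (wt lam) (-(lam / 2) * wt lam x) x := fun x => by
    convert! ((hasDerivAt_id x).const_mul (-(lam / 2))).exp using 1
    simp [wt]; ring
  have hd : ∀ x ∈ Ioo 0 l, HasDerivAt (fun ξ => wt lam ξ * h₀ ξ)
      (wt lam x * (-(lam / 2) * h₀ x + deriv h₀ x)) x := fun x hx => by
    have h2 : HasDerivAt h₀ (deriv h₀ x) x := ((hdata.c1_h₀.differentiableOn one_ne_zero x
      hx).differentiableAt (Ioo_mem_nhds hx.1 hx.2)).hasDerivAt
    exact ((hwt x).mul h2).congr_deriv (by ring)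
  have hd2 : ∀ x ∈ Ioo 0 l, HasDerivWithinAt
      (fun x => wt lam x * (-(lam / 2) * h₀ x + deriv h₀ x))
      (wt lam x * (lam ^ 2 / 4 * h₀ x - lam * deriv h₀ x + deriv (deriv h₀) x)) (Ioo 0 l) x :=
    fun x hx => by
    have h2 : HasDerivAt h₀ (deriv h₀ x) x := ((hdata.c1_h₀.differentiableOn one_ne_zero x
      hx).differentiableAt (Ioo_mem_nhds hx.1 hx.2)).hasDerivAt
    have h3 : HasDerivAt (deriv h₀) (deriv (deriv h₀) x) x := ((hdata.diff_h₀' x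
      hx).differentiableAt (Ioo_mem_nhds hx.1 hx.2)).hasDerivAt
    exact (((hwt x).mul ((h2.const_mul _).add h3)).congr_deriv
      (by simp only [Pi.add_apply]; ring)).hasDerivWithinAt
  have hlip := (convex_Ioo 0 l).lipschitzOnWith_of_nnnorm_hasDerivWithin_le hd2
    (C := (lam ^ 2 / 4 * B + lam * B + B).toNNReal) fun x hx => by
      rw [← NNReal.coe_le_coe, coe_nnnorm, Real.coe_toNNReal _ (by positivity), Real.norm_eq_abs,
        abs_mul]
      obtain ⟨b1, -, b2, b3, -⟩ := hB x hx
      have h3 : |lam ^ 2 / 4 * h₀ x - lam * deriv h₀ x + deriv (deriv h₀) x| ≤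
          lam ^ 2 / 4 * B + lam * B + B := by
        refine (abs_add_le _ _).trans (add_le_add ((abs_sub _ _).trans (add_le_add ?_ ?_)) b3)
        · rw [abs_mul, abs_of_pos (show 0 < lam ^ 2 / 4 by positivity)]; gcongr
        · rw [abs_mul, abs_of_pos hlam]; gcongr
      calc _ ≤ 1 * |lam ^ 2 / 4 * h₀ x - lam * deriv h₀ x + deriv (deriv h₀) x| := by
            gcongr; exact abs_wt_le hlam hx.1.le
        _ ≤ _ := by rw [one_mul]; exact h3
  obtain ⟨g, hg, hge⟩ := hlip.extend_real
  exact summable_mul_sinCoef hl hK' (by simp [h0]) (by simp [hl0])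
    (hg.lipschitzOnWith (s := Icc 0 l)) fun x hx => by rw [(hd x hx).deriv]; exact hge hx

end

section Space

variable {l α ε lam : ℝ} {a d : ℕ → ℝ} {f : ℝ → ℝ → ℝ}

/-- One power of the frequency can be spared: (n+1)|G_n| is at most C/(n+1), and this factor is
summed by Cauchy–Schwarz against the square-summable coefficients of the velocity and of the source.
-/
lemma exists_weighted_ym_bound (hl : 0 < l) (hα : 0 < α) (hε : 0 < ε) (hlam : 0 < lam) {M D : ℝ}
    (hf : IsSource l M f) (ha : Summable fun n : ℕ => ((n : ℝ) + 1) * |a n|)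
    (hd : ∀ N, ∑ n ∈ Finset.range N, d n ^ 2 ≤ D) (T : ℝ) :
    ∃ C, ∀ t ∈ Icc 0 T, ∀ N, ∑ n ∈ Finset.range N, ((n : ℝ) + 1) * |ym l α ε lam a d f n t| ≤ C := by
  obtain ⟨C, hC, h⟩ := exists_mode_bounds hl hα hε hlam
  obtain ⟨A, hA, hw⟩ := weighted_sum_le_of_sq (p := -1) (by norm_num)
  set E := A * √(l ^ 2 * M ^ 2 / 2) with hE
  refine ⟨C * (∑' n : ℕ, ((n : ℝ) + 1) * |a n|) + C * (A * √D) + C * E * T, fun t ht N => ?_⟩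
  have hsrc : ∀ τ, 0 < τ → ∑ n ∈ Finset.range N, ((n : ℝ) + 1) ^ (-1 : ℝ) * |srcCoef l lam f n τ| ≤
      E := fun τ hτ => hw _ _ (sum_sinCoef_sq_le hl ((hf.bddMeas hτ).wt_mul hlam)) N
  have hone : ∀ n : ℕ, ((n : ℝ) + 1) * (1 / ((n : ℝ) + 1) ^ 2) = ((n : ℝ) + 1) ^ (-1 : ℝ) := by
    intro n
    rw [Real.rpow_neg_one]
    field_simp
  have hconv : ∑ n ∈ Finset.range N, |∫ τ in (0 : ℝ)..t,
      ((n : ℝ) + 1) * (gm l α ε lam n (t - τ) * srcCoef l lam f n τ)| ≤ C * E * T := by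
    refine (sum_abs_integral_le ht.1 (g := fun _ => C * E) N (fun n => ?_) (by simp)
      fun τ hτ => ?_).trans ?_
    · exact ((intervalIntegrable_of_continuousOn_Ioi (hf.continuousOn_srcCoef hl hlam n)
        (fun t ht => hf.abs_srcCoef_le hl hlam n ht) le_rfl ht.1).continuousOn_mul
        ((continuous_gm l α ε lam n).comp (by fun_prop)).continuousOn).const_mul _
    · refine le_trans (Finset.sum_le_sum fun n _ => ?_)
        ((Finset.mul_sum _ _ _).symm.le.trans (mul_le_mul_of_nonneg_left (hsrc τ hτ.1) hC.le))
      have hn : (0 : ℝ) < (n : ℝ) + 1 := by positivity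
      rw [abs_mul, abs_mul, abs_of_pos hn, ← hone]
      have := (h n (t - τ) (by linarith [hτ.2])).1
      calc _ ≤ ((n : ℝ) + 1) * (C * (1 / ((n : ℝ) + 1) ^ 2) * |srcCoef l lam f n τ|) := by gcongr
        _ = _ := by ring
    · rw [intervalIntegral.integral_const, smul_eq_mul, sub_zero, mul_comm]
      have := ht.2
      gcongr
  have hterm : ∀ n : ℕ, ((n : ℝ) + 1) * |ym l α ε lam a d f n t| ≤
      C * (((n : ℝ) + 1) * |a n|) + C * (((n : ℝ) + 1) ^ (-1 : ℝ) * |d n|) +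
      |∫ τ in (0 : ℝ)..t, ((n : ℝ) + 1) * (gm l α ε lam n (t - τ) * srcCoef l lam f n τ)| := by
    intro n
    have hn : (0 : ℝ) < (n : ℝ) + 1 := by positivity
    rw [intervalIntegral.integral_const_mul, abs_mul, abs_of_pos hn, ← hone]
    have h1 := (h n t ht.1).1
    have h2 := (h n t ht.1).2.2.1
    have h3 : |ym l α ε lam a d f n t| ≤ C * |a n| + C * (1 / ((n : ℝ) + 1) ^ 2) * |d n| +
        |∫ τ in (0 : ℝ)..t, gm l α ε lam n (t - τ) * srcCoef l lam f n τ| := by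
      refine (abs_sub _ _).trans (add_le_add ((abs_add_le _ _).trans (add_le_add ?_ ?_)) le_rfl)
      · rw [abs_mul]; gcongr
      · rw [abs_mul]; gcongr
    calc _ ≤ ((n : ℝ) + 1) * (C * |a n| + C * (1 / ((n : ℝ) + 1) ^ 2) * |d n| +
        |∫ τ in (0 : ℝ)..t, gm l α ε lam n (t - τ) * srcCoef l lam f n τ|) := by gcongr
      _ = _ := by ring
  refine (Finset.sum_le_sum fun n _ => hterm n).trans ?_
  rw [Finset.sum_add_distrib, Finset.sum_add_distrib, ← Finset.mul_sum, ← Finset.mul_sum]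
  refine add_le_add (add_le_add ?_ ?_) hconv
  · gcongr
    exact ha.sum_le_tsum _ fun n _ => by positivity
  · gcongr
    exact hw d D hd N

lemma abs_sin_sub_sin_le (k x y : ℝ) : |Real.sin (k * x) - Real.sin (k * y)| ≤ |k| * |x - y| := by
  have h := Real.lipschitzWith_sin.dist_le_mul (k * x) (k * y)
  rw [Real.dist_eq, Real.dist_eq, ← mul_sub, abs_mul] at h
  simpa using h

lemma exists_lipschitz_Uhat (hl : 0 < l) (hα : 0 < α) (hε : 0 < ε) (hlam : 0 < lam) {M D : ℝ}
    (hf : IsSource l M f) (ha : Summable fun n : ℕ => ((n : ℝ) + 1) * |a n|)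
    (hd : ∀ N, ∑ n ∈ Finset.range N, d n ^ 2 ≤ D) (T : ℝ) :
    ∃ L, 0 ≤ L ∧ ∀ t ∈ Icc 0 T, ∀ x y,
      |Uhat l α ε lam a d f x t - Uhat l α ε lam a d f y t| ≤ L * |x - y| := by
  obtain ⟨C, hC⟩ := exists_weighted_ym_bound hl hα hε hlam hf ha hd T
  have hpi := Real.pi_pos
  refine ⟨2 / l * (Real.pi / l * max C 0), by positivity, fun t ht x y => ?_⟩
  have hs : Summable fun n : ℕ => ((n : ℝ) + 1) * |ym l α ε lam a d f n t| :=
    summable_of_sum_range_le (fun n => by positivity) (hC t ht)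
  have hs1 : Summable fun n : ℕ => |ym l α ε lam a d f n t| :=
    Summable.of_nonneg_of_le (fun _ => abs_nonneg _) (fun n => by
      nlinarith [abs_nonneg (ym l α ε lam a d f n t), n.cast_nonneg (α := ℝ)]) hs
  have hsx : ∀ x, Summable fun n => ym l α ε lam a d f n t * Real.sin (wave l n * x) := fun x =>
    Summable.of_norm_bounded hs1 fun n => by
      rw [Real.norm_eq_abs, abs_mul]
      exact mul_le_of_le_one_right (abs_nonneg _) (Real.abs_sin_le_one _)
  rw [Uhat, Uhat, ← mul_sub, ← (hsx x).tsum_sub (hsx y), abs_mul,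
    abs_of_pos (show 0 < 2 / l by positivity), mul_assoc, ← Real.norm_eq_abs (∑' _, _)]
  refine mul_le_mul_of_nonneg_left ?_ (by positivity)
  refine (tsum_of_norm_bounded ((hs.mul_left (Real.pi / l * |x - y|)).hasSum) fun n => ?_).trans ?_
  · rw [← mul_sub, norm_mul, Real.norm_eq_abs, Real.norm_eq_abs]
    have := abs_sin_sub_sin_le (wave l n) x y
    rw [abs_of_pos (wave_pos hl n), wave_eq] at this
    calc _ ≤ |ym l α ε lam a d f n t| * (((n : ℝ) + 1) * (Real.pi / l) * |x - y|) := by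
          rw [wave_eq]; gcongr
      _ = _ := by ring
  · rw [tsum_mul_left]
    have : ∑' n : ℕ, ((n : ℝ) + 1) * |ym l α ε lam a d f n t| ≤ max C 0 :=
      (Summable.tsum_le_of_sum_range_le hs (hC t ht)).trans (le_max_left _ _)
    calc _ ≤ Real.pi / l * |x - y| * max C 0 := by gcongr
      _ = _ := by ring

end Space

/-! ### Gain of regularity -/

/-- The exponential is traded for (c(n+1)²y)^{-15/16}, whose singularity in y is still integrable.
The exponent 15/8 is below 2 but large enough for both applications: -5/8 + 15/8 exceeds 1 and 1/4 +
15/8 exceeds 2. -/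
lemma rpow_mul_exp_neg_le {c y : ℝ} (hc : 0 < c) (hy : 0 < y) {κ : ℝ} {n : ℕ}
    (hκ : c * ((n : ℝ) + 1) ^ 2 ≤ κ) :
    ((n : ℝ) + 1) ^ (15 / 8 : ℝ) * Real.exp (-κ * y) ≤
      c ^ (-(15 / 16) : ℝ) * y ^ (-(15 / 16) : ℝ) := by
  have hn : (0 : ℝ) < (n : ℝ) + 1 := by positivity
  have h1 : Real.exp (-κ * y) ≤ (c * ((n : ℝ) + 1) ^ 2 * y) ^ (-(15 / 16) : ℝ) := by
    refine le_trans (Real.exp_le_exp.2 ?_) (exp_neg_le_rpow (by norm_num) (by norm_num)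
      (by positivity))
    rw [neg_mul, neg_le_neg_iff]
    gcongr
  have h2 : (((n : ℝ) + 1) ^ 2) ^ (-(15 / 16) : ℝ) = ((n : ℝ) + 1) ^ (-(15 / 8) : ℝ) := by
    rw [← Real.rpow_natCast, ← Real.rpow_mul hn.le]; norm_num
  rw [Real.mul_rpow (by positivity) hy.le, Real.mul_rpow hc.le (by positivity), h2] at h1
  calc _ ≤ ((n : ℝ) + 1) ^ (15 / 8 : ℝ) * (c ^ (-(15 / 16) : ℝ) * ((n : ℝ) + 1) ^ (-(15 / 8) : ℝ) *
        y ^ (-(15 / 16) : ℝ)) := by gcongr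
    _ = (((n : ℝ) + 1) ^ (15 / 8 : ℝ) * ((n : ℝ) + 1) ^ (-(15 / 8) : ℝ)) *
        (c ^ (-(15 / 16) : ℝ) * y ^ (-(15 / 16) : ℝ)) := by ring
    _ = _ := by rw [← Real.rpow_add hn]; norm_num

/-- Duhamel's integral gains almost two powers of the frequency. -/
lemma duhamel_gain {c σ : ℝ} (hc : 0 < c) {κ : ℕ → ℝ} (hκ : ∀ n : ℕ, c * ((n : ℝ) + 1) ^ 2 ≤ κ n)
    {ρ : ℕ → ℝ → ℝ} {s t B : ℝ} (hst : s ≤ t) (hρ : ∀ n, IntervalIntegrable (ρ n) volume s t)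
    (hB : ∀ τ ∈ Ioo s t, ∀ N, ∑ n ∈ Finset.range N, ((n : ℝ) + 1) ^ σ * |ρ n τ| ≤ B) (N : ℕ) :
    ∑ n ∈ Finset.range N, ((n : ℝ) + 1) ^ (σ + 15 / 8) *
      |∫ τ in s..t, Real.exp (-κ n * (t - τ)) * ρ n τ| ≤
      16 * c ^ (-(15 / 16) : ℝ) * B * (t - s) ^ (1 / 16 : ℝ) := by
  -- The constant 16 (t - s)^{1/16} in the bound is the integral of this singular function over [s,
  -- t].
  have hi : IntervalIntegrable (fun τ => (t - τ) ^ (-(15 / 16) : ℝ)) volume s t := by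
    have := (intervalIntegral.intervalIntegrable_rpow' (a := t - s) (b := t - t)
      (r := -(15 / 16)) (by norm_num)).comp_sub_left t
    simpa using this
  have h := sum_abs_integral_le hst
    (φ := fun n τ => ((n : ℝ) + 1) ^ (σ + 15 / 8) * (Real.exp (-κ n * (t - τ)) * ρ n τ))
    (g := fun τ => c ^ (-(15 / 16) : ℝ) * B * (t - τ) ^ (-(15 / 16) : ℝ)) N
    (fun n => ((hρ n).continuousOn_mul (by fun_prop)).const_mul _) (hi.const_mul _)
    fun τ hτ => by
      refine le_trans (Finset.sum_le_sum fun n _ => ?_)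
        ((Finset.mul_sum (Finset.range N) (fun n : ℕ => ((n : ℝ) + 1) ^ σ * |ρ n τ|)
        (c ^ (-(15 / 16) : ℝ) * (t - τ) ^ (-(15 / 16) : ℝ))).symm.le.trans
        ((mul_le_mul_of_nonneg_left (hB τ hτ N) ?_).trans (le_of_eq (by ring))))
      · have hn : (0 : ℝ) < (n : ℝ) + 1 := by positivity
        rw [abs_mul, abs_mul, abs_of_pos (Real.exp_pos _),
          abs_of_pos (Real.rpow_pos_of_pos hn _), Real.rpow_add hn]
        have h1 := rpow_mul_exp_neg_le hc (y := t - τ) (by linarith [hτ.2]) (hκ n)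
        calc _ = ((n : ℝ) + 1) ^ σ * |ρ n τ| * (((n : ℝ) + 1) ^ (15 / 8 : ℝ) *
              Real.exp (-κ n * (t - τ))) := by ring
          _ ≤ ((n : ℝ) + 1) ^ σ * |ρ n τ| *
              (c ^ (-(15 / 16) : ℝ) * (t - τ) ^ (-(15 / 16) : ℝ)) := by gcongr
          _ = _ := by ring
      · have : 0 ≤ t - τ := by linarith [hτ.2]
        positivity
  refine le_trans (le_of_eq (Finset.sum_congr rfl fun n _ => ?_)) (h.trans (le_of_eq ?_))
  · rw [intervalIntegral.integral_const_mul, abs_mul,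
      abs_of_pos (Real.rpow_pos_of_pos (show (0 : ℝ) < (n : ℝ) + 1 by positivity) _)]
  · rw [intervalIntegral.integral_const_mul,
      intervalIntegral.integral_comp_sub_left (fun y => y ^ (-(15 / 16) : ℝ)) t, sub_self,
      integral_rpow (Or.inl (by norm_num))]
    rw [Real.zero_rpow (by norm_num)]
    norm_num
    ring

/-- The data that determine a solution of the linear problem. -/
structure FlowData (l α ε lam M : ℝ) (K : NNReal) (a : ℕ → ℝ) (k : ℝ → ℝ) (f : ℝ → ℝ → ℝ) :
    Prop where
  hl : 0 < l
  hα : 0 < α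
  hε : 0 < ε
  hlam : 0 < lam
  hf : IsSource l M f
  ha : Summable fun n : ℕ => ((n : ℝ) + 1) * |a n|
  hk : LipschitzOnWith K k (Icc 0 l)

section Relaxed

variable (l α ε lam : ℝ) (a : ℕ → ℝ) (k : ℝ → ℝ) (f : ℝ → ℝ → ℝ)

/-- The modes of `ε u_t + u`. -/
noncomputable def zm (n : ℕ) (t : ℝ) : ℝ :=
  ε * ym' l α ε lam a (sinCoef l k) f n t + ym l α ε lam a (sinCoef l k) f n t

/-- The source of the heat equation for `ε u_t + u`. -/
noncomputable def rhat (x t : ℝ) : ℝ :=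
  (1 - ε * α) * Vhat l α ε lam a k f x t - ε * (wt lam x * f x t)

/-- The modes of the source `rhat`. -/
noncomputable def rz (n : ℕ) (t : ℝ) : ℝ :=
  (1 - ε * α) * ym' l α ε lam a (sinCoef l k) f n t - ε * srcCoef l lam f n t

variable {l α ε lam a k f} {M : ℝ} {K : NNReal}

namespace FlowData

variable (S : FlowData l α ε lam M K a k f)
include S

lemma hM : 0 ≤ M := (S.hf.bddMeas zero_lt_one).nonneg S.hl

lemma summable_a : Summable fun n => |a n| :=
  Summable.of_nonneg_of_le (fun _ => abs_nonneg _)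
    (fun n => by nlinarith [abs_nonneg (a n), n.cast_nonneg (α := ℝ)]) S.ha

lemma exists_bddMeas : ∃ B, BddMeas l B k := bddMeas_of_lipschitz S.hk

lemma exists_coef_bound : ∃ D, ∀ n, |sinCoef l k n| ≤ D := by
  obtain ⟨B, hB⟩ := S.exists_bddMeas
  exact ⟨_, abs_sinCoef_le S.hl hB.2⟩

/-- In εy'' + y' all terms carrying b group into -εb(εy' + y). So εu_t + u satisfies a heat equation
whose source contains only u_t and f, and no space derivatives. -/
lemma hasDerivAt_zm (n : ℕ) {t : ℝ} (ht : 0 < t) : HasDerivAt (zm l α ε lam a k f n)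
    (-(ε * bC l lam n) * zm l α ε lam a k f n t + rz l α ε lam a k f n t) t := by
  refine (((hasDerivAt_ym' S.hl S.hlam S.hf n ht).const_mul ε).add
    (hasDerivAt_ym S.hl S.hlam S.hf n ht)).congr_deriv ?_
  rw [zm, rz]; ring

lemma continuousOn_zm (n : ℕ) : ContinuousOn (zm l α ε lam a k f n) (Ici 0) :=
  ((continuousOn_ym' S.hl S.hα S.hε S.hlam S.hf n).const_mul ε).add
    (continuousOn_ym S.hl S.hα S.hε S.hlam S.hf n)

lemma intervalIntegrable_rz (n : ℕ) {s t : ℝ} (hs : 0 ≤ s) (ht : 0 ≤ t) :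
    IntervalIntegrable (rz l α ε lam a k f n) volume s t := by
  refine IntervalIntegrable.sub (IntervalIntegrable.const_mul ?_ _) (IntervalIntegrable.const_mul
    (intervalIntegrable_of_continuousOn_Ioi (S.hf.continuousOn_srcCoef S.hl S.hlam n)
      (fun t ht => S.hf.abs_srcCoef_le S.hl S.hlam n ht) hs ht) _)
  refine ((continuousOn_ym' S.hl S.hα S.hε S.hlam S.hf n).mono ?_).intervalIntegrable
  exact fun τ hτ => (le_min hs ht).trans hτ.1

lemma continuousOn_Vhat_interior (T : ℝ) :
    ContinuousOn (fun p : ℝ × ℝ => Vhat l α ε lam a k f p.1 p.2) (Icc 0 l ×ˢ Ioc 0 T) := by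
  obtain ⟨D, hD⟩ := S.exists_coef_bound
  exact (continuousOn_Vhat S.hl S.hα S.hε S.hlam S.hf S.hM S.summable_a hD S.hk T).mono
    fun p hp => ⟨hp.1, Ioc_subset_Icc_self hp.2, fun h => absurd h hp.2.1.ne'⟩

lemma continuousOn_rhat (T : ℝ) :
    ContinuousOn (fun p : ℝ × ℝ => rhat l α ε lam a k f p.1 p.2) (Ioo 0 l ×ˢ Ioc 0 T) := by
  have h1 := (S.continuousOn_Vhat_interior T).mono
    (prod_mono_left (Ioo_subset_Icc_self (a := (0 : ℝ)) (b := l)) : _ ⊆ Icc 0 l ×ˢ Ioc 0 T)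
  have h2 : ContinuousOn (fun p : ℝ × ℝ => f p.1 p.2) (Ioo 0 l ×ˢ Ioc 0 T) :=
    S.hf.cont.mono (prod_mono_right Ioc_subset_Ioi_self)
  exact (continuousOn_const.mul h1).sub (continuousOn_const.mul
    (((continuous_wt lam).comp continuous_fst).continuousOn.mul h2))

lemma exists_rhat_bound (T : ℝ) :
    ∃ R, ∀ t ∈ Ioc 0 T, BddMeas l R (fun x => rhat l α ε lam a k f x t) ∧
      ∀ n, sinCoef l (fun x => rhat l α ε lam a k f x t) n = rz l α ε lam a k f n t := by
  obtain ⟨D, hD⟩ := S.exists_coef_bound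
  obtain ⟨B, hB⟩ := exists_Vhat_bound S.hl S.hα S.hε S.hlam S.hf S.hM S.summable_a hD S.hk T
  refine ⟨|1 - ε * α| * B + ε * M, fun t ht => ?_⟩
  have hV : BddMeas l B (fun x => Vhat l α ε lam a k f x t) := bddMeas_of_continuousOn
    ((S.continuousOn_Vhat_interior T).comp (f := fun x => (x, t)) (by fun_prop)
      fun x hx => ⟨Ioo_subset_Icc_self hx, ht⟩)
    fun x hx => hB x (Ioo_subset_Icc_self hx) t (Ioc_subset_Icc_self ht)
  have hF := (S.hf.bddMeas ht.1).wt_mul S.hlam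
  have hV' : BddMeas l (|1 - ε * α| * B) (fun x => (1 - ε * α) * Vhat l α ε lam a k f x t) :=
    ⟨hV.1.const_mul _, fun x hx => by rw [abs_mul]; gcongr; exact hV.2 x hx⟩
  have hF' : BddMeas l (ε * M) (fun x => ε * (wt lam x * f x t)) :=
    ⟨hF.1.const_mul _, fun x hx => by
      rw [abs_mul, abs_of_pos S.hε]; have := S.hε; gcongr; exact hF.2 x hx⟩
  refine ⟨⟨hV'.1.sub hF'.1, fun x hx => (abs_sub _ _).trans
    (add_le_add (hV'.2 x hx) (hF'.2 x hx))⟩, fun n => ?_⟩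
  have h1 := sinCoef_sub S.hl hV' hF' n
  rw [sinCoef_const_mul, sinCoef_const_mul] at h1
  refine h1.trans ?_
  obtain ⟨u, hu, hub⟩ := exists_ym'_bound S.hl S.hα S.hε S.hlam S.hf S.hM S.summable_a hD ht.1 t
  have h2 : sinCoef l (fun x => Vhat l α ε lam a k f x t) n =
      ym' l α ε lam a (sinCoef l k) f n t := by
    rw [sinCoef_congr S.hl (fun x _ => Vhat_eq_tsum S.hl S.hα S.hε S.hlam S.hf S.hM S.summable_a hD
      S.hk x ht.1) n, sinCoef_const_mul, sinCoef_tsum S.hl (Summable.of_nonneg_of_le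
      (fun _ => abs_nonneg _) (fun n => hub n t ⟨le_rfl, le_rfl⟩) hu)]
    have := S.hl.ne'
    field_simp
  rw [h2, rz, srcCoef]

lemma le_eps_bC (n : ℕ) : ε * (Real.pi / l) ^ 2 * ((n : ℝ) + 1) ^ 2 ≤ ε * bC l lam n := by
  have := S.hε
  rw [mul_assoc]
  gcongr
  exact le_bC l lam n

/-- For positive times the modes of `ε u_t + u` decay like those of a `C^{1}` function. -/
lemma exists_zm_bound {δ : ℝ} (hδ : 0 < δ) (T : ℝ) :
    ∃ C, ∀ t ∈ Icc δ T, ∀ N,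
      ∑ n ∈ Finset.range N, ((n : ℝ) + 1) ^ (5 / 4 : ℝ) * |zm l α ε lam a k f n t| ≤ C := by
  obtain ⟨R, hR⟩ := S.exists_rhat_bound T
  obtain ⟨A, hA, hw⟩ := weighted_sum_le_of_sq (p := -(5 / 8)) (by norm_num)
  obtain ⟨A', hA', hw'⟩ := weighted_sum_le_of_sq (p := -(3 / 4)) (by norm_num)
  obtain ⟨B, hB⟩ := S.exists_bddMeas
  have hpi := Real.pi_pos
  have hl := S.hl
  have hε := S.hε
  set c := ε * (Real.pi / l) ^ 2 with hc
  set E := 1 / (c * δ) with hE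
  set Z := ε * (A' * √(l ^ 2 * B ^ 2 / 2)) + ∑' n, |a n| with hZ
  set B₁ := A * √(l ^ 2 * R ^ 2 / 2) with hB₁
  refine ⟨E * Z + 16 * c ^ (-(15 / 16) : ℝ) * B₁ * T ^ (1 / 16 : ℝ), fun t ht N => ?_⟩
  have ht0 : 0 < t := hδ.trans_le ht.1
  have hvar : ∀ n, zm l α ε lam a k f n t = Real.exp (-(ε * bC l lam n) * (t - 0)) *
      zm l α ε lam a k f n 0 + ∫ τ in (0 : ℝ)..t, Real.exp (-(ε * bC l lam n) * (t - τ)) *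
        rz l α ε lam a k f n τ := fun n =>
    variation_of_constants ht0.le ((S.continuousOn_zm n).mono fun τ hτ => hτ.1)
      (fun τ hτ => S.hasDerivAt_zm n hτ.1) (S.intervalIntegrable_rz n le_rfl ht0.le)
  -- The source is only known to be bounded, so its coefficients are square-summable and hence
  -- summable with the weight -5/8 < -1/2; the gain of 15/8 leads to 5/4.
  have hduh := duhamel_gain (σ := -(5 / 8)) (c := c) (by positivity) (fun n => S.le_eps_bC n)
    ht0.le (fun n => S.intervalIntegrable_rz n le_rfl ht0.le) (B := B₁) (fun τ hτ N => by
      obtain ⟨h1, h2⟩ := hR τ ⟨hτ.1, hτ.2.le.trans ht.2⟩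
      simp_rw [← h2]
      exact hw _ _ (sum_sinCoef_sq_le S.hl h1) N) N
  have hB₁0 : 0 ≤ B₁ := by positivity
  -- For t ≥ δ the exponential supplies (n+1)^{-2}. Since 5/4 - 2 = -3/4 < -1/2, square-summable
  -- velocity coefficients and summable a_n suffice at the initial time.
  have hhom : ∑ n ∈ Finset.range N, ((n : ℝ) + 1) ^ (-(3 / 4) : ℝ) *
      |zm l α ε lam a k f n 0| ≤ Z := by
    have h1 : ∀ n : ℕ, ((n : ℝ) + 1) ^ (-(3 / 4) : ℝ) * |zm l α ε lam a k f n 0| ≤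
        ε * (((n : ℝ) + 1) ^ (-(3 / 4) : ℝ) * |sinCoef l k n|) + |a n| := by
      intro n
      rw [zm, ym'_zero, ym_zero]
      have h2 : ((n : ℝ) + 1) ^ (-(3 / 4) : ℝ) ≤ 1 :=
        Real.rpow_le_one_of_one_le_of_nonpos (by linarith [n.cast_nonneg (α := ℝ)]) (by norm_num)
      have h3 := abs_add_le (ε * sinCoef l k n) (a n)
      rw [abs_mul, abs_of_pos hε] at h3
      calc _ ≤ ((n : ℝ) + 1) ^ (-(3 / 4) : ℝ) * (ε * |sinCoef l k n| + |a n|) := by gcongr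
        _ = ε * (((n : ℝ) + 1) ^ (-(3 / 4) : ℝ) * |sinCoef l k n|) +
            ((n : ℝ) + 1) ^ (-(3 / 4) : ℝ) * |a n| := by ring
        _ ≤ _ := by
          gcongr
          exact mul_le_of_le_one_left (abs_nonneg _) h2
    refine (Finset.sum_le_sum fun n _ => h1 n).trans ?_
    rw [Finset.sum_add_distrib, ← Finset.mul_sum]
    refine add_le_add ?_ (S.summable_a.sum_le_tsum _ fun n _ => abs_nonneg _)
    gcongr
    exact hw' _ _ (sum_sinCoef_sq_le S.hl hB) N
  have hterm : ∀ n : ℕ, ((n : ℝ) + 1) ^ (5 / 4 : ℝ) * |zm l α ε lam a k f n t| ≤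
      E * (((n : ℝ) + 1) ^ (-(3 / 4) : ℝ) * |zm l α ε lam a k f n 0|) +
      ((n : ℝ) + 1) ^ (-(5 / 8) + 15 / 8 : ℝ) * |∫ τ in (0 : ℝ)..t,
        Real.exp (-(ε * bC l lam n) * (t - τ)) * rz l α ε lam a k f n τ| := by
    intro n
    have hn : (0 : ℝ) < (n : ℝ) + 1 := by positivity
    have h1 := exp_bC_le (lam := lam) S.hl S.hε hδ n ht.1
    rw [← hc, ← hE] at h1
    rw [show (-(5 / 8) + 15 / 8 : ℝ) = 5 / 4 by norm_num, hvar n, sub_zero]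
    have h2 : ((n : ℝ) + 1) ^ (5 / 4 : ℝ) * (1 / ((n : ℝ) + 1) ^ 2) =
        ((n : ℝ) + 1) ^ (-(3 / 4) : ℝ) := by
      rw [one_div, ← Real.rpow_natCast, ← Real.rpow_neg hn.le, ← Real.rpow_add hn]; norm_num
    rw [← h2]
    refine (mul_le_mul_of_nonneg_left (abs_add_le _ _) (by positivity)).trans ?_
    rw [mul_add, abs_mul, abs_of_pos (Real.exp_pos _)]
    refine add_le_add ?_ le_rfl
    calc _ ≤ ((n : ℝ) + 1) ^ (5 / 4 : ℝ) * (E * (1 / ((n : ℝ) + 1) ^ 2) *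
          |zm l α ε lam a k f n 0|) := by gcongr
      _ = _ := by ring
  refine (Finset.sum_le_sum fun n _ => hterm n).trans ?_
  rw [Finset.sum_add_distrib, ← Finset.mul_sum]
  refine add_le_add ?_ (hduh.trans ?_)
  · gcongr
  · rw [sub_zero]
    have := ht.2
    gcongr

end FlowData

end Relaxed

/-! ### The function `ε u_t + u` and its space derivative -/

lemma mul_wave_weight (l : ℝ) (n : ℕ) (z : ℝ) (p : ℝ) :
    ((n : ℝ) + 1) ^ p * (wave l n * |z|) = Real.pi / l * (((n : ℝ) + 1) ^ (p + 1) * |z|) := by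
  have hn : (0 : ℝ) < (n : ℝ) + 1 := by positivity
  rw [wave_eq, Real.rpow_add hn, Real.rpow_one]
  ring

lemma hasDerivAt_sin_wave (k x : ℝ) :
    HasDerivAt (fun x => Real.sin (k * x)) (k * Real.cos (k * x)) x := by
  have h : HasDerivAt (fun x => Real.sin (k * x)) (Real.cos (k * x) * (k * 1)) x :=
    ((hasDerivAt_id x).const_mul _).sin
  convert! h using 1
  ring

lemma hasDerivAt_cos_wave (k x : ℝ) :
    HasDerivAt (fun x => Real.cos (k * x)) (-(k * Real.sin (k * x))) x := by
  have h : HasDerivAt (fun x => Real.cos (k * x)) (-Real.sin (k * x) * (k * 1)) x :=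
    ((hasDerivAt_id x).const_mul _).cos
  convert! h using 1
  ring

section Relaxed

variable (l α ε lam : ℝ) (a : ℕ → ℝ) (k : ℝ → ℝ) (f : ℝ → ℝ → ℝ)

/-- The function `e^{-λx/2} (ε u_t + u)`. -/
noncomputable def Zhat (x t : ℝ) : ℝ :=
  ε * Vhat l α ε lam a k f x t + Uhat l α ε lam a (sinCoef l k) f x t

/-- The space derivative of `Zhat`. -/
noncomputable def Zx (x t : ℝ) : ℝ :=
  2 / l * ∑' n, zm l α ε lam a k f n t * (wave l n * Real.cos (wave l n * x))

variable {l α ε lam a k f} {M : ℝ} {K : NNReal}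

namespace FlowData

variable (S : FlowData l α ε lam M K a k f)
include S

lemma summable_zm {t : ℝ} (ht : 0 < t) : Summable fun n => |zm l α ε lam a k f n t| := by
  obtain ⟨C, hC⟩ := S.exists_zm_bound ht t
  exact summable_of_weight (by norm_num) (hC t ⟨le_rfl, le_rfl⟩)

lemma Zhat_eq_tsum (x : ℝ) {t : ℝ} (ht : 0 < t) : Zhat l α ε lam a k f x t =
    2 / l * ∑' n, zm l α ε lam a k f n t * Real.sin (wave l n * x) := by
  obtain ⟨D, hD⟩ := S.exists_coef_bound
  have s1 := (unifSum_ym' S.hl S.hα S.hε S.hlam S.hf S.hM S.summable_a hD ht t).summable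
    (x := (x, t)) ⟨mem_univ _, le_rfl, le_rfl⟩
  have s2 := (unifSum_ym S.hl S.hα S.hε S.hlam S.hf S.hM S.summable_a hD t).summable
    (x := (x, t)) ⟨mem_univ _, ht.le, le_rfl⟩
  rw [Zhat, Vhat_eq_tsum S.hl S.hα S.hε S.hlam S.hf S.hM S.summable_a hD S.hk x ht, Uhat,
    mul_left_comm, ← mul_add, ← tsum_mul_left, ← (s1.mul_left ε).tsum_add s2]
  congr 1
  exact tsum_congr fun n => by rw [zm]; ring

/-- Of the weight 5/4 one power pays for the x-derivative; the remaining 1/4 yields uniform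
convergence. -/
lemma unifSum_Zx {δ : ℝ} (hδ : 0 < δ) (T : ℝ) : UnifSum (fun n (p : ℝ × ℝ) =>
    zm l α ε lam a k f n p.2 * (wave l n * Real.cos (wave l n * p.1))) (univ ×ˢ Icc δ T) := by
  obtain ⟨C, hC⟩ := S.exists_zm_bound hδ T
  have hpi := Real.pi_pos
  have hl := S.hl
  refine unifSum_of_weight (δ := 1 / 4) (C := Real.pi / l * C) (by norm_num) fun p hp N => ?_
  refine le_trans (Finset.sum_le_sum fun n _ => ?_) ((Finset.mul_sum _ _ _).symm.le.trans
    (mul_le_mul_of_nonneg_left (hC p.2 hp.2 N) (by positivity)))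
  rw [show (5 / 4 : ℝ) = 1 / 4 + 1 by norm_num, ← mul_wave_weight l, abs_mul, abs_mul,
    abs_of_pos (wave_pos hl n)]
  refine mul_le_mul_of_nonneg_left ?_ (by positivity)
  have := Real.abs_cos_le_one (wave l n * p.1)
  have := wave_pos hl n
  calc _ ≤ |zm l α ε lam a k f n p.2| * (wave l n * 1) := by gcongr
    _ = _ := by ring

lemma hasDerivAt_Zhat (x : ℝ) {t : ℝ} (ht : 0 < t) :
    HasDerivAt (fun y => Zhat l α ε lam a k f y t) (Zx l α ε lam a k f x t) x := by
  have h : (fun y => Zhat l α ε lam a k f y t) = fun y => 2 / l * ∑' n,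
    zm l α ε lam a k f n t * Real.sin (wave l n * y) := funext fun y => S.Zhat_eq_tsum y ht
  rw [h]
  refine (UnifSum.hasDerivAt isOpen_univ ((S.unifSum_Zx ht t).comp (fun y => (y, t))
    fun y _ => ⟨mem_univ _, le_rfl, le_rfl⟩) (fun n y _ => ?_) (fun y _ => ?_)
    (mem_univ x)).const_mul _
  · exact (hasDerivAt_sin_wave _ _).const_mul _
  · refine Summable.of_norm_bounded (S.summable_zm ht) fun n => ?_
    rw [Real.norm_eq_abs, abs_mul]
    exact mul_le_of_le_one_right (abs_nonneg _) (Real.abs_sin_le_one _)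

lemma continuousOn_Zx {δ : ℝ} (hδ : 0 < δ) (T : ℝ) :
    ContinuousOn (fun p : ℝ × ℝ => Zx l α ε lam a k f p.1 p.2) (univ ×ˢ Icc δ T) := by
  refine ((S.unifSum_Zx hδ T).continuousOn fun n => ?_).const_mul _
  exact ((S.continuousOn_zm n).comp (by fun_prop) fun p hp => hδ.le.trans hp.2.1).mul (by fun_prop)

lemma continuousOn_Zhat (T : ℝ) :
    ContinuousOn (fun p : ℝ × ℝ => Zhat l α ε lam a k f p.1 p.2) (Icc 0 l ×ˢ Ioc 0 T) := by
  obtain ⟨D, hD⟩ := S.exists_coef_bound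
  exact ((S.continuousOn_Vhat_interior T).const_mul ε).add
    ((continuousOn_Uhat S.hl S.hα S.hε S.hlam S.hf S.hM S.summable_a hD T).mono
      fun p hp => ⟨mem_univ _, Ioc_subset_Icc_self hp.2⟩)

lemma exists_Z_bound {δ : ℝ} (hδ : 0 < δ) (T : ℝ) :
    ∃ C, 0 ≤ C ∧ ∀ x, ∀ t ∈ Icc δ T, |Zhat l α ε lam a k f x t| ≤ C ∧
      |Zx l α ε lam a k f x t| ≤ C := by
  obtain ⟨C, hC⟩ := S.exists_zm_bound hδ T
  have hpi := Real.pi_pos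
  have hl := S.hl
  refine ⟨2 / l * max C 0 + 2 / l * (Real.pi / l * max C 0), by positivity, fun x t ht => ?_⟩
  have ht0 : 0 < t := hδ.trans_le ht.1
  have hs : Summable fun n : ℕ => ((n : ℝ) + 1) ^ (5 / 4 : ℝ) * |zm l α ε lam a k f n t| :=
    summable_of_sum_range_le (fun n => by positivity) (hC t ht)
  have hle : ∑' n : ℕ, ((n : ℝ) + 1) ^ (5 / 4 : ℝ) * |zm l α ε lam a k f n t| ≤ max C 0 :=
    (Summable.tsum_le_of_sum_range_le hs (hC t ht)).trans (le_max_left _ _)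
  have hC0 : 0 ≤ max C 0 := le_max_right _ _
  have h1 : ∀ n : ℕ, (1 : ℝ) ≤ ((n : ℝ) + 1) ^ (1 / 4 : ℝ) ∧ (1 : ℝ) ≤ ((n : ℝ) + 1) ^ (5 / 4 : ℝ) :=
    fun n => ⟨Real.one_le_rpow (by linarith [n.cast_nonneg (α := ℝ)]) (by norm_num),
      Real.one_le_rpow (by linarith [n.cast_nonneg (α := ℝ)]) (by norm_num)⟩
  constructor
  · rw [S.Zhat_eq_tsum x ht0, abs_mul, abs_of_pos (show 0 < 2 / l by positivity)]
    refine le_trans (mul_le_mul_of_nonneg_left ?_ (by positivity))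
      (le_add_of_nonneg_right (by positivity))
    rw [← Real.norm_eq_abs]
    refine (tsum_of_norm_bounded hs.hasSum fun n => ?_).trans hle
    rw [norm_mul, Real.norm_eq_abs, Real.norm_eq_abs]
    have := Real.abs_sin_le_one (wave l n * x)
    have h2 := (h1 n).2
    calc |zm l α ε lam a k f n t| * |Real.sin (wave l n * x)|
        ≤ |zm l α ε lam a k f n t| * 1 := by gcongr
      _ = 1 * |zm l α ε lam a k f n t| := by ring
      _ ≤ _ := by gcongr
  · rw [Zx, abs_mul, abs_of_pos (show 0 < 2 / l by positivity)]
    refine le_trans (mul_le_mul_of_nonneg_left ?_ (by positivity))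
      (le_add_of_nonneg_left (by positivity))
    rw [← Real.norm_eq_abs]
    refine (tsum_of_norm_bounded (hs.mul_left (Real.pi / l)).hasSum fun n => ?_).trans ?_
    · rw [norm_mul, norm_mul, Real.norm_eq_abs, Real.norm_eq_abs, Real.norm_eq_abs,
        show (5 / 4 : ℝ) = 1 / 4 + 1 by norm_num, ← mul_wave_weight l, abs_of_pos (wave_pos hl n)]
      have := Real.abs_cos_le_one (wave l n * x)
      have h2 := (h1 n).1
      have hw := wave_pos hl n
      calc |zm l α ε lam a k f n t| * (wave l n * |Real.cos (wave l n * x)|)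
          ≤ |zm l α ε lam a k f n t| * (wave l n * 1) := by gcongr
        _ = 1 * (wave l n * |zm l α ε lam a k f n t|) := by ring
        _ ≤ _ := by gcongr
    · rw [tsum_mul_left]
      gcongr

lemma exists_lipschitz_Zhat {δ : ℝ} (hδ : 0 < δ) (T : ℝ) :
    ∃ C : NNReal, ∀ t ∈ Icc δ T, LipschitzWith C (fun x => Zhat l α ε lam a k f x t) := by
  obtain ⟨C, hC0, hC⟩ := S.exists_Z_bound hδ T
  refine ⟨C.toNNReal, fun t ht => ?_⟩
  refine lipschitzWith_of_nnnorm_deriv_le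
    (fun x => (S.hasDerivAt_Zhat x (hδ.trans_le ht.1)).differentiableAt) fun x => ?_
  rw [(S.hasDerivAt_Zhat x (hδ.trans_le ht.1)).deriv, ← NNReal.coe_le_coe, coe_nnnorm, Real.coe_toNNReal _ hC0]
  exact (hC x t ht).2

/-- The velocity equals (Z - U)/ε: Z is Lipschitz by parabolic smoothing, U by the decay of the
initial coefficients. Its Lipschitz bound is thus obtained without differentiating its own series.
-/
lemma exists_lipschitz_Vhat {δ : ℝ} (hδ : 0 < δ) (T : ℝ) :
    ∃ C : NNReal, ∀ t ∈ Icc δ T, LipschitzWith C (fun x => Vhat l α ε lam a k f x t) := by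
  obtain ⟨C, hC⟩ := S.exists_lipschitz_Zhat hδ T
  obtain ⟨B, hB⟩ := S.exists_bddMeas
  obtain ⟨L, hL0, hL⟩ := exists_lipschitz_Uhat S.hl S.hα S.hε S.hlam S.hf S.ha
    (sum_sinCoef_sq_le S.hl hB) T
  have hε := S.hε
  refine ⟨((C + L) / ε).toNNReal, fun t ht => LipschitzWith.of_dist_le_mul fun x y => ?_⟩
  have h1 := (hC t ht).dist_le_mul x y
  have h2 := hL t ⟨hδ.le.trans ht.1, ht.2⟩ x y
  rw [Real.dist_eq, Real.dist_eq] at h1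
  rw [Real.dist_eq, Real.dist_eq, Real.coe_toNNReal _ (by positivity)]
  have h3 : Vhat l α ε lam a k f x t - Vhat l α ε lam a k f y t =
      ((Zhat l α ε lam a k f x t - Zhat l α ε lam a k f y t) -
      (Uhat l α ε lam a (sinCoef l k) f x t - Uhat l α ε lam a (sinCoef l k) f y t)) / ε := by
    rw [Zhat, Zhat]; field_simp; ring
  rw [h3, abs_div, abs_of_pos hε, div_mul_eq_mul_div]
  gcongr
  calc _ ≤ _ := abs_sub _ _
    _ ≤ C * |x - y| + L * |x - y| := add_le_add h1 h2
    _ = _ := by ring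

end FlowData

end Relaxed

/-! ### Cutoff functions -/

/-- A bounded Lipschitz function that vanishes outside `[c,d] ⊂ (0,l)`. -/
structure Bump (l c d : ℝ) (K : NNReal) (η : ℝ → ℝ) : Prop where
  hc : 0 < c
  hd : d < l
  lip : LipschitzWith K η
  bdd : ∀ x, |η x| ≤ K
  zero : ∀ x, x ∉ Icc c d → η x = 0

/-- A cutoff function together with its first two derivatives. -/
structure Cutoff (l c d : ℝ) (K : NNReal) (ζ ζ₁ ζ₂ : ℝ → ℝ) : Prop where
  bump : Bump l c d K ζ
  bump₁ : Bump l c d K ζ₁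
  bump₂ : Bump l c d K ζ₂
  deriv₁ : ∀ x, HasDerivAt ζ (ζ₁ x) x
  deriv₂ : ∀ x, HasDerivAt ζ₁ (ζ₂ x) x

/-- Allowing every larger constant lets a single one serve for the cutoff and both its derivatives.
-/
lemma exists_bump_of_contDiff {l c d : ℝ} (hc : 0 < c) (hd : d < l) {η : ℝ → ℝ}
    (h : ContDiff ℝ 1 η) (hz : ∀ x, x ∉ Icc c d → η x = 0) :
    ∃ K : NNReal, ∀ K', K ≤ K' → Bump l c d K' η := by
  have hs : HasCompactSupport η := HasCompactSupport.intro isCompact_Icc hz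
  obtain ⟨K, hK⟩ := h.lipschitzWith_of_hasCompactSupport hs (by norm_num)
  obtain ⟨C, hC⟩ := hs.exists_bound_of_continuous h.continuous
  refine ⟨max K C.toNNReal, fun K' hK' => ⟨hc, hd, hK.weaken ((le_max_left _ _).trans hK'),
    fun x => ?_, hz⟩⟩
  have h1 : C ≤ (C.toNNReal : ℝ) := Real.le_coe_toNNReal C
  have h2 : (C.toNNReal : ℝ) ≤ K' := NNReal.coe_le_coe.2 ((le_max_right _ _).trans hK')
  exact (hC x).trans (h1.trans h2)

lemma deriv_eq_zero_of_notMem_Icc {c d : ℝ} {η : ℝ → ℝ} (hz : ∀ x, x ∉ Icc c d → η x = 0) (x : ℝ)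
    (hx : x ∉ Icc c d) : deriv η x = 0 := by
  have : η =ᶠ[𝓝 x] fun _ => 0 := by
    filter_upwards [isClosed_Icc.isOpen_compl.mem_nhds hx] with y hy using hz y hy
  rw [this.deriv_eq, deriv_const]

lemma exists_cutoff {l x₀ : ℝ} (hx : x₀ ∈ Ioo 0 l) : ∃ (r c d : ℝ) (K : NNReal) (ζ ζ₁ ζ₂ : ℝ → ℝ),
    0 < r ∧ c ≤ d ∧ Cutoff l c d K ζ ζ₁ ζ₂ ∧ ∀ x ∈ Ioo (x₀ - r) (x₀ + r), ζ x = 1 := by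
  set r := min x₀ (l - x₀) / 4 with hr
  have h0 : 0 < min x₀ (l - x₀) := lt_min hx.1 (sub_pos.2 hx.2)
  have hr0 : 0 < r := by positivity
  have h1 := min_le_left x₀ (l - x₀)
  have h2 := min_le_right x₀ (l - x₀)
  let φ : ContDiffBump x₀ := ⟨r, 2 * r, hr0, by linarith⟩
  have hφ : ContDiff ℝ (⊤ : ℕ∞) φ := φ.contDiff
  have hφ' : ContDiff ℝ (⊤ : ℕ∞) (deriv φ) := by
    have := hφ.iterate_deriv 1
    simpa using this
  have hφ'' : ContDiff ℝ (⊤ : ℕ∞) (deriv (deriv φ)) := by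
    have := hφ.iterate_deriv 2
    simpa using this
  have hz : ∀ x, x ∉ Icc (x₀ - 2 * r) (x₀ + 2 * r) → φ x = 0 := fun x hx => by
    refine φ.zero_of_le_dist ?_
    rw [← Real.closedBall_eq_Icc, Metric.mem_closedBall, not_le] at hx
    exact hx.le
  have hz' := deriv_eq_zero_of_notMem_Icc hz
  have hz'' := deriv_eq_zero_of_notMem_Icc hz'
  have hc : 0 < x₀ - 2 * r := by linarith
  have hd : x₀ + 2 * r < l := by linarith
  obtain ⟨K₀, hK₀⟩ := exists_bump_of_contDiff hc hd (hφ.of_le (by norm_cast)) hz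
  obtain ⟨K₁, hK₁⟩ := exists_bump_of_contDiff hc hd (hφ'.of_le (by norm_cast)) hz'
  obtain ⟨K₂, hK₂⟩ := exists_bump_of_contDiff hc hd (hφ''.of_le (by norm_cast)) hz''
  refine ⟨r, _, _, max K₀ (max K₁ K₂), φ, deriv φ, deriv (deriv φ), hr0, by linarith,
    ⟨hK₀ _ (le_max_left _ _), hK₁ _ ((le_max_left _ _).trans (le_max_right _ _)),
      hK₂ _ ((le_max_right _ _).trans (le_max_right _ _)),
      fun x => (hφ.differentiable (by simp) x).hasDerivAt,
      fun x => (hφ'.differentiable (by simp) x).hasDerivAt⟩, fun x hx => ?_⟩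
  refine φ.one_of_mem_closedBall ?_
  rw [Real.closedBall_eq_Icc]
  exact Ioo_subset_Icc_self hx

namespace Bump

variable {l c d : ℝ} {K : NNReal} {η : ℝ → ℝ}

lemma apply_zero (h : Bump l c d K η) : η 0 = 0 := h.zero 0 fun hx => absurd hx.1 h.hc.not_ge

lemma apply_right (h : Bump l c d K η) : η l = 0 := h.zero l fun hx => absurd hx.2 h.hd.not_ge

lemma bddMeas (h : Bump l c d K η) : BddMeas l K η :=
  bddMeas_of_continuousOn h.lip.continuous.continuousOn fun x _ => h.bdd x

/-- The factor g is controlled only on [c, d]. For a pair with one point outside, η vanishes there,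
so the Lipschitz bound of η and the bound of g at the inner point suffice. -/
lemma lipschitz_mul (h : Bump l c d K η) {g : ℝ → ℝ} {L : NNReal} {B : ℝ} (hB0 : 0 ≤ B)
    (hg : LipschitzOnWith L g (Icc c d)) (hB : ∀ x ∈ Icc c d, |g x| ≤ B) :
    LipschitzWith (K * L + B * K).toNNReal (fun x => η x * g x) := by
  set Q := ((K : ℝ) * L + B * K).toNNReal with hQdef
  have hQ : (Q : ℝ) = K * L + B * K := Real.coe_toNNReal _ (by positivity)
  have hin := exists_lipschitz_mul h.lip.lipschitzOnWith hg (fun x _ => h.bdd x) hB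
  rw [← hQdef] at hin
  have hout : ∀ x ∈ Icc c d, ∀ y, y ∉ Icc c d → |η x * g x - η y * g y| ≤ Q * |x - y| := by
    intro x hx y hy
    have h1 := h.lip.dist_le_mul x y
    rw [Real.dist_eq, Real.dist_eq, h.zero y hy, sub_zero] at h1
    rw [h.zero y hy, zero_mul, sub_zero, abs_mul, hQ]
    calc |η x| * |g x| ≤ K * |x - y| * B := by gcongr; exact hB x hx
      _ ≤ K * L * |x - y| + K * |x - y| * B := le_add_of_nonneg_left (by positivity)
      _ = _ := by ring
  refine LipschitzWith.of_dist_le_mul fun x y => ?_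
  rw [Real.dist_eq, Real.dist_eq]
  by_cases hx : x ∈ Icc c d <;> by_cases hy : y ∈ Icc c d
  · have := hin.dist_le_mul x hx y hy
    rwa [Real.dist_eq, Real.dist_eq] at this
  · exact hout x hx y hy
  · rw [abs_sub_comm, abs_sub_comm x]
    exact hout y hy x hx
  · rw [h.zero x hx, h.zero y hy]
    simp only [zero_mul, sub_zero, abs_zero]
    positivity

end Bump

/-! ### Sine coefficients of products with a cutoff function -/

/-- Two integrations by parts: the boundary terms with φ' vanish because of the sine, those with the
cosine because of φ. Hence φ' is unrestricted at the ends. -/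
lemma sinCoef_second_deriv {l : ℝ} (hl : 0 < l) (lam : ℝ) {φ φ₁ φ₂ : ℝ → ℝ}
    (h₁ : ∀ x, HasDerivAt φ (φ₁ x) x) (h₂ : ∀ x, HasDerivAt φ₁ (φ₂ x) x) (hc : Continuous φ₂)
    (h0 : φ 0 = 0) (hl0 : φ l = 0) (m : ℕ) :
    sinCoef l (fun x => lam ^ 2 / 4 * φ x - φ₂ x) m = bC l lam m * sinCoef l φ m := by
  have hφc : Continuous φ := continuous_iff_continuousAt.2 fun x => (h₁ x).continuousAt
  have hder : ∀ x, HasDerivAt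
      (fun x => φ₁ x * Real.sin (wave l m * x) - φ x * (wave l m * Real.cos (wave l m * x)))
      (φ₂ x * Real.sin (wave l m * x) + wave l m ^ 2 * (φ x * Real.sin (wave l m * x))) x := by
    intro x
    refine (((h₂ x).mul (hasDerivAt_sin_wave (wave l m) x)).sub
      ((h₁ x).mul ((hasDerivAt_cos_wave (wave l m) x).const_mul (wave l m)))).congr_deriv ?_
    ring
  have h := intervalIntegral.integral_eq_sub_of_hasDerivAt (a := 0) (b := l) (fun x _ => hder x)
    ((by fun_prop : Continuous fun x => φ₂ x * Real.sin (wave l m * x) +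
      wave l m ^ 2 * (φ x * Real.sin (wave l m * x))).intervalIntegrable _ _)
  rw [sin_wave_right hl, h0, hl0] at h
  simp only [mul_zero, zero_mul, Real.sin_zero, sub_zero] at h
  rw [sinCoef, sinCoef, ← intervalIntegral.integral_const_mul, ← sub_eq_zero,
    ← intervalIntegral.integral_sub ((by fun_prop : Continuous fun x =>
      (lam ^ 2 / 4 * φ x - φ₂ x) * Real.sin (wave l m * x)).intervalIntegrable _ _)
      ((by fun_prop : Continuous fun x =>
      bC l lam m * (φ x * Real.sin (wave l m * x))).intervalIntegrable _ _), ← neg_eq_zero,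
    ← intervalIntegral.integral_neg, ← h]
  congr 1
  ext x
  rw [bC_eq]
  ring

/-- Each value of |n - m| is attained at most twice, once on either side of m. -/
lemma sum_natAbs_sub_le {w : ℕ → ℝ} {W : ℝ} (hw : ∀ j, 0 ≤ w j)
    (hW : ∀ N, ∑ j ∈ Finset.range N, w j ≤ W) (m N : ℕ) :
    ∑ n ∈ Finset.range N, w ((n : ℤ) - m).natAbs ≤ 2 * W := by
  have h1 : ∑ n ∈ Finset.range N, w ((n : ℤ) - m).natAbs ≤
      ∑ n ∈ Finset.range (m + N), w ((n : ℤ) - m).natAbs :=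
    Finset.sum_le_sum_of_subset_of_nonneg (Finset.range_subset_range.2 (by omega))
      fun _ _ _ => hw _
  refine h1.trans ?_
  rw [Finset.sum_range_add, two_mul]
  refine add_le_add ?_ ?_
  · rw [← Finset.sum_range_reflect]
    have h2 : ∑ j ∈ Finset.range m, w (j + 1) ≤ W := by
      have := hW (m + 1)
      rw [Finset.sum_range_succ'] at this
      linarith [hw 0]
    refine le_trans (le_of_eq (Finset.sum_congr rfl fun j hj => ?_)) h2
    have := Finset.mem_range.1 hj
    congr 1
    omega
  · refine le_trans (le_of_eq (Finset.sum_congr rfl fun n _ => ?_)) (hW N)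
    congr 1
    push_cast
    omega

lemma sum_add_le {w : ℕ → ℝ} {W : ℝ} (hw : ∀ j, 0 ≤ w j)
    (hW : ∀ N, ∑ j ∈ Finset.range N, w j ≤ W) (m N : ℕ) :
    ∑ n ∈ Finset.range N, w (m + n) ≤ W := by
  have h := hW (m + N)
  rw [Finset.sum_range_add] at h
  linarith [Finset.sum_nonneg fun (j : ℕ) (_ : j ∈ Finset.range m) => hw j]

/-- The sine coefficients of `η` times a cosine are concentrated near its frequency. -/
lemma Bump.exists_sum_sinCoef_mul_cos_le {l c d : ℝ} {K : NNReal} {η : ℝ → ℝ} (hl : 0 < l)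
    (h : Bump l c d K η) : ∃ A, 0 ≤ A ∧ ∀ m N : ℕ, ∑ n ∈ Finset.range N, ((n : ℝ) + 1) ^ (1 / 4 : ℝ) *
      |sinCoef l (fun x => η x * Real.cos (wave l m * x)) n| ≤ A * ((m : ℝ) + 1) ^ (1 / 4 : ℝ) := by
  obtain ⟨A, hA, hw⟩ := weighted_sinCoef_le_of_lipschitz hl (q := 1 / 4) (by norm_num)
  have hW := hw η K h.lip.lipschitzOnWith h.apply_zero h.apply_right
  -- Here j is the actual frequency, one more than the index of `sinCoef`; the value 0, which occurs
  -- as n - m, is thereby included.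
  set e : ℕ → ℝ := fun j => ∫ x in (0 : ℝ)..l, η x * Real.sin (j * (Real.pi / l) * x) with he
  have he0 : e 0 = 0 := by simp [he]
  have hes : ∀ j, e (j + 1) = sinCoef l η j := fun j => by
    simp only [he, sinCoef, wave_eq]; push_cast; rfl
  set w : ℕ → ℝ := fun j => ((j : ℝ) + 1) ^ (1 / 4 : ℝ) * |e j| with hwdef
  have hw0 : ∀ j, 0 ≤ w j := fun j => by positivity
  have hwW : ∀ N, ∑ j ∈ Finset.range N, w j ≤ 2 * (A * K) := by
    intro N
    have h1 : ∑ j ∈ Finset.range N, w j ≤ ∑ j ∈ Finset.range (N + 1), w j :=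
      Finset.sum_le_sum_of_subset_of_nonneg (Finset.range_subset_range.2 (by omega))
        fun _ _ _ => hw0 _
    refine h1.trans ?_
    rw [Finset.sum_range_succ']
    have h2 : w 0 = 0 := by simp [hwdef, he0]
    rw [h2, add_zero]
    refine le_trans ?_ (mul_le_mul_of_nonneg_left (hW N) zero_le_two)
    rw [Finset.mul_sum]
    refine Finset.sum_le_sum fun j _ => ?_
    rw [hwdef]
    simp only [hes]
    rw [← mul_assoc]
    gcongr
    have h3 : (2 : ℝ) ^ (1 / 4 : ℝ) ≤ 2 := by
      conv_rhs => rw [← Real.rpow_one 2]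
      exact Real.rpow_le_rpow_of_exponent_le (by norm_num) (by norm_num)
    calc (((j + 1 : ℕ) : ℝ) + 1) ^ (1 / 4 : ℝ) ≤ (2 * ((j : ℝ) + 1)) ^ (1 / 4 : ℝ) := by
          refine Real.rpow_le_rpow (by positivity) ?_ (by norm_num)
          push_cast; linarith [j.cast_nonneg (α := ℝ)]
      _ = 2 ^ (1 / 4 : ℝ) * ((j : ℝ) + 1) ^ (1 / 4 : ℝ) :=
          Real.mul_rpow (by norm_num) (by positivity)
      _ ≤ _ := by gcongr
  have hsgn : ∀ i : ℤ, |∫ x in (0 : ℝ)..l, η x * Real.sin (i * (Real.pi / l) * x)| =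
      |e i.natAbs| := by
    intro i
    rcases Int.natAbs_eq i with hi | hi
    · conv_lhs => rw [hi]
      simp only [he, Int.cast_natCast]
    · conv_lhs => rw [hi]
      simp only [he, Int.cast_neg, Int.cast_natCast, neg_mul, Real.sin_neg, mul_neg,
        intervalIntegral.integral_neg, abs_neg]
  -- Product-to-sum formula: the frequencies n + 1 and m + 1 combine to the sum m + n + 2 and the
  -- difference n - m.
  have hterm : ∀ n m : ℕ, |sinCoef l (fun x => η x * Real.cos (wave l m * x)) n| ≤
      |e (m + 2 + n)| + |e ((n : ℤ) - m).natAbs| := by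
    intro n m
    have h1 : sinCoef l (fun x => η x * Real.cos (wave l m * x)) n =
        2⁻¹ * ((∫ x in (0 : ℝ)..l, η x * Real.sin ((m + 2 + n : ℕ) * (Real.pi / l) * x)) +
        ∫ x in (0 : ℝ)..l, η x * Real.sin (((n : ℤ) - m : ℤ) * (Real.pi / l) * x)) := by
      rw [← intervalIntegral.integral_add (h.bddMeas.mul_sin hl _) (h.bddMeas.mul_sin hl _),
        ← intervalIntegral.integral_const_mul, sinCoef]
      congr 1
      ext x
      rw [show (((m + 2 + n : ℕ) : ℝ) * (Real.pi / l) * x) = wave l n * x + wave l m * x by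
          rw [wave_eq, wave_eq]; push_cast; ring,
        show ((((n : ℤ) - m : ℤ) : ℝ) * (Real.pi / l) * x) = wave l n * x - wave l m * x by
          rw [wave_eq, wave_eq]; push_cast; ring, Real.sin_add, Real.sin_sub]
      ring
    rw [h1, abs_mul, abs_of_pos (by norm_num : (0 : ℝ) < 2⁻¹)]
    have h2 := abs_add_le (e (m + 2 + n))
      (∫ x in (0 : ℝ)..l, η x * Real.sin (((n : ℤ) - m : ℤ) * (Real.pi / l) * x))
    rw [hsgn] at h2
    have h3 : 0 ≤ |e (m + 2 + n)| + |e ((n : ℤ) - m).natAbs| := by positivity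
    linarith
  refine ⟨2 * (A * K) + 2 * (2 * (A * K)), by positivity, fun m N => ?_⟩
  have hm1 : (1 : ℝ) ≤ ((m : ℝ) + 1) ^ (1 / 4 : ℝ) :=
    Real.one_le_rpow (by linarith [m.cast_nonneg (α := ℝ)]) (by norm_num)
  calc _ ≤ ∑ n ∈ Finset.range N, ((m : ℝ) + 1) ^ (1 / 4 : ℝ) *
        (w (m + 2 + n) + w ((n : ℤ) - m).natAbs) := by
        refine Finset.sum_le_sum fun n _ => ?_
        have h1 : ((n : ℝ) + 1) ^ (1 / 4 : ℝ) ≤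
            ((m : ℝ) + 1) ^ (1 / 4 : ℝ) * (((m + 2 + n : ℕ) : ℝ) + 1) ^ (1 / 4 : ℝ) := by
          rw [← Real.mul_rpow (by positivity) (by positivity)]
          refine Real.rpow_le_rpow (by positivity) ?_ (by norm_num)
          push_cast
          nlinarith [n.cast_nonneg (α := ℝ), m.cast_nonneg (α := ℝ),
            mul_nonneg (n.cast_nonneg (α := ℝ)) (m.cast_nonneg (α := ℝ))]
        -- From n + 1 ≤ (m + 1)(|n - m| + 1): the weight in n is distributed over the frequency m of
        -- the cosine and the shift caused by η.
        have h2 : ((n : ℝ) + 1) ^ (1 / 4 : ℝ) ≤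
            ((m : ℝ) + 1) ^ (1 / 4 : ℝ) * ((((n : ℤ) - m).natAbs : ℝ) + 1) ^ (1 / 4 : ℝ) := by
          rw [← Real.mul_rpow (by positivity) (by positivity)]
          refine Real.rpow_le_rpow (by positivity) ?_ (by norm_num)
          have h3 : (n : ℝ) ≤ m + ((n : ℤ) - m).natAbs := by
            have : n ≤ m + ((n : ℤ) - m).natAbs := by omega
            exact_mod_cast this
          nlinarith [mul_nonneg (m.cast_nonneg (α := ℝ))
            (Nat.cast_nonneg (α := ℝ) ((n : ℤ) - m).natAbs)]
        calc _ ≤ ((n : ℝ) + 1) ^ (1 / 4 : ℝ) * (|e (m + 2 + n)| + |e ((n : ℤ) - m).natAbs|) := by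
              gcongr; exact hterm n m
          _ = ((n : ℝ) + 1) ^ (1 / 4 : ℝ) * |e (m + 2 + n)| +
              ((n : ℝ) + 1) ^ (1 / 4 : ℝ) * |e ((n : ℤ) - m).natAbs| := by ring
          _ ≤ ((m : ℝ) + 1) ^ (1 / 4 : ℝ) * (((m + 2 + n : ℕ) : ℝ) + 1) ^ (1 / 4 : ℝ) *
              |e (m + 2 + n)| + ((m : ℝ) + 1) ^ (1 / 4 : ℝ) *
              ((((n : ℤ) - m).natAbs : ℝ) + 1) ^ (1 / 4 : ℝ) * |e ((n : ℤ) - m).natAbs| := by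
              gcongr
          _ = _ := by simp only [hwdef]; ring
    _ = ((m : ℝ) + 1) ^ (1 / 4 : ℝ) * (∑ n ∈ Finset.range N, w (m + 2 + n) +
        ∑ n ∈ Finset.range N, w ((n : ℤ) - m).natAbs) := by
        rw [← Finset.mul_sum, Finset.sum_add_distrib]
    _ ≤ ((m : ℝ) + 1) ^ (1 / 4 : ℝ) * (2 * (A * K) + 2 * (2 * (A * K))) := by
        gcongr
        · exact sum_add_le hw0 hwW _ _
        · exact sum_natAbs_sub_le hw0 hwW _ _
    _ = _ := mul_comm _ _

/-- Multiplication by a cutoff function maps cosine series with coefficients of weight `1/4` to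
functions whose sine coefficients have weight `1/4`. -/
lemma Bump.exists_sum_sinCoef_mul_cosSeries_le {l c d : ℝ} {K : NNReal} {η : ℝ → ℝ} (hl : 0 < l)
    (h : Bump l c d K η) : ∃ A, 0 ≤ A ∧ ∀ (z : ℕ → ℝ) (C : ℝ),
      (∀ N, ∑ m ∈ Finset.range N, ((m : ℝ) + 1) ^ (1 / 4 : ℝ) * |z m| ≤ C) →
      ∀ N, ∑ n ∈ Finset.range N, ((n : ℝ) + 1) ^ (1 / 4 : ℝ) *
        |sinCoef l (fun x => η x * ∑' m, z m * Real.cos (wave l m * x)) n| ≤ A * C := by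
  obtain ⟨A, hA, hS⟩ := h.exists_sum_sinCoef_mul_cos_le hl
  refine ⟨A, hA, fun z C hz N => ?_⟩
  have hzs : Summable fun m => |z m| := summable_of_weight (by norm_num) hz
  obtain ⟨s, hs⟩ : ∃ s : ℕ → ℕ → ℝ, ∀ m n,
      s m n = sinCoef l (fun x => η x * Real.cos (wave l m * x)) n := ⟨_, fun _ _ => rfl⟩
  simp only [← hs] at hS
  have hwz : Summable fun m : ℕ => ((m : ℝ) + 1) ^ (1 / 4 : ℝ) * |z m| :=
    summable_of_sum_range_le (fun m => by positivity) hz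
  have hsb : ∀ m n, |s m n| ≤ K * l := fun m n => hs m n ▸ abs_sinCoef_le hl (fun x _ => by
    rw [abs_mul]
    exact (mul_le_of_le_one_right (abs_nonneg _) (Real.abs_cos_le_one _)).trans (h.bdd x)) n
  have hsum : ∀ n, Summable fun m => |z m * s m n| := fun n =>
    Summable.of_nonneg_of_le (fun _ => abs_nonneg _) (fun m => by
      rw [abs_mul]; exact mul_le_mul_of_nonneg_left (hsb m n) (abs_nonneg _)) (hzs.mul_right _)
  have hexp : ∀ n, sinCoef l (fun x => η x * ∑' m, z m * Real.cos (wave l m * x)) n =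
      ∑' m, z m * s m n := by
    intro n
    have h1 := hasSum_integral_mul_series hl (r := fun x => η x * Real.sin (wave l n * x))
      (h.bddMeas.mul_continuous hl (by fun_prop) fun x => Real.abs_sin_le_one _) hzs
      (ψ := fun m x => Real.cos (wave l m * x)) (fun m => by fun_prop)
      fun m x => Real.abs_cos_le_one _
    have h2 : ∀ m, s m n = ∫ x in (0 : ℝ)..l,
        η x * Real.sin (wave l n * x) * Real.cos (wave l m * x) := fun m => by
      simp only [hs, sinCoef, mul_right_comm]
    rw [tsum_congr fun m => by rw [h2 m], h1.tsum_eq, sinCoef]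
    simp only [mul_right_comm (η _)]
  calc _ ≤ ∑ n ∈ Finset.range N, ∑' m, ((n : ℝ) + 1) ^ (1 / 4 : ℝ) * |z m * s m n| := by
        refine Finset.sum_le_sum fun n _ => ?_
        rw [hexp, tsum_mul_left]
        refine mul_le_mul_of_nonneg_left ?_ (by positivity)
        exact norm_tsum_le_tsum_norm (f := fun m => z m * s m n) (hsum n)
    _ = ∑' m, ∑ n ∈ Finset.range N, ((n : ℝ) + 1) ^ (1 / 4 : ℝ) * |z m * s m n| :=
        (Summable.tsum_finsetSum fun n _ => (hsum n).mul_left _).symm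
    _ ≤ ∑' m : ℕ, A * (((m : ℝ) + 1) ^ (1 / 4 : ℝ) * |z m|) := by
        refine Summable.tsum_le_tsum (fun m => ?_)
          (summable_sum fun n _ => (hsum n).mul_left _) (hwz.mul_left A)
        simp_rw [abs_mul, mul_left_comm _ |z m|]
        rw [← Finset.mul_sum]
        calc _ ≤ |z m| * (A * ((m : ℝ) + 1) ^ (1 / 4 : ℝ)) := by gcongr; exact hS m N
          _ = _ := by ring
    _ ≤ A * C := by
        rw [tsum_mul_left]
        refine mul_le_mul_of_nonneg_left ?_ hA
        exact Summable.tsum_le_of_sum_range_le hwz hz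

/-! ### Localization of `ε u_t + u` -/

section Relaxed

variable (l α ε lam : ℝ) (a : ℕ → ℝ) (k : ℝ → ℝ) (f : ℝ → ℝ → ℝ)

/-- The source of the heat equation for `ζ (ε u_t + u)`. -/
noncomputable def locSrc (ζ ζ₁ ζ₂ : ℝ → ℝ) (x t : ℝ) : ℝ :=
  ζ x * rhat l α ε lam a k f x t - 2 * ε * (ζ₁ x * Zx l α ε lam a k f x t) -
    ε * (ζ₂ x * Zhat l α ε lam a k f x t)

/-- The modes of `ζ (ε u_t + u)`. -/
noncomputable def locMode (ζ : ℝ → ℝ) (n : ℕ) (t : ℝ) : ℝ :=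
  sinCoef l (fun x => ζ x * Zhat l α ε lam a k f x t) n

variable {l α ε lam a k f} {M : ℝ} {K : NNReal} {c d : ℝ} {Kζ : NNReal} {ζ ζ₁ ζ₂ : ℝ → ℝ}

lemma Cutoff.hasDerivAt_mul_sin (H : Cutoff l c d Kζ ζ ζ₁ ζ₂) (n : ℕ) (x : ℝ) :
    HasDerivAt (fun x => ζ x * Real.sin (wave l n * x))
      (ζ₁ x * Real.sin (wave l n * x) + ζ x * (wave l n * Real.cos (wave l n * x))) x :=
  (H.deriv₁ x).mul (hasDerivAt_sin_wave _ _)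

lemma Cutoff.hasDerivAt_mul_sin' (H : Cutoff l c d Kζ ζ ζ₁ ζ₂) (n : ℕ) (x : ℝ) : HasDerivAt
    (fun x => ζ₁ x * Real.sin (wave l n * x) + ζ x * (wave l n * Real.cos (wave l n * x)))
      (ζ₂ x * Real.sin (wave l n * x) + 2 * (ζ₁ x * (wave l n * Real.cos (wave l n * x))) -
        wave l n ^ 2 * (ζ x * Real.sin (wave l n * x))) x := by
  refine (((H.deriv₂ x).mul (hasDerivAt_sin_wave (wave l n) x)).add ((H.deriv₁ x).mul
    ((hasDerivAt_cos_wave (wave l n) x).const_mul (wave l n)))).congr_deriv ?_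
  ring

lemma Cutoff.exists_sum_coef_mul_sin_le (hl : 0 < l) (H : Cutoff l c d Kζ ζ ζ₁ ζ₂) (n : ℕ) :
    ∃ C, ∀ N, ∑ m ∈ Finset.range N, ((m : ℝ) + 1) ^ (1 / 4 : ℝ) *
      |sinCoef l (fun x => ζ x * Real.sin (wave l n * x)) m| ≤ C := by
  obtain ⟨A, hA, h⟩ := weighted_sinCoef_le_of_lipschitz hl (q := 1 / 4) (by norm_num)
  refine ⟨_, h _ (Kζ + Kζ * wave l n).toNNReal (lipschitzOnWith_Icc_of_hasDerivAt (fun x _ =>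
    (H.hasDerivAt_mul_sin n x).continuousAt.continuousWithinAt)
    (fun x _ => H.hasDerivAt_mul_sin n x) fun x _ => ?_) (by simp) (by simp [sin_wave_right hl])⟩
  refine le_trans ?_ (Real.le_coe_toNNReal _)
  refine (abs_add_le _ _).trans ?_
  rw [abs_mul, abs_mul, abs_mul, abs_of_pos (wave_pos hl n)]
  have h1 := H.bump.bdd x
  have h2 := H.bump₁.bdd x
  have h3 := Real.abs_sin_le_one (wave l n * x)
  have h4 := Real.abs_cos_le_one (wave l n * x)
  have h5 := wave_pos hl n
  calc _ ≤ (Kζ : ℝ) * 1 + Kζ * (wave l n * 1) := by gcongr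
    _ = _ := by ring

namespace FlowData

variable (S : FlowData l α ε lam M K a k f)
include S

lemma continuous_Zhat {t : ℝ} (ht : 0 < t) : Continuous fun x => Zhat l α ε lam a k f x t :=
  continuous_iff_continuousAt.2 fun x => (S.hasDerivAt_Zhat x ht).continuousAt

lemma continuous_Zx {t : ℝ} (ht : 0 < t) : Continuous fun x => Zx l α ε lam a k f x t :=
  continuousOn_univ.1 ((S.continuousOn_Zx ht t).comp (f := fun x => (x, t)) (by fun_prop)
    fun _ _ => ⟨mem_univ _, le_rfl, le_rfl⟩)

lemma hasSum_integral_mul_Zhat {t : ℝ} (ht : 0 < t) {φ : ℝ → ℝ} (hφ : Continuous φ) :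
    HasSum (fun m => zm l α ε lam a k f m t * sinCoef l φ m)
      (l / 2 * ∫ x in (0 : ℝ)..l, φ x * Zhat l α ε lam a k f x t) := by
  obtain ⟨B, hB⟩ := isCompact_Icc.exists_bound_of_continuousOn (hφ.continuousOn (s := Icc 0 l))
  have hr : BddMeas l B φ := bddMeas_of_continuousOn hφ.continuousOn
    fun x hx => hB x (Ioo_subset_Icc_self hx)
  convert! hasSum_integral_mul_series S.hl hr (S.summable_zm ht)
    (ψ := fun m x => Real.sin (wave l m * x)) (fun m => by fun_prop)
    (fun m x => Real.abs_sin_le_one _) using 1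
  rw [← intervalIntegral.integral_const_mul]
  congr 1
  ext x
  rw [S.Zhat_eq_tsum x ht]
  rw [mul_left_comm (φ x), ← mul_assoc (l / 2), show l / 2 * (2 / l) = 1 by
    have := S.hl.ne'
    field_simp, one_mul]

/-- The modes of `ζ (ε u_t + u)` satisfy the localized heat equation. -/
lemma hasDerivAt_locMode (H : Cutoff l c d Kζ ζ ζ₁ ζ₂) (n : ℕ) {t : ℝ} (ht : 0 < t) :
    HasDerivAt (locMode l α ε lam a k f ζ n) (-(ε * bC l lam n) * locMode l α ε lam a k f ζ n t +
      sinCoef l (fun x => locSrc l α ε lam a k f ζ ζ₁ ζ₂ x t) n) t := by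
  have hl := S.hl
  have hζ := H.bump.lip.continuous
  have hζ₁ := H.bump₁.lip.continuous
  have hζ₂ := H.bump₂.lip.continuous
  -- The mode of ζZ is the pairing of Z with φ = ζ sin(γ_n x), hence a series of the z_m against the
  -- coefficients κ_m of φ. With ψ = λ²φ/4 - φ'' the products b_m κ_m are coefficients of ψ and so
  -- bounded: both space derivatives are put on φ, as Z is not yet known to have two.
  set φ : ℝ → ℝ := fun x => ζ x * Real.sin (wave l n * x) with hφdef
  set ψ : ℝ → ℝ := fun x => lam ^ 2 / 4 * φ x - (ζ₂ x * Real.sin (wave l n * x) +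
    2 * (ζ₁ x * (wave l n * Real.cos (wave l n * x))) -
      wave l n ^ 2 * (ζ x * Real.sin (wave l n * x))) with hψdef
  have hφ : Continuous φ := by fun_prop
  have hψ : Continuous ψ := by fun_prop
  obtain ⟨κ, hκ⟩ : ∃ κ : ℕ → ℝ, ∀ m, κ m = sinCoef l φ m := ⟨_, fun _ => rfl⟩
  have hκψ : ∀ m, sinCoef l ψ m = bC l lam m * κ m := fun m => by
    rw [hκ]
    exact sinCoef_second_deriv hl lam (H.hasDerivAt_mul_sin n) (H.hasDerivAt_mul_sin' n)
      (by fun_prop) (by simp) (by simp [sin_wave_right hl]) m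
  obtain ⟨Cκ, hCκ⟩ := H.exists_sum_coef_mul_sin_le hl n
  simp only [← hφdef, ← hκ] at hCκ
  have hκs : Summable fun m => |κ m| := summable_of_weight (by norm_num) hCκ
  have hmode : ∀ s, 0 < s → locMode l α ε lam a k f ζ n s =
      2 / l * ∑' m, κ m * zm l α ε lam a k f m s := by
    intro s hs
    have h1 := (S.hasSum_integral_mul_Zhat hs hφ).tsum_eq
    rw [tsum_congr fun m => (by rw [← hκ, mul_comm] : zm l α ε lam a k f m s * sinCoef l φ m =
      κ m * zm l α ε lam a k f m s)] at h1
    rw [h1, ← mul_assoc, show 2 / l * (l / 2) = 1 by field_simp, one_mul, locMode, sinCoef]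
    congr 1
    ext x
    rw [hφdef]
    ring
  obtain ⟨R, hR⟩ := S.exists_rhat_bound (t + 1)
  obtain ⟨C, hC⟩ := S.exists_zm_bound (half_pos ht) (t + 1)
  obtain ⟨Q, hQ⟩ : ∃ Q, ∀ m, |bC l lam m * κ m| ≤ Q := by
    obtain ⟨B, hB⟩ := isCompact_Icc.exists_bound_of_continuousOn (hψ.continuousOn (s := Icc 0 l))
    exact ⟨B * l, fun m => hκψ m ▸
      abs_sinCoef_le hl (fun x hx => hB x (Ioo_subset_Icc_self hx)) m⟩
  have hQ0 : 0 ≤ Q := (abs_nonneg _).trans (hQ 0)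
  have hε := S.hε
  have hR0 : 0 ≤ R := (hR (t + 1) ⟨by linarith, le_rfl⟩).1.nonneg hl
  have hrz : ∀ s ∈ Ioo (t / 2) (t + 1), ∀ m, |rz l α ε lam a k f m s| ≤ R * l := by
    intro s hs m
    obtain ⟨h1, h2⟩ := hR s ⟨(half_pos ht).trans hs.1, hs.2.le⟩
    rw [← h2 m]
    exact abs_sinCoef_le hl h1.2 m
  -- In the first term b_m κ_m is bounded and z_m has weight 5/4; in the second the modes of the
  -- source are bounded and κ_m has weight 1/4. So weight 1/4 is available for both.
  have hunif : UnifSum (fun m s => κ m * (-(ε * bC l lam m) * zm l α ε lam a k f m s +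
      rz l α ε lam a k f m s)) (Ioo (t / 2) (t + 1)) := by
    refine unifSum_of_weight (δ := 1 / 4) (C := ε * Q * C + R * l * Cκ) (by norm_num)
      fun s hs N => ?_
    have hstep : ∀ m : ℕ, ((m : ℝ) + 1) ^ (1 / 4 : ℝ) * |κ m * (-(ε * bC l lam m) *
        zm l α ε lam a k f m s + rz l α ε lam a k f m s)| ≤
        ε * Q * (((m : ℝ) + 1) ^ (5 / 4 : ℝ) * |zm l α ε lam a k f m s|) +
        R * l * (((m : ℝ) + 1) ^ (1 / 4 : ℝ) * |κ m|) := by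
      intro m
      have h1 : κ m * (-(ε * bC l lam m) * zm l α ε lam a k f m s + rz l α ε lam a k f m s) =
        -(ε * (bC l lam m * κ m) * zm l α ε lam a k f m s) + κ m * rz l α ε lam a k f m s := by ring
      have h2 : ((m : ℝ) + 1) ^ (1 / 4 : ℝ) ≤ ((m : ℝ) + 1) ^ (5 / 4 : ℝ) :=
        Real.rpow_le_rpow_of_exponent_le (by linarith [m.cast_nonneg (α := ℝ)]) (by norm_num)
      rw [h1]
      have h3 := hQ m
      have h4 := hrz s hs m
      calc _ ≤ ((m : ℝ) + 1) ^ (1 / 4 : ℝ) * (ε * |bC l lam m * κ m| *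
              |zm l α ε lam a k f m s| + |κ m| * |rz l α ε lam a k f m s|) := by
            gcongr
            refine (abs_add_le _ _).trans (le_of_eq ?_)
            rw [abs_neg, abs_mul, abs_mul ε, abs_of_pos hε, abs_mul (κ m)]
        _ ≤ ((m : ℝ) + 1) ^ (1 / 4 : ℝ) * (ε * Q * |zm l α ε lam a k f m s|) +
            ((m : ℝ) + 1) ^ (1 / 4 : ℝ) * (|κ m| * (R * l)) := by
            rw [← mul_add]; gcongr
        _ ≤ ((m : ℝ) + 1) ^ (5 / 4 : ℝ) * (ε * Q * |zm l α ε lam a k f m s|) +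
            ((m : ℝ) + 1) ^ (1 / 4 : ℝ) * (|κ m| * (R * l)) := by gcongr
        _ = _ := by ring
    refine (Finset.sum_le_sum fun m _ => hstep m).trans ?_
    rw [Finset.sum_add_distrib, ← Finset.mul_sum, ← Finset.mul_sum]
    gcongr
    · exact hC s (Ioo_subset_Icc_self hs) N
    · exact hCκ N
  have hder := (UnifSum.hasDerivAt isOpen_Ioo hunif
    (fun m s hs => (S.hasDerivAt_zm m ((half_pos ht).trans hs.1)).const_mul (κ m))
    (fun s hs => by
      have := (S.hasSum_integral_mul_Zhat ((half_pos ht).trans hs.1) hφ).summable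
      simpa only [← hκ, mul_comm] using this)
    (show t ∈ Ioo (t / 2) (t + 1) by constructor <;> linarith)).const_mul (2 / l)
  refine (hder.congr_of_eventuallyEq ?_).congr_deriv ?_
  · filter_upwards [lt_mem_nhds ht] with s hs using hmode s hs
  obtain ⟨hr1, hr2⟩ := hR t ⟨ht, by linarith⟩
  have hs1 := S.hasSum_integral_mul_Zhat ht hψ
  simp only [hκψ] at hs1
  have hs2 := hasSum_integral_mul_series hl hr1 hκs (ψ := fun m x => Real.sin (wave l m * x))
    (fun m => by fun_prop) fun m x => Real.abs_sin_le_one _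
  have hs3 : HasSum (fun m => κ m * rz l α ε lam a k f m t)
      (l / 2 * ∫ x in (0 : ℝ)..l, rhat l α ε lam a k f x t * φ x) := by
    convert! hs2 using 1
    · ext m; rw [← hr2 m, sinCoef]
    · rw [← intervalIntegral.integral_const_mul]
      refine intervalIntegral_congr_Ioo hl fun x hx => ?_
      have h1 := eq_sine_series hl (f := φ) hφ.continuousOn (by simpa only [← hκ] using hκs) hx
      simp only [← hκ] at h1
      rw [h1, mul_left_comm (rhat _ _ _ _ _ _ _ _ _), ← mul_assoc (l / 2),
        show l / 2 * (2 / l) = 1 by field_simp, one_mul]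
  have hs4 := ((hs1.mul_left (-ε)).add hs3).tsum_eq
  rw [tsum_congr fun m => (by ring : κ m * (-(ε * bC l lam m) * zm l α ε lam a k f m t +
    rz l α ε lam a k f m t) = -ε * (zm l α ε lam a k f m t * (bC l lam m * κ m)) +
    κ m * rz l α ε lam a k f m t), hs4]
  have hZ := S.continuous_Zhat ht
  have hZx := S.continuous_Zx ht
  -- The derivative of ζ₁ Z sin(γ_n x) integrates to zero. Twice this identity replaces the term
  -- with the cosine in ψZ by one with Z_x, as required by the form of `locSrc`.
  have hibp := intervalIntegral.integral_eq_sub_of_hasDerivAt (a := 0) (b := l)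
    (f := fun x => ζ₁ x * Zhat l α ε lam a k f x t * Real.sin (wave l n * x))
    (fun x _ => ((H.deriv₂ x).mul (S.hasDerivAt_Zhat x ht)).mul (hasDerivAt_sin_wave (wave l n) x))
    ((by fun_prop : Continuous fun x => (ζ₂ x * Zhat l α ε lam a k f x t +
      ζ₁ x * Zx l α ε lam a k f x t) * Real.sin (wave l n * x) +
      ζ₁ x * Zhat l α ε lam a k f x t * (wave l n * Real.cos (wave l n * x))).intervalIntegrable
        _ _)
  rw [H.bump₁.apply_zero, H.bump₁.apply_right] at hibp
  simp only [zero_mul, sub_zero] at hibp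
  have hibp' : ∫ x in (0 : ℝ)..l, ((ζ₂ x * Zhat l α ε lam a k f x t +
      ζ₁ x * Zx l α ε lam a k f x t) * Real.sin (wave l n * x) +
      ζ₁ x * Zhat l α ε lam a k f x t * (wave l n * Real.cos (wave l n * x))) = 0 := hibp
  have hi : ∀ {g : ℝ → ℝ}, Continuous g → IntervalIntegrable g volume 0 l :=
    fun hg => hg.intervalIntegrable _ _
  have c0 : Continuous fun x => ζ x * Zhat l α ε lam a k f x t * Real.sin (wave l n * x) := by
    fun_prop
  have c1 : Continuous fun x => ζ₁ x * Zx l α ε lam a k f x t * Real.sin (wave l n * x) := by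
    fun_prop
  have c2 : Continuous fun x => ζ₂ x * Zhat l α ε lam a k f x t * Real.sin (wave l n * x) := by
    fun_prop
  have c3 : IntervalIntegrable (fun x => rhat l α ε lam a k f x t * φ x) volume 0 l :=
    (hr1.mul_continuous hl hφ (N := Kζ) fun x => by
      rw [hφdef, abs_mul]
      exact (mul_le_of_le_one_right (abs_nonneg _) (Real.abs_sin_le_one _)).trans
        (H.bump.bdd x)).intervalIntegrable hl
  have hP : ∫ x in (0 : ℝ)..l, ψ x * Zhat l α ε lam a k f x t =
      bC l lam n * (∫ x in (0 : ℝ)..l, ζ x * Zhat l α ε lam a k f x t * Real.sin (wave l n * x)) +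
      (∫ x in (0 : ℝ)..l, ζ₂ x * Zhat l α ε lam a k f x t * Real.sin (wave l n * x)) +
      2 * ∫ x in (0 : ℝ)..l, ζ₁ x * Zx l α ε lam a k f x t * Real.sin (wave l n * x) := by
    refine (add_zero _).symm.trans ((congrArg (_ + ·) ((mul_zero (2 : ℝ)).symm.trans
      (congrArg ((2 : ℝ) * ·) hibp'.symm))).trans ?_)
    rw [← intervalIntegral.integral_const_mul, ← intervalIntegral.integral_const_mul,
      ← intervalIntegral.integral_const_mul,
      ← intervalIntegral.integral_add (hi (by fun_prop)) (hi (by fun_prop)),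
      ← intervalIntegral.integral_add (hi (by fun_prop)) (hi (by fun_prop)),
      ← intervalIntegral.integral_add (hi (by fun_prop)) (hi (by fun_prop))]
    congr 1
    ext x
    rw [hψdef, hφdef, bC_eq]
    ring
  have hsrc : sinCoef l (fun x => locSrc l α ε lam a k f ζ ζ₁ ζ₂ x t) n =
      (∫ x in (0 : ℝ)..l, rhat l α ε lam a k f x t * φ x) -
      2 * ε * (∫ x in (0 : ℝ)..l, ζ₁ x * Zx l α ε lam a k f x t * Real.sin (wave l n * x)) -
      ε * ∫ x in (0 : ℝ)..l, ζ₂ x * Zhat l α ε lam a k f x t * Real.sin (wave l n * x) := by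
    rw [← intervalIntegral.integral_const_mul, ← intervalIntegral.integral_const_mul,
      ← intervalIntegral.integral_sub c3 (hi (by fun_prop)),
      ← intervalIntegral.integral_sub (c3.sub (hi (by fun_prop))) (hi (by fun_prop)), sinCoef]
    congr 1
    ext x
    rw [hφdef, locSrc]
    ring
  rw [hP, hsrc, locMode, sinCoef]
  field_simp
  ring

end FlowData

end Relaxed

/-- Local Lipschitz continuity in `x`, uniform in `t`, in the interior of the strip. -/
def LocLip (l : ℝ) (f : ℝ → ℝ → ℝ) : Prop :=
  ∀ c d δ T : ℝ, 0 < c → d < l → 0 < δ →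
    ∃ L : NNReal, ∀ t ∈ Icc δ T, LipschitzOnWith L (fun x => f x t) (Icc c d)

lemma lipschitzOnWith_const_mul (r : ℝ) {g : ℝ → ℝ} {L : NNReal} {s : Set ℝ}
    (h : LipschitzOnWith L g s) : LipschitzOnWith (‖r‖₊ * L) (fun x => r * g x) s :=
  LipschitzOnWith.of_dist_le_mul fun x hx y hy => by
    have h1 := h.dist_le_mul x hx y hy
    rw [Real.dist_eq] at h1
    rw [Real.dist_eq, ← mul_sub, abs_mul, NNReal.coe_mul, coe_nnnorm, Real.norm_eq_abs, mul_assoc]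
    gcongr

/-! ### The second gain of regularity, for the localized heat equation -/

section Relaxed

variable {l α ε lam : ℝ} {a : ℕ → ℝ} {k : ℝ → ℝ} {f : ℝ → ℝ → ℝ} {M : ℝ} {K : NNReal}
  {c d : ℝ} {Kζ : NNReal} {ζ ζ₁ ζ₂ : ℝ → ℝ}

namespace FlowData

variable (S : FlowData l α ε lam M K a k f)
include S

lemma exists_lipschitz_rhat (hL : LocLip l f) (T : ℝ) {c d δ : ℝ} (hc : 0 < c) (hd : d < l)
    (hδ : 0 < δ) : ∃ L : NNReal, ∀ t ∈ Icc δ T,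
      LipschitzOnWith L (fun x => rhat l α ε lam a k f x t) (Icc c d) := by
  obtain ⟨L, hL⟩ := hL c d δ T hc hd hδ
  obtain ⟨L', hL'⟩ := S.exists_lipschitz_Vhat hδ T
  have hsub : Icc c d ⊆ Icc 0 l := Icc_subset_Icc hc.le hd.le
  have key : ∀ t ∈ Icc δ T, _ := fun t ht =>
    (lipschitzOnWith_const_mul (1 - ε * α) ((hL' t ht).lipschitzOnWith (s := Icc c d))).sub
      (lipschitzOnWith_const_mul ε (exists_lipschitz_mul ((lipschitz_wt (l := l) S.hlam).mono hsub) (hL t ht)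
        (fun x hx => abs_wt_le S.hlam (hsub hx).1) (B := M) fun x hx =>
          S.hf.bdd x ⟨hc.trans_le hx.1, hx.2.trans_lt hd⟩ t (hδ.trans_le ht.1)))
  exact ⟨_, key⟩

lemma abs_locSrc_le (H : Cutoff l c d Kζ ζ ζ₁ ζ₂) {R C x t : ℝ}
    (h1 : |rhat l α ε lam a k f x t| ≤ R) (h2 : |Zhat l α ε lam a k f x t| ≤ C)
    (h3 : |Zx l α ε lam a k f x t| ≤ C) :
    |locSrc l α ε lam a k f ζ ζ₁ ζ₂ x t| ≤ Kζ * R + 2 * ε * (Kζ * C) + ε * (Kζ * C) := by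
  have hε := S.hε
  have b0 := H.bump.bdd x
  have b1 := H.bump₁.bdd x
  have b2 := H.bump₂.bdd x
  rw [locSrc]
  refine (abs_sub _ _).trans (add_le_add ((abs_sub _ _).trans (add_le_add ?_ ?_)) ?_)
  · rw [abs_mul]; gcongr
  · rw [abs_mul, abs_mul (ζ₁ x), abs_of_pos (by positivity : 0 < 2 * ε)]; gcongr
  · rw [abs_mul, abs_mul (ζ₂ x), abs_of_pos hε]; gcongr

lemma continuousOn_locSrc (H : Cutoff l c d Kζ ζ ζ₁ ζ₂) {δ : ℝ} (hδ : 0 < δ) (T : ℝ) :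
    ContinuousOn (fun p : ℝ × ℝ => locSrc l α ε lam a k f ζ ζ₁ ζ₂ p.1 p.2)
      (Ioo 0 l ×ˢ Icc δ T) := by
  have hT : Icc δ T ⊆ Ioc 0 T := fun t ht => ⟨hδ.trans_le ht.1, ht.2⟩
  have h1 := (S.continuousOn_rhat T).mono (prod_mono_right (s := Ioo 0 l) hT)
  have h2 := (S.continuousOn_Zx hδ T).mono (prod_mono_left (t := Icc δ T) (subset_univ (Ioo 0 l)))
  have h3 := (S.continuousOn_Zhat T).mono (prod_mono (Ioo_subset_Icc_self (a := 0) (b := l)) hT)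
  have hc : ∀ {η : ℝ → ℝ}, Bump l c d Kζ η →
      ContinuousOn (fun p : ℝ × ℝ => η p.1) (Ioo 0 l ×ˢ Icc δ T) := fun h =>
    (h.lip.continuous.comp continuous_fst).continuousOn
  exact (((hc H.bump).mul h1).sub (((hc H.bump₁).mul h2).const_mul _)).sub
    (((hc H.bump₂).mul h3).const_mul _)

lemma exists_locSrc_bound (H : Cutoff l c d Kζ ζ ζ₁ ζ₂) {δ : ℝ} (hδ : 0 < δ) (T : ℝ) :
    ∃ B, ∀ x ∈ Ioo 0 l, ∀ t ∈ Icc δ T, |locSrc l α ε lam a k f ζ ζ₁ ζ₂ x t| ≤ B := by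
  obtain ⟨R, hR⟩ := S.exists_rhat_bound T
  obtain ⟨C, hC0, hC⟩ := S.exists_Z_bound hδ T
  exact ⟨_, fun x hx t ht => S.abs_locSrc_le H ((hR t ⟨hδ.trans_le ht.1, ht.2⟩).1.2 x hx)
    (hC x t ht).1 (hC x t ht).2⟩

lemma continuousOn_sinCoef_locSrc (H : Cutoff l c d Kζ ζ ζ₁ ζ₂) {δ : ℝ} (hδ : 0 < δ) (T : ℝ)
    (n : ℕ) : ContinuousOn (fun t => sinCoef l (fun x => locSrc l α ε lam a k f ζ ζ₁ ζ₂ x t) n)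
      (Icc δ T) := by
  obtain ⟨B, hB⟩ := S.exists_locSrc_bound H hδ T
  exact continuousOn_integral_mul S.hl (S.continuousOn_locSrc H hδ T) hB (by fun_prop)
    fun x _ => Real.abs_sin_le_one _

/-- The source of the localized heat equation has sine coefficients of weight `1/4`. -/
lemma exists_sum_sinCoef_locSrc_le (hL : LocLip l f) (H : Cutoff l c d Kζ ζ ζ₁ ζ₂) {δ : ℝ}
    (hδ : 0 < δ) (T : ℝ) : ∃ C, ∀ t ∈ Icc δ T, ∀ N, ∑ n ∈ Finset.range N,
      ((n : ℝ) + 1) ^ (1 / 4 : ℝ) *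
        |sinCoef l (fun x => locSrc l α ε lam a k f ζ ζ₁ ζ₂ x t) n| ≤ C := by
  have hl := S.hl
  have hε := S.hε
  have hpi := Real.pi_pos
  obtain ⟨A, hA, hw⟩ := weighted_sinCoef_le_of_lipschitz hl (q := 1 / 4) (by norm_num)
  obtain ⟨A₁, hA₁, hw₁⟩ := H.bump₁.exists_sum_sinCoef_mul_cosSeries_le hl
  obtain ⟨L, hLr⟩ := S.exists_lipschitz_rhat hL T H.bump.hc H.bump.hd hδ
  obtain ⟨L', hLz⟩ := S.exists_lipschitz_Zhat hδ T
  obtain ⟨R, hR⟩ := S.exists_rhat_bound T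
  obtain ⟨C, hC0, hC⟩ := S.exists_Z_bound hδ T
  obtain ⟨Cz, hCz⟩ := S.exists_zm_bound hδ T
  have hcd : ∀ x ∈ Icc c d, x ∈ Ioo 0 l := fun x hx =>
    ⟨H.bump.hc.trans_le hx.1, hx.2.trans_lt H.bump.hd⟩
  refine ⟨A * (Kζ * L + R * Kζ).toNNReal + 2 * ε * (A₁ * (2 / l * (Real.pi / l * Cz))) +
    ε * (A * (Kζ * L' + C * Kζ).toNNReal), fun t ht N => ?_⟩
  have ht0 : 0 < t := hδ.trans_le ht.1
  obtain ⟨hr, -⟩ := hR t ⟨ht0, ht.2⟩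
  have hR0 := hr.nonneg hl
  have l1 := H.bump.lipschitz_mul hR0 (hLr t ht) fun x hx => hr.2 x (hcd x hx)
  have l2 := H.bump₂.lipschitz_mul hC0 (hLz t ht).lipschitzOnWith fun x _ => (hC x t ht).1
  have e1 := hw _ _ l1.lipschitzOnWith (by simp [H.bump.apply_zero])
    (by simp [H.bump.apply_right]) N
  have e2 := hw _ _ l2.lipschitzOnWith (by simp [H.bump₂.apply_zero])
    (by simp [H.bump₂.apply_right]) N
  -- The other two terms of the source are Lipschitz and vanish at the endpoints. For ζ₁ Z_x no
  -- Lipschitz bound is known; its cosine coefficients have weight 5/4 - 1 = 1/4, and multiplication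
  -- by the cutoff preserves this weight.
  have e3 := hw₁ (fun m => 2 / l * (wave l m * zm l α ε lam a k f m t))
    (2 / l * (Real.pi / l * Cz)) (fun N => by
      have h1 : ∀ m : ℕ, ((m : ℝ) + 1) ^ (1 / 4 : ℝ) *
          |2 / l * (wave l m * zm l α ε lam a k f m t)| =
          2 / l * (Real.pi / l * (((m : ℝ) + 1) ^ (5 / 4 : ℝ) * |zm l α ε lam a k f m t|)) := by
        intro m
        rw [abs_mul, abs_mul, abs_of_pos (wave_pos hl m), abs_of_pos (by positivity : 0 < 2 / l),
          mul_left_comm, mul_wave_weight]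
        norm_num
      simp_rw [h1]
      rw [← Finset.mul_sum, ← Finset.mul_sum]
      have := hCz t ht N
      gcongr) N
  have hZx : ∀ x, ζ₁ x * ∑' m, 2 / l * (wave l m * zm l α ε lam a k f m t) *
      Real.cos (wave l m * x) = ζ₁ x * Zx l α ε lam a k f x t := fun x => by
    rw [Zx]
    congr 1
    rw [← tsum_mul_left]
    exact tsum_congr fun m => by ring
  simp only [hZx] at e3
  have hcont : Continuous fun x => ζ₁ x * Zx l α ε lam a k f x t :=
    H.bump₁.lip.continuous.mul (S.continuous_Zx ht0)
  have m1 : BddMeas l (Kζ * R) (fun x => ζ x * rhat l α ε lam a k f x t) :=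
    H.bump.bddMeas.mul hl hr
  have m2 : BddMeas l (2 * ε * (Kζ * C)) (fun x => 2 * ε * (ζ₁ x * Zx l α ε lam a k f x t)) :=
    bddMeas_of_continuousOn (hcont.const_mul _).continuousOn fun x _ => by
      rw [abs_mul, abs_mul (ζ₁ x), abs_of_pos (by positivity : 0 < 2 * ε)]
      have := H.bump₁.bdd x
      have := (hC x t ht).2
      gcongr
  have m3 : BddMeas l (ε * (Kζ * C)) (fun x => ε * (ζ₂ x * Zhat l α ε lam a k f x t)) :=
    bddMeas_of_continuousOn ((H.bump₂.lip.continuous.mul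
      (S.continuous_Zhat ht0)).const_mul ε).continuousOn fun x _ => by
      rw [abs_mul, abs_mul (ζ₂ x), abs_of_pos hε]
      have := H.bump₂.bdd x
      have := (hC x t ht).1
      gcongr
  have m12 : BddMeas l (Kζ * R + 2 * ε * (Kζ * C)) (fun x => ζ x * rhat l α ε lam a k f x t -
      2 * ε * (ζ₁ x * Zx l α ε lam a k f x t)) :=
    ⟨m1.1.sub m2.1, fun x hx => (abs_sub _ _).trans (add_le_add (m1.2 x hx) (m2.2 x hx))⟩
  have hdec : ∀ n, |sinCoef l (fun x => locSrc l α ε lam a k f ζ ζ₁ ζ₂ x t) n| ≤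
      |sinCoef l (fun x => ζ x * rhat l α ε lam a k f x t) n| +
      2 * ε * |sinCoef l (fun x => ζ₁ x * Zx l α ε lam a k f x t) n| +
      ε * |sinCoef l (fun x => ζ₂ x * Zhat l α ε lam a k f x t) n| := by
    intro n
    have h := sinCoef_sub hl m12 m3 n
    rw [sinCoef_sub hl m1 m2 n, sinCoef_const_mul, sinCoef_const_mul] at h
    rw [show sinCoef l (fun x => locSrc l α ε lam a k f ζ ζ₁ ζ₂ x t) n = _ from h]
    refine (abs_sub _ _).trans (add_le_add ((abs_sub _ _).trans (add_le_add le_rfl ?_)) ?_)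
    · rw [abs_mul, abs_of_pos (by positivity : 0 < 2 * ε)]
    · rw [abs_mul, abs_of_pos hε]
  calc _ ≤ ∑ n ∈ Finset.range N, (((n : ℝ) + 1) ^ (1 / 4 : ℝ) *
          |sinCoef l (fun x => ζ x * rhat l α ε lam a k f x t) n| +
        2 * ε * (((n : ℝ) + 1) ^ (1 / 4 : ℝ) *
          |sinCoef l (fun x => ζ₁ x * Zx l α ε lam a k f x t) n|) +
        ε * (((n : ℝ) + 1) ^ (1 / 4 : ℝ) *
          |sinCoef l (fun x => ζ₂ x * Zhat l α ε lam a k f x t) n|)) := by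
        refine Finset.sum_le_sum fun n _ => ?_
        refine (mul_le_mul_of_nonneg_left (hdec n) (by positivity)).trans (le_of_eq ?_)
        ring
    _ ≤ _ := by
        rw [Finset.sum_add_distrib, Finset.sum_add_distrib, ← Finset.mul_sum, ← Finset.mul_sum]
        gcongr

/-- For positive times the modes of `ζ (ε u_t + u)` decay like those of a `C²` function. -/
lemma exists_sum_locMode_le (hL : LocLip l f) (H : Cutoff l c d Kζ ζ ζ₁ ζ₂) {δ : ℝ}
    (hδ : 0 < δ) (T : ℝ) : ∃ C, ∀ t ∈ Icc (2 * δ) T, ∀ N, ∑ n ∈ Finset.range N,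
      ((n : ℝ) + 1) ^ (17 / 8 : ℝ) * |locMode l α ε lam a k f ζ n t| ≤ C := by
  have hl := S.hl
  have hε := S.hε
  have hpi := Real.pi_pos
  obtain ⟨B, hB⟩ := S.exists_sum_sinCoef_locSrc_le hL H hδ T
  obtain ⟨C, hC0, hC⟩ := S.exists_Z_bound hδ T
  set e := ε * (Real.pi / l) ^ 2 with he
  set E := 1 / (e * (δ / 2)) with hE
  set Q := Kζ * C * l with hQ
  have hs := summable_add_one_rpow (p := -(15 / 8)) (by norm_num)
  refine ⟨E ^ 2 * Q * (∑' n : ℕ, ((n : ℝ) + 1) ^ (-(15 / 8) : ℝ)) +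
    16 * e ^ (-(15 / 16) : ℝ) * B * T ^ (1 / 16 : ℝ), fun t ht N => ?_⟩
  have htδ : δ ≤ t := by linarith [ht.1]
  have hmode : ∀ n, |locMode l α ε lam a k f ζ n δ| ≤ Q := fun n =>
    abs_sinCoef_le hl (fun x _ => by
      rw [abs_mul]
      have := H.bump.bdd x
      have := (hC x δ ⟨le_rfl, htδ.trans ht.2⟩).1
      gcongr) n
  have hint : ∀ n, IntervalIntegrable
      (fun t => sinCoef l (fun x => locSrc l α ε lam a k f ζ ζ₁ ζ₂ x t) n) volume δ t := fun n =>
    ((S.continuousOn_sinCoef_locSrc H hδ t n).mono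
      (by rw [uIcc_of_le htδ])).intervalIntegrable
  have hvar : ∀ n, locMode l α ε lam a k f ζ n t = Real.exp (-(ε * bC l lam n) * (t - δ)) *
      locMode l α ε lam a k f ζ n δ + ∫ τ in δ..t, Real.exp (-(ε * bC l lam n) * (t - τ)) *
        sinCoef l (fun x => locSrc l α ε lam a k f ζ ζ₁ ζ₂ x τ) n := fun n =>
    variation_of_constants htδ (fun τ hτ =>
        (S.hasDerivAt_locMode H n (hδ.trans_le hτ.1)).continuousAt.continuousWithinAt)
      (fun τ hτ => S.hasDerivAt_locMode H n (hδ.trans hτ.1)) (hint n)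
  -- The evolution is started at δ and not at 0, because the source is controlled only for positive
  -- times. The gain leads from 1/4 to 17/8, which exceeds the 2 needed for two derivatives.
  have hduh := duhamel_gain (σ := 1 / 4) (c := e) (by positivity) (fun n => S.le_eps_bC n)
    htδ hint (B := B) (fun τ hτ N => hB τ ⟨hτ.1.le, hτ.2.le.trans ht.2⟩ N) N
  have hB0 : 0 ≤ B := by simpa using hB t ⟨htδ, ht.2⟩ 0
  have hQ0 : 0 ≤ Q := by positivity
  have hterm : ∀ n : ℕ, ((n : ℝ) + 1) ^ (17 / 8 : ℝ) * |locMode l α ε lam a k f ζ n t| ≤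
      E ^ 2 * Q * ((n : ℝ) + 1) ^ (-(15 / 8) : ℝ) +
      ((n : ℝ) + 1) ^ (1 / 4 + 15 / 8 : ℝ) * |∫ τ in δ..t,
        Real.exp (-(ε * bC l lam n) * (t - τ)) *
          sinCoef l (fun x => locSrc l α ε lam a k f ζ ζ₁ ζ₂ x τ) n| := by
    intro n
    have hn : (0 : ℝ) < (n : ℝ) + 1 := by positivity
    have h1 := exp_bC_le (lam := lam) hl hε (half_pos hδ) n
      (show δ / 2 ≤ (t - δ) / 2 by linarith [ht.1])
    rw [← he, ← hE] at h1
    -- Splitting the time span into two halves uses the bound for the exponential twice and gives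
    -- (n+1)^{-4}; then 17/8 - 4 = -15/8 is summable even against merely bounded modes.
    have h2 : Real.exp (-(ε * bC l lam n) * (t - δ)) ≤ (E * (1 / ((n : ℝ) + 1) ^ 2)) ^ 2 := by
      have h3 : Real.exp (-(ε * bC l lam n) * (t - δ)) =
          Real.exp (-(ε * bC l lam n) * ((t - δ) / 2)) ^ 2 := by
        rw [sq, ← Real.exp_add]; congr 1; ring
      rw [h3]
      gcongr
    have h4 : ((n : ℝ) + 1) ^ (17 / 8 : ℝ) * (1 / ((n : ℝ) + 1) ^ 2) ^ 2 =
        ((n : ℝ) + 1) ^ (-(15 / 8) : ℝ) := by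
      rw [one_div, inv_pow, ← pow_mul, ← Real.rpow_natCast, ← Real.rpow_neg hn.le,
        ← Real.rpow_add hn]
      norm_num
    rw [show (1 / 4 + 15 / 8 : ℝ) = 17 / 8 by norm_num, hvar n, ← h4]
    refine (mul_le_mul_of_nonneg_left (abs_add_le _ _) (by positivity)).trans ?_
    rw [mul_add, abs_mul, abs_of_pos (Real.exp_pos _)]
    refine add_le_add ?_ le_rfl
    have h5 := hmode n
    calc _ ≤ ((n : ℝ) + 1) ^ (17 / 8 : ℝ) * ((E * (1 / ((n : ℝ) + 1) ^ 2)) ^ 2 * Q) := by gcongr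
      _ = _ := by ring
  refine (Finset.sum_le_sum fun n _ => hterm n).trans ?_
  rw [Finset.sum_add_distrib, ← Finset.mul_sum]
  refine add_le_add ?_ (hduh.trans ?_)
  · have := hs.sum_le_tsum (Finset.range N) fun n _ => by positivity
    gcongr
  · have := ht.2
    have : t - δ ≤ T := by linarith
    have : 0 ≤ t - δ := by linarith
    gcongr

end FlowData

end Relaxed

lemma UnifSum.slice {z φ : ℕ → ℝ → ℝ} {s : Set ℝ}
    (h : UnifSum (fun n (p : ℝ × ℝ) => z n p.2 * φ n p.1) (univ ×ˢ s)) {t : ℝ} (ht : t ∈ s) :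
    UnifSum (fun n x => z n t * φ n x) univ :=
  h.comp (fun x => (x, t)) fun _ _ => ⟨mem_univ _, ht⟩

/-! ### Second space derivative and time derivative of the weighted function `Zhat` -/

section Relaxed

variable (l α ε lam : ℝ) (a : ℕ → ℝ) (k : ℝ → ℝ) (f : ℝ → ℝ → ℝ)

/-- The second space derivative of `Zhat`. -/
noncomputable def Zxx (x t : ℝ) : ℝ := deriv (fun y => Zx l α ε lam a k f y t) x

/-- The series of the second space derivative of `ζ · Zhat`. -/
noncomputable def locZxx (ζ : ℝ → ℝ) (x t : ℝ) : ℝ :=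
  2 / l * ∑' n, locMode l α ε lam a k f ζ n t * -(wave l n * (wave l n * Real.sin (wave l n * x)))

variable {l α ε lam a k f} {M : ℝ} {K : NNReal} {c d : ℝ} {Kζ : NNReal} {ζ ζ₁ ζ₂ : ℝ → ℝ}

lemma exists_cutoff_nhds {x₀ : ℝ} (hx : x₀ ∈ Ioo 0 l) :
    ∃ (s : Set ℝ) (c d : ℝ) (K : NNReal) (ζ ζ₁ ζ₂ : ℝ → ℝ), IsOpen s ∧ x₀ ∈ s ∧ s ⊆ Ioo 0 l ∧
      Cutoff l c d K ζ ζ₁ ζ₂ ∧ ∀ x ∈ s, ζ x = 1 := by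
  obtain ⟨r, c, d, K, ζ, ζ₁, ζ₂, hr, -, H, h1⟩ := exists_cutoff hx
  exact ⟨Ioo (x₀ - r) (x₀ + r) ∩ Ioo 0 l, c, d, K, ζ, ζ₁, ζ₂, isOpen_Ioo.inter isOpen_Ioo,
    ⟨⟨by linarith, by linarith⟩, hx⟩, inter_subset_right, H, fun x hx => h1 x hx.1⟩

namespace FlowData

variable (S : FlowData l α ε lam M K a k f)
include S

lemma continuousOn_locMode (H : Cutoff l c d Kζ ζ ζ₁ ζ₂) (n : ℕ) :
    ContinuousOn (locMode l α ε lam a k f ζ n) (Ioi 0) := fun _ ht =>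
  (S.hasDerivAt_locMode H n ht).continuousAt.continuousWithinAt

lemma exists_sum_sq_mul_locMode_le (hL : LocLip l f) (H : Cutoff l c d Kζ ζ ζ₁ ζ₂) {δ : ℝ}
    (hδ : 0 < δ) (T : ℝ) : ∃ C, ∀ t ∈ Icc δ T, ∀ N, ∑ n ∈ Finset.range N,
      ((n : ℝ) + 1) ^ (1 / 8 : ℝ) * (((n : ℝ) + 1) ^ 2 * |locMode l α ε lam a k f ζ n t|) ≤ C := by
  obtain ⟨C, hC⟩ := S.exists_sum_locMode_le hL H (half_pos hδ) T
  refine ⟨C, fun t ht N => ?_⟩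
  refine le_trans (le_of_eq (Finset.sum_congr rfl fun n _ => ?_))
    (hC t (by rwa [mul_div_cancel₀ _ two_ne_zero]) N)
  have hn : (0 : ℝ) < (n : ℝ) + 1 := by positivity
  rw [← mul_assoc, ← Real.rpow_natCast, ← Real.rpow_add hn]
  norm_num

lemma unifSum_locMode_of_le (hL : LocLip l f) (H : Cutoff l c d Kζ ζ ζ₁ ζ₂) {δ : ℝ}
    (hδ : 0 < δ) (T : ℝ) {φ : ℕ → ℝ → ℝ} {A : ℝ} (hA : 0 ≤ A)
    (hφ : ∀ n x, |φ n x| ≤ A * ((n : ℝ) + 1) ^ 2) :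
    UnifSum (fun n (p : ℝ × ℝ) => locMode l α ε lam a k f ζ n p.2 * φ n p.1)
      (univ ×ˢ Icc δ T) := by
  obtain ⟨C, hC⟩ := S.exists_sum_sq_mul_locMode_le hL H hδ T
  refine unifSum_of_weight (δ := 1 / 8) (C := A * C) (by norm_num) fun p hp N => ?_
  refine le_trans (Finset.sum_le_sum fun n _ => ?_) ((Finset.mul_sum _ _ _).symm.le.trans
    (mul_le_mul_of_nonneg_left (hC p.2 hp.2 N) hA))
  rw [abs_mul]
  have := hφ n p.1
  calc _ ≤ ((n : ℝ) + 1) ^ (1 / 8 : ℝ) *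
        (|locMode l α ε lam a k f ζ n p.2| * (A * ((n : ℝ) + 1) ^ 2)) := by gcongr
    _ = _ := by ring

lemma abs_wave_pow_le (n : ℕ) : 1 ≤ ((n : ℝ) + 1) ^ 2 ∧
    wave l n ≤ Real.pi / l * ((n : ℝ) + 1) ^ 2 ∧
    wave l n * wave l n ≤ (Real.pi / l) ^ 2 * ((n : ℝ) + 1) ^ 2 := by
  have h0 : (0 : ℝ) ≤ n := n.cast_nonneg
  have hpi := Real.pi_pos
  have hl := S.hl
  refine ⟨by nlinarith, ?_, by rw [wave_eq]; apply le_of_eq; ring⟩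
  rw [wave_eq, mul_comm]
  gcongr
  nlinarith

lemma unifSum_locMode_sin (hL : LocLip l f) (H : Cutoff l c d Kζ ζ ζ₁ ζ₂) {δ : ℝ}
    (hδ : 0 < δ) (T : ℝ) : UnifSum (fun n (p : ℝ × ℝ) => locMode l α ε lam a k f ζ n p.2 *
      Real.sin (wave l n * p.1)) (univ ×ˢ Icc δ T) :=
  S.unifSum_locMode_of_le hL H hδ T zero_le_one (φ := fun n x => Real.sin (wave l n * x))
    fun n x => by
      rw [one_mul]; exact (Real.abs_sin_le_one _).trans (S.abs_wave_pow_le n).1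

lemma unifSum_locMode_cos (hL : LocLip l f) (H : Cutoff l c d Kζ ζ ζ₁ ζ₂) {δ : ℝ}
    (hδ : 0 < δ) (T : ℝ) : UnifSum (fun n (p : ℝ × ℝ) => locMode l α ε lam a k f ζ n p.2 *
      (wave l n * Real.cos (wave l n * p.1))) (univ ×ˢ Icc δ T) :=
  S.unifSum_locMode_of_le hL H hδ T (div_pos Real.pi_pos S.hl).le
    (φ := fun n x => wave l n * Real.cos (wave l n * x)) fun n x => by
      rw [abs_mul, abs_of_pos (wave_pos S.hl n)]
      exact (mul_le_of_le_one_right (wave_pos S.hl n).le (Real.abs_cos_le_one _)).trans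
        (S.abs_wave_pow_le n).2.1

lemma unifSum_locZxx (hL : LocLip l f) (H : Cutoff l c d Kζ ζ ζ₁ ζ₂) {δ : ℝ}
    (hδ : 0 < δ) (T : ℝ) : UnifSum (fun n (p : ℝ × ℝ) => locMode l α ε lam a k f ζ n p.2 *
      -(wave l n * (wave l n * Real.sin (wave l n * p.1)))) (univ ×ˢ Icc δ T) :=
  S.unifSum_locMode_of_le hL H hδ T (sq_nonneg (Real.pi / l))
    (φ := fun n x => -(wave l n * (wave l n * Real.sin (wave l n * x)))) fun n x => by
      rw [abs_neg, ← mul_assoc, abs_mul, abs_of_pos (mul_pos (wave_pos S.hl n) (wave_pos S.hl n))]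
      exact (mul_le_of_le_one_right (mul_pos (wave_pos S.hl n) (wave_pos S.hl n)).le
        (Real.abs_sin_le_one _)).trans (S.abs_wave_pow_le n).2.2

lemma mul_Zhat_eq_tsum (hL : LocLip l f) (H : Cutoff l c d Kζ ζ ζ₁ ζ₂) {x t : ℝ}
    (hx : x ∈ Ioo 0 l) (ht : 0 < t) : ζ x * Zhat l α ε lam a k f x t =
      2 / l * ∑' n, locMode l α ε lam a k f ζ n t * Real.sin (wave l n * x) := by
  obtain ⟨C, hC⟩ := S.exists_sum_locMode_le hL H (half_pos ht) t
  refine eq_sine_series S.hl (f := fun x => ζ x * Zhat l α ε lam a k f x t)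
    (H.bump.lip.continuous.mul (S.continuous_Zhat ht)).continuousOn ?_ hx
  exact summable_of_weight (by norm_num) (hC t ⟨by linarith, le_rfl⟩)

lemma continuousOn_locZxx (hL : LocLip l f) (H : Cutoff l c d Kζ ζ ζ₁ ζ₂) {δ : ℝ}
    (hδ : 0 < δ) (T : ℝ) : ContinuousOn
      (fun p : ℝ × ℝ => locZxx l α ε lam a k f ζ p.1 p.2) (univ ×ˢ Icc δ T) := by
  refine ((S.unifSum_locZxx hL H hδ T).continuousOn fun n => ?_).const_mul _
  exact ((S.continuousOn_locMode H n).comp (by fun_prop) fun p hp => hδ.trans_le hp.2.1).mul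
    (by fun_prop)

/-- Where ζ = 1, Z coincides with the sine series of ζZ, which may be differentiated twice term by
term. Uniqueness of derivatives on the open set s identifies the first derivative of that series
with `Zx`, and the second then differentiates `Zx`. -/
lemma hasDerivAt_Zx_of_cutoff (hL : LocLip l f) (H : Cutoff l c d Kζ ζ ζ₁ ζ₂) {s : Set ℝ}
    (hs : IsOpen s) (hsl : s ⊆ Ioo 0 l) (h1 : ∀ x ∈ s, ζ x = 1) {x t : ℝ} (hx : x ∈ s)
    (ht : 0 < t) :
    HasDerivAt (fun y => Zx l α ε lam a k f y t) (locZxx l α ε lam a k f ζ x t) x := by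
  have u1 : UnifSum (fun n y => locMode l α ε lam a k f ζ n t * Real.sin (wave l n * y)) univ :=
    UnifSum.slice (z := locMode l α ε lam a k f ζ) (φ := fun n y => Real.sin (wave l n * y))
      (S.unifSum_locMode_sin hL H ht t) ⟨le_rfl, le_rfl⟩
  have u2 : UnifSum (fun n y => locMode l α ε lam a k f ζ n t *
      (wave l n * Real.cos (wave l n * y))) univ := UnifSum.slice (z := locMode l α ε lam a k f ζ) (φ := 
      fun n y => wave l n * Real.cos (wave l n * y)) (S.unifSum_locMode_cos hL H ht t) ⟨le_rfl, le_rfl⟩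
  have u3 : UnifSum (fun n y => locMode l α ε lam a k f ζ n t *
      -(wave l n * (wave l n * Real.sin (wave l n * y)))) univ :=
    UnifSum.slice (z := locMode l α ε lam a k f ζ) (φ := 
      fun n y => -(wave l n * (wave l n * Real.sin (wave l n * y))))
      (S.unifSum_locZxx hL H ht t) ⟨le_rfl, le_rfl⟩
  have d1 : ∀ y, HasDerivAt
      (fun y => 2 / l * ∑' n, locMode l α ε lam a k f ζ n t * Real.sin (wave l n * y))
      (2 / l * ∑' n, locMode l α ε lam a k f ζ n t * (wave l n * Real.cos (wave l n * y))) y :=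
    fun y => (UnifSum.hasDerivAt isOpen_univ u2
      (fun n y _ => (hasDerivAt_sin_wave (wave l n) y).const_mul _)
      (fun y hy => u1.summable hy) (mem_univ y)).const_mul _
  have d2 : ∀ y, HasDerivAt
      (fun y => 2 / l * ∑' n, locMode l α ε lam a k f ζ n t * (wave l n * Real.cos (wave l n * y)))
      (locZxx l α ε lam a k f ζ y t) y := by
    intro y
    rw [locZxx]
    refine (UnifSum.hasDerivAt isOpen_univ u3 (fun n y _ => ?_)
      (fun y hy => u2.summable hy) (mem_univ y)).const_mul _
    simpa only [mul_neg] using ((hasDerivAt_cos_wave (wave l n) y).const_mul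
      (wave l n)).const_mul (locMode l α ε lam a k f ζ n t)
  have hZ : ∀ y ∈ s, Zhat l α ε lam a k f y t =
      2 / l * ∑' n, locMode l α ε lam a k f ζ n t * Real.sin (wave l n * y) := fun y hy => by
    rw [← S.mul_Zhat_eq_tsum hL H (hsl hy) ht, h1 y hy, one_mul]
  refine (d2 x).congr_of_eventuallyEq ?_
  filter_upwards [hs.mem_nhds hx] with y hy
  refine (S.hasDerivAt_Zhat y ht).unique ((d1 y).congr_of_eventuallyEq ?_)
  filter_upwards [hs.mem_nhds hy] with z hz using hZ z hz

lemma unifSum_deriv_locMode_sin (hL : LocLip l f) (H : Cutoff l c d Kζ ζ ζ₁ ζ₂) {δ : ℝ}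
    (hδ : 0 < δ) (T x : ℝ) : UnifSum (fun n τ =>
      (-(ε * bC l lam n) * locMode l α ε lam a k f ζ n τ +
      sinCoef l (fun x => locSrc l α ε lam a k f ζ ζ₁ ζ₂ x τ) n) * Real.sin (wave l n * x))
      (Ioo δ T) := by
  have hl := S.hl
  have hε := S.hε
  have hpi := Real.pi_pos
  obtain ⟨C, hC⟩ := S.exists_sum_sq_mul_locMode_le hL H hδ T
  obtain ⟨D, hD⟩ := S.exists_sum_sinCoef_locSrc_le hL H hδ T
  set B := (Real.pi / l) ^ 2 + lam ^ 2 / 4 with hB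
  have hbB : ∀ n, bC l lam n ≤ B * ((n : ℝ) + 1) ^ 2 := fun n => by
    obtain ⟨h2, -, h3⟩ := S.abs_wave_pow_le n
    rw [bC_eq, hB]
    nlinarith [sq_nonneg lam]
  refine unifSum_of_weight (δ := 1 / 8) (C := ε * B * C + D) (by norm_num) fun τ hτ N => ?_
  have hτ' : τ ∈ Icc δ T := Ioo_subset_Icc_self hτ
  refine le_trans (Finset.sum_le_sum fun n _ => ?_) ((Finset.sum_add_distrib).trans_le
    (add_le_add ((Finset.mul_sum _ _ _).symm.le.trans
      (mul_le_mul_of_nonneg_left (hC τ hτ' N) (by positivity))) (hD τ hτ' N)))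
  have hn : ((n : ℝ) + 1) ^ (1 / 8 : ℝ) ≤ ((n : ℝ) + 1) ^ (1 / 4 : ℝ) :=
    Real.rpow_le_rpow_of_exponent_le (by linarith [n.cast_nonneg (α := ℝ)]) (by norm_num)
  have hb := hbB n
  have hb0 := bC_pos l lam S.hlam n
  rw [abs_mul]
  calc _ ≤ ((n : ℝ) + 1) ^ (1 / 8 : ℝ) * (ε * (B * ((n : ℝ) + 1) ^ 2) *
        |locMode l α ε lam a k f ζ n τ| +
        |sinCoef l (fun x => locSrc l α ε lam a k f ζ ζ₁ ζ₂ x τ) n|) := by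
        gcongr
        refine (mul_le_of_le_one_right (abs_nonneg _) (Real.abs_sin_le_one _)).trans
          ((abs_add_le _ _).trans (add_le_add ?_ le_rfl))
        rw [abs_mul, abs_neg, abs_of_pos (by positivity : 0 < ε * bC l lam n)]
        gcongr
    _ = ε * B * (((n : ℝ) + 1) ^ (1 / 8 : ℝ) * (((n : ℝ) + 1) ^ 2 *
        |locMode l α ε lam a k f ζ n τ|)) + ((n : ℝ) + 1) ^ (1 / 8 : ℝ) *
        |sinCoef l (fun x => locSrc l α ε lam a k f ζ ζ₁ ζ₂ x τ) n| := by ring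
    _ ≤ _ := by gcongr

lemma continuous_locSrc (hL : LocLip l f) (H : Cutoff l c d Kζ ζ ζ₁ ζ₂) {t : ℝ} (ht : 0 < t) :
    Continuous fun x => locSrc l α ε lam a k f ζ ζ₁ ζ₂ x t := by
  obtain ⟨R, hR⟩ := S.exists_rhat_bound t
  obtain ⟨hr, -⟩ := hR t ⟨ht, le_rfl⟩
  obtain ⟨L, hLr⟩ := S.exists_lipschitz_rhat hL t H.bump.hc H.bump.hd ht
  have c1 := (H.bump.lipschitz_mul (hr.nonneg S.hl) (hLr t ⟨le_rfl, le_rfl⟩) fun x hx =>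
    hr.2 x ⟨H.bump.hc.trans_le hx.1, hx.2.trans_lt H.bump.hd⟩).continuous
  exact (c1.sub ((H.bump₁.lip.continuous.mul (S.continuous_Zx ht)).const_mul _)).sub
    ((H.bump₂.lip.continuous.mul (S.continuous_Zhat ht)).const_mul _)

/-- The localized series is differentiated in time term by term. Its source equals `rhat` at points
near which ζ is constantly 1, so the heat equation for ζZ becomes the one for Z; different cutoffs
cover the whole interior. -/
lemma hasDerivAt_Zhat_time_of_cutoff (hL : LocLip l f) (H : Cutoff l c d Kζ ζ ζ₁ ζ₂) {s : Set ℝ}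
    (hs : IsOpen s) (hsl : s ⊆ Ioo 0 l) (h1 : ∀ x ∈ s, ζ x = 1) {x t : ℝ} (hx : x ∈ s)
    (ht : 0 < t) : HasDerivAt (fun τ => Zhat l α ε lam a k f x τ)
      (ε * (locZxx l α ε lam a k f ζ x t - lam ^ 2 / 4 * Zhat l α ε lam a k f x t) +
        rhat l α ε lam a k f x t) t := by
  have hl := S.hl
  have hε := S.hε
  have hpi := Real.pi_pos
  have hδ := half_pos ht
  set δ := t / 2 with hδdef
  set T := t + 1 with hT
  have hsin : ∀ τ ∈ Ioo δ T, Summable fun n =>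
      locMode l α ε lam a k f ζ n τ * Real.sin (wave l n * x) := fun τ hτ =>
    (UnifSum.slice (z := locMode l α ε lam a k f ζ) (φ := fun n y => Real.sin (wave l n * y))
      (S.unifSum_locMode_sin hL H hδ T) (Ioo_subset_Icc_self hτ)).summable (mem_univ x)
  have htm : t ∈ Ioo δ T := by constructor <;> linarith
  -- the derivatives of the cutoff vanish where it is constant
  have hz1 : ∀ y ∈ s, ζ₁ y = 0 := fun y hy => by
    refine (H.deriv₁ y).unique ((hasDerivAt_const y (1 : ℝ)).congr_of_eventuallyEq ?_)
    filter_upwards [hs.mem_nhds hy] with z hz using h1 z hz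
  have hz2 : ζ₂ x = 0 := by
    refine (H.deriv₂ x).unique ((hasDerivAt_const x (0 : ℝ)).congr_of_eventuallyEq ?_)
    filter_upwards [hs.mem_nhds hx] with z hz using hz1 z hz
  obtain ⟨D, hD⟩ := S.exists_sum_sinCoef_locSrc_le hL H hδ T
  have hunif := S.unifSum_deriv_locMode_sin hL H hδ T x
  have hder := (UnifSum.hasDerivAt isOpen_Ioo hunif
    (fun n τ hτ => (S.hasDerivAt_locMode H n (hδ.trans hτ.1)).mul_const _)
    hsin htm).const_mul (2 / l)
  refine (hder.congr_of_eventuallyEq ?_).congr_deriv ?_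
  · filter_upwards [lt_mem_nhds ht] with τ hτ
    rw [← S.mul_Zhat_eq_tsum hL H (hsl hx) hτ, h1 x hx, one_mul]
  have s1 := hsin t htm
  have s2 := (UnifSum.slice (z := locMode l α ε lam a k f ζ) (φ := 
    fun n y => -(wave l n * (wave l n * Real.sin (wave l n * y))))
    (S.unifSum_locZxx hL H ht t) ⟨le_rfl, le_rfl⟩).summable (mem_univ x)
  have hρ : Summable fun n => |sinCoef l (fun x => locSrc l α ε lam a k f ζ ζ₁ ζ₂ x t) n| :=
    summable_of_weight (by norm_num) (hD t (Ioo_subset_Icc_self htm))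
  have s3 : Summable fun n => sinCoef l (fun x => locSrc l α ε lam a k f ζ ζ₁ ζ₂ x t) n *
      Real.sin (wave l n * x) := Summable.of_norm_bounded hρ fun n => by
    rw [Real.norm_eq_abs, abs_mul]
    exact mul_le_of_le_one_right (abs_nonneg _) (Real.abs_sin_le_one _)
  have hcont := S.continuous_locSrc hL H ht
  have hsrc : rhat l α ε lam a k f x t = 2 / l * ∑' n,
      sinCoef l (fun x => locSrc l α ε lam a k f ζ ζ₁ ζ₂ x t) n * Real.sin (wave l n * x) := by
    rw [← eq_sine_series hl hcont.continuousOn hρ (hsl hx), locSrc, h1 x hx, hz1 x hx, hz2]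
    ring
  have hZ : Zhat l α ε lam a k f x t =
      2 / l * ∑' n, locMode l α ε lam a k f ζ n t * Real.sin (wave l n * x) := by
    rw [← S.mul_Zhat_eq_tsum hL H (hsl hx) ht, h1 x hx, one_mul]
  rw [hsrc, hZ, locZxx, tsum_congr fun n => (by rw [bC_eq]; ring :
    (-(ε * bC l lam n) * locMode l α ε lam a k f ζ n t +
      sinCoef l (fun x => locSrc l α ε lam a k f ζ ζ₁ ζ₂ x t) n) * Real.sin (wave l n * x) =
    ε * (locMode l α ε lam a k f ζ n t * -(wave l n * (wave l n * Real.sin (wave l n * x)))) -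
    ε * (lam ^ 2 / 4) * (locMode l α ε lam a k f ζ n t * Real.sin (wave l n * x)) +
    sinCoef l (fun x => locSrc l α ε lam a k f ζ ζ₁ ζ₂ x t) n * Real.sin (wave l n * x)),
    Summable.tsum_add ((s2.mul_left ε).sub (s1.mul_left _)) s3,
    Summable.tsum_sub (s2.mul_left ε) (s1.mul_left _), tsum_mul_left, tsum_mul_left]
  ring

lemma hasDerivAt_Zx (hL : LocLip l f) {x t : ℝ} (hx : x ∈ Ioo 0 l) (ht : 0 < t) :
    HasDerivAt (fun y => Zx l α ε lam a k f y t) (Zxx l α ε lam a k f x t) x := by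
  obtain ⟨s, c, d, K, ζ, ζ₁, ζ₂, hs, hxs, hsl, H, h1⟩ := exists_cutoff_nhds hx
  exact (S.hasDerivAt_Zx_of_cutoff hL H hs hsl h1 hxs ht).differentiableAt.hasDerivAt

lemma hasDerivAt_Zhat_time (hL : LocLip l f) {x t : ℝ} (hx : x ∈ Ioo 0 l) (ht : 0 < t) :
    HasDerivAt (fun τ => Zhat l α ε lam a k f x τ)
      (ε * (Zxx l α ε lam a k f x t - lam ^ 2 / 4 * Zhat l α ε lam a k f x t) +
        rhat l α ε lam a k f x t) t := by
  obtain ⟨s, c, d, K, ζ, ζ₁, ζ₂, hs, hxs, hsl, H, h1⟩ := exists_cutoff_nhds hx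
  rw [(S.hasDerivAt_Zx hL hx ht).unique (S.hasDerivAt_Zx_of_cutoff hL H hs hsl h1 hxs ht)]
  exact S.hasDerivAt_Zhat_time_of_cutoff hL H hs hsl h1 hxs ht

lemma continuousOn_Zxx (hL : LocLip l f) (T : ℝ) :
    ContinuousOn (fun p : ℝ × ℝ => Zxx l α ε lam a k f p.1 p.2) (Ioo 0 l ×ˢ Ioc 0 T) := by
  refine continuousOn_of_local fun p hp => ?_
  obtain ⟨s, c, d, K, ζ, ζ₁, ζ₂, hs, hxs, hsl, H, h1⟩ := exists_cutoff_nhds hp.1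
  have hδ := half_pos hp.2.1
  refine ⟨s ×ˢ Icc (p.2 / 2) T, ?_, ⟨hxs, by linarith, hp.2.2⟩, ?_⟩
  · refine ((S.continuousOn_locZxx hL H hδ T).mono (prod_mono_left (subset_univ s))).congr
      fun q hq => ?_
    have hq0 : 0 < q.2 := hδ.trans_le hq.2.1
    exact (S.hasDerivAt_Zx hL (hsl hq.1) hq0).unique
      (S.hasDerivAt_Zx_of_cutoff hL H hs hsl h1 hq.1 hq0)
  · refine mem_nhdsWithin.2 ⟨s ×ˢ Ioi (p.2 / 2), hs.prod isOpen_Ioi, ⟨hxs, ?_⟩, ?_⟩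
    · exact half_lt_self hp.2.1
    · exact fun q hq => ⟨hq.1.1, le_of_lt hq.1.2, hq.2.2.2⟩

end FlowData

end Relaxed

/-! ### The regular solution -/

section Solution

variable (l α ε lam : ℝ) (a : ℕ → ℝ) (k : ℝ → ℝ) (f : ℝ → ℝ → ℝ)

/-- The function with the modes `ym`. -/
noncomputable def sol (x t : ℝ) : ℝ :=
  Real.exp (lam / 2 * x) * Uhat l α ε lam a (sinCoef l k) f x t

variable {l α ε lam a k f} {M T : ℝ} {K : NNReal} {h₀ h₁ : ℝ → ℝ} {F : ℝ → ℝ → ℝ → ℝ}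

lemma hasDerivAt_exp_mul {g g' : ℝ → ℝ} {x : ℝ} (h : HasDerivAt g (g' x) x) :
    HasDerivAt (fun y => Real.exp (lam / 2 * y) * g y)
      (Real.exp (lam / 2 * x) * (lam / 2 * g x + g' x)) x := by
  have h1 : HasDerivAt (fun y => Real.exp (lam / 2 * y))
      (Real.exp (lam / 2 * x) * (lam / 2 * 1)) x := ((hasDerivAt_id x).const_mul _).exp
  refine (h1.mul h).congr_deriv ?_
  ring

namespace FlowData

variable (S : FlowData l α ε lam M K a k f)
include S

lemma hasDerivWithinAt_sol (hT : 0 < T) (hk : ∀ x, k x = wt lam x * h₁ x) {x t : ℝ}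
    (h : (x, t) ∈ VelocityRect l T h₁) : HasDerivWithinAt (fun s => sol l α ε lam a k f x s)
      (Real.exp (lam / 2 * x) * Vhat l α ε lam a k f x t) (Icc 0 T) t := by
  obtain ⟨D, hD⟩ := S.exists_coef_bound
  refine (hasDerivWithinAt_Uhat S.hl S.hα S.hε S.hlam S.hf S.hM S.summable_a hD S.hk hT
    h.1.1 h.1.2.1 fun ht => ⟨fun hx => ?_, fun hx => ?_⟩).const_mul _
  · have := h.2 ht (Or.inl hx)
    rw [show (x, t).1 = 0 from hx] at this
    rw [hk, this, mul_zero]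
  · have := h.2 ht (Or.inr hx)
    rw [show (x, t).1 = l from hx] at this
    rw [hk, this, mul_zero]

lemma dt_sol (hT : 0 < T) (hk : ∀ x, k x = wt lam x * h₁ x) {x t : ℝ}
    (h : (x, t) ∈ VelocityRect l T h₁) : dt T (sol l α ε lam a k f) x t =
      Real.exp (lam / 2 * x) * Vhat l α ε lam a k f x t :=
  (S.hasDerivWithinAt_sol hT hk h).derivWithin (uniqueDiffOn_Icc hT t h.1.2)

/-- The second time derivative comes from writing e^{-λx/2} u_t as (Z - U)/ε, both terms of which
have known time derivatives. -/
lemma hasDerivWithinAt_dt_sol (hT : 0 < T) (hk : ∀ x, k x = wt lam x * h₁ x) (hL : LocLip l f)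
    {x t : ℝ} (h : (x, t) ∈ Omega l T) :
    HasDerivWithinAt (fun s => dt T (sol l α ε lam a k f) x s) (Real.exp (lam / 2 * x) *
      (Zxx l α ε lam a k f x t - lam ^ 2 / 4 * Zhat l α ε lam a k f x t +
        (rhat l α ε lam a k f x t - Vhat l α ε lam a k f x t) / ε)) (Icc 0 T) t := by
  obtain ⟨D, hD⟩ := S.exists_coef_bound
  have hε := S.hε.ne'
  have h1 := S.hasDerivAt_Zhat_time hL h.1 h.2.1
  have h2 := hasDerivAt_Uhat S.hl S.hα S.hε S.hlam S.hf S.hM S.summable_a hD S.hk x h.2.1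
  have h3 := ((h1.sub h2).div_const ε).const_mul (Real.exp (lam / 2 * x))
  refine (h3.hasDerivWithinAt (s := Icc 0 T)).congr_of_mem (fun s hs => ?_) ⟨h.2.1.le, h.2.2⟩
    |>.congr_deriv ?_
  · rw [S.dt_sol hT hk (mem_VelocityRect_of_interior h.1 hs), Pi.sub_apply, Zhat,
      add_sub_cancel_right, mul_div_cancel_left₀ _ hε]
  · field_simp
    ring

lemma dt_dt_sol (hT : 0 < T) (hk : ∀ x, k x = wt lam x * h₁ x) (hL : LocLip l f)
    {x t : ℝ} (h : (x, t) ∈ Omega l T) :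
    dt T (dt T (sol l α ε lam a k f)) x t = Real.exp (lam / 2 * x) *
      (Zxx l α ε lam a k f x t - lam ^ 2 / 4 * Zhat l α ε lam a k f x t +
        (rhat l α ε lam a k f x t - Vhat l α ε lam a k f x t) / ε) :=
  (S.hasDerivWithinAt_dt_sol hT hk hL h).derivWithin
    (uniqueDiffOn_Icc hT t ⟨h.2.1.le, h.2.2⟩)

lemma relaxed_sol (hT : 0 < T) (hk : ∀ x, k x = wt lam x * h₁ x) {x t : ℝ}
    (h : (x, t) ∈ Omega l T) : relaxed T ε (sol l α ε lam a k f) x t =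
      Real.exp (lam / 2 * x) * Zhat l α ε lam a k f x t := by
  rw [relaxed, S.dt_sol hT hk (mem_VelocityRect_of_interior h.1 (Ioc_subset_Icc_self h.2)), sol,
    Zhat]
  ring

lemma hasDerivAt_relaxed_sol (hT : 0 < T) (hk : ∀ x, k x = wt lam x * h₁ x) {x t : ℝ}
    (h : (x, t) ∈ Omega l T) : HasDerivAt (fun y => relaxed T ε (sol l α ε lam a k f) y t)
      (Real.exp (lam / 2 * x) *
        (lam / 2 * Zhat l α ε lam a k f x t + Zx l α ε lam a k f x t)) x := by
  refine (hasDerivAt_exp_mul (lam := lam) (g' := fun y => Zx l α ε lam a k f y t)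
    (S.hasDerivAt_Zhat x h.2.1)).congr_of_eventuallyEq ?_
  filter_upwards [isOpen_Ioo.mem_nhds h.1] with y hy using S.relaxed_sol hT hk ⟨hy, h.2⟩

lemma hasDerivAt_dx_relaxed_sol (hT : 0 < T) (hk : ∀ x, k x = wt lam x * h₁ x) (hL : LocLip l f)
    {x t : ℝ} (h : (x, t) ∈ Omega l T) :
    HasDerivAt (fun y => dx (relaxed T ε (sol l α ε lam a k f)) y t)
      (Real.exp (lam / 2 * x) * (lam ^ 2 / 4 * Zhat l α ε lam a k f x t +
        lam * Zx l α ε lam a k f x t + Zxx l α ε lam a k f x t)) x := by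
  have h1 := hasDerivAt_exp_mul (lam := lam)
    (g := fun y => lam / 2 * Zhat l α ε lam a k f y t + Zx l α ε lam a k f y t)
    (g' := fun y => lam / 2 * Zx l α ε lam a k f y t + Zxx l α ε lam a k f y t)
    (((S.hasDerivAt_Zhat x h.2.1).const_mul (lam / 2)).add (S.hasDerivAt_Zx hL h.1 h.2.1))
  refine (h1.congr_of_eventuallyEq ?_).congr_deriv (by ring)
  filter_upwards [isOpen_Ioo.mem_nhds h.1] with y hy
  exact (S.hasDerivAt_relaxed_sol hT hk ⟨hy, h.2⟩).deriv

lemma continuousOn_Zx_interior (T : ℝ) :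
    ContinuousOn (fun p : ℝ × ℝ => Zx l α ε lam a k f p.1 p.2) (Omega l T) := by
  refine continuousOn_of_local fun p hp => ?_
  have hδ := half_pos hp.2.1
  refine ⟨univ ×ˢ Icc (p.2 / 2) T, S.continuousOn_Zx hδ T,
    ⟨mem_univ _, (half_lt_self hp.2.1).le, hp.2.2⟩, ?_⟩
  refine mem_nhdsWithin.2 ⟨univ ×ˢ Ioi (p.2 / 2), isOpen_univ.prod isOpen_Ioi,
    ⟨mem_univ _, half_lt_self hp.2.1⟩, ?_⟩
  exact fun q hq => ⟨mem_univ _, le_of_lt hq.1.2, hq.2.2.2⟩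

lemma isRegularSolution_sol (hT : 0 < T) (hk : ∀ x, k x = wt lam x * h₁ x) (hL : LocLip l f)
    (h0 : ∀ x ∈ Icc 0 l, sol l α ε lam a k f x 0 = h₀ x)
    (hF : ∀ x t, (x, t) ∈ Omega l T → f x t = F x t (sol l α ε lam a k f x t)) :
    IsRegularSolution l T α ε lam h₀ h₁ F (sol l α ε lam a k f) := by
  obtain ⟨D, hD⟩ := S.exists_coef_bound
  have hε := S.hε
  have hexp : ∀ s : Set (ℝ × ℝ), ContinuousOn (fun p : ℝ × ℝ => Real.exp (lam / 2 * p.1)) s :=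
    fun s => by fun_prop
  have hV := continuousOn_Vhat S.hl S.hα S.hε S.hlam S.hf S.hM S.summable_a hD S.hk T
  have hsub : Omega l T ⊆ Icc 0 l ×ˢ Ioc 0 T := prod_mono_left Ioo_subset_Icc_self
  have cV := (S.continuousOn_Vhat_interior T).mono hsub
  have cZ := (S.continuousOn_Zhat T).mono hsub
  have cZx := S.continuousOn_Zx_interior T
  have cZxx := S.continuousOn_Zxx hL T
  have cr := S.continuousOn_rhat T
  constructor
  · exact (hexp _).mul ((continuousOn_Uhat S.hl S.hα S.hε S.hlam S.hf S.hM S.summable_a hD T).mono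
      (prod_mono_left (subset_univ _)))
  · exact fun x t h => (S.hasDerivWithinAt_sol hT hk h).differentiableWithinAt
  · refine ((hexp _).mul (hV.mono fun p hp => ⟨hp.1.1, hp.1.2, fun ht => ⟨fun hx => ?_,
      fun hx => ?_⟩⟩)).congr fun p hp => S.dt_sol hT hk hp
    · have := hp.2 ht (Or.inl hx)
      rw [hx] at this
      rw [hk, this, mul_zero]
    · have := hp.2 ht (Or.inr hx)
      rw [hx] at this
      rw [hk, this, mul_zero]
  · obtain ⟨B, hB⟩ := exists_Vhat_bound S.hl S.hα S.hε S.hlam S.hf S.hM S.summable_a hD S.hk T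
    refine ⟨Real.exp (lam / 2 * l) * B, fun x t h => ?_⟩
    have ht := Ioc_subset_Icc_self h.2
    rw [S.dt_sol hT hk (mem_VelocityRect_of_interior h.1 ht), abs_mul, Real.abs_exp]
    have := hB x (Ioo_subset_Icc_self h.1) t ht
    have := S.hlam
    have := h.1.2.le
    gcongr
  · exact fun x t h => (S.hasDerivWithinAt_dt_sol hT hk hL h).differentiableWithinAt
  · refine ((hexp _).mul ((cZxx.sub (continuousOn_const.mul cZ)).add
      ((cr.sub cV).div_const ε))).congr fun p hp => S.dt_dt_sol hT hk hL hp
  · exact fun x t h => (S.hasDerivAt_relaxed_sol hT hk h).differentiableAt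
  · exact ((hexp _).mul ((continuousOn_const.mul cZ).add cZx)).congr fun p hp =>
      (S.hasDerivAt_relaxed_sol hT hk hp).deriv
  · exact fun x t h => (S.hasDerivAt_dx_relaxed_sol hT hk hL h).differentiableAt
  · exact ((hexp _).mul (((continuousOn_const.mul cZ).add (continuousOn_const.mul cZx)).add
      cZxx)).congr fun p hp => (S.hasDerivAt_dx_relaxed_sol hT hk hL hp).deriv
  · intro x t h
    rw [show dx (dx (relaxed T ε (sol l α ε lam a k f))) x t = _ from
        (S.hasDerivAt_dx_relaxed_sol hT hk hL h).deriv,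
      show dx (relaxed T ε (sol l α ε lam a k f)) x t = _ from
        (S.hasDerivAt_relaxed_sol hT hk h).deriv, S.dt_dt_sol hT hk hL h,
      S.dt_sol hT hk (mem_VelocityRect_of_interior h.1 (Ioc_subset_Icc_self h.2)), ← hF x t h,
      ← one_mul (f x t), ← exp_mul_wt lam x, rhat]
    field_simp
    ring
  · exact h0
  · intro x h
    rw [S.dt_sol hT hk h, Vhat_initial S.hl S.hε S.hlam S.hk h.1.1
      (fun hx => ?_) (fun hx => ?_), hk, ← mul_assoc, exp_mul_wt, one_mul]
    · have := h.2 rfl (Or.inl hx)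
      rw [show (x, (0 : ℝ)).1 = 0 from hx] at this
      rw [hk, this, mul_zero]
    · have := h.2 rfl (Or.inr hx)
      rw [show (x, (0 : ℝ)).1 = l from hx] at this
      rw [hk, this, mul_zero]
  · intro t _
    constructor
    · simp [sol, Uhat]
    · simp [sol, Uhat, sin_wave_right S.hl]

/-- Spatial Lipschitz continuity of the solution. -/
lemma exists_lipschitz_sol (T : ℝ) : ∃ L : NNReal, ∀ t ∈ Icc 0 T,
    LipschitzOnWith L (fun x => sol l α ε lam a k f x t) (Icc 0 l) := by
  obtain ⟨B, hB⟩ := S.exists_bddMeas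
  obtain ⟨D, hD⟩ := S.exists_coef_bound
  obtain ⟨L, hL0, hL⟩ := exists_lipschitz_Uhat S.hl S.hα S.hε S.hlam S.hf S.ha
    (sum_sinCoef_sq_le S.hl hB) T
  obtain ⟨C, hC⟩ := abs_Uhat_le S.hl S.hα S.hε S.hlam S.hf S.hM S.summable_a hD T
  obtain ⟨Le, hLe⟩ : ∃ Le : NNReal, LipschitzOnWith Le (fun x => Real.exp (lam / 2 * x))
      (Icc 0 l) := by
    refine ⟨(Real.exp (lam / 2 * l) * (lam / 2)).toNNReal,
      lipschitzOnWith_Icc_of_hasDerivAt (f' := fun x => Real.exp (lam / 2 * x) * (lam / 2 * 1))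
      (by fun_prop) (fun x _ => ((hasDerivAt_id x).const_mul _).exp) fun x hx => ?_⟩
    refine le_trans ?_ (Real.le_coe_toNNReal _)
    have := S.hlam
    have := hx.2.le
    rw [mul_one, abs_mul, Real.abs_exp, abs_of_pos (by positivity : 0 < lam / 2)]
    gcongr
  have key : ∀ t ∈ Icc 0 T, _ := fun t ht =>
    exists_lipschitz_mul hLe (L := L.toNNReal) (g := fun x => Uhat l α ε lam a (sinCoef l k) f x t)
      (LipschitzOnWith.of_dist_le_mul fun x _ y _ => by
        rw [Real.dist_eq, Real.dist_eq, Real.coe_toNNReal _ hL0]; exact hL t ht x y)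
      (A := Real.exp (lam / 2 * l)) (fun x hx => by
        rw [Real.abs_exp]
        have := S.hlam
        have := hx.2
        gcongr) fun x _ => hC x t ht
  exact ⟨_, key⟩

end FlowData

/-- The composition of `F` with a function that is Lipschitz in `x` is locally Lipschitz. -/
lemma DataAssumption.locLip_srcOf (hT : 0 < T) (hdata : DataAssumption l T h₀ h₁ F)
    {v : ℝ → ℝ → ℝ} {L : NNReal} {B : ℝ}
    (hv : ∀ t ∈ Ioc 0 T, LipschitzOnWith L (fun x => v x t) (Ioo 0 l))
    (hB : ∀ x t, (x, t) ∈ Omega l T → |v x t| ≤ B) : LocLip l (srcOf T F v) := by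
  intro c d δ T' hc hd hδ
  -- The source is frozen after T, so only times in [min δ T, T] matter; with x in [c, d] they form
  -- a compact subset of Ω_T, as the local Lipschitz hypothesis on F requires.
  have hδT : 0 < min δ T := lt_min hδ hT
  have hKs : Icc c d ×ˢ Icc (min δ T) T ⊆ Omega l T := fun p hp =>
    ⟨⟨hc.trans_le hp.1.1, hp.1.2.trans_lt hd⟩, hδT.trans_le hp.2.1, hp.2.2⟩
  obtain ⟨L', hL'⟩ := hdata.lip_F _ (isCompact_Icc.prod isCompact_Icc) hKs B
  refine ⟨L' * max 1 L, fun t ht => LipschitzOnWith.of_dist_le_mul fun x hx y hy => ?_⟩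
  have htm : min t T ∈ Icc (min δ T) T := ⟨min_le_min_right T ht.1, min_le_right _ _⟩
  have hmem : ∀ x ∈ Icc c d, ((x, min t T), v x (min t T)) ∈
      (Icc c d ×ˢ Icc (min δ T) T) ×ˢ Icc (-B) B := fun x hx =>
    ⟨⟨hx, htm⟩, abs_le.1 (hB x _ (hKs (mk_mem_prod hx htm)))⟩
  have h1 := hL'.dist_le_mul _ (hmem x hx) _ (hmem y hy)
  have h2 := (hv (min t T) ⟨hδT.trans_le htm.1, htm.2⟩).dist_le_mul x
    ⟨hc.trans_le hx.1, hx.2.trans_lt hd⟩ y ⟨hc.trans_le hy.1, hy.2.trans_lt hd⟩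
  refine h1.trans ?_
  rw [NNReal.coe_mul, mul_assoc]
  refine mul_le_mul_of_nonneg_left ?_ L'.2
  rw [Prod.dist_eq, Prod.dist_eq, dist_self, max_eq_left (dist_nonneg), NNReal.coe_max,
    NNReal.coe_one]
  refine max_le ?_ (h2.trans ?_)
  · exact le_mul_of_one_le_left dist_nonneg (le_max_left _ _)
  · exact mul_le_mul_of_nonneg_right (le_max_right _ _) dist_nonneg

/-- The fixed point of the integral equation is the restriction of a regular solution. -/
lemma exists_isRegularSolution_of_fixedPoint (hl : 0 < l) (hT : 0 < T) (hα : 0 < α) (hε : 0 < ε)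
    (hlam : 0 < lam) (hdata : DataAssumption l T h₀ h₁ F) (h0 : h₀ 0 = 0) (hl0 : h₀ l = 0)
    {U : BT l T} (hU : ∀ p : Omega l T,
      U p = integralMap l α ε lam h₀ h₁ F (extendZero U) p.1.1 p.1.2) :
    ∃ u, IsRegularSolution l T α ε lam h₀ h₁ F u ∧ ∀ p : Omega l T, U p = u p.1.1 p.1.2 := by
  obtain ⟨M, -, hf⟩ := hdata.exists_isSource hT hl (continuousOn_extendZero U)
    fun x t h => abs_extendZero_le U h
  obtain ⟨K₁, hK₁⟩ := hdata.exists_lipschitz_h₁ hl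
  obtain ⟨K, hK⟩ := exists_lipschitz_wt_mul (lam := lam) hlam hK₁
  obtain ⟨B, hB₀, hB₁⟩ := hdata.exists_bddMeas
  have hs := hdata.summable_coef hl hlam h0 hl0
  have S : FlowData l α ε lam M K (sinCoef l fun ξ => wt lam ξ * h₀ ξ) (fun ξ => wt lam ξ * h₁ ξ)
      (srcOf T F (extendZero U)) :=
    ⟨hl, hα, hε, hlam, hf, hdata.summable_mul_coef hl hlam h0 hl0, hK⟩
  set u := sol l α ε lam (sinCoef l fun ξ => wt lam ξ * h₀ ξ) (fun ξ => wt lam ξ * h₁ ξ)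
    (srcOf T F (extendZero U)) with hu
  have hUu : ∀ p : Omega l T, U p = u p.1.1 p.1.2 := fun p => by
    rw [hU, integralMap_eq hl hα hε hlam hf hB₀ hB₁ hs
      (fun x _ t ht => (srcOf_of_le ht.2).symm) _ p.2.2]
    rfl
  have hext : ∀ x t, (x, t) ∈ Omega l T → extendZero U x t = u x t := fun x t h => by
    rw [extendZero_of_mem U h, hUu]
  obtain ⟨L, hL⟩ := S.exists_lipschitz_sol T
  -- The bootstrap: the series representation makes the fixed point Lipschitz in x uniformly in
  -- time, so F(x,t,U) is locally Lipschitz in x, which is the input of the second gain of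
  -- regularity.
  have hloc : LocLip l (srcOf T F (extendZero U)) := by
    refine hdata.locLip_srcOf hT (L := L) (fun t ht => ?_) fun x t h => abs_extendZero_le U h
    have h1 := (hL t (Ioc_subset_Icc_self ht)).mono Ioo_subset_Icc_self
    exact fun x hx y hy => by
      simp only [hext x t ⟨hx, ht⟩, hext y t ⟨hy, ht⟩]
      exact h1 hx hy
  refine ⟨u, S.isRegularSolution_sol hT (fun _ => rfl) hloc (fun x hx => ?_) fun x t h => ?_, hUu⟩
  · obtain ⟨K₀, hK₀⟩ := hdata.exists_lipschitz_h₀ hl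
    have h1 := eq_sine_series_of_boundary hl (f := fun ξ => wt lam ξ * h₀ ξ)
      ((continuous_wt lam).continuousOn.mul hK₀.continuousOn) hs (by simp [h0]) (by simp [hl0]) hx
    simp only [sol, Uhat, ym_zero]
    rw [← h1, ← mul_assoc, exp_mul_wt, one_mul]
  · rw [srcOf_of_le h.2.2, hext x t h]

/-- A regular solution restricts to a fixed point of the integral equation. -/
lemma IsRegularSolution.exists_fixedPoint (hl : 0 < l) (hT : 0 < T) (hα : 0 < α) (hε : 0 < ε)
    (hlam : 0 < lam) (hdata : DataAssumption l T h₀ h₁ F) (h0 : h₀ 0 = 0) (hl0 : h₀ l = 0)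
    {w : ℝ → ℝ → ℝ} (hw : IsRegularSolution l T α ε lam h₀ h₁ F w) :
    ∃ V : BT l T, (∀ p : Omega l T, V p = w p.1.1 p.1.2) ∧ ∀ p : Omega l T,
      V p = integralMap l α ε lam h₀ h₁ F (extendZero V) p.1.1 p.1.2 := by
  obtain ⟨B, hB⟩ := hw.exists_bound hdata
  have hc : ContinuousOn (fun p : ℝ × ℝ => w p.1 p.2) (Omega l T) := hw.cont.mono
    (prod_mono Ioo_subset_Icc_self Ioc_subset_Icc_self)
  let V : BT l T := BoundedContinuousFunction.ofNormedAddCommGroup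
    (fun p : Omega l T => w p.1.1 p.1.2) hc.domRestrict B
    fun p => (hB p.1.1 p.2.1 p.1.2 (Ioc_subset_Icc_self p.2.2)).1
  refine ⟨V, fun p => rfl, fun p => ?_⟩
  exact hw.eq_integralMap hT hl hα hε hlam hdata h0 hl0
    (fun x t h => by rw [extendZero_of_mem V h]; rfl) p.2

end Solution

end JosephsonStrip

open JosephsonStrip

theorem mainTheorem8 (l T α ε lam : ℝ) (hl : 0 < l) (hT : 0 < T)
    (hα : 0 < α) (hε : 0 < ε) (hlam : 0 < lam)
    (h₀ h₁ : ℝ → ℝ) (F : ℝ → ℝ → ℝ → ℝ)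
    (hdata : DataAssumption l T h₀ h₁ F)
    (hcompat₀ : h₀ 0 = 0) (hcompatl : h₀ l = 0) :
    ∃ u : ℝ → ℝ → ℝ,
      IsRegularSolution l T α ε lam h₀ h₁ F u ∧
      (∀ w : ℝ → ℝ → ℝ, IsRegularSolution l T α ε lam h₀ h₁ F w →
        ∀ x t : ℝ, (x, t) ∈ ClosedRect l T → w x t = u x t) ∧
      ∃ Ψ : BT l T → BT l T,
        (∀ (v : BT l T) (p : Omega l T),
          Ψ v p = integralMap l α ε lam h₀ h₁ F (extendZero v) p.1.1 p.1.2) ∧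
        (∃ κ q : ℝ, 0 ≤ κ ∧ 0 ≤ q ∧ q < 1 ∧ ∀ v w : BT l T,
          weightedNorm κ (Ψ v - Ψ w) ≤ q * weightedNorm κ (v - w)) ∧
        ∃ U : BT l T, Ψ U = U ∧ (∀ V : BT l T, Ψ V = V → V = U) ∧
          ∀ p : Omega l T, U p = u p.1.1 p.1.2 := by
  obtain ⟨Ψ, hΨ⟩ := exists_integralMap_operator α ε lam hl hT hα hε hlam
    hdata hcompat₀ hcompatl
  obtain ⟨κ, hκ, hcon⟩ := exists_weightedNorm_contraction hl hT hα hε hlam hdata hcompat₀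
    hcompatl hΨ
  obtain ⟨U, hU, huniq⟩ := exists_fixedPoint hl hT hcon
  obtain ⟨u, hu, hUu⟩ := exists_isRegularSolution_of_fixedPoint hl hT hα hε hlam hdata hcompat₀
    hcompatl (U := U) fun p => by rw [← hΨ, hU]
  refine ⟨u, hu, fun w hw x t hxt => ?_, Ψ, hΨ, ⟨κ, 1 / 2, hκ, by norm_num, by norm_num, hcon⟩,
    U, hU, huniq, hUu⟩
  obtain ⟨V, hVw, hV⟩ := hw.exists_fixedPoint hl hT hα hε hlam hdata hcompat₀ hcompatl
  -- The restriction of w to Ω_T is a fixed point and therefore equals U; on the initial line and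
  -- the lateral sides both solutions are given by the data.
  have hVU : V = U := huniq V (BoundedContinuousFunction.ext fun p => by rw [hΨ, ← hV])
  rcases eq_or_lt_of_le hxt.2.1 with ht | ht
  · have ht' : t = 0 := ht.symm
    rw [ht', hw.init_value x hxt.1, hu.init_value x hxt.1]
  rcases eq_or_lt_of_le hxt.1.1 with h | h
  · have hx : x = 0 := h.symm
    rw [hx, (hw.boundary t ⟨ht, hxt.2.2⟩).1, (hu.boundary t ⟨ht, hxt.2.2⟩).1]
  rcases eq_or_lt_of_le hxt.1.2 with h' | h'
  · have hx : x = l := h'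
    rw [hx, (hw.boundary t ⟨ht, hxt.2.2⟩).2, (hu.boundary t ⟨ht, hxt.2.2⟩).2]
  have hmem : (x, t) ∈ Omega l T := ⟨⟨h, h'⟩, ht, hxt.2.2⟩
  rw [← hVw ⟨(x, t), hmem⟩, ← hUu ⟨(x, t), hmem⟩, hVU]
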